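/- Let $k$ be a field with $\mathrm{char}(k)\neq 2$ and let $\mathcal C$ be a $k$-linear additive idempotent-complete ribbon category with $k$-bilinear tensor product and $\mathrm{End}_{\mathcal C}(1)=k\cdot\mathrm{id}_1\cong k$. Write $c$ for the braiding and $\theta$ for the twist. **Definitions.** A Frobenius algebra $A=(A,\mu,\eta,\Delta,\epsilon)$ in $\mathcal C$ is an object with an algebra structure $(\mu,\eta)$ and a coalgebra structure $(\Delta,\epsilon)$ such that $(\mathrm{id}\otimes\mu)\circ(\Delta\otimes\mathrm{id})=\Delta\circ\mu=(\mu\otimes\mathrm{id})\circ(\mathrm{id}\otimes\Delta)$. It is *commutative* if $\mu\circ c_{A,A}=\mu$, *$\Delta$-separable* if $\mu\circ\Delta=\mathrm{id}_A$, *special* if $\epsilon\circ\eta$ and $\mu\circ\Delta$ are non-zero multiples of the identity, *haploid* if $\dim\mathrm{Hom}(1,A)=1$, and *symmetric* if its Nakayama automorphism $N_A$ is $\mathrm{id}_A$. Explicitly, $N_A=(\mathrm{ev}_A\otimes\mathrm{id}_A)\circ(\mathrm{id}_{A^*}\otimes(\Delta\circ\eta\circ\epsilon\circ\mu))\circ(\widetilde{\mathrm{coev}}_A\otimes\mathrm{id}_A)$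 up to associators and unitors, where $\mathrm{ev}_A:A^*\otimes A\to 1$, and $\widetilde{\mathrm{coev}}_A:1\to A^*\otimes A$ is the coevaluation of the opposite handedness, which is obtained from $\mathrm{coev}_A:1\to A\otimes A^*$ by braiding and twist. Let $A$ be a commutative $\Delta$-separable Frobenius algebra. For $A$-modules $M,N$ let $M\otimes_A N$ be the image of the idempotent on $M\otimes N$ that inserts $\Delta\circ\eta:1\to A\otimes A$, lets the second leg act on $N$ after braiding it past $M$ by $c_{A,M}$, and lets the first leg act on $M$; denote by $\iota:M\otimes_A N\to M\otimes N$ and $\pi:M\otimes N\to M\otimes_A N$ the inclusion and the projection. A module $(M,\rho)$ is *local* if $\rho\circ c_{M,A}\circ c_{A,M}=\rho$; $\mathcal C_A^{\mathsf{loc}}$ is the full subcategory of local modules. A module is *Nakayama-local* of degree $\nu\in\{0,1\}$ if $\rho\circ c_{M,A}\circ c_{A,M}=\rho\circ(N_A^{\nu}\otimes\mathrm{id}_M)$; it is even for $\nu=0$ and odd for $\nu=1$. For $A$ haploid and not symmetric, the category $\mathcal L^{\mathrm{spin}}_A$ has as objects triples $(M,\rho_M,t_M)$, where $(M,\rho_M)$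 is a finite direct sum of Nakayama-local $A$-modules and $t_M:M\to M$ satisfies $t_M\circ t_M=\mathrm{id}_M$ and $t_M\circ\rho_M=\rho_M\circ(N_A\otimes t_M)$; morphisms are the module morphisms that commute with the $t$'s. It is monoidal with tensor product $\otimes_A$, $t_{M\otimes_A N}=\pi\circ(t_M\otimes t_N)\circ\iota$, and unit $(A,\mu,N_A)$. Its braiding and twist are $$\hat c_{M,N}=\pi\circ(t_N^{\deg M}\otimes\mathrm{id}_M)\circ c_{M,N}\circ\iota,\qquad \hat\theta_M=t_M^{1+\deg M}\circ\theta_M ,$$ where $\deg M$ is read on each even or odd direct summand of $M$. If $B$ is a symmetric commutative $\Delta$-separable Frobenius algebra, $\mathcal C_B^{\mathsf{loc}}$ is monoidal under $\otimes_B$, with braiding $\pi\circ c_{M,N}\circ\iota$ and twist $\theta_M$. A *ribbon equivalence* is an equivalence of categories that is $k$-linear, admits a (strong) monoidal structure for which it is braided, and maps twists to twists. **Statement.** (1) Let $f\in\mathcal C$ be a fermion, i.e. $\theta_f=-\mathrm{id}_f$ and $f\otimes f\cong 1$, and let $A$ be a commutative $\Delta$-separable Frobenius algebra in $\mathcal C$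 whose underlying object is isomorphic to $1\oplus f$. Then $A$ is haploid and not symmetric, for every $x\in\mathcal C$ the module $(A\otimes x,\mu\otimes\mathrm{id}_x)$ is a finite direct sum of Nakayama-local modules, $\mathcal L^{\mathrm{spin}}_A$ is a ribbon category, and the induction functor $$U:\mathcal C\to\mathcal L^{\mathrm{spin}}_A,\qquad x\mapsto(A\otimes x,\ \mu\otimes\mathrm{id}_x,\ N_A\otimes\mathrm{id}_x),\qquad g\mapsto\mathrm{id}_A\otimes g$$ is a ribbon equivalence. (2) Let $A$ be a haploid commutative $\Delta$-separable special Frobenius algebra in $\mathcal C$ that is not symmetric, and let $B$ be the image of the idempotent $\tfrac12(\mathrm{id}_A+\theta_A)$, with inclusion $\iota_B:B\to A$ and projection $\pi_B:A\to B$. Equip $B$ with $\mu_B=\pi_B\circ\mu\circ(\iota_B\otimes\iota_B)$, $\eta_B=\pi_B\circ\eta$, $\Delta_B=2\,(\pi_B\otimes\pi_B)\circ\Delta\circ\iota_B$, $\epsilon_B=\tfrac12\,\epsilon\circ\iota_B$; this makes $B$ a symmetric commutative $\Delta$-separable Frobenius algebra. Then $\mathcal L^{\mathrm{spin}}_A$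 and $\mathcal C_B^{\mathsf{loc}}$ are ribbon categories, and there is a ribbon equivalence $$\mathcal L^{\mathrm{spin}}_A\simeq\mathcal C_B^{\mathsf{loc}} .$$ -/

import Mathlib

open CategoryTheory MonoidalCategory MonObj ComonObj

set_option linter.unusedSectionVars false
set_option linter.unusedSimpArgs false
set_option linter.unusedVariables false
set_option linter.style.longLine false

universe w v u

namespace SpinLine

section Ribbon

variable (C : Type u) [Category.{v} C] [MonoidalCategory C] [BraidedCategory C]

/-- A family of endomorphisms `θ_X : X ⟶ X`, the underlying datum of a ribbon twist. -/
class HasTwist where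
  twist (X : C) : X ⟶ X

variable {C} in
/-- The double braiding `c_{Y,X} ∘ c_{X,Y}`. -/
def monodromy (X Y : C) : X ⊗ Y ⟶ X ⊗ Y := (β_ X Y).hom ≫ (β_ Y X).hom

open HasTwist in
/-- A braided category with a twist is a ribbon category: the twist is a natural automorphism of
the identity with `θ_{X ⊗ Y} = c_{Y,X} ∘ c_{X,Y} ∘ (θ_X ⊗ θ_Y)`, every object has a dual, and the
twist is compatible with duals, `θ_{X*} = (θ_X)*`. (By the braiding, one-sided duals are
two-sided.) -/
class IsRibbon [HasTwist C] : Prop where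
  twist_naturality {X Y : C} (f : X ⟶ Y) : f ≫ twist Y = twist X ≫ f
  isIso_twist (X : C) : IsIso (twist X)
  twist_tensor (X Y : C) : twist (X ⊗ Y) = (twist X ⊗ₘ twist Y) ≫ monodromy X Y
  exists_dual (X : C) : ∃ Y : C, Nonempty (ExactPairing X Y)
  twist_dual (X Y : C) [ExactPairing X Y] : η_ X Y ≫ twist X ▷ Y = η_ X Y ≫ X ◁ twist Y

end Ribbon

section Monodromy
variable {C : Type u} [Category.{v} C] [MonoidalCategory C] [BraidedCategory C]

lemma monodromy_naturality {X Y X' Y' : C} (f : X ⟶ X') (g : Y ⟶ Y') :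
    (f ⊗ₘ g) ≫ monodromy X' Y' = monodromy X Y ≫ (f ⊗ₘ g) := by
  simp [monodromy]

lemma monodromy_naturality_left {X X' : C} (f : X ⟶ X') (Y : C) :
    f ▷ Y ≫ monodromy X' Y = monodromy X Y ≫ f ▷ Y := by
  simp [monodromy]

lemma monodromy_naturality_right (X : C) {Y Y' : C} (f : Y ⟶ Y') :
    X ◁ f ≫ monodromy X Y' = monodromy X Y ≫ X ◁ f := by
  simp [monodromy]

end Monodromy

section Twist
open HasTwist
variable {C : Type u} [Category.{v} C] [MonoidalCategory C] [BraidedCategory C] [HasTwist C]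
  [IsRibbon C]

lemma twist_nat {X Y : C} (f : X ⟶ Y) : f ≫ twist Y = twist X ≫ f := IsRibbon.twist_naturality f

instance (X : C) : IsIso (twist X) := IsRibbon.isIso_twist X

lemma twist_unit : twist (𝟙_ C) = 𝟙 _ := by
  have h := IsRibbon.twist_tensor (𝟙_ C) (𝟙_ C)
  have h2 := twist_nat (λ_ (𝟙_ C)).hom
  have h3 : monodromy (𝟙_ C) (𝟙_ C) = 𝟙 _ := by
    simp [monodromy, unitors_inv_equal]
  rw [h, h3, Category.comp_id, MonoidalCategory.tensorHom_def, Category.assoc,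
    leftUnitor_naturality, unitors_equal, rightUnitor_naturality_assoc] at h2
  have h4 := (cancel_epi _).1 h2
  have : twist (𝟙_ C) ≫ 𝟙 _ = twist (𝟙_ C) ≫ twist (𝟙_ C) := by
    simpa using h4
  exact ((cancel_epi _).1 this).symm

end Twist

section Frobenius
variable {C : Type u} [Category.{v} C] [MonoidalCategory C]

/-- An object with an algebra and a coalgebra structure is a Frobenius algebra if
`(μ ⊗ id) ∘ (id ⊗ Δ) = Δ ∘ μ = (id ⊗ μ) ∘ (Δ ⊗ id)`. -/
class IsFrobenius (A : C) [MonObj A] [ComonObj A] : Prop where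
  frob_left (A) : A ◁ Δ[A] ≫ (α_ A A A).inv ≫ μ[A] ▷ A = μ[A] ≫ Δ[A]
  frob_right (A) : Δ[A] ▷ A ≫ (α_ A A A).hom ≫ A ◁ μ[A] = μ[A] ≫ Δ[A]

/-- `Δ`-separability: `μ ∘ Δ = id`. -/
class IsDeltaSeparable (A : C) [MonObj A] [ComonObj A] : Prop where
  comul_mul (A) : Δ[A] ≫ μ[A] = 𝟙 A

/-- The copairing `Δ ∘ η`. -/
def copair (A : C) [MonObj A] [ComonObj A] : 𝟙_ C ⟶ A ⊗ A := η[A] ≫ Δ[A]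

variable (A : C) [MonObj A] [ComonObj A]

lemma copair_mul [IsDeltaSeparable A] : copair A ≫ μ[A] = η[A] := by
  simp [copair, IsDeltaSeparable.comul_mul]

variable [IsFrobenius A]

lemma copair_left : (ρ_ A).inv ≫ A ◁ copair A ≫ (α_ A A A).inv ≫ μ[A] ▷ A = Δ[A] := by
  simp [copair, IsFrobenius.frob_left]

lemma copair_right : (λ_ A).inv ≫ copair A ▷ A ≫ (α_ A A A).hom ≫ A ◁ μ[A] = Δ[A] := by
  simp [copair, IsFrobenius.frob_right]

lemma copair_braid [BraidedCategory C] [IsCommMonObj A] :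
    (λ_ A).inv ≫ copair A ▷ A ≫ (α_ A A A).hom ≫ A ◁ (β_ A A).hom ≫ (α_ A A A).inv ≫ μ[A] ▷ A
      = Δ[A] := by
  have h : copair A ▷ A ≫ (β_ (A ⊗ A) A).hom = (β_ (𝟙_ C) A).hom ≫ A ◁ copair A :=
    BraidedCategory.braiding_naturality_left _ _
  rw [BraidedCategory.braiding_tensor_left_hom] at h
  have h1 : copair A ▷ A ≫ (α_ A A A).hom ≫ A ◁ (β_ A A).hom ≫ (α_ A A A).inv =
     (λ_ A).hom ≫ (ρ_ A).inv ≫ A ◁ copair A ≫ (α_ A A A).inv ≫ (β_ A A).inv ▷ A := by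
    rw [← cancel_mono ((β_ A A).hom ▷ A), ← cancel_mono (α_ A A A).hom]
    simp only [Category.assoc, inv_hom_whiskerRight, Iso.inv_hom_id, Category.comp_id]
    rw [h]
    simp
  rw [← copair_left]
  have h2 := congr((λ_ A).inv ≫ $h1 ≫ μ[A] ▷ A)
  simp only [Category.assoc] at h2
  rw [h2, ← comp_whiskerRight, IsCommMonObj.mul_comm']
  simp

end Frobenius

section CoevSlide
variable {C : Type u} [Category.{v} C] [MonoidalCategory C] (A : C)

lemma coev_snake (Y : C) [ExactPairing A Y] (k : A ⊗ A ⟶ 𝟙_ C) (q : 𝟙_ C ⟶ A ⊗ A) :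
    (ρ_ A).inv ≫ A ◁ η_ A Y ≫ (α_ _ _ _).inv ≫ k ▷ Y ≫ (λ_ Y).hom ≫ (ρ_ Y).inv ≫
      Y ◁ q ≫ (α_ _ _ _).inv ≫ ε_ A Y ▷ A ≫ (λ_ A).hom =
    (ρ_ A).inv ≫ A ◁ q ≫ (α_ _ _ _).inv ≫ k ▷ A ≫ (λ_ A).hom := by
  calc _ = 𝟙 A ⊗≫ A ◁ η_ A Y ⊗≫ (k ▷ (Y ⊗ 𝟙_ C) ≫ 𝟙_ C ◁ (Y ◁ q)) ⊗≫ ε_ A Y ▷ A ⊗≫ 𝟙 A := by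
        monoidal
    _ = 𝟙 A ⊗≫ A ◁ (η_ A Y ▷ 𝟙_ C ≫ (A ⊗ Y) ◁ q) ⊗≫
          (k ▷ ((Y ⊗ A) ⊗ A) ≫ 𝟙_ C ◁ (ε_ A Y ▷ A)) ⊗≫ 𝟙 A := by
        rw [← whisker_exchange]; monoidal
    _ = 𝟙 A ⊗≫ A ◁ q ⊗≫ A ◁ ((η_ A Y ▷ A ⊗≫ A ◁ ε_ A Y) ▷ A) ⊗≫ k ▷ A ⊗≫ 𝟙 A := by
        rw [← whisker_exchange, ← whisker_exchange]; monoidal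
    _ = _ := by
        rw [ExactPairing.evaluation_coevaluation'']; monoidal

lemma coev_braid_slide [BraidedCategory C] (Y : C) [ExactPairing A Y] (k : A ⊗ A ⟶ 𝟙_ C) :
    (η_ A Y ≫ (β_ A Y).hom) ▷ A ≫ (α_ _ _ _).hom ≫ Y ◁ k =
      (λ_ A).hom ≫ (ρ_ A).inv ≫ A ◁ η_ A Y ≫ (α_ _ _ _).inv ≫ ((β_ A A).hom ≫ k) ▷ Y ≫
        (λ_ Y).hom ≫ (ρ_ Y).inv := by
  have h1 : k ▷ Y ≫ (β_ (𝟙_ C) Y).hom = (β_ (A ⊗ A) Y).hom ≫ Y ◁ k :=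
    BraidedCategory.braiding_naturality_left _ _
  rw [← Iso.inv_comp_eq, BraidedCategory.braiding_tensor_left_inv] at h1
  have h2 : A ◁ η_ A Y ≫ (β_ A (A ⊗ Y)).hom = (β_ A (𝟙_ C)).hom ≫ η_ A Y ▷ A :=
    BraidedCategory.braiding_naturality_right _ _
  rw [← Iso.inv_comp_eq, ← Category.assoc, ← Iso.eq_comp_inv,
    BraidedCategory.braiding_tensor_right_inv] at h2
  have h3 : η_ A Y ▷ A ≫ (α_ _ _ _).hom ≫ A ◁ (β_ A Y).inv ≫ (α_ _ _ _).inv =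
      (β_ A (𝟙_ C)).inv ≫ A ◁ η_ A Y ≫ (α_ _ _ _).inv ≫ (β_ A A).hom ▷ Y := by
    rw [← cancel_mono ((β_ A A).inv ▷ Y), ← cancel_mono (α_ A A Y).hom]
    simp only [Category.assoc] at h2 ⊢
    rw [← h2]
    simp
  rw [← h1]
  have h4 := congr($h3 ≫ k ▷ Y ≫ (β_ (𝟙_ C) Y).hom)
  simp only [Category.assoc] at h4
  simp only [comp_whiskerRight, Category.assoc, Iso.hom_inv_id_assoc,
    hom_inv_whiskerRight_assoc]
  rw [h4]
  simp [braiding_tensorUnit_left]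

end CoevSlide

section Nakayama
open HasTwist
variable {C : Type u} [Category.{v} C] [MonoidalCategory C] [BraidedCategory C] [HasTwist C]
  [IsRibbon C]

/-- A chosen dual object. -/
noncomputable def dual (X : C) : C := (IsRibbon.exists_dual X).choose

noncomputable instance (X : C) : ExactPairing X (dual X) :=
  (IsRibbon.exists_dual X).choose_spec.some

/-- The coevaluation of the opposite handedness,
`(id ⊗ θ_X) ∘ c_{X,X*} ∘ coev_X : 1 ⟶ X* ⊗ X`. -/
noncomputable def coevLeft (X : C) : 𝟙_ C ⟶ dual X ⊗ X :=
  η_ X (dual X) ≫ (β_ X (dual X)).hom ≫ dual X ◁ twist X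

variable (A : C) [MonObj A] [ComonObj A]

/-- The Nakayama automorphism `N_A` of a Frobenius algebra: with the pairing `κ = ε ∘ μ`, it is
the morphism with `κ ∘ (N_A ⊗ id)` equal to the pivotal rotation of `κ`, written out with the
copairing `Δ ∘ η` inverse to `κ`. -/
noncomputable def nak : A ⟶ A :=
  (λ_ A).inv ≫ coevLeft A ▷ A ≫ (α_ _ _ _).hom ≫ dual A ◁ (μ[A] ≫ ε[A] ≫ copair A) ≫
    (α_ _ _ _).inv ≫ ε_ A (dual A) ▷ A ≫ (λ_ A).hom

/-- A Frobenius algebra is symmetric if its Nakayama automorphism is the identity. -/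
class IsSymmetricFrobenius : Prop where
  nak_eq_id : nak A = 𝟙 A

variable [IsFrobenius A]

/-- A Frobenius algebra is its own dual. -/
@[reducible]
def selfPairing : ExactPairing A A where
  coevaluation' := copair A
  evaluation' := μ[A] ≫ ε[A]
  coevaluation_evaluation' := by
    have := copair_left A
    rw [Iso.inv_comp_eq] at this
    rw [comp_whiskerRight, reassoc_of% this]
    simp
  evaluation_coevaluation' := by
    have := copair_right A
    rw [Iso.inv_comp_eq] at this
    rw [MonoidalCategory.whiskerLeft_comp, reassoc_of% this]
    simp

lemma copair_twist : copair A ≫ twist A ▷ A = copair A ≫ A ◁ twist A :=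
  letI := selfPairing A
  IsRibbon.twist_dual A A

lemma pairing_snake :
    (ρ_ A).inv ≫ A ◁ copair A ≫ (α_ A A A).inv ≫ (μ[A] ≫ ε[A]) ▷ A ≫ (λ_ A).hom = 𝟙 A := by
  have := (selfPairing A).coevaluation_evaluation'
  change A ◁ copair A ≫ (α_ A A A).inv ≫ (μ[A] ≫ ε[A]) ▷ A = _ at this
  rw [reassoc_of% this]; simp

lemma pairing_snake_twist :
    (ρ_ A).inv ≫ A ◁ copair A ≫ (α_ A A A).inv ≫ (A ◁ twist A ≫ μ[A] ≫ ε[A]) ▷ A ≫ (λ_ A).hom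
      = twist A := by
  have h : A ◁ copair A ≫ (α_ A A A).inv ≫ (A ◁ twist A) ▷ A =
      A ◁ copair A ≫ (α_ A A A).inv ≫ (A ⊗ A) ◁ twist A := by
    have := congr(A ◁ $(copair_twist A) ≫ (α_ A A A).inv)
    simpa using this
  rw [comp_whiskerRight, Category.assoc, reassoc_of% h, whisker_exchange_assoc,
    leftUnitor_naturality]
  have := pairing_snake A
  have h2 := congr($this ≫ twist A)
  simpa only [Category.assoc, Category.id_comp] using h2

/-- For a commutative Frobenius algebra the Nakayama automorphism is the twist. -/
lemma nak_eq_twist [IsCommMonObj A] : nak A = twist A := by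
  have h1 : nak A = (λ_ A).inv ≫ ((η_ A (dual A) ≫ (β_ A (dual A)).hom) ▷ A ≫ (α_ _ _ _).hom ≫
      dual A ◁ (twist A ▷ A ≫ μ[A] ≫ ε[A])) ≫ dual A ◁ copair A ≫
      (α_ _ _ _).inv ≫ ε_ A (dual A) ▷ A ≫ (λ_ A).hom := by
    simp [nak, coevLeft]
  rw [h1, coev_braid_slide]
  simp only [Category.assoc, Iso.inv_hom_id_assoc]
  rw [coev_snake, ← BraidedCategory.braiding_naturality_right_assoc, IsCommMonObj.mul_comm_assoc]
  exact pairing_snake_twist A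

lemma mul_pairing_twist [IsCommMonObj A] {Z : C} (g : A ⊗ A ⟶ Z) (hg : (β_ A A).hom ≫ g = g) :
    twist (A ⊗ A) ≫ g = (twist A ⊗ₘ twist A) ≫ g := by
  rw [IsRibbon.twist_tensor, monodromy, Category.assoc, Category.assoc, hg, hg]

lemma twist_mul [IsCommMonObj A] : (twist A ⊗ₘ twist A) ≫ μ[A] = μ[A] ≫ twist A := by
  rw [twist_nat, mul_pairing_twist _ _ (by simp)]

lemma one_twist : η[A] ≫ twist A = η[A] := by
  rw [twist_nat, twist_unit, Category.id_comp]

lemma twist_twist [IsCommMonObj A] : twist A ≫ twist A = 𝟙 A := by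
  have h : (twist A ⊗ₘ twist A) ≫ μ[A] ≫ ε[A] = μ[A] ≫ ε[A] := by
    rw [← mul_pairing_twist _ _ (by simp), ← twist_nat, twist_unit]
    simp
  have h1 := pairing_snake A
  rw [← h, MonoidalCategory.tensorHom_def] at h1
  nth_rw 2 [← pairing_snake_twist A]
  rw [← h1, rightUnitor_inv_naturality_assoc, ← whisker_exchange_assoc,
    associator_inv_naturality_left_assoc]
  simp only [comp_whiskerRight, Category.assoc]

lemma nak_nak [IsCommMonObj A] : nak A ≫ nak A = 𝟙 A := by rw [nak_eq_twist, twist_twist]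

lemma copair_twist_twist [IsCommMonObj A] : copair A ≫ (twist A ⊗ₘ twist A) = copair A := by
  rw [MonoidalCategory.tensorHom_def, reassoc_of% copair_twist, ← MonoidalCategory.whiskerLeft_comp,
    twist_twist]
  simp

end Nakayama

section TwoActions
variable {C : Type u} [Category.{v} C] [MonoidalCategory C] {A : C} [MonObj A] [ComonObj A] {W : C}

/-- For two actions `a₁`, `a₂` of `A` on `W`, the endomorphism of `W` that lets the second leg of
`Δ ∘ η` act by `a₂` and then the first leg by `a₁`. -/
def twoActProj (a₁ a₂ : A ⊗ W ⟶ W) : W ⟶ W :=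
  (λ_ W).inv ≫ copair A ▷ W ≫ (α_ A A W).hom ≫ A ◁ a₂ ≫ a₁

/-- `Δ` followed by the two actions. -/
def twoActK (a₁ a₂ : A ⊗ W ⟶ W) : A ⊗ W ⟶ W :=
  Δ[A] ▷ W ≫ (α_ A A W).hom ≫ A ◁ a₂ ≫ a₁

variable [BraidedCategory C]

/-- Two commuting actions of `A` on `W`. -/
structure TwoActions (a₁ a₂ : A ⊗ W ⟶ W) : Prop where
  one₁ : η[A] ▷ W ≫ a₁ = (λ_ W).hom
  one₂ : η[A] ▷ W ≫ a₂ = (λ_ W).hom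
  mul₁ : μ[A] ▷ W ≫ a₁ = (α_ A A W).hom ≫ A ◁ a₁ ≫ a₁
  mul₂ : μ[A] ▷ W ≫ a₂ = (α_ A A W).hom ≫ A ◁ a₂ ≫ a₂
  comm : A ◁ a₁ ≫ a₂ = (α_ A A W).inv ≫ (β_ A A).hom ▷ W ≫ (α_ A A W).hom ≫ A ◁ a₂ ≫ a₁

namespace TwoActions

variable {a₁ a₂ : A ⊗ W ⟶ W}

variable [IsFrobenius A]

lemma whisker_proj_act₁ (h : TwoActions a₁ a₂) : A ◁ twoActProj a₁ a₂ ≫ a₁ = twoActK a₁ a₂ := by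
  rw [twoActK, ← copair_left]
  have e := h.mul₁
  rw [← Iso.inv_comp_eq] at e
  simp only [twoActProj, MonoidalCategory.whiskerLeft_comp, Category.assoc, comp_whiskerRight]
  have e1 : μ[A] ▷ A ▷ W ≫ (α_ A A W).hom ≫ A ◁ a₂ ≫ a₁ =
    (α_ (A ⊗ A) A W).hom ≫ (A ⊗ A) ◁ a₂ ≫ (α_ A A W).hom ≫ A ◁ a₁ ≫ a₁ := by
    rw [← h.mul₁, whisker_exchange_assoc]; simp
  rw [e1]
  monoidal

lemma act₂_proj (h : TwoActions a₁ a₂) : a₂ ≫ twoActProj a₁ a₂ = twoActK a₁ a₂ := by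
  rw [twoActK, ← copair_right]
  have e1 : A ◁ μ[A] ▷ W ≫ A ◁ a₂ ≫ a₁ =
      A ◁ (α_ A A W).hom ≫ A ◁ A ◁ a₂ ≫ A ◁ a₂ ≫ a₁ := by
    rw [← MonoidalCategory.whiskerLeft_comp_assoc, h.mul₂]; simp
  have e2 : a₂ ≫ (λ_ W).inv ≫ copair A ▷ W =
      (λ_ _).inv ≫ copair A ▷ _ ≫ (A ⊗ A) ◁ a₂ := by
    rw [← whisker_exchange, leftUnitor_inv_naturality_assoc]
  simp only [twoActProj, Category.assoc, comp_whiskerRight]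
  rw [reassoc_of% e2, associator_naturality_middle_assoc, e1]
  monoidal

lemma act₁_proj [IsCommMonObj A] (h : TwoActions a₁ a₂) :
    a₁ ≫ twoActProj a₁ a₂ = twoActK a₁ a₂ := by
  rw [twoActK, ← copair_braid]
  have e1 : μ[A] ▷ A ▷ W ≫ (α_ A A W).hom ≫ A ◁ a₂ ≫ a₁ =
    (α_ (A ⊗ A) A W).hom ≫ (A ⊗ A) ◁ a₂ ≫ (α_ A A W).hom ≫ A ◁ a₁ ≫ a₁ := by
    rw [← h.mul₁, whisker_exchange_assoc]; simp
  have e2 : a₁ ≫ (λ_ W).inv ≫ copair A ▷ W =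
      (λ_ _).inv ≫ copair A ▷ _ ≫ (A ⊗ A) ◁ a₁ := by
    rw [← whisker_exchange, leftUnitor_inv_naturality_assoc]
  simp only [twoActProj, Category.assoc, comp_whiskerRight]
  rw [reassoc_of% e2, e1]
  have e3 : (A ⊗ A) ◁ a₁ ≫ (α_ A A W).hom ≫ A ◁ a₂ =
      (α_ _ _ _).hom ≫ A ◁ ((α_ A A W).inv ≫ (β_ A A).hom ▷ W ≫ (α_ A A W).hom ≫
        A ◁ a₂ ≫ a₁) := by
    rw [← h.comm]; simp
  rw [reassoc_of% e3]
  monoidal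

/-- The part of the projector before the final action; a section of the second action. -/
def sec (a₂ : A ⊗ W ⟶ W) : W ⟶ A ⊗ W :=
  (λ_ W).inv ≫ copair A ▷ W ≫ (α_ A A W).hom ≫ A ◁ a₂

lemma sec_act₁ : sec a₂ ≫ a₁ = twoActProj a₁ a₂ := by simp [sec, twoActProj]

variable [IsDeltaSeparable A]

lemma sec_act₂ (h : TwoActions a₁ a₂) : sec a₂ ≫ a₂ = 𝟙 W := by
  have e := h.mul₂
  simp only [sec, Category.assoc]
  rw [← e, ← comp_whiskerRight_assoc, copair_mul, h.one₂]
  simp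

lemma proj_proj [IsCommMonObj A] (h : TwoActions a₁ a₂) :
    twoActProj a₁ a₂ ≫ twoActProj a₁ a₂ = twoActProj a₁ a₂ := by
  nth_rw 1 [← sec_act₁]
  rw [Category.assoc, h.act₁_proj, ← h.act₂_proj, reassoc_of% h.sec_act₂]

end TwoActions

end TwoActions

section Actions
variable {C : Type u} [Category.{v} C] [MonoidalCategory C]

/-- Left modules over the algebra `A` in `C`. -/
abbrev Modl (A : C) [MonObj A] := CategoryTheory.Mod C A

variable {A : C} [MonObj A]

/-- The action `A ⊗ M ⟶ M`. -/
def act (M : Modl A) : A ⊗ M.X ⟶ M.X := ModObj.smul (M := A) (X := M.X)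

lemma one_act (M : Modl A) : η[A] ▷ M.X ≫ act M = (λ_ M.X).hom := ModObj.one_smul_self A M.X

lemma mul_act (M : Modl A) : μ[A] ▷ M.X ≫ act M = (α_ _ _ _).hom ≫ A ◁ act M ≫ act M :=
  ModObj.mul_smul_self A M.X

/-- A module from an action on `X`. -/
def mkMod (X : C) (a : A ⊗ X ⟶ X) (h₁ : η[A] ▷ X ≫ a = (λ_ X).hom)
    (h₂ : μ[A] ▷ X ≫ a = (α_ A A X).hom ≫ A ◁ a ≫ a) : Modl A :=
  letI : ModObj A X := { smul := a, one_smul := h₁, mul_smul := h₂ }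
  ⟨X⟩

@[simp] lemma mkMod_X (X : C) (a : A ⊗ X ⟶ X) (h₁ h₂) : (mkMod X a h₁ h₂).X = X := rfl
@[simp] lemma act_mkMod (X : C) (a : A ⊗ X ⟶ X) (h₁ h₂) : act (mkMod X a h₁ h₂) = a := rfl

lemma act_hom {M N : Modl A} (f : M ⟶ N) : act M ≫ f.hom = A ◁ f.hom ≫ act N :=
  IsModHom.smul_hom (A := A) (f := f.hom)

/-- A morphism of modules from an intertwiner. -/
def mkHom {M N : Modl A} (f : M.X ⟶ N.X) (h : act M ≫ f = A ◁ f ≫ act N) : M ⟶ N :=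
  Mod.Hom.mk' f h

@[simp] lemma mkHom_hom {M N : Modl A} (f : M.X ⟶ N.X) (h) : (mkHom f h).hom = f := rfl

/-- The action of `A` on the first factor of `M ⊗ Y`. -/
def actFst (M : Modl A) (Y : C) : A ⊗ (M.X ⊗ Y) ⟶ M.X ⊗ Y := (α_ _ _ _).inv ≫ act M ▷ Y

variable [BraidedCategory C]

/-- The action of `A` on the second factor of `X ⊗ N`, braiding `A` over `X`. -/
def actSnd (X : C) (N : Modl A) : A ⊗ (X ⊗ N.X) ⟶ X ⊗ N.X :=
  (α_ _ _ _).inv ≫ (β_ A X).hom ▷ N.X ≫ (α_ _ _ _).hom ≫ X ◁ act N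

lemma twoActions (M N : Modl A) : TwoActions (actFst M N.X) (actSnd M.X N) where
  one₁ := by
    have := congr($(one_act M) ▷ N.X)
    rw [comp_whiskerRight] at this
    simp only [actFst, associator_inv_naturality_left_assoc, this]
    monoidal
  mul₁ := by
    have := congr($(mul_act M) ▷ N.X)
    simp only [comp_whiskerRight] at this
    simp only [actFst, associator_inv_naturality_left_assoc, this]
    monoidal
  one₂ := by
    have h : η[A] ▷ M.X ≫ (β_ A M.X).hom = (β_ (𝟙_ C) M.X).hom ≫ M.X ◁ η[A] :=
      BraidedCategory.braiding_naturality_left _ _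
    have := congr(M.X ◁ $(one_act N))
    rw [MonoidalCategory.whiskerLeft_comp] at this
    simp only [actSnd, associator_inv_naturality_left_assoc]
    rw [← comp_whiskerRight_assoc, h, comp_whiskerRight_assoc,
      associator_naturality_middle_assoc, this]
    simp
  mul₂ := by
    have h : μ[A] ▷ M.X ≫ (β_ A M.X).hom = (β_ (A ⊗ A) M.X).hom ≫ M.X ◁ μ[A] :=
      BraidedCategory.braiding_naturality_left _ _
    have := congr(M.X ◁ $(mul_act N))
    simp only [MonoidalCategory.whiskerLeft_comp] at this
    simp only [actSnd, associator_inv_naturality_left_assoc]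
    rw [← comp_whiskerRight_assoc, h, comp_whiskerRight_assoc,
      associator_naturality_middle_assoc, this]
    have e : (β_ A M.X).hom ▷ (A ⊗ N.X) ≫ (M.X ⊗ A) ◁ act N = (A ⊗ M.X) ◁ act N ≫
        (β_ A M.X).hom ▷ N.X := (whisker_exchange _ _).symm
    rw [BraidedCategory.braiding_tensor_left_hom]
    simp only [MonoidalCategory.whiskerLeft_comp, comp_whiskerRight, Category.assoc]
    have e2 : A ◁ M.X ◁ act N ≫ (α_ A M.X N.X).inv ≫ (β_ A M.X).hom ▷ N.X =
      (α_ _ _ _).inv ≫ (β_ A M.X).hom ▷ (A ⊗ N.X) ≫ (M.X ⊗ A) ◁ act N := by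
      rw [e]; simp
    rw [reassoc_of% e2]
    monoidal
  comm := by
    simp only [actSnd, actFst]
    have h : act M ▷ N.X ≫ 𝟙 _ = act M ▷ N.X := Category.comp_id _
    have h : A ◁ act M ≫ (β_ A M.X).hom = (β_ A (A ⊗ M.X)).hom ≫ act M ▷ A :=
      BraidedCategory.braiding_naturality_right _ _
    rw [BraidedCategory.braiding_tensor_right_hom] at h
    have e1 : (act M ▷ A) ▷ N.X ≫ (α_ _ _ _).hom ≫ M.X ◁ act N =
      (α_ _ _ _).hom ≫ (A ⊗ M.X) ◁ act N ≫ act M ▷ N.X := by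
      rw [whisker_exchange]; simp
    have h2 := congr($h ▷ N.X ≫ (α_ _ _ _).hom ≫ M.X ◁ act N)
    simp only [comp_whiskerRight, Category.assoc, e1] at h2
    simp only [MonoidalCategory.whiskerLeft_comp, Category.assoc,
      associator_inv_naturality_middle_assoc]
    rw [h2]
    monoidal

end Actions

section Slide
variable {C : Type u} [Category.{v} C] [MonoidalCategory C] [BraidedCategory C] {A : C}

instance isSplitEpi_whiskerRight {X Y : C} (f : X ⟶ Y) [IsSplitEpi f] (Z : C) :
    IsSplitEpi (f ▷ Z) :=
  inferInstanceAs (IsSplitEpi ((tensorRight Z).map f))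

instance isSplitEpi_whiskerLeft {X Y : C} (f : X ⟶ Y) [IsSplitEpi f] (Z : C) :
    IsSplitEpi (Z ◁ f) :=
  inferInstanceAs (IsSplitEpi ((tensorLeft Z).map f))

/-- Let `A` act on the second factor of `X ⊗ W`, braiding `A` over `X`. -/
def slide (X : C) {W : C} (a : A ⊗ W ⟶ W) : A ⊗ (X ⊗ W) ⟶ X ⊗ W :=
  (α_ _ _ _).inv ≫ (β_ A X).hom ▷ W ≫ (α_ _ _ _).hom ≫ X ◁ a

lemma slide_whiskerLeft (X : C) {W W' : C} (a : A ⊗ W ⟶ W) (b : A ⊗ W' ⟶ W') (f : W ⟶ W')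
    (h : a ≫ f = A ◁ f ≫ b) : slide X a ≫ X ◁ f = A ◁ X ◁ f ≫ slide X b := by
  simp only [slide, Category.assoc, ← MonoidalCategory.whiskerLeft_comp, h]
  rw [associator_inv_naturality_right_assoc, whisker_exchange_assoc]
  simp

lemma whiskerRight_slide {X X' : C} (f : X ⟶ X') {W : C} (a : A ⊗ W ⟶ W) :
    A ◁ f ▷ W ≫ slide X' a = slide X a ≫ f ▷ W := by
  simp only [slide, Category.assoc, associator_inv_naturality_middle_assoc]
  rw [← comp_whiskerRight_assoc, BraidedCategory.braiding_naturality_right,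
    comp_whiskerRight_assoc, associator_naturality_left_assoc, ← whisker_exchange]

lemma slide_slide (X Y : C) {W : C} (a : A ⊗ W ⟶ W) :
    A ◁ (α_ X Y W).hom ≫ slide X (slide Y a) = slide (X ⊗ Y) a ≫ (α_ X Y W).hom := by
  simp only [slide, BraidedCategory.braiding_tensor_right_hom]
  monoidal

end Slide

section RelTensor
variable {C : Type u} [Category.{v} C] [MonoidalCategory C] {A : C} [MonObj A]

lemma actFst_whiskerLeft (M : Modl A) {Y Y' : C} (f : Y ⟶ Y') :
    actFst M Y ≫ M.X ◁ f = A ◁ M.X ◁ f ≫ actFst M Y' := by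
  simp only [actFst, Category.assoc, ← whisker_exchange]
  simp

lemma actFst_whiskerRight {M N : Modl A} (f : M ⟶ N) (Y : C) :
    actFst M Y ≫ f.hom ▷ Y = A ◁ f.hom ▷ Y ≫ actFst N Y := by
  simp only [actFst, Category.assoc, ← comp_whiskerRight, act_hom]
  simp

lemma whiskerLeft_actFst_tensor (M : Modl A) (Y Z : C) :
    A ◁ (α_ M.X Y Z).hom ≫ actFst M (Y ⊗ Z) =
      (α_ _ _ _).inv ≫ actFst M Y ▷ Z ≫ (α_ M.X Y Z).hom := by
  simp only [actFst]; monoidal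

variable [BraidedCategory C]

lemma actSnd_eq (X : C) (N : Modl A) : actSnd X N = slide X (act N) := rfl

lemma slide_actFst (X : C) (N : Modl A) (Y : C) :
    A ◁ (α_ X N.X Y).hom ≫ slide X (actFst N Y) =
      (α_ _ _ _).inv ≫ actSnd X N ▷ Y ≫ (α_ _ _ _).hom := by
  simp only [actFst, actSnd, slide]; monoidal

/-- The projector on `M ⊗ N` with image `M ⊗_A N`. -/
def relProj [ComonObj A] (M N : Modl A) : M.X ⊗ N.X ⟶ M.X ⊗ N.X :=
  twoActProj (actFst M N.X) (actSnd M.X N)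

variable [ComonObj A] [IsFrobenius A] [IsDeltaSeparable A] [IsCommMonObj A]
  [IsIdempotentComplete C]

lemma exists_split (M N : Modl A) : ∃ (Y : C) (i : Y ⟶ M.X ⊗ N.X) (e : M.X ⊗ N.X ⟶ Y),
    i ≫ e = 𝟙 Y ∧ e ≫ i = relProj M N :=
  IsIdempotentComplete.idempotents_split _ _ (twoActions M N).proj_proj

/-- The object underlying `M ⊗_A N`. -/
noncomputable def relT (M N : Modl A) : C := (exists_split M N).choose

/-- The inclusion `M ⊗_A N ⟶ M ⊗ N`. -/
noncomputable def relι₀ (M N : Modl A) : relT M N ⟶ M.X ⊗ N.X :=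
  (exists_split M N).choose_spec.choose

/-- The projection `M ⊗ N ⟶ M ⊗_A N`. -/
noncomputable def relπ₀ (M N : Modl A) : M.X ⊗ N.X ⟶ relT M N :=
  (exists_split M N).choose_spec.choose_spec.choose

@[simp]
lemma relι₀_π (M N : Modl A) : relι₀ M N ≫ relπ₀ M N = 𝟙 _ :=
  (exists_split M N).choose_spec.choose_spec.choose_spec.1

lemma relπ₀_ι (M N : Modl A) : relπ₀ M N ≫ relι₀ M N = relProj M N :=
  (exists_split M N).choose_spec.choose_spec.choose_spec.2

instance (M N : Modl A) : IsSplitEpi (relπ₀ M N) := ⟨⟨⟨relι₀ M N, relι₀_π M N⟩⟩⟩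
instance (M N : Modl A) : IsSplitMono (relι₀ M N) := ⟨⟨⟨relπ₀ M N, relι₀_π M N⟩⟩⟩

lemma relProj_π₀ (M N : Modl A) : relProj M N ≫ relπ₀ M N = relπ₀ M N := by
  rw [← relπ₀_ι, Category.assoc, relι₀_π, Category.comp_id]

lemma actFst_π₀ (M N : Modl A) : actFst M N.X ≫ relπ₀ M N = actSnd M.X N ≫ relπ₀ M N := by
  rw [← cancel_mono (relι₀ M N), Category.assoc, Category.assoc, relπ₀_ι, relProj,
    (twoActions M N).act₁_proj, (twoActions M N).act₂_proj]

lemma relProj_comp {M N : Modl A} {Z : C} (g : M.X ⊗ N.X ⟶ Z)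
    (hg : actFst M N.X ≫ g = actSnd M.X N ≫ g) : relProj M N ≫ g = g := by
  rw [relProj, ← TwoActions.sec_act₁, Category.assoc, hg, reassoc_of% (twoActions M N).sec_act₂]

lemma relProj_whiskerRight_comp {M N : Modl A} {Y Z : C} (g : (M.X ⊗ N.X) ⊗ Y ⟶ Z)
    (hg : actFst M N.X ▷ Y ≫ g = actSnd M.X N ▷ Y ≫ g) : relProj M N ▷ Y ≫ g = g := by
  rw [relProj, ← TwoActions.sec_act₁, comp_whiskerRight_assoc, hg, ← comp_whiskerRight_assoc,
    (twoActions M N).sec_act₂]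
  simp

lemma whiskerLeft_relProj_comp {M N : Modl A} {Y Z : C} (g : Y ⊗ (M.X ⊗ N.X) ⟶ Z)
    (hg : Y ◁ actFst M N.X ≫ g = Y ◁ actSnd M.X N ≫ g) : Y ◁ relProj M N ≫ g = g := by
  rw [relProj, ← TwoActions.sec_act₁, MonoidalCategory.whiskerLeft_comp_assoc, hg,
    ← MonoidalCategory.whiskerLeft_comp_assoc, (twoActions M N).sec_act₂]
  simp

/-- The action of `A` on `M ⊗_A N`. -/
noncomputable def relAct (M N : Modl A) : A ⊗ relT M N ⟶ relT M N :=
  A ◁ relι₀ M N ≫ actFst M N.X ≫ relπ₀ M N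

lemma whisker_π_relAct₀ (M N : Modl A) :
    A ◁ relπ₀ M N ≫ relAct M N = actFst M N.X ≫ relπ₀ M N := by
  rw [relAct, ← MonoidalCategory.whiskerLeft_comp_assoc, relπ₀_ι, relProj,
    reassoc_of% (twoActions M N).whisker_proj_act₁, ← (twoActions M N).act₁_proj, Category.assoc]
  erw [relProj_π₀]

/-- The relative tensor product `M ⊗_A N`. -/
noncomputable def relMod (M N : Modl A) : Modl A :=
  mkMod (relT M N) (relAct M N)
    (by
      rw [← cancel_epi (𝟙_ C ◁ relπ₀ M N), whisker_exchange_assoc, whisker_π_relAct₀,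
        ← Category.assoc, (twoActions M N).one₁]
      simp)
    (by
      rw [← cancel_epi ((A ⊗ A) ◁ relπ₀ M N), whisker_exchange_assoc, whisker_π_relAct₀,
        ← Category.assoc, (twoActions M N).mul₁]
      have : A ◁ A ◁ relπ₀ M N ≫ A ◁ relAct M N = A ◁ actFst M N.X ≫ A ◁ relπ₀ M N := by
        simp only [← MonoidalCategory.whiskerLeft_comp, whisker_π_relAct₀]
      rw [associator_naturality_right_assoc, reassoc_of% this, whisker_π_relAct₀]
      simp)

/-- The inclusion `M ⊗_A N ⟶ M ⊗ N`. -/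
noncomputable def relι (M N : Modl A) : (relMod M N).X ⟶ M.X ⊗ N.X := relι₀ M N

/-- The projection `M ⊗ N ⟶ M ⊗_A N`. -/
noncomputable def relπ (M N : Modl A) : M.X ⊗ N.X ⟶ (relMod M N).X := relπ₀ M N

@[simp]
lemma relι_π (M N : Modl A) : relι M N ≫ relπ M N = 𝟙 _ := relι₀_π M N

@[simp]
lemma relι_π_assoc (M N : Modl A) {Z : C} (h : (relMod M N).X ⟶ Z) :
    relι M N ≫ relπ M N ≫ h = h := by
  rw [← Category.assoc, relι_π, Category.id_comp]

lemma relπ_ι (M N : Modl A) : relπ M N ≫ relι M N = relProj M N := relπ₀_ι M N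

instance (M N : Modl A) : IsSplitEpi (relπ M N) := ⟨⟨⟨relι M N, relι_π M N⟩⟩⟩

lemma actFst_π (M N : Modl A) : actFst M N.X ≫ relπ M N = actSnd M.X N ≫ relπ M N := actFst_π₀ M N

lemma whisker_π_act (M N : Modl A) :
    A ◁ relπ M N ≫ act (relMod M N) = actFst M N.X ≫ relπ M N := whisker_π_relAct₀ M N

/-- The map on `M ⊗_A N` induced by a balanced map on `M ⊗ N`. -/
noncomputable def relDesc {M N : Modl A} {Z : C} (g : M.X ⊗ N.X ⟶ Z) : (relMod M N).X ⟶ Z :=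
  relι M N ≫ g

lemma π_relDesc {M N : Modl A} {Z : C} (g : M.X ⊗ N.X ⟶ Z)
    (hg : actFst M N.X ≫ g = actSnd M.X N ≫ g) : relπ M N ≫ relDesc g = g := by
  rw [relDesc, reassoc_of% relπ_ι, relProj_comp g hg]

lemma relMod_hom_intertwine {M N Z : Modl A} (h : (relMod M N).X ⟶ Z.X)
    (hg : actFst M N.X ≫ relπ M N ≫ h = A ◁ (relπ M N ≫ h) ≫ act Z) :
    act (relMod M N) ≫ h = A ◁ h ≫ act Z := by
  have := whisker_π_act M N
  rw [← cancel_epi (A ◁ relπ M N)]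
  rw [reassoc_of% this]
  rw [hg, MonoidalCategory.whiskerLeft_comp]
  simp

lemma relMap_balanced {M N M' N' : Modl A} (f : M ⟶ M') (g : N ⟶ N') :
    actFst M N.X ≫ (f.hom ⊗ₘ g.hom) ≫ relπ M' N' =
      actSnd M.X N ≫ (f.hom ⊗ₘ g.hom) ≫ relπ M' N' := by
  have h1 : actFst M N.X ≫ (f.hom ⊗ₘ g.hom) = A ◁ (f.hom ⊗ₘ g.hom) ≫ actFst M' N'.X := by
    rw [MonoidalCategory.tensorHom_def, reassoc_of% actFst_whiskerRight, actFst_whiskerLeft]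
    simp
  have h2 : actSnd M.X N ≫ (f.hom ⊗ₘ g.hom) = A ◁ (f.hom ⊗ₘ g.hom) ≫ actSnd M'.X N' := by
    rw [MonoidalCategory.tensorHom_def, actSnd_eq, ← reassoc_of% whiskerRight_slide,
      slide_whiskerLeft _ _ _ _ (act_hom g)]
    simp [actSnd_eq]
  rw [reassoc_of% h1, reassoc_of% h2, actFst_π]

lemma actFst_tensorHom {M N M' N' : Modl A} (f : M ⟶ M') (g : N ⟶ N') :
    actFst M N.X ≫ (f.hom ⊗ₘ g.hom) ≫ relπ M' N' =
      A ◁ ((f.hom ⊗ₘ g.hom) ≫ relπ M' N') ≫ act (relMod M' N') := by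
  rw [MonoidalCategory.tensorHom_def, Category.assoc, reassoc_of% actFst_whiskerRight,
    reassoc_of% actFst_whiskerLeft]
  simp [whisker_π_act]

/-- The tensor product of module morphisms, `π ∘ (f ⊗ g) ∘ ι`. -/
noncomputable def relMap {M N M' N' : Modl A} (f : M ⟶ M') (g : N ⟶ N') :
    relMod M N ⟶ relMod M' N' :=
  mkHom (relι M N ≫ (f.hom ⊗ₘ g.hom) ≫ relπ M' N') <| relMod_hom_intertwine _ <| by
    have := π_relDesc _ (relMap_balanced f g)
    simp only [relDesc] at this
    rw [this]
    exact actFst_tensorHom f g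

lemma π_relMap {M N M' N' : Modl A} (f : M ⟶ M') (g : N ⟶ N') :
    relπ M N ≫ (relMap f g).hom = (f.hom ⊗ₘ g.hom) ≫ relπ M' N' :=
  π_relDesc _ (relMap_balanced f g)

lemma rel_hom_ext {M N Z : Modl A} {f g : relMod M N ⟶ Z}
    (h : relπ M N ≫ f.hom = relπ M N ≫ g.hom) : f = g := by
  ext
  exact (cancel_epi (relπ M N)).1 h

section Assoc
variable (M N P : Modl A)

/-- Projection to the right-bracketed triple tensor product. -/
noncomputable def π₃ : M.X ⊗ (N.X ⊗ P.X) ⟶ (relMod M (relMod N P)).X :=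
  M.X ◁ relπ N P ≫ relπ M (relMod N P)

/-- Projection to the left-bracketed triple tensor product. -/
noncomputable def π₃' : (M.X ⊗ N.X) ⊗ P.X ⟶ (relMod (relMod M N) P).X :=
  relπ M N ▷ P.X ≫ relπ (relMod M N) P

instance : IsSplitEpi (π₃ M N P) := by unfold π₃; infer_instance
instance : IsSplitEpi (π₃' M N P) := by unfold π₃'; infer_instance

lemma actFst_π₃ : actFst M (N.X ⊗ P.X) ≫ π₃ M N P = A ◁ π₃ M N P ≫ act (relMod M (relMod N P)) := by
  have := whisker_π_act M (relMod N P)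
  rw [π₃, MonoidalCategory.whiskerLeft_comp, Category.assoc]
  rw [this]
  rw [reassoc_of% actFst_whiskerLeft]

lemma slide_actFst_π₃ :
    slide M.X (actFst N P.X) ≫ π₃ M N P = A ◁ π₃ M N P ≫ act (relMod M (relMod N P)) := by
  have := whisker_π_act M (relMod N P)
  rw [π₃, MonoidalCategory.whiskerLeft_comp, Category.assoc]
  rw [this]
  rw [reassoc_of% (slide_whiskerLeft _ _ _ _ (whisker_π_act N P).symm)]
  rw [actFst_π]
  rfl

lemma slide_actSnd_π₃ :
    slide M.X (actSnd N.X P) ≫ π₃ M N P = A ◁ π₃ M N P ≫ act (relMod M (relMod N P)) := by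
  have := whisker_π_act M (relMod N P)
  rw [π₃, MonoidalCategory.whiskerLeft_comp, Category.assoc]
  rw [this]
  rw [reassoc_of% (slide_whiskerLeft _ _ (act (relMod N P)) _)
    ((actFst_π N P).symm.trans (whisker_π_act N P).symm)]
  rw [actFst_π]
  rfl

lemma actFst_π₃' : actFst M N.X ▷ P.X ≫ π₃' M N P =
    (α_ _ _ _).hom ≫ A ◁ π₃' M N P ≫ act (relMod (relMod M N) P) := by
  have := whisker_π_act (relMod M N) P
  rw [π₃', MonoidalCategory.whiskerLeft_comp, Category.assoc]
  rw [this]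
  rw [← comp_whiskerRight_assoc, ← whisker_π_act]
  simp [actFst]

lemma actSnd_π₃' : actSnd M.X N ▷ P.X ≫ π₃' M N P =
    (α_ _ _ _).hom ≫ A ◁ π₃' M N P ≫ act (relMod (relMod M N) P) := by
  rw [← actFst_π₃', π₃', ← comp_whiskerRight_assoc, ← comp_whiskerRight_assoc, actFst_π]

lemma slide_π₃' : slide (M.X ⊗ N.X) (act P) ≫ π₃' M N P =
    A ◁ π₃' M N P ≫ act (relMod (relMod M N) P) := by
  have := whisker_π_act (relMod M N) P
  rw [π₃', MonoidalCategory.whiskerLeft_comp, Category.assoc]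
  rw [this]
  rw [actFst_π, ← reassoc_of% whiskerRight_slide]
  rfl

lemma assoc_bal₁ : actFst M N.X ▷ P.X ≫ (α_ _ _ _).hom ≫ π₃ M N P =
    (α_ _ _ _).hom ≫ A ◁ ((α_ _ _ _).hom ≫ π₃ M N P) ≫ act (relMod M (relMod N P)) := by
  have := (reassoc_of% (whiskerLeft_actFst_tensor M N.X P.X)) (π₃ M N P)
  rw [← cancel_epi (α_ _ _ _).inv, ← this, actFst_π₃]
  simp

lemma assoc_bal₂ : actSnd M.X N ▷ P.X ≫ (α_ _ _ _).hom ≫ π₃ M N P =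
    (α_ _ _ _).hom ≫ A ◁ ((α_ _ _ _).hom ≫ π₃ M N P) ≫ act (relMod M (relMod N P)) := by
  have := (reassoc_of% (slide_actFst M.X N P.X)) (π₃ M N P)
  rw [← cancel_epi (α_ _ _ _).inv, ← this, slide_actFst_π₃]
  simp

lemma assoc_bal₃ : slide (M.X ⊗ N.X) (act P) ≫ (α_ _ _ _).hom ≫ π₃ M N P =
    A ◁ ((α_ _ _ _).hom ≫ π₃ M N P) ≫ act (relMod M (relMod N P)) := by
  rw [← reassoc_of% slide_slide, ← actSnd_eq, slide_actSnd_π₃]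
  simp

lemma assocInv_bal₁ : actFst M (N.X ⊗ P.X) ≫ (α_ _ _ _).inv ≫ π₃' M N P =
    A ◁ ((α_ _ _ _).inv ≫ π₃' M N P) ≫ act (relMod (relMod M N) P) := by
  have := (reassoc_of% (whiskerLeft_actFst_tensor M N.X P.X)) ((α_ _ _ _).inv ≫ π₃' M N P)
  rw [← cancel_epi (A ◁ (α_ M.X N.X P.X).hom), this]
  simp [actFst_π₃']

lemma assocInv_bal₂ : slide M.X (actFst N P.X) ≫ (α_ _ _ _).inv ≫ π₃' M N P =
    A ◁ ((α_ _ _ _).inv ≫ π₃' M N P) ≫ act (relMod (relMod M N) P) := by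
  have := (reassoc_of% (slide_actFst M.X N P.X)) ((α_ _ _ _).inv ≫ π₃' M N P)
  rw [← cancel_epi (A ◁ (α_ M.X N.X P.X).hom), this]
  simp [actSnd_π₃']

lemma assocInv_bal₃ : slide M.X (actSnd N.X P) ≫ (α_ _ _ _).inv ≫ π₃' M N P =
    A ◁ ((α_ _ _ _).inv ≫ π₃' M N P) ≫ act (relMod (relMod M N) P) := by
  have := (reassoc_of% (slide_slide M.X N.X (act P))) ((α_ _ _ _).inv ≫ π₃' M N P)
  rw [← cancel_epi (A ◁ (α_ M.X N.X P.X).hom), actSnd_eq, this]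
  simp [slide_π₃']

/-- The underlying morphism of the associator. -/
noncomputable def relAssocHom : (relMod (relMod M N) P).X ⟶ (relMod M (relMod N P)).X :=
  relι (relMod M N) P ≫ relι M N ▷ P.X ≫ (α_ _ _ _).hom ≫ π₃ M N P

/-- The underlying morphism of the inverse associator. -/
noncomputable def relAssocInv : (relMod M (relMod N P)).X ⟶ (relMod (relMod M N) P).X :=
  relι M (relMod N P) ≫ M.X ◁ relι N P ≫ (α_ _ _ _).inv ≫ π₃' M N P

lemma π₃'_assocHom : π₃' M N P ≫ relAssocHom M N P = (α_ _ _ _).hom ≫ π₃ M N P := by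
  have e : relProj M N ▷ P.X ≫ (α_ _ _ _).hom ≫ π₃ M N P = (α_ _ _ _).hom ≫ π₃ M N P :=
    relProj_whiskerRight_comp _ (by rw [assoc_bal₁, assoc_bal₂])
  have e' : relπ M N ▷ P.X ≫ relι M N ▷ P.X ≫ (α_ _ _ _).hom ≫ π₃ M N P =
      (α_ _ _ _).hom ≫ π₃ M N P := by
    rw [← comp_whiskerRight_assoc, relπ_ι, e]
  rw [π₃', relAssocHom, Category.assoc, ← relDesc, π_relDesc, e']
  rw [← cancel_epi (A ◁ (relπ M N ▷ P.X)), actSnd_eq]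
  rw [reassoc_of% whiskerRight_slide, e', assoc_bal₃]
  have h2 : A ◁ relπ M N ▷ P.X ≫ actFst (relMod M N) P.X =
      (α_ _ _ _).inv ≫ actFst M N.X ▷ P.X ≫ relπ M N ▷ P.X := by
    have := congr((α_ _ _ _).inv ≫ $(whisker_π_act M N) ▷ P.X)
    simp only [comp_whiskerRight] at this
    rw [← this]
    simp [actFst]
  rw [reassoc_of% h2, e', assoc_bal₁]
  simp

lemma π₃_assocInv : π₃ M N P ≫ relAssocInv M N P = (α_ _ _ _).inv ≫ π₃' M N P := by
  have e : M.X ◁ relProj N P ≫ (α_ _ _ _).inv ≫ π₃' M N P = (α_ _ _ _).inv ≫ π₃' M N P := by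
    refine whiskerLeft_relProj_comp _ ?_
    have i := (assocInv_bal₂ M N P).trans (assocInv_bal₃ M N P).symm
    simp only [slide, Category.assoc] at i
    exact (cancel_epi _).1 ((cancel_epi _).1 ((cancel_epi _).1 i))
  have e' : M.X ◁ relπ N P ≫ M.X ◁ relι N P ≫ (α_ _ _ _).inv ≫ π₃' M N P =
      (α_ _ _ _).inv ≫ π₃' M N P := by
    rw [← MonoidalCategory.whiskerLeft_comp_assoc, relπ_ι, e]
  rw [π₃, relAssocInv, Category.assoc, ← relDesc, π_relDesc, e']
  rw [← cancel_epi (A ◁ (M.X ◁ relπ N P)), actSnd_eq]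
  rw [← reassoc_of% (slide_whiskerLeft _ _ _ _ (whisker_π_act N P).symm)]
  rw [e', assocInv_bal₂]
  rw [← assocInv_bal₁]
  rw [← reassoc_of% actFst_whiskerLeft]
  rw [e']

lemma relAssoc_hom_inv : relAssocHom M N P ≫ relAssocInv M N P = 𝟙 _ := by
  rw [← cancel_epi (π₃' M N P), reassoc_of% π₃'_assocHom, π₃_assocInv]; simp

lemma relAssoc_inv_hom : relAssocInv M N P ≫ relAssocHom M N P = 𝟙 _ := by
  rw [← cancel_epi (π₃ M N P), reassoc_of% π₃_assocInv, π₃'_assocHom]; simp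

lemma relAssoc_intertwine : act (relMod (relMod M N) P) ≫ relAssocHom M N P =
    A ◁ relAssocHom M N P ≫ act (relMod M (relMod N P)) := by
  rw [← cancel_epi (A ◁ π₃' M N P), ← MonoidalCategory.whiskerLeft_comp_assoc,
    π₃'_assocHom, ← cancel_epi (α_ _ _ _).hom, ← assoc_bal₁]
  have := actFst_π₃' M N P
  rw [← reassoc_of% this, π₃'_assocHom]

end Assoc

end RelTensor

section Monoidal
variable {C : Type u} [Category.{v} C] [MonoidalCategory C] {A : C} [MonObj A]

@[simp] lemma act_regular : act (Mod.regular A) = μ[A] := rfl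

variable [BraidedCategory C] [ComonObj A] [IsFrobenius A] [IsDeltaSeparable A] [IsCommMonObj A]
  [IsIdempotentComplete C]

/-- The right action `M ⊗ A ⟶ M`. -/
def ract (M : Modl A) : M.X ⊗ A ⟶ M.X := (β_ A M.X).inv ≫ act M

lemma ract_hom {M N : Modl A} (f : M ⟶ N) : ract M ≫ f.hom = f.hom ▷ A ≫ ract N := by
  simp [ract, act_hom]

/-- The projection `A ⊗ M ⟶ A ⊗_A M`. -/
noncomputable def lamπ (M : Modl A) : A ⊗ M.X ⟶ (relMod (Mod.regular A) M).X :=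
  relπ (Mod.regular A) M

/-- The projection `M ⊗ A ⟶ M ⊗_A A`. -/
noncomputable def rhoπ (M : Modl A) : M.X ⊗ A ⟶ (relMod M (Mod.regular A)).X :=
  relπ M (Mod.regular A)

lemma lamπ_bal (M : Modl A) : (α_ A A M.X).inv ≫ μ[A] ▷ M.X ≫ lamπ M =
    slide A (act M) ≫ lamπ M := by
  have := actFst_π (Mod.regular A) M
  simp only [actFst, Category.assoc] at this
  exact this

lemma rhoπ_bal (M : Modl A) : actFst M A ≫ rhoπ M = slide M.X μ[A] ≫ rhoπ M :=
  actFst_π M (Mod.regular A)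

lemma act_balanced (M : Modl A) :
    (α_ A A M.X).inv ≫ μ[A] ▷ M.X ≫ act M = slide A (act M) ≫ act M := by
  have h1 : (β_ A A).hom ▷ M.X ≫ μ[A] ▷ M.X = μ[A] ▷ M.X := by
    rw [← comp_whiskerRight, IsCommMonObj.mul_comm]
  simp only [slide, Category.assoc]
  rw [← mul_act, reassoc_of% h1]

lemma ract_balanced (M : Modl A) : actFst M A ≫ ract M = slide M.X μ[A] ≫ ract M := by
  have h1 : act M ▷ A ≫ (β_ A M.X).inv = (β_ A (A ⊗ M.X)).inv ≫ A ◁ act M :=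
    (BraidedCategory.braiding_inv_naturality_left _ _)
  have h2 : M.X ◁ μ[A] ≫ (β_ A M.X).inv = (β_ (A ⊗ A) M.X).inv ≫ μ[A] ▷ M.X :=
    (BraidedCategory.braiding_inv_naturality_right _ _)
  simp only [actFst, slide, ract, Category.assoc]
  rw [reassoc_of% h1, reassoc_of% h2, mul_act, BraidedCategory.braiding_tensor_right_inv,
    BraidedCategory.braiding_tensor_left_inv]
  have h3 := mul_act M
  rw [← Iso.inv_comp_eq] at h3
  simp only [Category.assoc]
  rw [← h3]
  have h4 : (β_ A A).inv ▷ M.X ≫ μ[A] ▷ M.X = μ[A] ▷ M.X := by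
    rw [← comp_whiskerRight, IsCommMonObj.mul_comm']
  have e : (β_ A A).inv ▷ M.X ≫ (α_ A A M.X).hom ≫ A ◁ act M ≫ act M =
      (α_ A A M.X).hom ≫ A ◁ act M ≫ act M := by
    rw [← mul_act, reassoc_of% h4]
  simp [mul_act, e]

lemma relDesc_act (M : Modl A) : lamπ M ≫ relι (Mod.regular A) M ≫ act M = act M :=
  π_relDesc (M := Mod.regular A) (N := M) (act M) <|
    (Category.assoc _ _ _).trans (act_balanced M)

lemma relDesc_ract (M : Modl A) : rhoπ M ≫ relι M (Mod.regular A) ≫ ract M = ract M :=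
  π_relDesc (M := M) (N := Mod.regular A) (ract M) (ract_balanced M)

/-- The left unitor, induced by the action. -/
noncomputable def relLam (M : Modl A) : relMod (Mod.regular A) M ⟶ M :=
  mkHom (relι (Mod.regular A) M ≫ act M) <| relMod_hom_intertwine _ <| by
    have h : (α_ A A M.X).inv ≫ μ[A] ▷ M.X ≫ act M = A ◁ act M ≫ act M := by
      rw [mul_act]; simp
    have h2 := relDesc_act M
    exact (congrArg (fun x => ((α_ A A M.X).inv ≫ μ[A] ▷ M.X) ≫ x) h2).trans
      (((Category.assoc _ _ _).trans h).trans (congrArg (fun x => A ◁ x ≫ act M) h2).symm)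

lemma lamπ_relLam (M : Modl A) : lamπ M ≫ (relLam M).hom = act M := relDesc_act M

/-- The inverse left unitor, induced by the unit of `A`. -/
noncomputable def relLamInv (M : Modl A) : M.X ⟶ (relMod (Mod.regular A) M).X :=
  (λ_ M.X).inv ≫ η[A] ▷ M.X ≫ lamπ M

lemma relLam_inv_hom (M : Modl A) : relLamInv M ≫ (relLam M).hom = 𝟙 _ := by
  rw [relLamInv, Category.assoc, Category.assoc, lamπ_relLam, one_act, Iso.inv_hom_id]

lemma relLam_hom_inv (M : Modl A) : (relLam M).hom ≫ relLamInv M = 𝟙 _ := by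
  have : IsSplitEpi (lamπ M) := inferInstanceAs (IsSplitEpi (relπ _ _))
  rw [← cancel_epi (lamπ M), reassoc_of% lamπ_relLam, relLamInv]
  have h : act M ≫ (λ_ M.X).inv ≫ η[A] ▷ M.X =
      A ◁ ((λ_ M.X).inv ≫ η[A] ▷ M.X) ≫ slide A (act M) := by
    rw [MonoidalCategory.whiskerLeft_comp, Category.assoc, whiskerRight_slide]
    rw [slide, leftUnitor_inv_naturality_assoc]
    simp
  rw [reassoc_of% h, ← lamπ_bal]
  have h2 : A ◁ η[A] ≫ μ[A] = (ρ_ A).hom := by simp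
  have h3 := congr(A ◁ (λ_ M.X).inv ≫ (α_ _ _ _).inv ≫ $h2 ▷ M.X)
  simp only [comp_whiskerRight] at h3
  simp only [MonoidalCategory.whiskerLeft_comp, Category.assoc,
    associator_inv_naturality_middle_assoc]
  rw [reassoc_of% h3]
  simp

/-- The left unitor. -/
noncomputable def relLamIso (M : Modl A) : relMod (Mod.regular A) M ≅ M where
  hom := relLam M
  inv := mkHom (relLamInv M) (by
    have e : IsIso (relLam M).hom := ⟨⟨_, relLam_hom_inv M, relLam_inv_hom M⟩⟩
    rw [← cancel_mono (relLam M).hom, Category.assoc, Category.assoc, act_hom,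
      ← MonoidalCategory.whiskerLeft_comp_assoc, relLam_inv_hom]
    simp)
  hom_inv_id := by ext; exact relLam_hom_inv M
  inv_hom_id := by ext; exact relLam_inv_hom M

/-- The right unitor, induced by the action. -/
noncomputable def relRho (M : Modl A) : relMod M (Mod.regular A) ⟶ M :=
  mkHom (relι M (Mod.regular A) ≫ ract M) <| relMod_hom_intertwine _ <| by
    have h2 : M.X ◁ μ[A] ≫ (β_ A M.X).inv = (β_ (A ⊗ A) M.X).inv ≫ μ[A] ▷ M.X :=
      (BraidedCategory.braiding_inv_naturality_right _ _)
    have h : actFst M A ≫ ract M = A ◁ ract M ≫ act M := by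
      rw [ract_balanced]
      simp only [slide, ract, Category.assoc]
      rw [reassoc_of% h2, mul_act, BraidedCategory.braiding_tensor_left_inv]
      simp
    have h2 := relDesc_ract M
    exact (congrArg (fun x => actFst M A ≫ x) h2).trans
      (h.trans (congrArg (fun x => A ◁ x ≫ act M) h2).symm)

lemma rhoπ_relRho (M : Modl A) : rhoπ M ≫ (relRho M).hom = ract M := relDesc_ract M

/-- The inverse right unitor, induced by the unit of `A`. -/
noncomputable def relRhoInv (M : Modl A) : M.X ⟶ (relMod M (Mod.regular A)).X :=
  (ρ_ M.X).inv ≫ M.X ◁ η[A] ≫ rhoπ M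

lemma relRho_inv_hom (M : Modl A) : relRhoInv M ≫ (relRho M).hom = 𝟙 _ := by
  have h2 : M.X ◁ η[A] ≫ (β_ A M.X).inv = (β_ (𝟙_ C) M.X).inv ≫ η[A] ▷ M.X :=
      (BraidedCategory.braiding_inv_naturality_right _ _)
  rw [relRhoInv, Category.assoc, Category.assoc, rhoπ_relRho, ract, reassoc_of% h2, one_act]
  simp

lemma relRho_hom_inv (M : Modl A) : (relRho M).hom ≫ relRhoInv M = 𝟙 _ := by
  have : IsSplitEpi (rhoπ M) := inferInstanceAs (IsSplitEpi (relπ _ _))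
  rw [← cancel_epi (rhoπ M), reassoc_of% rhoπ_relRho, relRhoInv, ract]
  have h : act M ≫ (ρ_ M.X).inv ≫ M.X ◁ η[A] =
      A ◁ ((ρ_ M.X).inv ≫ M.X ◁ η[A]) ≫ actFst M A := by
    rw [MonoidalCategory.whiskerLeft_comp, Category.assoc, ← actFst_whiskerLeft]
    rw [actFst, rightUnitor_inv_naturality_assoc]
    simp
  rw [Category.assoc, reassoc_of% h, rhoπ_bal]
  have h2 : A ◁ η[A] ≫ μ[A] = (ρ_ A).hom := by simp
  have h3 := congr(M.X ◁ $h2)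
  simp only [MonoidalCategory.whiskerLeft_comp] at h3
  simp only [slide, MonoidalCategory.whiskerLeft_comp, Category.assoc]
  have h5 : A ◁ M.X ◁ η[A] ≫ (α_ _ _ _).inv ≫ (β_ A M.X).hom ▷ A ≫ (α_ _ _ _).hom =
     (α_ _ _ _).inv ≫ (β_ A M.X).hom ▷ 𝟙_ C ≫ (α_ _ _ _).hom ≫ M.X ◁ A ◁ η[A] := by
    rw [associator_inv_naturality_right_assoc, whisker_exchange_assoc]
    simp
  rw [reassoc_of% h5, reassoc_of% h3]
  simp

/-- The right unitor. -/
noncomputable def relRhoIso (M : Modl A) : relMod M (Mod.regular A) ≅ M where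
  hom := relRho M
  inv := mkHom (relRhoInv M) (by
    have e : IsIso (relRho M).hom := ⟨⟨_, relRho_hom_inv M, relRho_inv_hom M⟩⟩
    rw [← cancel_mono (relRho M).hom, Category.assoc, Category.assoc, act_hom,
      ← MonoidalCategory.whiskerLeft_comp_assoc, relRho_inv_hom]
    simp)
  hom_inv_id := by ext; exact relRho_hom_inv M
  inv_hom_id := by ext; exact relRho_inv_hom M

lemma π_relLam (M : Modl A) : relπ (Mod.regular A) M ≫ (relLam M).hom = act M := relDesc_act M

lemma π_relRho (M : Modl A) : relπ M (Mod.regular A) ≫ (relRho M).hom = ract M := relDesc_ract M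

/-- The associator. -/
noncomputable def relAssocIso (M N P : Modl A) :
    relMod (relMod M N) P ≅ relMod M (relMod N P) where
  hom := mkHom (relAssocHom M N P) (relAssoc_intertwine M N P)
  inv := mkHom (relAssocInv M N P) (by
    have e : IsIso (relAssocHom M N P) :=
      ⟨⟨_, relAssoc_hom_inv M N P, relAssoc_inv_hom M N P⟩⟩
    rw [← cancel_mono (relAssocHom M N P), Category.assoc, Category.assoc, relAssoc_intertwine,
      ← MonoidalCategory.whiskerLeft_comp_assoc, relAssoc_inv_hom]
    simp)
  hom_inv_id := by ext; exact relAssoc_hom_inv M N P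
  inv_hom_id := by ext; exact relAssoc_inv_hom M N P

noncomputable instance : MonoidalCategoryStruct (Modl A) where
  tensorObj M N := relMod M N
  tensorHom f g := relMap f g
  whiskerLeft M _ _ g := relMap (𝟙 M) g
  whiskerRight f N := relMap f (𝟙 N)
  tensorUnit := Mod.regular A
  associator := relAssocIso
  leftUnitor := relLamIso
  rightUnitor := relRhoIso

lemma π₃'_assoc (M N P : Modl A) :
    π₃' M N P ≫ (relAssocIso M N P).hom.hom = (α_ _ _ _).hom ≫ π₃ M N P :=
  π₃'_assocHom M N P

lemma π₃_relMap {M N P M' N' P' : Modl A} (f : M ⟶ M') (g : N ⟶ N') (h : P ⟶ P') :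
    π₃ M N P ≫ (relMap f (relMap g h)).hom = (f.hom ⊗ₘ (g.hom ⊗ₘ h.hom)) ≫ π₃ M' N' P' := by
  rw [π₃, Category.assoc, π_relMap]
  have : M.X ◁ relπ N P ≫ (f.hom ⊗ₘ (relMap g h).hom) =
    (f.hom ⊗ₘ (g.hom ⊗ₘ h.hom)) ≫ M'.X ◁ relπ N' P' := by
    rw [← id_tensorHom, ← id_tensorHom, tensorHom_comp_tensorHom, tensorHom_comp_tensorHom,
      π_relMap]
    simp
  rw [reassoc_of% this]
  rfl

lemma π₃'_relMap {M N P M' N' P' : Modl A} (f : M ⟶ M') (g : N ⟶ N') (h : P ⟶ P') :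
    π₃' M N P ≫ (relMap (relMap f g) h).hom = ((f.hom ⊗ₘ g.hom) ⊗ₘ h.hom) ≫ π₃' M' N' P' := by
  rw [π₃', Category.assoc, π_relMap]
  have : relπ M N ▷ P.X ≫ ((relMap f g).hom ⊗ₘ h.hom) =
    ((f.hom ⊗ₘ g.hom) ⊗ₘ h.hom) ≫ relπ M' N' ▷ P'.X := by
    rw [← tensorHom_id, ← tensorHom_id, tensorHom_comp_tensorHom, tensorHom_comp_tensorHom,
      π_relMap]
    simp
  rw [reassoc_of% this]
  rfl

lemma rel_hom_ext₃ {M N P Z : Modl A} {f g : relMod (relMod M N) P ⟶ Z}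
    (h : π₃' M N P ≫ f.hom = π₃' M N P ≫ g.hom) : f = g := by
  ext
  exact (cancel_epi (π₃' M N P)).1 h

lemma rel_pentagon (W X Y Z : Modl A) :
    relMap (relAssocIso W X Y).hom (𝟙 Z) ≫ (relAssocIso W (relMod X Y) Z).hom ≫
      relMap (𝟙 W) (relAssocIso X Y Z).hom =
    (relAssocIso (relMod W X) Y Z).hom ≫ (relAssocIso W X (relMod Y Z)).hom := by
  ext
  rw [← cancel_epi (relπ (relMod (relMod W X) Y) Z), ← cancel_epi (π₃' W X Y ▷ Z.X)]
  simp only [Mod.comp_hom', reassoc_of% π_relMap]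
  have h1 : π₃' W X Y ▷ Z.X ≫ ((relAssocIso W X Y).hom.hom ⊗ₘ (𝟙 Z : Z ⟶ Z).hom) =
      (α_ _ _ _).hom ▷ Z.X ≫ (W.X ◁ relπ X Y) ▷ Z.X ≫ relπ W (relMod X Y) ▷ Z.X := by
    rw [Mod.id_hom', tensorHom_id, ← comp_whiskerRight, π₃'_assoc, π₃]
    simp
  rw [reassoc_of% h1]
  have h2 := π₃'_assoc W (relMod X Y) Z
  rw [π₃', Category.assoc] at h2
  rw [reassoc_of% h2, π₃, Category.assoc, π_relMap]
  have h3 := congr(W.X ◁ $(π₃'_assoc X Y Z))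
  simp only [π₃', π₃, MonoidalCategory.whiskerLeft_comp, Category.assoc] at h3
  have h4 : π₃' W X Y = relπ W X ▷ Y.X ≫ relπ (relMod W X) Y := rfl
  rw [h4, Mod.id_hom', id_tensorHom]
  simp only [comp_whiskerRight, Category.assoc]
  have h5 := π₃'_assoc (relMod W X) Y Z
  rw [π₃', Category.assoc] at h5
  rw [reassoc_of% h5, π₃, Category.assoc]
  have h6 := π₃'_assoc W X (relMod Y Z)
  simp only [π₃', π₃, Category.assoc] at h6
  have h7 : (relπ W X ▷ Y.X) ▷ Z.X ≫ (α_ _ _ _).hom ≫ (relMod W X).X ◁ relπ Y Z =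
    (α_ _ _ _).hom ≫ (W.X ⊗ X.X) ◁ relπ Y Z ≫ relπ W X ▷ _ := by
    rw [whisker_exchange]; simp
  rw [reassoc_of% h7, h6]
  have h8 : (W.X ◁ relπ X Y) ▷ Z.X ≫ (α_ _ _ _).hom = (α_ _ _ _).hom ≫ W.X ◁ relπ X Y ▷ Z.X := by
    simp
  rw [reassoc_of% h8, reassoc_of% h3]
  simp

lemma rel_triangle (X Y : Modl A) :
    (relAssocIso X (Mod.regular A) Y).hom ≫ relMap (𝟙 X) (relLamIso Y).hom =
      relMap (relRhoIso X).hom (𝟙 Y) := by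
  apply rel_hom_ext₃
  rw [Mod.comp_hom', reassoc_of% π₃'_assoc, π₃', Category.assoc, π_relMap, π₃, Category.assoc,
    π_relMap]
  have h1 := congr(X.X ◁ $(π_relLam Y))
  have h2 := congr($(π_relRho X) ▷ Y.X)
  rw [MonoidalCategory.whiskerLeft_comp] at h1
  rw [comp_whiskerRight] at h2
  simp only [Mod.id_hom', id_tensorHom, tensorHom_id, relLamIso, relRhoIso]
  rw [reassoc_of% h1, reassoc_of% h2]
  have h3 := actFst_π X Y
  have h4 : ract X ▷ Y.X = (β_ A X.X).inv ▷ Y.X ≫ (α_ _ _ _).hom ≫ actFst X Y.X := by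
    simp [ract, actFst]
  have h5 : (α_ X.X A Y.X).hom ≫ X.X ◁ act Y ≫ relπ X Y = ract X ▷ Y.X ≫ relπ X Y := by
    rw [h4, Category.assoc, Category.assoc, h3]
    simp [actSnd]
  exact h5

lemma relLam_naturality {X Y : Modl A} (f : X ⟶ Y) :
    relMap (𝟙 (Mod.regular A)) f ≫ relLam Y = relLam X ≫ f := by
  have h := π_relMap (𝟙 (Mod.regular A)) f
  rw [Mod.id_hom', id_tensorHom] at h
  have h' : lamπ X ≫ (relMap (𝟙 (Mod.regular A)) f).hom = A ◁ f.hom ≫ lamπ Y := h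
  refine rel_hom_ext ?_
  change lamπ X ≫ _ = lamπ X ≫ _
  rw [Mod.comp_hom', Mod.comp_hom', reassoc_of% h', lamπ_relLam, reassoc_of% lamπ_relLam, act_hom]

lemma relRho_naturality {X Y : Modl A} (f : X ⟶ Y) :
    relMap f (𝟙 (Mod.regular A)) ≫ relRho Y = relRho X ≫ f := by
  have h := π_relMap f (𝟙 (Mod.regular A))
  rw [Mod.id_hom', tensorHom_id] at h
  have h' : rhoπ X ≫ (relMap f (𝟙 (Mod.regular A))).hom = f.hom ▷ A ≫ rhoπ Y := h
  refine rel_hom_ext ?_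
  change rhoπ X ≫ _ = rhoπ X ≫ _
  rw [Mod.comp_hom', Mod.comp_hom', reassoc_of% h', rhoπ_relRho, reassoc_of% rhoπ_relRho, ract_hom]

noncomputable instance : MonoidalCategory (Modl A) :=
  MonoidalCategory.ofTensorHom
    (id_tensorHom_id := fun M N => rel_hom_ext <| by
      erw [π_relMap]; simp; exact (Category.comp_id _).symm)
    (id_tensorHom := fun _ _ _ _ => rfl)
    (tensorHom_id := fun _ _ => rfl)
    (tensorHom_comp_tensorHom := fun f₁ f₂ g₁ g₂ => rel_hom_ext <| by
      change _ ≫ (relMap f₁ f₂ ≫ relMap g₁ g₂).hom = _ ≫ (relMap (f₁ ≫ g₁) (f₂ ≫ g₂)).hom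
      rw [Mod.comp_hom', reassoc_of% π_relMap, π_relMap, π_relMap]
      simp)
    (associator_naturality := fun f g h => rel_hom_ext₃ <| by
      change _ ≫ (relMap (relMap f g) h ≫ (relAssocIso _ _ _).hom).hom =
        _ ≫ ((relAssocIso _ _ _).hom ≫ relMap f (relMap g h)).hom
      rw [Mod.comp_hom', Mod.comp_hom', reassoc_of% π₃'_relMap, π₃'_assoc, reassoc_of% π₃'_assoc, π₃_relMap]
      simp)
    (leftUnitor_naturality := fun f => relLam_naturality f)
    (rightUnitor_naturality := fun f => relRho_naturality f)
    (pentagon := fun W X Y Z => rel_pentagon W X Y Z)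
    (triangle := fun X Y => rel_triangle X Y)

end Monoidal

section ModlLinear
variable {C : Type u} [Category.{v} C] [MonoidalCategory C] {A : C} [MonObj A]
  [Preadditive C] [MonoidalPreadditive C]

instance (M N : Modl A) : Zero (M ⟶ N) := ⟨mkHom 0 (by simp)⟩

instance (M N : Modl A) : Add (M ⟶ N) := ⟨fun f g => mkHom (f.hom + g.hom) (by
  rw [Preadditive.comp_add, act_hom, act_hom, MonoidalPreadditive.whiskerLeft_add,
    Preadditive.add_comp])⟩

instance (M N : Modl A) : Neg (M ⟶ N) := ⟨fun f => mkHom (-f.hom) (by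
  have h : A ◁ (-f.hom) = -(A ◁ f.hom) := (tensorLeft A).map_neg
  rw [Preadditive.comp_neg, act_hom, h, Preadditive.neg_comp])⟩

instance (M N : Modl A) : AddCommGroup (M ⟶ N) where
  add_assoc f g h := Mod.hom_ext _ _ (add_assoc f.hom g.hom h.hom)
  zero_add f := Mod.hom_ext _ _ (zero_add f.hom)
  add_zero f := Mod.hom_ext _ _ (add_zero f.hom)
  neg_add_cancel f := Mod.hom_ext _ _ (neg_add_cancel f.hom)
  add_comm f g := Mod.hom_ext _ _ (add_comm f.hom g.hom)
  nsmul := nsmulRec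
  zsmul := zsmulRec

@[simp] lemma add_hom {M N : Modl A} (f g : M ⟶ N) : (f + g).hom = f.hom + g.hom := rfl
@[simp] lemma zero_hom (M N : Modl A) : (0 : M ⟶ N).hom = 0 := rfl

instance : Preadditive (Modl A) where
  add_comp _ _ _ f g h := Mod.hom_ext _ _ (by simp)
  comp_add _ _ _ f g h := Mod.hom_ext _ _ (by simp)

/-- Taking the underlying morphism is additive. -/
def homAdd (M N : Modl A) : (M ⟶ N) →+ (M.X ⟶ N.X) where
  toFun f := f.hom
  map_zero' := rfl
  map_add' _ _ := rfl

lemma sum_hom {M N : Modl A} {J : Type} (s : Finset J) (f : J → (M ⟶ N)) :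
    (∑ j ∈ s, f j).hom = ∑ j ∈ s, (f j).hom := map_sum (homAdd M N) f s

variable {k : Type*} [Field k] [Linear k C] [MonoidalLinear k C]

instance (M N : Modl A) : Module k (M ⟶ N) where
  smul a f := mkHom (a • f.hom) (by
    rw [Linear.comp_smul, act_hom, MonoidalLinear.whiskerLeft_smul, Linear.smul_comp])
  one_smul f := Mod.hom_ext _ _ (one_smul k f.hom)
  mul_smul a b f := Mod.hom_ext _ _ (mul_smul a b f.hom)
  smul_zero a := Mod.hom_ext _ _ (smul_zero a)
  zero_smul f := Mod.hom_ext _ _ (zero_smul k f.hom)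
  smul_add a f g := Mod.hom_ext _ _ (smul_add a f.hom g.hom)
  add_smul a b f := Mod.hom_ext _ _ (add_smul a b f.hom)

@[simp] lemma smul_hom {M N : Modl A} (a : k) (f : M ⟶ N) : (a • f).hom = a • f.hom := rfl

instance : Linear k (Modl A) where
  smul_comp _ _ _ a f g := Mod.hom_ext _ _ (by simp)
  comp_smul _ _ _ f a g := Mod.hom_ext _ _ (by simp)

end ModlLinear

section Locality
open HasTwist
variable {C : Type u} [Category.{v} C] [MonoidalCategory C] [BraidedCategory C]
  {A : C} [MonObj A]

/-- A module is local if the double braiding with `A` drops out of the action. -/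
def IsLocal (M : Modl A) : Prop := monodromy A M.X ≫ act M = act M

section
variable [ComonObj A] [IsFrobenius A] [IsDeltaSeparable A] [IsCommMonObj A]
  [IsIdempotentComplete C]

/-- `M ⊗_A N` inherits the effect of the double braiding from `M` and `N`. -/
lemma monodromy_relMod (M N : Modl A) (φ ψ : A ⟶ A)
    (hM : monodromy A M.X ≫ act M = φ ▷ M.X ≫ act M)
    (hN : monodromy A N.X ≫ act N = ψ ▷ N.X ≫ act N) :
    monodromy A (relMod M N).X ≫ act (relMod M N) =
      (φ ≫ ψ) ▷ (relMod M N).X ≫ act (relMod M N) := by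
  have key : monodromy A (M.X ⊗ N.X) ≫ actFst M N.X ≫ relπ M N =
      (φ ≫ ψ) ▷ (M.X ⊗ N.X) ≫ actFst M N.X ≫ relπ M N := by
    have h1 : monodromy A (M.X ⊗ N.X) = (α_ _ _ _).inv ≫ (β_ A M.X).hom ▷ N.X ≫
        (α_ _ _ _).hom ≫ M.X ◁ monodromy A N.X ≫ (α_ _ _ _).inv ≫ (β_ M.X A).hom ▷ N.X ≫
        (α_ _ _ _).hom := by
      simp [monodromy]
    have h3 := congr($hN)
    have h4 : (β_ A M.X).hom ▷ N.X ≫ (α_ _ _ _).hom ≫ M.X ◁ (monodromy A N.X ≫ act N) =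
      ((ψ ▷ M.X) ▷ N.X) ≫ (β_ A M.X).hom ▷ N.X ≫ (α_ _ _ _).hom ≫ M.X ◁ act N := by
      rw [hN, ← comp_whiskerRight_assoc, BraidedCategory.braiding_naturality_left]
      simp
    have h5 : (β_ M.X A).hom ▷ N.X ≫ act M ▷ N.X ≫ relπ M N =
        (β_ A M.X).inv ▷ N.X ≫ φ ▷ M.X ▷ N.X ≫ act M ▷ N.X ≫ relπ M N := by
      rw [← comp_whiskerRight_assoc, ← comp_whiskerRight_assoc (φ ▷ M.X), ← hM]
      simp [monodromy]
    have h6 : act M ▷ N.X ≫ relπ M N =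
        (β_ A M.X).hom ▷ N.X ≫ (α_ _ _ _).hom ≫ M.X ◁ act N ≫ relπ M N := by
      have := actFst_π M N
      rw [actFst, actSnd] at this
      simpa using congr((α_ A M.X N.X).hom ≫ $this)
    have h7 : (β_ A M.X).inv ▷ N.X ≫ φ ▷ M.X ▷ N.X ≫ (β_ A M.X).hom ▷ N.X =
        (M.X ◁ φ) ▷ N.X := by
      simp only [← comp_whiskerRight]
      rw [BraidedCategory.braiding_naturality_left]; simp
    rw [h1]
    simp only [actFst, Category.assoc, Iso.hom_inv_id_assoc]
    rw [h5, h6, reassoc_of% h7]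
    have h8 : M.X ◁ monodromy A N.X ≫ (α_ M.X A N.X).inv ≫ (M.X ◁ φ) ▷ N.X ≫
        (α_ M.X A N.X).hom ≫ M.X ◁ act N = M.X ◁ (φ ▷ N.X) ≫ M.X ◁ (monodromy A N.X ≫ act N) := by
      simp only [whisker_assoc, Category.assoc, Iso.inv_hom_id_assoc, Iso.inv_hom_id, ← MonoidalCategory.whiskerLeft_comp]
      rw [← reassoc_of% (monodromy_naturality_left φ N.X)]
    rw [reassoc_of% h8]
    have h9 : (β_ A M.X).hom ▷ N.X ≫ (α_ _ _ _).hom ≫ M.X ◁ (φ ▷ N.X) =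
        φ ▷ M.X ▷ N.X ≫ (β_ A M.X).hom ▷ N.X ≫ (α_ _ _ _).hom := by
      rw [← comp_whiskerRight_assoc (φ ▷ M.X), BraidedCategory.braiding_naturality_left]
      simp
    rw [reassoc_of% h9, reassoc_of% h4]
    simp
  rw [← cancel_epi (A ◁ relπ M N), ← Category.assoc, monodromy_naturality_right, Category.assoc,
    whisker_π_act, key, whisker_exchange_assoc, whisker_π_act]

lemma IsLocal.relMod {M N : Modl A} (hM : IsLocal M) (hN : IsLocal N) :
    IsLocal (relMod M N) := by
  have := monodromy_relMod M N (𝟙 A) (𝟙 A) (by simpa [IsLocal] using hM) (by simpa [IsLocal] using hN)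
  simpa [IsLocal] using this

end

lemma isLocal_regular [IsCommMonObj A] : IsLocal (Mod.regular A) := by
  change monodromy A A ≫ μ[A] = μ[A]
  simp [monodromy]

variable [HasTwist C] [IsRibbon C] [ComonObj A]

/-- A module is odd if the double braiding with `A` acts through the Nakayama automorphism. -/
def IsOdd (M : Modl A) : Prop := monodromy A M.X ≫ act M = nak A ▷ M.X ≫ act M

/-- Nakayama-local modules: `ρ ∘ c ∘ c = ρ ∘ (N_A^ν ⊗ id)` with `ν ∈ {0, 1}`. -/
def IsNakayamaLocal (M : Modl A) : Prop := IsLocal M ∨ IsOdd M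

variable [Preadditive C] [MonoidalPreadditive C]

/-- Finite direct sums of Nakayama-local modules. -/
def IsNakayamaLocalSum (M : Modl A) : Prop :=
  ∃ (n : ℕ) (P : Fin n → Modl A) (i : ∀ j, P j ⟶ M) (p : ∀ j, M ⟶ P j),
    (∀ j, IsNakayamaLocal (P j)) ∧ (∀ j, i j ≫ p j = 𝟙 (P j)) ∧
    (∀ j l, j ≠ l → i j ≫ p l = 0) ∧ ∑ j, p j ≫ i j = 𝟙 M

/-- Variant of the definition of direct sums with an arbitrary finite index type. -/
lemma IsNakayamaLocalSum.of_fintype {M : Modl A} {J : Type} [Fintype J] (P : J → Modl A)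
    (i : ∀ j, P j ⟶ M) (p : ∀ j, M ⟶ P j) (hP : ∀ j, IsNakayamaLocal (P j))
    (h₁ : ∀ j, i j ≫ p j = 𝟙 (P j)) (h₂ : ∀ j l, j ≠ l → i j ≫ p l = 0)
    (h₃ : ∑ j, p j ≫ i j = 𝟙 M) : IsNakayamaLocalSum M := by
  let e := (Fintype.equivFin J).symm
  refine ⟨_, fun j => P (e j), fun j => i (e j), fun j => p (e j), fun j => hP _, fun j => h₁ _,
    fun j l h => h₂ _ _ (fun h' => h (e.injective h')), ?_⟩
  rw [← h₃]
  exact Fintype.sum_equiv e _ _ (fun _ => rfl)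

lemma IsNakayamaLocal.sum {M : Modl A} (h : IsNakayamaLocal M) : IsNakayamaLocalSum M :=
  .of_fintype (J := Unit) (fun _ => M) (fun _ => 𝟙 M) (fun _ => 𝟙 M) (fun _ => h) (by simp)
    (fun _ _ h => (h rfl).elim) (by simp)

section
variable [IsFrobenius A] [IsDeltaSeparable A] [IsCommMonObj A] [IsIdempotentComplete C]

lemma IsNakayamaLocal.relMod {M N : Modl A} (hM : IsNakayamaLocal M) (hN : IsNakayamaLocal N) :
    IsNakayamaLocal (relMod M N) := by
  have hid (M : Modl A) (h : IsLocal M) : monodromy A M.X ≫ act M = 𝟙 A ▷ M.X ≫ act M := by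
    simpa [IsLocal] using h
  rcases hM with hM | hM <;> rcases hN with hN | hN
  · exact Or.inl (hM.relMod hN)
  · exact Or.inr (by simpa [IsOdd] using monodromy_relMod M N _ _ (hid _ hM) hN)
  · exact Or.inr (by simpa [IsOdd] using monodromy_relMod M N _ _ hM (hid _ hN))
  · have := monodromy_relMod M N _ _ hM hN
    rw [nak_eq_twist, twist_twist] at this
    exact Or.inl (by simpa [IsLocal] using this)

lemma relMap_zero_left {M N M' N' : Modl A} (g : N ⟶ N') :
    relMap (0 : M ⟶ M') g = 0 := by
  ext; simp [relMap]

lemma relMap_zero_right {M N M' N' : Modl A} (f : M ⟶ M') :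
    relMap f (0 : N ⟶ N') = 0 := by
  ext; simp [relMap]

lemma relMap_id (M N : Modl A) : relMap (𝟙 M) (𝟙 N) = 𝟙 (SpinLine.relMod M N) :=
  id_tensorHom_id M N

lemma relMap_comp {M N M' N' M'' N'' : Modl A} (f : M ⟶ M') (g : N ⟶ N') (f' : M' ⟶ M'')
    (g' : N' ⟶ N'') : relMap f g ≫ relMap f' g' = relMap (f ≫ f') (g ≫ g') :=
  tensorHom_comp_tensorHom f g f' g'

lemma IsNakayamaLocalSum.relMod {M N : Modl A} (hM : IsNakayamaLocalSum M)
    (hN : IsNakayamaLocalSum N) : IsNakayamaLocalSum (relMod M N) := by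
  obtain ⟨m, P, i, p, hP, h₁, h₂, h₃⟩ := hM
  obtain ⟨n, Q, i', p', hQ, h₁', h₂', h₃'⟩ := hN
  refine .of_fintype (J := Fin m × Fin n) (fun x => SpinLine.relMod (P x.1) (Q x.2))
    (fun x => relMap (i x.1) (i' x.2)) (fun x => relMap (p x.1) (p' x.2))
    (fun x => (hP _).relMod (hQ _)) (fun x => ?_) (fun x y hxy => ?_) ?_
  · rw [relMap_comp, h₁, h₁', relMap_id]
  · rw [relMap_comp]
    by_cases h : x.1 = y.1
    · rw [h₂' _ _ (fun h' => hxy (Prod.ext h h')), relMap_zero_right]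
    · rw [h₂ _ _ h, relMap_zero_left]
  · simp only [relMap_comp]
    ext
    rw [sum_hom, ← relMap_id, ← h₃, ← h₃', Fintype.sum_prod_type]
    simp only [relMap, mkHom_hom, sum_hom, tensor_sum, sum_tensor, Preadditive.comp_sum,
      Preadditive.sum_comp]
    exact Finset.sum_comm

end

end Locality

section BraidAux
variable {C : Type u} [Category.{v} C] [MonoidalCategory C] [BraidedCategory C]
  {A : C} [MonObj A]

/-- The double braiding of `A` with the first factor of `X ⊗ Y`. -/
def monoFst (A X Y : C) : A ⊗ (X ⊗ Y) ⟶ A ⊗ (X ⊗ Y) :=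
  (α_ _ _ _).inv ≫ monodromy A X ▷ Y ≫ (α_ _ _ _).hom

instance (X Y : C) : IsIso (monodromy X Y) := by unfold monodromy; infer_instance

instance (A X Y : C) : IsIso (monoFst A X Y) := by unfold monoFst; infer_instance

lemma actFst_braid (M N : Modl A) :
    actFst M N.X ≫ (β_ M.X N.X).hom = A ◁ (β_ M.X N.X).hom ≫ actSnd N.X M := by
  simp only [actFst, actSnd, Category.assoc, BraidedCategory.braiding_naturality_left,
    BraidedCategory.braiding_tensor_left_hom]
  simp

lemma actSnd_braid (M N : Modl A) : actSnd M.X N ≫ (β_ M.X N.X).hom =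
    monoFst A M.X N.X ≫ A ◁ (β_ M.X N.X).hom ≫ actFst N M.X := by
  simp only [actFst, actSnd, monoFst, monodromy, Category.assoc,
    BraidedCategory.braiding_naturality_right, BraidedCategory.braiding_tensor_right_hom]
  simp

lemma monoFst_whisker {X X' Y : C} (f : X ⟶ X') :
    A ◁ f ▷ Y ≫ monoFst A X' Y = monoFst A X Y ≫ A ◁ f ▷ Y := by
  have := congr((α_ _ _ _).inv ≫ $(monodromy_naturality_right A f) ▷ Y ≫ (α_ _ _ _).hom)
  simp only [comp_whiskerRight, Category.assoc] at this
  simp only [monoFst, Category.assoc, associator_inv_naturality_middle_assoc, this]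
  simp

lemma monoFst_left {X Y : C} (f : A ⟶ A) :
    f ▷ (X ⊗ Y) ≫ monoFst A X Y = monoFst A X Y ≫ f ▷ (X ⊗ Y) := by
  have := congr((α_ _ _ _).inv ≫ $(monodromy_naturality_left f X) ▷ Y ≫ (α_ _ _ _).hom)
  simp only [comp_whiskerRight, Category.assoc] at this
  simp only [monoFst, Category.assoc, associator_inv_naturality_left_assoc, this]
  simp

lemma actSnd_left (X : C) (N : Modl A) (f : A ⟶ A) (g : N.X ⟶ N.X)
    (h : act N ≫ g = (f ⊗ₘ g) ≫ act N) :
    actSnd X N ≫ X ◁ g = f ▷ (X ⊗ N.X) ≫ A ◁ X ◁ g ≫ actSnd X N := by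
  have h1 := congr(X ◁ $h)
  rw [MonoidalCategory.tensorHom_def] at h1
  simp only [MonoidalCategory.whiskerLeft_comp, Category.assoc] at h1
  simp only [actSnd, Category.assoc]
  rw [h1, associator_inv_naturality_right_assoc, whisker_exchange_assoc,
    associator_inv_naturality_left_assoc, ← comp_whiskerRight_assoc (f ▷ X),
    BraidedCategory.braiding_naturality_left]
  simp

lemma actFst_left (N : Modl A) (Y : C) (f : A ⟶ A) (g : N.X ⟶ N.X)
    (h : act N ≫ g = (f ⊗ₘ g) ≫ act N) :
    actFst N Y ≫ g ▷ Y = f ▷ (N.X ⊗ Y) ≫ A ◁ g ▷ Y ≫ actFst N Y := by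
  have h1 := congr($h ▷ Y)
  rw [MonoidalCategory.tensorHom_def] at h1
  simp only [comp_whiskerRight, Category.assoc] at h1
  simp only [actFst, Category.assoc]
  rw [h1]
  simp

end BraidAux

section Graded
open HasTwist
variable {C : Type u} [Category.{v} C] [MonoidalCategory C] [BraidedCategory C]
  [HasTwist C] [IsRibbon C] {A : C} [MonObj A] [ComonObj A]

/-- An involution that is semilinear with respect to the Nakayama automorphism. -/
structure IsSpinMap (M : Modl A) (t : M.X ⟶ M.X) : Prop where
  invol : t ≫ t = 𝟙 _
  act_t : act M ≫ t = (nak A ⊗ₘ t) ≫ act M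

variable [Preadditive C]

/-- `e` is the idempotent onto an even direct summand whose complement is odd. -/
structure IsGrading (M : Modl A) (e : M.X ⟶ M.X) : Prop where
  idem : e ≫ e = e
  act_e : act M ≫ e = A ◁ e ≫ act M
  even : A ◁ e ≫ monodromy A M.X ≫ act M = A ◁ e ≫ act M
  odd : A ◁ (𝟙 _ - e) ≫ monodromy A M.X ≫ act M = (nak A ⊗ₘ (𝟙 _ - e)) ≫ act M

lemma add_ext {X Z : C} {a b : X ⟶ X} (h : a + b = 𝟙 X) {f g : X ⟶ Z} (ha : a ≫ f = a ≫ g)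
    (hb : b ≫ f = b ≫ g) : f = g := by
  rw [← Category.id_comp f, ← Category.id_comp g, ← h, Preadditive.add_comp,
    Preadditive.add_comp, ha, hb]

/-- For `e` the projection to the even part of `M` this is `t_N ^ (deg M)` on `N ⊗ M`. -/
def sgn (M N : Modl A) (e : M.X ⟶ M.X) (t : N.X ⟶ N.X) : N.X ⊗ M.X ⟶ N.X ⊗ M.X :=
  N.X ◁ e + t ▷ M.X ≫ N.X ◁ (𝟙 _ - e)

variable [MonoidalPreadditive C]

lemma IsGrading.act_o {M : Modl A} {e : M.X ⟶ M.X} (he : IsGrading M e) :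
    act M ≫ (𝟙 _ - e) = A ◁ (𝟙 _ - e) ≫ act M := by
  have h : A ◁ (𝟙 M.X - e) = 𝟙 _ - A ◁ e :=
    ((tensorLeft A).map_sub).trans (by simp)
  rw [h, Preadditive.comp_sub, Preadditive.sub_comp, he.act_e]; simp

lemma IsGrading.e_o {M : Modl A} {e : M.X ⟶ M.X} (he : IsGrading M e) :
    e ≫ (𝟙 _ - e) = 0 := by rw [Preadditive.comp_sub, he.idem]; simp

lemma IsGrading.o_e {M : Modl A} {e : M.X ⟶ M.X} (he : IsGrading M e) :
    (𝟙 _ - e) ≫ e = 0 := by rw [Preadditive.sub_comp, he.idem]; simp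

lemma IsGrading.o_o {M : Modl A} {e : M.X ⟶ M.X} (he : IsGrading M e) :
    (𝟙 _ - e) ≫ (𝟙 _ - e) = 𝟙 _ - e := by rw [Preadditive.comp_sub, he.o_e]; simp

lemma ext₁ {X Y Z : C} (e : X ⟶ X) {f g : X ⊗ Y ⟶ Z} (h : e ▷ Y ≫ f = e ▷ Y ≫ g)
    (h' : (𝟙 X - e) ▷ Y ≫ f = (𝟙 X - e) ▷ Y ≫ g) : f = g :=
  add_ext (by rw [← MonoidalPreadditive.add_whiskerRight]; simp) h h'

lemma extA {B X Y Z : C} (e : X ⟶ X) {f g : B ⊗ (X ⊗ Y) ⟶ Z}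
    (h : B ◁ e ▷ Y ≫ f = B ◁ e ▷ Y ≫ g)
    (h' : B ◁ (𝟙 X - e) ▷ Y ≫ f = B ◁ (𝟙 X - e) ▷ Y ≫ g) : f = g :=
  add_ext (by rw [← MonoidalPreadditive.whiskerLeft_add, ← MonoidalPreadditive.add_whiskerRight]
              simp) h h'

section
variable {M N : Modl A} {e : M.X ⟶ M.X} {t : N.X ⟶ N.X}

lemma sgn_even (he : IsGrading M e) (t : N.X ⟶ N.X) : N.X ◁ e ≫ sgn M N e t = N.X ◁ e := by
  rw [sgn, Preadditive.comp_add, ← MonoidalCategory.whiskerLeft_comp, he.idem,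
    whisker_exchange_assoc, ← MonoidalCategory.whiskerLeft_comp, he.e_o]
  simp

lemma sgn_odd (he : IsGrading M e) (t : N.X ⟶ N.X) :
    N.X ◁ (𝟙 _ - e) ≫ sgn M N e t = N.X ◁ (𝟙 _ - e) ≫ t ▷ M.X := by
  rw [sgn, Preadditive.comp_add, ← MonoidalCategory.whiskerLeft_comp, he.o_e,
    whisker_exchange_assoc, ← MonoidalCategory.whiskerLeft_comp, he.o_o, whisker_exchange]
  simp

/-- The braiding corrected by the sign map. -/
def sbraid (M N : Modl A) (e : M.X ⟶ M.X) (t : N.X ⟶ N.X) : M.X ⊗ N.X ⟶ N.X ⊗ M.X :=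
  (β_ M.X N.X).hom ≫ sgn M N e t

lemma sbraid_even (he : IsGrading M e) (t : N.X ⟶ N.X) :
    e ▷ N.X ≫ sbraid M N e t = e ▷ N.X ≫ (β_ M.X N.X).hom := by
  rw [sbraid, BraidedCategory.braiding_naturality_left_assoc, sgn_even he,
    BraidedCategory.braiding_naturality_left]

lemma sbraid_odd (he : IsGrading M e) (t : N.X ⟶ N.X) :
    (𝟙 _ - e) ▷ N.X ≫ sbraid M N e t =
      (𝟙 _ - e) ▷ N.X ≫ (β_ M.X N.X).hom ≫ t ▷ M.X := by
  rw [sbraid, BraidedCategory.braiding_naturality_left_assoc, sgn_odd he,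
    BraidedCategory.braiding_naturality_left_assoc]

/-- The inverse of `sbraid`. -/
def sbraidInv (M N : Modl A) (e : M.X ⟶ M.X) (t : N.X ⟶ N.X) : N.X ⊗ M.X ⟶ M.X ⊗ N.X :=
  sgn M N e t ≫ (β_ M.X N.X).inv

lemma sgn_sgn (he : IsGrading M e) (ht : t ≫ t = 𝟙 _) :
    sgn M N e t ≫ sgn M N e t = 𝟙 _ := by
  nth_rw 1 [sgn]
  rw [Preadditive.add_comp, sgn_even he, Category.assoc, sgn_odd he, whisker_exchange,
    ← comp_whiskerRight_assoc, ht]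
  rw [id_whiskerRight, Category.id_comp, ← MonoidalPreadditive.whiskerLeft_add]
  simp

lemma sbraid_inv (he : IsGrading M e) (ht : t ≫ t = 𝟙 _) :
    sbraid M N e t ≫ sbraidInv M N e t = 𝟙 _ := by
  simp [sbraid, sbraidInv, reassoc_of% (sgn_sgn he ht)]

lemma sbraidInv_hom (he : IsGrading M e) (ht : t ≫ t = 𝟙 _) :
    sbraidInv M N e t ≫ sbraid M N e t = 𝟙 _ := by
  simp [sbraid, sbraidInv, sgn_sgn he ht]

lemma sgn_actSnd (he : IsGrading M e) (t : N.X ⟶ N.X) :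
    A ◁ sgn M N e t ≫ actSnd N.X M = actSnd N.X M ≫ sgn M N e t := by
  have h1 (f : M.X ⟶ M.X) (h : act M ≫ f = A ◁ f ≫ act M) :
      A ◁ N.X ◁ f ≫ actSnd N.X M = actSnd N.X M ≫ N.X ◁ f := by
    rw [actSnd_eq, slide_whiskerLeft _ _ _ _ h]
  have h2 : A ◁ t ▷ M.X ≫ actSnd N.X M = actSnd N.X M ≫ t ▷ M.X := by
    rw [actSnd_eq, whiskerRight_slide]
  rw [sgn, MonoidalPreadditive.whiskerLeft_add, Preadditive.add_comp, Preadditive.comp_add,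
    MonoidalCategory.whiskerLeft_comp, Category.assoc, h1 _ he.act_e, h1 _ he.act_o,
    reassoc_of% h2]

lemma sbraid_actSnd (he : IsGrading M e) (t : N.X ⟶ N.X) :
    A ◁ sbraid M N e t ≫ actSnd N.X M = actFst M N.X ≫ sbraid M N e t := by
  rw [sbraid, MonoidalCategory.whiskerLeft_comp, Category.assoc, sgn_actSnd he,
    reassoc_of% actFst_braid]

lemma even_actFst (he : IsGrading M e) (Y : C) :
    A ◁ e ▷ Y ≫ monoFst A M.X Y ≫ actFst M Y = A ◁ e ▷ Y ≫ actFst M Y := by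
  have := congr((α_ _ _ _).inv ≫ $(he.even) ▷ Y)
  simp only [comp_whiskerRight] at this
  simp only [monoFst, actFst]
  simpa using this

lemma odd_actFst (he : IsGrading M e) (Y : C) :
    A ◁ (𝟙 _ - e) ▷ Y ≫ monoFst A M.X Y ≫ actFst M Y =
      A ◁ (𝟙 _ - e) ▷ Y ≫ nak A ▷ _ ≫ actFst M Y := by
  have := congr((α_ _ _ _).inv ≫ $(he.odd) ▷ Y)
  rw [MonoidalCategory.tensorHom_def'] at this
  simp only [comp_whiskerRight] at this
  simp only [monoFst, actFst]
  simpa using this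

lemma actFst_e (he : IsGrading M e) (Y : C) :
    A ◁ e ▷ Y ≫ actFst M Y = actFst M Y ≫ e ▷ Y := by
  simp only [actFst, Category.assoc, ← comp_whiskerRight, he.act_e]
  simp

lemma actFst_o (he : IsGrading M e) (Y : C) :
    A ◁ (𝟙 _ - e) ▷ Y ≫ actFst M Y = actFst M Y ≫ (𝟙 _ - e) ▷ Y := by
  simp only [actFst, Category.assoc, ← comp_whiskerRight, he.act_o]
  simp

variable [IsFrobenius A] [IsDeltaSeparable A] [IsCommMonObj A] [IsIdempotentComplete C]

lemma sbraid_bal (he : IsGrading M e) (ht : IsSpinMap N t) :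
    actFst M N.X ≫ sbraid M N e t ≫ relπ N M = actSnd M.X N ≫ sbraid M N e t ≫ relπ N M := by
  symm
  refine extA e ?_ ?_
  · rw [actSnd_eq, reassoc_of% whiskerRight_slide, reassoc_of% (sbraid_even he), ← reassoc_of% whiskerRight_slide,
      ← actSnd_eq, reassoc_of% actSnd_braid, actFst_π, ← reassoc_of% actFst_braid, reassoc_of% (even_actFst he),
      reassoc_of% (actFst_e he), reassoc_of% (actFst_e he), reassoc_of% (sbraid_even he)]
  · rw [actSnd_eq, reassoc_of% whiskerRight_slide, reassoc_of% (sbraid_odd he), ← reassoc_of% whiskerRight_slide,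
      ← actSnd_eq, reassoc_of% actSnd_braid, reassoc_of% (actFst_left _ _ _ _ ht.act_t), actFst_π,
      actSnd_eq, reassoc_of% whiskerRight_slide, ← actSnd_eq, whisker_exchange_assoc,
      ← reassoc_of% actFst_braid, ← reassoc_of% monoFst_left, whisker_exchange_assoc,
      reassoc_of% (odd_actFst he), whisker_exchange_assoc, ← comp_whiskerRight_assoc, nak_nak,
      id_whiskerRight, Category.id_comp, reassoc_of% (actFst_o he), reassoc_of% (actFst_o he),
      reassoc_of% (sbraid_odd he)]

lemma sbraidInv_bal (he : IsGrading M e) (ht : IsSpinMap N t) :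
    actFst N M.X ≫ sbraidInv M N e t ≫ relπ M N =
      actSnd N.X M ≫ sbraidInv M N e t ≫ relπ M N := by
  have : IsIso (sbraid M N e t) := ⟨_, sbraid_inv he ht.invol, sbraidInv_hom he ht.invol⟩
  rw [← cancel_epi (A ◁ sbraid M N e t), reassoc_of% (sbraid_actSnd he),
    reassoc_of% (sbraid_inv he ht.invol), ← cancel_epi (monoFst A M.X N.X)]
  have e1 : e ▷ N.X ≫ (β_ M.X N.X).hom ≫ sbraidInv M N e t = e ▷ N.X := by
    rw [← reassoc_of% (sbraid_even he t), sbraid_inv he ht.invol, Category.comp_id]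
  have e2 : (𝟙 _ - e) ▷ N.X ≫ (β_ M.X N.X).hom ≫ t ▷ M.X ≫ sbraidInv M N e t =
      (𝟙 _ - e) ▷ N.X := by
    rw [← reassoc_of% (sbraid_odd he t), sbraid_inv he ht.invol, Category.comp_id]
  refine extA e ?_ ?_
  · rw [reassoc_of% (even_actFst he), actFst_π, reassoc_of% monoFst_whisker,
      ← MonoidalCategory.whiskerLeft_comp_assoc,
      sbraid_even he, MonoidalCategory.whiskerLeft_comp_assoc, ← reassoc_of% monoFst_whisker,
      ← reassoc_of% actSnd_braid, actSnd_eq, reassoc_of% whiskerRight_slide, reassoc_of% e1,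
      reassoc_of% whiskerRight_slide]
  · have e3 : A ◁ t ▷ M.X ≫ actFst N M.X = nak A ▷ _ ≫ actFst N M.X ≫ t ▷ M.X := by
      rw [actFst_left _ _ _ _ ht.act_t, ← comp_whiskerRight_assoc, nak_nak]
      simp
    rw [reassoc_of% (odd_actFst he), actFst_π, reassoc_of% monoFst_whisker,
      ← MonoidalCategory.whiskerLeft_comp_assoc,
      sbraid_odd he, MonoidalCategory.whiskerLeft_comp_assoc,
      MonoidalCategory.whiskerLeft_comp_assoc, ← reassoc_of% monoFst_whisker,
      reassoc_of% e3, whisker_exchange_assoc, ← reassoc_of% monoFst_left, ← reassoc_of% actSnd_braid,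
      whisker_exchange_assoc, actSnd_eq, reassoc_of% whiskerRight_slide, reassoc_of% e2,
      whisker_exchange_assoc, reassoc_of% whiskerRight_slide]

/-- The braiding `π ∘ (t_N ^ (deg M) ⊗ id) ∘ c ∘ ι`. -/
noncomputable def relBraid (M N : Modl A) (e : M.X ⟶ M.X) (t : N.X ⟶ N.X) :
    (relMod M N).X ⟶ (relMod N M).X :=
  relι M N ≫ (β_ M.X N.X).hom ≫ sgn M N e t ≫ relπ N M

lemma π_relBraid (he : IsGrading M e) (ht : IsSpinMap N t) :
    relπ M N ≫ relBraid M N e t = sbraid M N e t ≫ relπ N M := by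
  have := π_relDesc _ (sbraid_bal he ht)
  simpa [relDesc, sbraid, relBraid] using this

/-- The inverse braiding. -/
noncomputable def relBraidInv (M N : Modl A) (e : M.X ⟶ M.X) (t : N.X ⟶ N.X) :
    (relMod N M).X ⟶ (relMod M N).X :=
  relι N M ≫ sbraidInv M N e t ≫ relπ M N

lemma π_relBraidInv (he : IsGrading M e) (ht : IsSpinMap N t) :
    relπ N M ≫ relBraidInv M N e t = sbraidInv M N e t ≫ relπ M N :=
  π_relDesc _ (sbraidInv_bal he ht)

lemma relBraid_inv (he : IsGrading M e) (ht : IsSpinMap N t) :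
    relBraid M N e t ≫ relBraidInv M N e t = 𝟙 _ := by
  rw [← cancel_epi (relπ M N), reassoc_of% (π_relBraid he ht), π_relBraidInv he ht,
    reassoc_of% (sbraid_inv he ht.invol), Category.comp_id]

lemma relBraidInv_hom (he : IsGrading M e) (ht : IsSpinMap N t) :
    relBraidInv M N e t ≫ relBraid M N e t = 𝟙 _ := by
  rw [← cancel_epi (relπ N M), reassoc_of% (π_relBraidInv he ht), π_relBraid he ht,
    reassoc_of% (sbraidInv_hom he ht.invol), Category.comp_id]

lemma relBraid_hom (he : IsGrading M e) (ht : IsSpinMap N t) :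
    act (relMod M N) ≫ relBraid M N e t = A ◁ relBraid M N e t ≫ act (relMod N M) :=
  relMod_hom_intertwine _ <| by
    rw [π_relBraid he ht, ← reassoc_of% (sbraid_actSnd he), ← actFst_π, ← whisker_π_act]
    simp

/-- The braiding as an isomorphism of modules. -/
noncomputable def relBraidIso (he : IsGrading M e) (ht : IsSpinMap N t) :
    relMod M N ≅ relMod N M where
  hom := mkHom (relBraid M N e t) (relBraid_hom he ht)
  inv := mkHom (relBraidInv M N e t) (by
    have : IsIso (relBraid M N e t) := ⟨_, relBraid_inv he ht, relBraidInv_hom he ht⟩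
    rw [← cancel_mono (relBraid M N e t), Category.assoc, Category.assoc, relBraid_hom he ht,
      ← MonoidalCategory.whiskerLeft_comp_assoc, relBraidInv_hom he ht]
    simp)
  hom_inv_id := by ext; exact relBraid_inv he ht
  inv_hom_id := by ext; exact relBraidInv_hom he ht

lemma relBraid_nat_left {M' : Modl A} {e' : M'.X ⟶ M'.X} (he : IsGrading M e)
    (he' : IsGrading M' e') (ht : IsSpinMap N t) (f : M ⟶ M') (hf : f.hom ≫ e' = e ≫ f.hom) :
    (relMap f (𝟙 N)).hom ≫ relBraid M' N e' t = relBraid M N e t ≫ (relMap (𝟙 N) f).hom := by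
  have h2 : N.X ◁ f.hom ≫ sgn M' N e' t = sgn M N e t ≫ N.X ◁ f.hom := by
    have h3 : f.hom ≫ (𝟙 _ - e') = (𝟙 _ - e) ≫ f.hom := by
      rw [Preadditive.comp_sub, Preadditive.sub_comp, hf]; simp
    rw [sgn, sgn, Preadditive.comp_add, Preadditive.add_comp, whisker_exchange_assoc,
      ← MonoidalCategory.whiskerLeft_comp, ← MonoidalCategory.whiskerLeft_comp, h3, hf]
    simp only [Category.assoc, MonoidalCategory.whiskerLeft_comp]
  rw [← cancel_epi (relπ M N), reassoc_of% π_relMap, π_relBraid he' ht, reassoc_of% (π_relBraid he ht),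
    π_relMap]
  simp only [Mod.id_hom', tensorHom_id, id_tensorHom, sbraid, Category.assoc,
    BraidedCategory.braiding_naturality_left_assoc, reassoc_of% h2]

lemma relBraid_nat_right {N' : Modl A} {t' : N'.X ⟶ N'.X} (he : IsGrading M e)
    (ht : IsSpinMap N t) (ht' : IsSpinMap N' t') (f : N ⟶ N') (hf : f.hom ≫ t' = t ≫ f.hom) :
    (relMap (𝟙 M) f).hom ≫ relBraid M N' e t' = relBraid M N e t ≫ (relMap f (𝟙 M)).hom := by
  have h2 : f.hom ▷ M.X ≫ sgn M N' e t' = sgn M N e t ≫ f.hom ▷ M.X := by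
    rw [sgn, sgn, Preadditive.comp_add, Preadditive.add_comp, ← comp_whiskerRight_assoc, hf,
      Category.assoc, whisker_exchange, whisker_exchange]
    simp
  rw [← cancel_epi (relπ M N), reassoc_of% π_relMap, π_relBraid he ht', reassoc_of% (π_relBraid he ht),
    π_relMap]
  simp only [Mod.id_hom', tensorHom_id, id_tensorHom, sbraid, Category.assoc,
    BraidedCategory.braiding_naturality_right_assoc, reassoc_of% h2]

end

end Graded

section TensorSpin
open HasTwist
variable {C : Type u} [Category.{v} C] [MonoidalCategory C] [BraidedCategory C]
  [HasTwist C] [IsRibbon C] {A : C} [MonObj A] [ComonObj A]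
  [IsFrobenius A] [IsDeltaSeparable A] [IsCommMonObj A] [IsIdempotentComplete C]

/-- The map `π ∘ (t_M ⊗ t_N) ∘ ι` on `M ⊗_A N`. -/
noncomputable def tensSpin {M N : Modl A} (t : M.X ⟶ M.X) (t' : N.X ⟶ N.X) :
    (relMod M N).X ⟶ (relMod M N).X :=
  relι M N ≫ (t ⊗ₘ t') ≫ relπ M N

lemma actFst_tens {M N : Modl A} {t : M.X ⟶ M.X} {t' : N.X ⟶ N.X} (ht : IsSpinMap M t) :
    actFst M N.X ≫ (t ⊗ₘ t') = nak A ▷ _ ≫ A ◁ (t ⊗ₘ t') ≫ actFst M N.X := by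
  rw [MonoidalCategory.tensorHom_def, reassoc_of% (actFst_left _ _ _ _ ht.act_t), actFst_whiskerLeft,
    MonoidalCategory.whiskerLeft_comp_assoc]

lemma actSnd_tens {M N : Modl A} {t : M.X ⟶ M.X} {t' : N.X ⟶ N.X} (ht : IsSpinMap N t') :
    actSnd M.X N ≫ (t ⊗ₘ t') = nak A ▷ _ ≫ A ◁ (t ⊗ₘ t') ≫ actSnd M.X N := by
  rw [MonoidalCategory.tensorHom_def', reassoc_of% (actSnd_left _ _ _ _ ht.act_t),
    MonoidalCategory.whiskerLeft_comp_assoc, actSnd_eq, whiskerRight_slide]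

lemma π_tensSpin {M N : Modl A} {t : M.X ⟶ M.X} {t' : N.X ⟶ N.X} (ht : IsSpinMap M t)
    (ht' : IsSpinMap N t') : relπ M N ≫ tensSpin t t' = (t ⊗ₘ t') ≫ relπ M N :=
  π_relDesc _ <| by rw [reassoc_of% (actFst_tens ht), actFst_π, reassoc_of% (actSnd_tens ht')]

lemma tensSpin_isSpinMap {M N : Modl A} {t : M.X ⟶ M.X} {t' : N.X ⟶ N.X} (ht : IsSpinMap M t)
    (ht' : IsSpinMap N t') : IsSpinMap (relMod M N) (tensSpin t t') where
  invol := by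
    rw [← cancel_epi (relπ M N), reassoc_of% (π_tensSpin ht ht'), π_tensSpin ht ht',
      tensorHom_comp_tensorHom_assoc, ht.invol, ht'.invol]
    simp
  act_t := by
    rw [← cancel_epi (A ◁ relπ M N), MonoidalCategory.tensorHom_def', ← Category.assoc,
      whisker_π_act, Category.assoc, π_tensSpin ht ht', Category.assoc,
      ← MonoidalCategory.whiskerLeft_comp_assoc, π_tensSpin ht ht',
      MonoidalCategory.whiskerLeft_comp_assoc, whisker_exchange_assoc, whisker_π_act,
      reassoc_of% (actFst_tens ht), whisker_exchange_assoc]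

lemma tensSpin_nat {M N M' N' : Modl A} {t : M.X ⟶ M.X} {t' : N.X ⟶ N.X} {s : M'.X ⟶ M'.X}
    {s' : N'.X ⟶ N'.X} (ht : IsSpinMap M t) (ht' : IsSpinMap N t') (hs : IsSpinMap M' s)
    (hs' : IsSpinMap N' s') (f : M ⟶ M') (g : N ⟶ N') (hf : t ≫ f.hom = f.hom ≫ s)
    (hg : t' ≫ g.hom = g.hom ≫ s') :
    tensSpin t t' ≫ (relMap f g).hom = (relMap f g).hom ≫ tensSpin s s' := by
  rw [← cancel_epi (relπ M N), reassoc_of% (π_tensSpin ht ht'), π_relMap, reassoc_of% π_relMap,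
    π_tensSpin hs hs', tensorHom_comp_tensorHom_assoc, tensorHom_comp_tensorHom_assoc, hf, hg]

lemma tensSpin_assoc {M N P : Modl A} {t : M.X ⟶ M.X} {t' : N.X ⟶ N.X} {s : P.X ⟶ P.X}
    (ht : IsSpinMap M t) (ht' : IsSpinMap N t') (hs : IsSpinMap P s) :
    tensSpin (tensSpin t t') s ≫ (relAssocIso M N P).hom.hom =
      (relAssocIso M N P).hom.hom ≫ tensSpin t (tensSpin t' s) := by
  rw [← cancel_epi (π₃' M N P), reassoc_of% π₃'_assoc, π₃', Category.assoc,
    reassoc_of% (π_tensSpin (tensSpin_isSpinMap ht ht') hs), π₃, Category.assoc,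
    π_tensSpin ht (tensSpin_isSpinMap ht' hs)]
  have h1 : relπ M N ▷ P.X ≫ (tensSpin t t' ⊗ₘ s) = ((t ⊗ₘ t') ⊗ₘ s) ≫ relπ M N ▷ P.X := by
    rw [← tensorHom_id, tensorHom_comp_tensorHom, tensorHom_comp_tensorHom,
      π_tensSpin ht ht']
    simp
  have h2 : M.X ◁ relπ N P ≫ (t ⊗ₘ tensSpin t' s) = (t ⊗ₘ (t' ⊗ₘ s)) ≫ M.X ◁ relπ N P := by
    rw [← id_tensorHom, tensorHom_comp_tensorHom, tensorHom_comp_tensorHom,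
      π_tensSpin ht' hs]
    simp
  have h3 := π₃'_assoc M N P
  simp only [π₃', π₃, Category.assoc] at h3
  rw [reassoc_of% h1, h3, reassoc_of% h2]
  simp

lemma nak_isSpinMap : IsSpinMap (Mod.regular A) (nak A) where
  invol := nak_nak A
  act_t := by
    change μ[A] ≫ nak A = (nak A ⊗ₘ nak A) ≫ μ[A]
    rw [nak_eq_twist, twist_mul]

lemma tensSpin_lam {M : Modl A} {t : M.X ⟶ M.X} (ht : IsSpinMap M t) :
    tensSpin (M := Mod.regular A) (nak A) t ≫ (relLam M).hom = (relLam M).hom ≫ t := by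
  have h := π_tensSpin (nak_isSpinMap (A := A)) ht
  rw [← cancel_epi (relπ (Mod.regular A) M), reassoc_of% h, π_relLam, ← Category.assoc, π_relLam]
  exact ht.act_t.symm

lemma tensSpin_rho {M : Modl A} {t : M.X ⟶ M.X} (ht : IsSpinMap M t) :
    tensSpin (N := Mod.regular A) t (nak A) ≫ (relRho M).hom = (relRho M).hom ≫ t := by
  have h := π_tensSpin ht (nak_isSpinMap (A := A))
  have e : (t ⊗ₘ nak A) ≫ ract M = ract M ≫ t := by
    rw [ract, Category.assoc, ht.act_t]
    rw [BraidedCategory.braiding_inv_naturality_assoc]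
  rw [← cancel_epi (relπ M (Mod.regular A)), reassoc_of% h, π_relRho, ← Category.assoc, π_relRho]
  exact e

end TensorSpin

section Hexagon
open HasTwist
variable {C : Type u} [Category.{v} C] [MonoidalCategory C] [BraidedCategory C]
  [HasTwist C] [IsRibbon C] {A : C} [MonObj A] [ComonObj A] [Preadditive C]
  [MonoidalPreadditive C]

lemma sbraid_of_even {M N : Modl A} {e : M.X ⟶ M.X} {t : N.X ⟶ N.X} {W : C} (f : W ⟶ M.X)
    (hf : f ≫ e = f) : f ▷ N.X ≫ sbraid M N e t = f ▷ N.X ≫ (β_ M.X N.X).hom := by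
  have h2 : f ≫ (𝟙 _ - e) = 0 := by rw [Preadditive.comp_sub, hf]; simp
  rw [sbraid, BraidedCategory.braiding_naturality_left_assoc, sgn, Preadditive.comp_add,
    whisker_exchange_assoc, ← MonoidalCategory.whiskerLeft_comp,
    ← MonoidalCategory.whiskerLeft_comp, h2, hf, BraidedCategory.braiding_naturality_left]
  simp

lemma sbraid_of_odd {M N : Modl A} {e : M.X ⟶ M.X} {t : N.X ⟶ N.X} {W : C} (f : W ⟶ M.X)
    (hf : f ≫ e = 0) :
    f ▷ N.X ≫ sbraid M N e t = f ▷ N.X ≫ (β_ M.X N.X).hom ≫ t ▷ M.X := by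
  have h2 : f ≫ (𝟙 _ - e) = f := by rw [Preadditive.comp_sub, hf]; simp
  rw [sbraid, BraidedCategory.braiding_naturality_left_assoc, sgn, Preadditive.comp_add,
    whisker_exchange_assoc, ← MonoidalCategory.whiskerLeft_comp,
    ← MonoidalCategory.whiskerLeft_comp, h2, hf,
    BraidedCategory.braiding_naturality_left_assoc, whisker_exchange]
  simp

variable [IsFrobenius A] [IsDeltaSeparable A] [IsCommMonObj A] [IsIdempotentComplete C]

lemma hexagon_forward_part {M N P : Modl A} {e x : M.X ⟶ M.X} {t τ : N.X ⟶ N.X}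
    {t' τ' : P.X ⟶ P.X} {T : (relMod N P).X ⟶ (relMod N P).X}
    (he : IsGrading M e) (ht : IsSpinMap N t) (ht' : IsSpinMap P t') (hx : x ≫ x = x)
    (hN : x ▷ N.X ≫ sbraid M N e t = x ▷ N.X ≫ (β_ M.X N.X).hom ≫ τ ▷ M.X)
    (hP : x ▷ P.X ≫ sbraid M P e t' = x ▷ P.X ≫ (β_ M.X P.X).hom ≫ τ' ▷ M.X)
    (hNP : x ▷ (relMod N P).X ≫ sbraid M (relMod N P) e (tensSpin t t') =
      x ▷ (relMod N P).X ≫ (β_ M.X (relMod N P).X).hom ≫ T ▷ M.X)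
    (hT : relπ N P ≫ T = (τ ⊗ₘ τ') ≫ relπ N P) :
    x ▷ N.X ▷ P.X ≫ π₃' M N P ≫ (relAssocIso M N P).hom.hom ≫
      (relBraidIso he (tensSpin_isSpinMap ht ht')).hom.hom ≫ (relAssocIso N P M).hom.hom =
    x ▷ N.X ▷ P.X ≫ π₃' M N P ≫ (relMap (relBraidIso he ht).hom (𝟙 P)).hom ≫
      (relAssocIso N M P).hom.hom ≫ (relMap (𝟙 N) (relBraidIso he ht').hom).hom := by
  have hπ := π_relBraid he (tensSpin_isSpinMap ht ht')
  have b1 : (relBraidIso he (tensSpin_isSpinMap ht ht')).hom.hom =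
    relBraid M (relMod N P) e (tensSpin t t') := rfl
  have b2 : (relBraidIso he ht).hom.hom = relBraid M N e t := rfl
  have b3 : (relBraidIso he ht').hom.hom = relBraid M P e t' := rfl
  have l1 : x ▷ N.X ▷ P.X ≫ π₃' M N P ≫ (relAssocIso M N P).hom.hom ≫
      relBraid M (relMod N P) e (tensSpin t t') ≫ (relAssocIso N P M).hom.hom =
      (α_ _ _ _).hom ≫ x ▷ (N.X ⊗ P.X) ≫ (β_ M.X (N.X ⊗ P.X)).hom ≫ (τ ⊗ₘ τ') ▷ M.X ≫
        (α_ _ _ _).hom ≫ π₃ N P M := by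
    rw [reassoc_of% π₃'_assoc, π₃, Category.assoc, reassoc_of% hπ, associator_naturality_left_assoc,
      ← whisker_exchange_assoc, reassoc_of% hNP, whisker_exchange_assoc,
      BraidedCategory.braiding_naturality_right_assoc, ← comp_whiskerRight_assoc, hT,
      comp_whiskerRight_assoc]
    have := π₃'_assoc N P M
    rw [π₃', Category.assoc] at this
    rw [this]
  have r1 : x ▷ N.X ▷ P.X ≫ π₃' M N P ≫ (relMap (relBraidIso he ht).hom (𝟙 P)).hom =
      (x ▷ N.X ≫ (β_ M.X N.X).hom ≫ τ ▷ M.X) ▷ P.X ≫ π₃' N M P := by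
    rw [π₃', Category.assoc, π_relMap, b2, Mod.id_hom', tensorHom_id,
      ← comp_whiskerRight_assoc (relπ M N), π_relBraid he ht, ← comp_whiskerRight_assoc,
      reassoc_of% hN, π₃']
    simp
  have r2 : N.X ◁ x ▷ P.X ≫ π₃ N M P ≫ (relMap (𝟙 N) (relBraidIso he ht').hom).hom =
      N.X ◁ (x ▷ P.X ≫ (β_ M.X P.X).hom ≫ τ' ▷ M.X) ≫ π₃ N P M := by
    rw [π₃, Category.assoc, π_relMap, b3, Mod.id_hom', id_tensorHom,
      ← MonoidalCategory.whiskerLeft_comp_assoc N.X (relπ M P), π_relBraid he ht',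
      ← MonoidalCategory.whiskerLeft_comp_assoc, reassoc_of% hP, π₃]
    simp
  have r3 : x ▷ N.X ≫ (β_ M.X N.X).hom ≫ τ ▷ M.X =
      (x ▷ N.X ≫ (β_ M.X N.X).hom ≫ τ ▷ M.X) ≫ N.X ◁ x := by
    nth_rw 1 [← hx]
    rw [Category.assoc, Category.assoc, ← whisker_exchange, comp_whiskerRight_assoc,
      BraidedCategory.braiding_naturality_left_assoc x]
  have r4 : (x ▷ N.X ≫ (β_ M.X N.X).hom ≫ τ ▷ M.X) ▷ P.X ≫ (α_ _ _ _).hom ≫ N.X ◁ x ▷ P.X =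
      (x ▷ N.X ≫ (β_ M.X N.X).hom ≫ τ ▷ M.X) ▷ P.X ≫ (α_ _ _ _).hom := by
    nth_rw 2 [r3]
    rw [comp_whiskerRight _ (N.X ◁ x), Category.assoc, associator_naturality_middle]
  have r5 : τ ▷ M.X ▷ P.X ≫ (α_ _ _ _).hom ≫ N.X ◁ (β_ M.X P.X).hom ≫ N.X ◁ τ' ▷ M.X =
      (α_ _ _ _).hom ≫ N.X ◁ (β_ M.X P.X).hom ≫ (α_ _ _ _).inv ≫ (τ ⊗ₘ τ') ▷ M.X ≫
        (α_ _ _ _).hom := by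
    rw [associator_naturality_left_assoc, ← whisker_exchange_assoc,
      MonoidalCategory.tensorHom_def]
    simp
  rw [b1, l1, reassoc_of% r1, reassoc_of% π₃'_assoc, ← reassoc_of% r4, r2,
    MonoidalCategory.whiskerLeft_comp_assoc, reassoc_of% r4]
  simp only [comp_whiskerRight, MonoidalCategory.whiskerLeft_comp, Category.assoc,
    reassoc_of% r5, BraidedCategory.braiding_tensor_right_hom]
  simp

lemma rel_hexagon_forward {M N P : Modl A} {e : M.X ⟶ M.X} {t : N.X ⟶ N.X} {t' : P.X ⟶ P.X}
    (he : IsGrading M e) (ht : IsSpinMap N t) (ht' : IsSpinMap P t') :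
    (relAssocIso M N P).hom ≫
      (relBraidIso he (tensSpin_isSpinMap ht ht')).hom ≫ (relAssocIso N P M).hom =
    relMap (relBraidIso he ht).hom (𝟙 P) ≫ (relAssocIso N M P).hom ≫
      relMap (𝟙 N) (relBraidIso he ht').hom := by
  apply rel_hom_ext₃
  simp only [Mod.comp_hom']
  refine add_ext (a := e ▷ N.X ▷ P.X) (b := (𝟙 _ - e) ▷ N.X ▷ P.X) (by
    rw [← MonoidalPreadditive.add_whiskerRight, ← MonoidalPreadditive.add_whiskerRight]
    simp) ?_ ?_
  · exact hexagon_forward_part (T := 𝟙 _) (τ := 𝟙 _) (τ' := 𝟙 _) he ht ht' he.idem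
      (by simpa using sbraid_even he t) (by simpa using sbraid_even he t')
      (by simpa using sbraid_even he (tensSpin t t')) (by simp)
  · exact hexagon_forward_part he ht ht' he.o_o (sbraid_odd he t) (sbraid_odd he t')
      (sbraid_odd he _) (π_tensSpin ht ht')

lemma ext₂ {X Y P Z : C} (e : X ⟶ X) (e' : Y ⟶ Y) {f g : X ⊗ (Y ⊗ P) ⟶ Z}
    (h₁ : e ▷ (Y ⊗ P) ≫ X ◁ e' ▷ P ≫ f = e ▷ (Y ⊗ P) ≫ X ◁ e' ▷ P ≫ g)
    (h₂ : e ▷ (Y ⊗ P) ≫ X ◁ (𝟙 _ - e') ▷ P ≫ f = e ▷ (Y ⊗ P) ≫ X ◁ (𝟙 _ - e') ▷ P ≫ g)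
    (h₃ : (𝟙 _ - e) ▷ (Y ⊗ P) ≫ X ◁ e' ▷ P ≫ f = (𝟙 _ - e) ▷ (Y ⊗ P) ≫ X ◁ e' ▷ P ≫ g)
    (h₄ : (𝟙 _ - e) ▷ (Y ⊗ P) ≫ X ◁ (𝟙 _ - e') ▷ P ≫ f =
      (𝟙 _ - e) ▷ (Y ⊗ P) ≫ X ◁ (𝟙 _ - e') ▷ P ≫ g) : f = g := by
  refine ext₁ e (extA e' ?_ ?_) (extA e' ?_ ?_) <;>
    simpa only [whisker_exchange_assoc]

lemma rel_hexagon_forward_of_eq {M N P : Modl A} {e : M.X ⟶ M.X} {t : N.X ⟶ N.X}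
    {t' : P.X ⟶ P.X} {T : (relMod N P).X ⟶ (relMod N P).X}
    (he : IsGrading M e) (ht : IsSpinMap N t) (ht' : IsSpinMap P t') (hT : IsSpinMap _ T)
    (h : T = tensSpin t t') :
    (relAssocIso M N P).hom ≫ (relBraidIso he hT).hom ≫ (relAssocIso N P M).hom =
    relMap (relBraidIso he ht).hom (𝟙 P) ≫ (relAssocIso N M P).hom ≫
      relMap (𝟙 N) (relBraidIso he ht').hom := by
  subst h
  exact rel_hexagon_forward he ht ht'

lemma relBraid_spin {M N : Modl A} {e t : M.X ⟶ M.X} {t' : N.X ⟶ N.X} (he : IsGrading M e)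
    (ht : IsSpinMap M t) (ht' : IsSpinMap N t') (h : e ≫ t = t ≫ e) :
    tensSpin t t' ≫ relBraid M N e t' = relBraid M N e t' ≫ tensSpin t' t := by
  have h' : t ≫ (𝟙 _ - e) = (𝟙 _ - e) ≫ t := by
    rw [Preadditive.comp_sub, Preadditive.sub_comp, h]; simp
  have h2 : (t' ⊗ₘ t) ≫ sgn M N e t' = sgn M N e t' ≫ (t' ⊗ₘ t) := by
    have e1 : N.X ◁ e ≫ (t' ⊗ₘ t) = (t' ⊗ₘ t) ≫ N.X ◁ e := by
      rw [← id_tensorHom, tensorHom_comp_tensorHom, tensorHom_comp_tensorHom, h]; simp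
    have e2 : N.X ◁ (𝟙 _ - e) ≫ (t' ⊗ₘ t) = (t' ⊗ₘ t) ≫ N.X ◁ (𝟙 _ - e) := by
      rw [← id_tensorHom, tensorHom_comp_tensorHom, tensorHom_comp_tensorHom, h']; simp
    have e3 : t' ▷ M.X ≫ (t' ⊗ₘ t) = (t' ⊗ₘ t) ≫ t' ▷ M.X := by
      rw [← tensorHom_id, tensorHom_comp_tensorHom, tensorHom_comp_tensorHom]; simp
    rw [sgn, Preadditive.comp_add, Preadditive.add_comp, Category.assoc, e1, e2,
      reassoc_of% e3]
  rw [← cancel_epi (relπ M N), reassoc_of% (π_tensSpin ht ht'), π_relBraid he ht',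
    reassoc_of% (π_relBraid he ht'), π_tensSpin ht' ht]
  simp only [sbraid, Category.assoc, BraidedCategory.braiding_naturality_assoc]
  rw [reassoc_of% h2]

lemma spinTwist_hom {M : Modl A} {e t : M.X ⟶ M.X} (he : IsGrading M e) (ht : IsSpinMap M t)
    (h : e ≫ t = t ≫ e) : act M ≫ (e ≫ t + (𝟙 _ - e)) ≫ twist M.X =
      A ◁ ((e ≫ t + (𝟙 _ - e)) ≫ twist M.X) ≫ act M := by
  have hθ : act M ≫ twist M.X = (nak A ⊗ₘ twist M.X) ≫ monodromy A M.X ≫ act M := by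
    rw [twist_nat, IsRibbon.twist_tensor, nak_eq_twist, Category.assoc]
  have e1 : act M ≫ e ≫ t ≫ twist M.X = A ◁ (e ≫ t ≫ twist M.X) ≫ act M := by
    have h1 : act M ≫ t ≫ twist M.X = (𝟙 A ⊗ₘ (t ≫ twist M.X)) ≫ monodromy A M.X ≫ act M := by
      rw [reassoc_of% ht.act_t, hθ, tensorHom_comp_tensorHom_assoc, nak_nak]
    have h2 : e ≫ t ≫ twist M.X = (t ≫ twist M.X) ≫ e := by
      rw [reassoc_of% h, twist_nat, Category.assoc]
    rw [reassoc_of% he.act_e, h1, id_tensorHom, ← MonoidalCategory.whiskerLeft_comp_assoc, h2,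
      MonoidalCategory.whiskerLeft_comp_assoc, he.even,
      ← MonoidalCategory.whiskerLeft_comp_assoc]
  have e2 : act M ≫ (𝟙 _ - e) ≫ twist M.X = A ◁ ((𝟙 _ - e) ≫ twist M.X) ≫ act M := by
    have h2 : (𝟙 _ - e) ≫ twist M.X = twist M.X ≫ (𝟙 _ - e) := twist_nat _
    rw [reassoc_of% he.act_o, hθ, MonoidalCategory.tensorHom_def', Category.assoc,
      ← MonoidalCategory.whiskerLeft_comp_assoc, h2, MonoidalCategory.whiskerLeft_comp_assoc,
      whisker_exchange_assoc, he.odd, MonoidalCategory.tensorHom_def, Category.assoc,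
      ← comp_whiskerRight_assoc, nak_nak, id_whiskerRight, Category.id_comp,
      ← MonoidalCategory.whiskerLeft_comp_assoc]
  rw [Preadditive.add_comp, Preadditive.comp_add, MonoidalPreadditive.whiskerLeft_add,
    Preadditive.add_comp, Category.assoc, e1, e2]

lemma π₃_assoc_inv (M N P : Modl A) :
    π₃ M N P ≫ (relAssocIso M N P).inv.hom = (α_ _ _ _).inv ≫ π₃' M N P := by
  have h := congr($(π₃'_assoc M N P) ≫ (relAssocIso M N P).inv.hom)
  rw [Category.assoc, ← Mod.comp_hom', Iso.hom_inv_id] at h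
  rw [Iso.eq_inv_comp]
  simpa using h.symm

lemma hexagon_reverse_part {M N P : Modl A} {e x : M.X ⟶ M.X} {e' y : N.X ⟶ N.X}
    {e'' : (relMod M N).X ⟶ (relMod M N).X} {t τ τ' τ'' : P.X ⟶ P.X}
    (he : IsGrading M e) (he' : IsGrading N e') (he'' : IsGrading (relMod M N) e'')
    (ht : IsSpinMap P t)
    (hM : x ▷ P.X ≫ sbraid M P e t = x ▷ P.X ≫ (β_ M.X P.X).hom ≫ τ ▷ M.X)
    (hN : y ▷ P.X ≫ sbraid N P e' t = y ▷ P.X ≫ (β_ N.X P.X).hom ≫ τ' ▷ N.X)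
    (hMN : ((x ⊗ₘ y) ≫ relπ M N) ▷ P.X ≫ sbraid (relMod M N) P e'' t =
      ((x ⊗ₘ y) ≫ relπ M N) ▷ P.X ≫ (β_ (relMod M N).X P.X).hom ≫ τ'' ▷ (relMod M N).X)
    (hτ : τ' ≫ τ = τ'') :
    x ▷ (N.X ⊗ P.X) ≫ M.X ◁ y ▷ P.X ≫ π₃ M N P ≫ (relAssocIso M N P).inv.hom ≫
      (relBraidIso he'' ht).hom.hom ≫ (relAssocIso P M N).inv.hom =
    x ▷ (N.X ⊗ P.X) ≫ M.X ◁ y ▷ P.X ≫ π₃ M N P ≫ (relMap (𝟙 M) (relBraidIso he' ht).hom).hom ≫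
      (relAssocIso M P N).inv.hom ≫ (relMap (relBraidIso he ht).hom (𝟙 N)).hom := by
  have b1 : (relBraidIso he'' ht).hom.hom = relBraid (relMod M N) P e'' t := rfl
  have b2 : (relBraidIso he ht).hom.hom = relBraid M P e t := rfl
  have b3 : (relBraidIso he' ht).hom.hom = relBraid N P e' t := rfl
  have hπ := π_relBraid he'' ht
  have l0 : x ▷ (N.X ⊗ P.X) ≫ M.X ◁ y ▷ P.X ≫ (α_ _ _ _).inv =
      (α_ _ _ _).inv ≫ (x ⊗ₘ y) ▷ P.X := by
    rw [MonoidalCategory.tensorHom_def]; simp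
  have l1 : x ▷ (N.X ⊗ P.X) ≫ M.X ◁ y ▷ P.X ≫ π₃ M N P ≫ (relAssocIso M N P).inv.hom ≫
      relBraid (relMod M N) P e'' t ≫ (relAssocIso P M N).inv.hom =
      (α_ _ _ _).inv ≫ (x ⊗ₘ y) ▷ P.X ≫ (β_ (M.X ⊗ N.X) P.X).hom ≫ τ'' ▷ (M.X ⊗ N.X) ≫
        (α_ _ _ _).inv ≫ π₃' P M N := by
    rw [reassoc_of% π₃_assoc_inv, π₃', Category.assoc, reassoc_of% hπ, reassoc_of% l0,
      ← comp_whiskerRight_assoc, reassoc_of% hMN, comp_whiskerRight_assoc,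
      BraidedCategory.braiding_naturality_left_assoc, whisker_exchange_assoc]
    have := π₃_assoc_inv P M N
    rw [π₃, Category.assoc] at this
    rw [this]
  have r1 : M.X ◁ y ▷ P.X ≫ π₃ M N P ≫ (relMap (𝟙 M) (relBraidIso he' ht).hom).hom =
      M.X ◁ (y ▷ P.X ≫ (β_ N.X P.X).hom ≫ τ' ▷ N.X) ≫ π₃ M P N := by
    rw [π₃, Category.assoc, π_relMap, b3, Mod.id_hom', id_tensorHom,
      ← MonoidalCategory.whiskerLeft_comp_assoc M.X (relπ N P), π_relBraid he' ht,
      ← MonoidalCategory.whiskerLeft_comp_assoc, reassoc_of% hN, π₃]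
    simp
  have r2 : x ▷ P.X ▷ N.X ≫ π₃' M P N ≫ (relMap (relBraidIso he ht).hom (𝟙 N)).hom =
      (x ▷ P.X ≫ (β_ M.X P.X).hom ≫ τ ▷ M.X) ▷ N.X ≫ π₃' P M N := by
    rw [π₃', Category.assoc, π_relMap, b2, Mod.id_hom', tensorHom_id,
      ← comp_whiskerRight_assoc (relπ M P), π_relBraid he ht, ← comp_whiskerRight_assoc,
      reassoc_of% hM, π₃']
    simp
  rw [b1, l1, reassoc_of% r1, reassoc_of% π₃_assoc_inv, ← whisker_exchange_assoc,
    associator_inv_naturality_left_assoc x, r2, ← hτ]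
  have r3 : M.X ◁ τ' ▷ N.X ≫ (α_ _ _ _).inv ≫ (β_ M.X P.X).hom ▷ N.X ≫ τ ▷ M.X ▷ N.X =
      (α_ _ _ _).inv ≫ (β_ M.X P.X).hom ▷ N.X ≫ (τ' ≫ τ) ▷ M.X ▷ N.X := by
    rw [associator_inv_naturality_middle_assoc, ← comp_whiskerRight_assoc,
      BraidedCategory.braiding_naturality_right]
    simp
  have r4 : M.X ◁ (y ▷ P.X ≫ (β_ N.X P.X).hom ≫ τ' ▷ N.X) ≫ (α_ _ _ _).inv ≫
      (x ▷ P.X ≫ (β_ M.X P.X).hom ≫ τ ▷ M.X) ▷ N.X =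
      x ▷ (N.X ⊗ P.X) ≫ M.X ◁ y ▷ P.X ≫ M.X ◁ (β_ N.X P.X).hom ≫
        (M.X ◁ τ' ▷ N.X ≫ (α_ _ _ _).inv ≫ (β_ M.X P.X).hom ▷ N.X ≫ τ ▷ M.X ▷ N.X) := by
    simp only [comp_whiskerRight, MonoidalCategory.whiskerLeft_comp, Category.assoc]
    rw [← associator_inv_naturality_left_assoc, ← whisker_exchange_assoc,
      ← whisker_exchange_assoc, ← whisker_exchange_assoc]
  rw [reassoc_of% r4, reassoc_of% r3, ← reassoc_of% l0, BraidedCategory.braiding_tensor_left_hom]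
  simp

lemma rel_hexagon_reverse {M N P : Modl A} {e : M.X ⟶ M.X} {e' : N.X ⟶ N.X}
    {e'' : (relMod M N).X ⟶ (relMod M N).X} {t : P.X ⟶ P.X}
    (he : IsGrading M e) (he' : IsGrading N e') (he'' : IsGrading (relMod M N) e'')
    (ht : IsSpinMap P t)
    (h : relπ M N ≫ e'' = ((e ⊗ₘ e') + ((𝟙 _ - e) ⊗ₘ (𝟙 _ - e'))) ≫ relπ M N) :
    (relAssocIso M N P).inv ≫ (relBraidIso he'' ht).hom ≫ (relAssocIso P M N).inv =
    relMap (𝟙 M) (relBraidIso he' ht).hom ≫ (relAssocIso M P N).inv ≫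
      relMap (relBraidIso he ht).hom (𝟙 N) := by
  ext
  rw [← cancel_epi (π₃ M N P)]
  simp only [Mod.comp_hom']
  have hM := sbraid_even he t
  have hM' := sbraid_odd he t
  have hN := sbraid_even he' t
  have hN' := sbraid_odd he' t
  have k1 : ((e ⊗ₘ e') ≫ relπ M N) ≫ e'' = (e ⊗ₘ e') ≫ relπ M N := by
    rw [Category.assoc, h, ← Category.assoc, Preadditive.comp_add, tensorHom_comp_tensorHom,
      tensorHom_comp_tensorHom, he.idem, he'.idem, he.e_o]
    simp
  have k2 : ((e ⊗ₘ (𝟙 _ - e')) ≫ relπ M N) ≫ e'' = 0 := by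
    rw [Category.assoc, h, ← Category.assoc, Preadditive.comp_add, tensorHom_comp_tensorHom,
      tensorHom_comp_tensorHom, he.e_o, he'.o_e]
    simp
  have k3 : (((𝟙 _ - e) ⊗ₘ e') ≫ relπ M N) ≫ e'' = 0 := by
    rw [Category.assoc, h, ← Category.assoc, Preadditive.comp_add, tensorHom_comp_tensorHom,
      tensorHom_comp_tensorHom, he.o_e, he'.e_o]
    simp
  have k4 : (((𝟙 _ - e) ⊗ₘ (𝟙 _ - e')) ≫ relπ M N) ≫ e'' =
      ((𝟙 _ - e) ⊗ₘ (𝟙 _ - e')) ≫ relπ M N := by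
    rw [Category.assoc, h, ← Category.assoc, Preadditive.comp_add, tensorHom_comp_tensorHom,
      tensorHom_comp_tensorHom, he.o_e, he.o_o, he'.o_o]
    simp
  refine ext₂ e e' ?_ ?_ ?_ ?_
  · exact hexagon_reverse_part (τ := 𝟙 _) (τ' := 𝟙 _) (τ'' := 𝟙 _) he he' he'' ht
      (by simpa using hM) (by simpa using hN) (by simpa using sbraid_of_even _ k1) (by simp)
  · exact hexagon_reverse_part (τ := 𝟙 _) he he' he'' ht (by simpa using hM) hN'
      (sbraid_of_odd _ k2) (by simp)
  · exact hexagon_reverse_part (τ' := 𝟙 _) he he' he'' ht hM' (by simpa using hN)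
      (sbraid_of_odd _ k3) (by simp)
  · exact hexagon_reverse_part (τ'' := 𝟙 _) he he' he'' ht hM' hN'
      (by simpa using sbraid_of_even _ k4) ht.invol

end Hexagon

section Haploid
open HasTwist
variable (k : Type*) [Field k] {C : Type u} [Category.{v} C] [MonoidalCategory C]
  [Preadditive C] [Linear k C]

/-- `A` is haploid if `Hom(1, A)` is one-dimensional. -/
class IsHaploid (A : C) : Prop where
  finrank_eq_one : Module.finrank k (𝟙_ C ⟶ A) = 1

/-- Haploid Frobenius algebras whose Nakayama automorphism is not the identity. -/
class IsHaploidNonsymmetric [BraidedCategory C] [HasTwist C] [IsRibbon C] (A : C) [MonObj A]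
    [ComonObj A] : Prop extends IsHaploid k A where
  nak_ne_id : nak A ≠ 𝟙 A

variable [MonoidalPreadditive C] [MonoidalLinear k C] [BraidedCategory C] [HasTwist C] [IsRibbon C]
  (A : C) [MonObj A] [ComonObj A] [IsFrobenius A] [IsCommMonObj A]

/-- The loop of `A` closed by the Nakayama automorphism vanishes. -/
lemma copair_nak_mul [IsHaploidNonsymmetric k A] : copair A ≫ nak A ▷ A ≫ μ[A] = 0 := by
  have hf := IsHaploid.finrank_eq_one (k := k) (A := A)
  have hη : η[A] ≠ 0 := by
    intro h
    refine IsHaploidNonsymmetric.nak_ne_id (k := k) (A := A) ?_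
    have h0 : 𝟙 A = 0 := by
      have := MonObj.one_mul A
      rw [h, MonoidalPreadditive.zero_whiskerRight, Limits.zero_comp] at this
      rw [← Iso.inv_hom_id (λ_ A), ← this]; simp
    rw [← Category.comp_id (nak A), h0]; simp
  obtain ⟨a, ha⟩ := (finrank_eq_one_iff_of_nonzero' _ hη).1 hf (copair A ≫ nak A ▷ A ≫ μ[A])
  have hN : (nak A ⊗ₘ nak A) ≫ μ[A] = μ[A] ≫ nak A := by rw [nak_eq_twist, twist_mul]
  have h1 : Δ[A] ≫ nak A ▷ A ≫ μ[A] = a • nak A := by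
    rw [← copair_left, Category.assoc, Category.assoc, Category.assoc,
      ← comp_whiskerRight_assoc, ← hN]
    have : A ◁ copair A ≫ (α_ A A A).inv ≫ ((nak A ⊗ₘ nak A) ≫ μ[A]) ▷ A ≫ μ[A] =
        nak A ▷ _ ≫ A ◁ (copair A ≫ nak A ▷ A ≫ μ[A]) ≫ μ[A] := by
      rw [MonoidalCategory.tensorHom_def]
      simp only [comp_whiskerRight, Category.assoc, MonObj.mul_assoc,
        MonoidalCategory.whiskerLeft_comp]
      rw [← whisker_exchange_assoc]
      simp
    rw [this, ← ha]
    simp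
  have h2 : Δ[A] ≫ nak A ▷ A ≫ μ[A] = a • 𝟙 A := by
    rw [← copair_right, Category.assoc, Category.assoc, Category.assoc]
    have : copair A ▷ A ≫ (α_ A A A).hom ≫ A ◁ μ[A] ≫ nak A ▷ A ≫ μ[A] =
        (copair A ≫ nak A ▷ A ≫ μ[A]) ▷ A ≫ μ[A] := by
      rw [whisker_exchange_assoc]
      simp
    rw [this, ← ha]
    simp
  have h3 : a • (nak A - 𝟙 A) = 0 := by rw [smul_sub, ← h1, ← h2, sub_self]
  rcases smul_eq_zero.1 h3 with h | h
  · rw [← ha, h, zero_smul]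
  · exact (IsHaploidNonsymmetric.nak_ne_id (k := k) (sub_eq_zero.1 h)).elim

lemma comul_nak_mul [IsHaploidNonsymmetric k A] : Δ[A] ≫ nak A ▷ A ≫ μ[A] = 0 := by
  rw [← copair_right, Category.assoc, Category.assoc, Category.assoc]
  have : copair A ▷ A ≫ (α_ A A A).hom ≫ A ◁ μ[A] ≫ nak A ▷ A ≫ μ[A] =
      (copair A ≫ nak A ▷ A ≫ μ[A]) ▷ A ≫ μ[A] := by
    rw [whisker_exchange_assoc]
    simp
  rw [this, copair_nak_mul k A]
  simp

end Haploid

section EvenProj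
open HasTwist
variable {C : Type u} [Category.{v} C] [MonoidalCategory C] [BraidedCategory C]
  {A : C} [MonObj A] [ComonObj A]

/-- The projector to the even part of a direct sum of Nakayama-local modules: the loop of `A`
around `M` attached to `M` at both ends. For haploid non-symmetric `A` it is the identity on even
modules and zero on odd modules. -/
def evenProj (M : Modl A) : M.X ⟶ M.X :=
  (λ_ M.X).inv ≫ copair A ▷ M.X ≫ (α_ A A M.X).hom ≫ A ◁ (monodromy A M.X ≫ act M) ≫ act M

lemma evenProj_nat {M M' : Modl A} (f : M ⟶ M') :
    evenProj M ≫ f.hom = f.hom ≫ evenProj M' := by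
  have h1 : A ◁ f.hom ≫ monodromy A M'.X ≫ act M' = (monodromy A M.X ≫ act M) ≫ f.hom := by
    rw [reassoc_of% monodromy_naturality_right, ← act_hom, Category.assoc]
  have h2 := congr(A ◁ $h1)
  rw [MonoidalCategory.whiskerLeft_comp] at h2
  simp only [evenProj, Category.assoc, act_hom]
  rw [leftUnitor_inv_naturality_assoc, whisker_exchange_assoc,
    associator_naturality_right_assoc, reassoc_of% h2]
  simp

variable [IsDeltaSeparable A]

lemma evenProj_even {M : Modl A} (h : IsLocal M) : evenProj M = 𝟙 _ := by
  rw [evenProj, show monodromy A M.X ≫ act M = act M from h, ← mul_act,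
    ← comp_whiskerRight_assoc, copair_mul, one_act, Iso.inv_hom_id]

variable [HasTwist C] [IsRibbon C]  [IsCommMonObj A]

lemma evenProj_spin [IsFrobenius A] {M : Modl A} {t : M.X ⟶ M.X} (ht : IsSpinMap M t) :
    evenProj M ≫ t = t ≫ evenProj M := by
  have h0 : copair A ≫ (nak A ⊗ₘ nak A) = copair A := by
    rw [nak_eq_twist, copair_twist_twist]
  have h1 : (monodromy A M.X ≫ act M) ≫ t = (nak A ⊗ₘ t) ≫ (monodromy A M.X ≫ act M) := by
    rw [Category.assoc, ht.act_t, reassoc_of% monodromy_naturality]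
  have h2 : A ◁ (monodromy A M.X ≫ act M) ≫ act M ≫ t =
      (nak A ⊗ₘ (nak A ⊗ₘ t)) ≫ A ◁ (monodromy A M.X ≫ act M) ≫ act M := by
    rw [ht.act_t, ← id_tensorHom, tensorHom_comp_tensorHom_assoc, h1,
      tensorHom_comp_tensorHom_assoc]
    simp
  rw [evenProj, Category.assoc, Category.assoc, Category.assoc, Category.assoc, h2,
    ← associator_naturality_assoc]
  have h3 : copair A ▷ M.X ≫ ((nak A ⊗ₘ nak A) ⊗ₘ t) = 𝟙_ C ◁ t ≫ copair A ▷ M.X := by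
    rw [whisker_exchange, MonoidalCategory.tensorHom_def, ← comp_whiskerRight_assoc, h0]
  rw [reassoc_of% h3, leftUnitor_inv_naturality_assoc]

variable [Preadditive C] [MonoidalPreadditive C] [IsFrobenius A]

lemma evenProj_odd (k : Type*) [Field k] [Linear k C] [MonoidalLinear k C]
    [IsHaploidNonsymmetric k A]
    {M : Modl A} (h : IsOdd M) : evenProj M = 0 := by
  have h0 : copair A ≫ A ◁ nak A ≫ μ[A] = 0 := by
    rw [← copair_nak_mul k A, nak_eq_twist, reassoc_of% copair_twist]
  have h1 : A ◁ (nak A ▷ M.X ≫ act M) ≫ act M =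
      A ◁ nak A ▷ M.X ≫ (α_ _ _ _).inv ≫ μ[A] ▷ M.X ≫ act M := by
    rw [mul_act]; simp
  rw [evenProj, show monodromy A M.X ≫ act M = nak A ▷ M.X ≫ act M from h, h1]
  have h2 := congr((λ_ M.X).inv ≫ $h0 ▷ M.X ≫ act M)
  simpa using h2

lemma evenProj_cases (k : Type*) [Field k] [Linear k C] [MonoidalLinear k C]
    [IsHaploidNonsymmetric k A]
    {M : Modl A} (h : IsNakayamaLocal M) : evenProj M = 𝟙 _ ∨ evenProj M = 0 :=
  h.imp evenProj_even (evenProj_odd k)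

end EvenProj

section EvenProjGrading
open HasTwist
variable {C : Type u} [Category.{v} C] [MonoidalCategory C] [BraidedCategory C]
  {A : C} [MonObj A] [ComonObj A]
  [HasTwist C] [IsRibbon C] [Preadditive C] [MonoidalPreadditive C]

lemma IsNakayamaLocalSum.hom_ext {M : Modl A} (h : IsNakayamaLocalSum M) {Z : C}
    {f g : M.X ⟶ Z} (H : ∀ (P : Modl A) (i : P ⟶ M), IsNakayamaLocal P →
      i.hom ≫ f = i.hom ≫ g) : f = g := by
  obtain ⟨n, P, i, p, hP, -, -, h₃⟩ := h
  have h4 := congr(Mod.Hom.hom $h₃)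
  rw [sum_hom, Mod.id_hom'] at h4
  rw [← Category.id_comp f, ← Category.id_comp g, ← h4, Preadditive.sum_comp,
    Preadditive.sum_comp]
  exact Finset.sum_congr rfl fun j _ => by
    rw [Mod.comp_hom', Category.assoc, Category.assoc, H _ _ (hP j)]

lemma IsNakayamaLocalSum.hom_ext_whisker {M : Modl A} (h : IsNakayamaLocalSum M) {Y Z : C}
    {f g : Y ⊗ M.X ⟶ Z} (H : ∀ (P : Modl A) (i : P ⟶ M), IsNakayamaLocal P →
      Y ◁ i.hom ≫ f = Y ◁ i.hom ≫ g) : f = g := by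
  obtain ⟨n, P, i, p, hP, -, -, h₃⟩ := h
  have h4 := congr(Mod.Hom.hom $h₃)
  rw [sum_hom, Mod.id_hom'] at h4
  rw [← Category.id_comp f, ← Category.id_comp g, ← MonoidalCategory.whiskerLeft_id, ← h4,
    whiskerLeft_sum, Preadditive.sum_comp, Preadditive.sum_comp]
  exact Finset.sum_congr rfl fun j _ => by
    rw [Mod.comp_hom', MonoidalCategory.whiskerLeft_comp, Category.assoc, Category.assoc,
      H _ _ (hP j)]

lemma IsNakayamaLocalSum.hom_ext_whiskerRight {M : Modl A} (h : IsNakayamaLocalSum M) {Y Z : C}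
    {f g : M.X ⊗ Y ⟶ Z} (H : ∀ (P : Modl A) (i : P ⟶ M), IsNakayamaLocal P →
      i.hom ▷ Y ≫ f = i.hom ▷ Y ≫ g) : f = g := by
  obtain ⟨n, P, i, p, hP, -, -, h₃⟩ := h
  have h4 := congr(Mod.Hom.hom $h₃)
  rw [sum_hom, Mod.id_hom'] at h4
  rw [← Category.id_comp f, ← Category.id_comp g, ← id_whiskerRight, ← h4,
    sum_whiskerRight, Preadditive.sum_comp, Preadditive.sum_comp]
  exact Finset.sum_congr rfl fun j _ => by
    rw [Mod.comp_hom', comp_whiskerRight, Category.assoc, Category.assoc, H _ _ (hP j)]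

variable [IsFrobenius A] [IsDeltaSeparable A] [IsCommMonObj A]

lemma isGrading_of_local (k : Type*) [Field k] [Linear k C] [MonoidalLinear k C]
    [IsHaploidNonsymmetric k A]
    {P : Modl A} (h : IsNakayamaLocal P) : IsGrading P (evenProj P) := by
  rcases h with h | h
  · have h' : monodromy A P.X ≫ act P = act P := h
    rw [evenProj_even h]
    constructor <;> simp [h']
  · have h' : monodromy A P.X ≫ act P = nak A ▷ P.X ≫ act P := h
    rw [evenProj_odd k h]
    constructor <;> simp [h']

lemma isGrading_evenProj (k : Type*) [Field k] [Linear k C] [MonoidalLinear k C]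
    [IsHaploidNonsymmetric k A]
    {M : Modl A} (h : IsNakayamaLocalSum M) : IsGrading M (evenProj M) where
  idem := h.hom_ext fun P i hP => by
    rw [← evenProj_nat, ← reassoc_of% (evenProj_nat i), ← evenProj_nat,
      reassoc_of% (isGrading_of_local k hP).idem]
  act_e := h.hom_ext_whisker fun P i hP => by
    rw [← reassoc_of% (act_hom i), ← evenProj_nat, ← Category.assoc,
      (isGrading_of_local k hP).act_e, ← MonoidalCategory.whiskerLeft_comp_assoc,
      ← evenProj_nat, MonoidalCategory.whiskerLeft_comp_assoc, Category.assoc, act_hom]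
  even := h.hom_ext_whisker fun P i hP => by
    rw [← MonoidalCategory.whiskerLeft_comp_assoc, ← MonoidalCategory.whiskerLeft_comp_assoc,
      ← evenProj_nat, MonoidalCategory.whiskerLeft_comp_assoc,
      MonoidalCategory.whiskerLeft_comp_assoc, reassoc_of% monodromy_naturality_right, ← act_hom,
      reassoc_of% (isGrading_of_local k hP).even]
  odd := h.hom_ext_whisker fun P i hP => by
    have h1 : i.hom ≫ (𝟙 M.X - evenProj M) = (𝟙 P.X - evenProj P) ≫ i.hom := by
      rw [Preadditive.comp_sub, Preadditive.sub_comp, evenProj_nat]; simp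
    rw [← MonoidalCategory.whiskerLeft_comp_assoc, h1, MonoidalCategory.whiskerLeft_comp_assoc,
      reassoc_of% monodromy_naturality_right, ← act_hom,
      reassoc_of% (isGrading_of_local k hP).odd, act_hom, MonoidalCategory.tensorHom_def',
      MonoidalCategory.tensorHom_def', Category.assoc, whisker_exchange_assoc, Category.assoc,
      ← MonoidalCategory.whiskerLeft_comp_assoc, ← h1, MonoidalCategory.whiskerLeft_comp_assoc,
      whisker_exchange_assoc, whisker_exchange_assoc]

variable [IsIdempotentComplete C]

lemma evenProj_relMod_local (k : Type*) [Field k] [Linear k C] [MonoidalLinear k C]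
    [IsHaploidNonsymmetric k A]
    {M N : Modl A} (hM : IsNakayamaLocal M) (hN : IsNakayamaLocal N) :
    relπ M N ≫ evenProj (relMod M N) =
      ((evenProj M ⊗ₘ evenProj N) + ((𝟙 _ - evenProj M) ⊗ₘ (𝟙 _ - evenProj N))) ≫ relπ M N := by
  have hid (M : Modl A) (h : IsLocal M) : monodromy A M.X ≫ act M = 𝟙 A ▷ M.X ≫ act M := by
    simpa [IsLocal] using h
  rcases hM with hM | hM <;> rcases hN with hN | hN
  · rw [evenProj_even hM, evenProj_even hN, evenProj_even (hM.relMod hN)]; simp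
  · have : IsOdd (relMod M N) := by
      simpa [IsOdd] using monodromy_relMod M N _ _ (hid _ hM) hN
    rw [evenProj_even hM, evenProj_odd k hN, evenProj_odd k this]; simp
  · have : IsOdd (relMod M N) := by
      simpa [IsOdd] using monodromy_relMod M N _ _ hM (hid _ hN)
    rw [evenProj_odd k hM, evenProj_even hN, evenProj_odd k this]; simp
  · have : IsLocal (relMod M N) := by
      have := monodromy_relMod M N _ _ hM hN
      rw [nak_nak] at this
      simpa [IsLocal] using this
    rw [evenProj_odd k hM, evenProj_odd k hN, evenProj_even this]; simp

lemma evenProj_relMod (k : Type*) [Field k] [Linear k C] [MonoidalLinear k C]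
    [IsHaploidNonsymmetric k A]
    {M N : Modl A} (hM : IsNakayamaLocalSum M) (hN : IsNakayamaLocalSum N) :
    relπ M N ≫ evenProj (relMod M N) =
      ((evenProj M ⊗ₘ evenProj N) + ((𝟙 _ - evenProj M) ⊗ₘ (𝟙 _ - evenProj N))) ≫ relπ M N := by
  refine hM.hom_ext_whiskerRight fun P i hP => hN.hom_ext_whisker fun Q j hQ => ?_
  have h1 {P M : Modl A} (i : P ⟶ M) :
      i.hom ≫ (𝟙 M.X - evenProj M) = (𝟙 P.X - evenProj P) ≫ i.hom := by
    rw [Preadditive.comp_sub, Preadditive.sub_comp, evenProj_nat]; simp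
  rw [← MonoidalCategory.tensorHom_def'_assoc, ← MonoidalCategory.tensorHom_def'_assoc,
    ← reassoc_of% π_relMap, ← evenProj_nat, reassoc_of% (evenProj_relMod_local k hP hQ), π_relMap,
    ← Category.assoc, ← Category.assoc]
  congr 1
  rw [Preadditive.add_comp, Preadditive.comp_add, tensorHom_comp_tensorHom,
    tensorHom_comp_tensorHom, tensorHom_comp_tensorHom, tensorHom_comp_tensorHom, h1, h1,
    evenProj_nat, evenProj_nat]

end EvenProjGrading

section LSpin
open HasTwist
variable {C : Type u} [Category.{v} C] [MonoidalCategory C] [BraidedCategory C]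
  [HasTwist C] [IsRibbon C] [Preadditive C] [MonoidalPreadditive C]

/-- Objects of `L^spin_A` are triples `(M, ρ, t)` of a direct sum `(M, ρ)` of Nakayama-local modules
and an endomorphism `t` of `M` with `t ∘ t = id` and `t ∘ ρ = ρ ∘ (N_A ⊗ t)`. -/
structure LSpin (k : Type w) (A : C) [MonObj A] [ComonObj A] where
  toMod : Modl A
  isSum : IsNakayamaLocalSum toMod
  t : toMod.X ⟶ toMod.X
  isSpin : IsSpinMap toMod t

namespace LSpin

variable {k : Type w} {A : C} [MonObj A] [ComonObj A]

/-- Morphisms of `L^spin_A` are module morphisms that commute with `t`. -/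
@[ext]
structure Hom (M N : LSpin k A) where
  hom : M.toMod ⟶ N.toMod
  comm : M.t ≫ hom.hom = hom.hom ≫ N.t

instance : Category (LSpin k A) where
  Hom M N := Hom M N
  id M := ⟨𝟙 M.toMod, by simp⟩
  comp f g := ⟨f.hom ≫ g.hom, by
    rw [Mod.comp_hom', ← Category.assoc, f.comm, Category.assoc, g.comm, Category.assoc]⟩

@[ext]
lemma hom_ext {M N : LSpin k A} {f g : M ⟶ N} (h : f.hom = g.hom) : f = g := Hom.ext h

@[simp] lemma id_hom (M : LSpin k A) : (𝟙 M : M ⟶ M).hom = 𝟙 M.toMod := rfl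
@[simp] lemma comp_hom {M N P : LSpin k A} (f : M ⟶ N) (g : N ⟶ P) :
    (f ≫ g).hom = f.hom ≫ g.hom := rfl

/-- An isomorphism of modules that commutes with `t`. -/
def mkIso {M N : LSpin k A} (e : M.toMod ≅ N.toMod)
    (h : M.t ≫ e.hom.hom = e.hom.hom ≫ N.t) : M ≅ N where
  hom := ⟨e.hom, h⟩
  inv := ⟨e.inv, by
    have h1 : e.hom.hom ≫ e.inv.hom = 𝟙 _ := by rw [← Mod.comp_hom', e.hom_inv_id]; rfl
    have h2 : e.inv.hom ≫ e.hom.hom = 𝟙 _ := by rw [← Mod.comp_hom', e.inv_hom_id]; rfl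
    rw [← Category.comp_id (N.t ≫ e.inv.hom), ← Category.id_comp (N.t ≫ e.inv.hom), ← h2,
      Category.comp_id, Category.assoc, ← reassoc_of% h, h1, Category.comp_id]⟩
  hom_inv_id := hom_ext e.hom_inv_id
  inv_hom_id := hom_ext e.inv_hom_id

section Linear

instance (M N : LSpin k A) : Zero (M ⟶ N) := ⟨⟨0, by simp⟩⟩

instance (M N : LSpin k A) : Add (M ⟶ N) := ⟨fun f g => ⟨f.hom + g.hom, by
  rw [add_hom, Preadditive.comp_add, Preadditive.add_comp, f.comm, g.comm]⟩⟩

instance (M N : LSpin k A) : Neg (M ⟶ N) := ⟨fun f => ⟨-f.hom, by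
  have h : (-f.hom).hom = -f.hom.hom := rfl
  rw [h, Preadditive.comp_neg, Preadditive.neg_comp, f.comm]⟩⟩

instance (M N : LSpin k A) : AddCommGroup (M ⟶ N) where
  add_assoc f g h := hom_ext (add_assoc f.hom g.hom h.hom)
  zero_add f := hom_ext (zero_add f.hom)
  add_zero f := hom_ext (add_zero f.hom)
  neg_add_cancel f := hom_ext (neg_add_cancel f.hom)
  add_comm f g := hom_ext (add_comm f.hom g.hom)
  nsmul := nsmulRec
  zsmul := zsmulRec

instance : Preadditive (LSpin k A) where
  add_comp _ _ _ f g h := hom_ext (Preadditive.add_comp _ _ _ f.hom g.hom h.hom)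
  comp_add _ _ _ f g h := hom_ext (Preadditive.comp_add _ _ _ f.hom g.hom h.hom)

variable [Field k] [Linear k C] [MonoidalLinear k C]

instance (M N : LSpin k A) : Module k (M ⟶ N) where
  smul a f := ⟨a • f.hom, by
    rw [smul_hom, Linear.comp_smul, Linear.smul_comp, f.comm]⟩
  one_smul f := hom_ext (one_smul k f.hom)
  mul_smul a b f := hom_ext (mul_smul a b f.hom)
  smul_zero a := hom_ext (smul_zero a)
  zero_smul f := hom_ext (zero_smul k f.hom)
  smul_add a f g := hom_ext (smul_add a f.hom g.hom)
  add_smul a b f := hom_ext (add_smul a b f.hom)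

instance : Linear k (LSpin k A) where
  smul_comp _ _ _ a f g := hom_ext (Linear.smul_comp _ _ _ a f.hom g.hom)
  comp_smul _ _ _ f a g := hom_ext (Linear.comp_smul _ _ _ f.hom a g.hom)

end Linear

variable [IsFrobenius A] [IsDeltaSeparable A] [IsCommMonObj A] [IsIdempotentComplete C]

/-- The tensor product `M ⊗_A N` with `π ∘ (t_M ⊗ t_N) ∘ ι`. -/
noncomputable def tensor (M N : LSpin k A) : LSpin k A where
  toMod := relMod M.toMod N.toMod
  isSum := M.isSum.relMod N.isSum
  t := tensSpin M.t N.t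
  isSpin := tensSpin_isSpinMap M.isSpin N.isSpin

/-- The tensor product of morphisms. -/
noncomputable def tensorMap {M N M' N' : LSpin k A} (f : M ⟶ M') (g : N ⟶ N') :
    tensor M N ⟶ tensor M' N' :=
  ⟨relMap f.hom g.hom, tensSpin_nat M.isSpin N.isSpin M'.isSpin N'.isSpin _ _ f.comm g.comm⟩

variable (k A) in
/-- The tensor unit `(A, μ, N_A)`. -/
noncomputable def unit : LSpin k A where
  toMod := Mod.regular A
  isSum := IsNakayamaLocal.sum (Or.inl isLocal_regular)
  t := nak A
  isSpin := nak_isSpinMap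

noncomputable instance : MonoidalCategoryStruct (LSpin k A) where
  tensorObj M N := tensor M N
  tensorHom f g := tensorMap f g
  whiskerLeft M _ _ g := tensorMap (𝟙 M) g
  whiskerRight f N := tensorMap f (𝟙 N)
  tensorUnit := unit k A
  associator M N P := mkIso (relAssocIso M.toMod N.toMod P.toMod)
    (tensSpin_assoc M.isSpin N.isSpin P.isSpin)
  leftUnitor M := mkIso (relLamIso M.toMod) (tensSpin_lam M.isSpin)
  rightUnitor M := mkIso (relRhoIso M.toMod) (tensSpin_rho M.isSpin)

noncomputable instance : MonoidalCategory (LSpin k A) where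
  tensorHom_def f g := hom_ext (MonoidalCategory.tensorHom_def f.hom g.hom)
  id_tensorHom_id M N := hom_ext (id_tensorHom_id M.toMod N.toMod)
  tensorHom_comp_tensorHom f₁ f₂ g₁ g₂ :=
    hom_ext (tensorHom_comp_tensorHom f₁.hom f₂.hom g₁.hom g₂.hom)
  whiskerLeft_id M N := hom_ext (MonoidalCategory.whiskerLeft_id M.toMod N.toMod)
  id_whiskerRight M N := hom_ext (id_whiskerRight M.toMod N.toMod)
  associator_naturality f g h := hom_ext (associator_naturality f.hom g.hom h.hom)
  leftUnitor_naturality f := hom_ext (leftUnitor_naturality f.hom)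
  rightUnitor_naturality f := hom_ext (rightUnitor_naturality f.hom)
  pentagon W X Y Z := hom_ext (pentagon W.toMod X.toMod Y.toMod Z.toMod)
  triangle X Y := hom_ext (triangle X.toMod Y.toMod)

variable [Field k] [Linear k C] [MonoidalLinear k C] [IsHaploidNonsymmetric k A]

lemma isGrading (M : LSpin k A) : IsGrading M.toMod (evenProj M.toMod) :=
  isGrading_evenProj k M.isSum

/-- The braiding `π ∘ (t_N ^ (deg M) ⊗ id) ∘ c_{M,N} ∘ ι`, where `deg M` is `0` on even and `1` on
odd direct summands. -/
noncomputable def braid (M N : LSpin k A) : tensor M N ≅ tensor N M :=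
  mkIso (relBraidIso M.isGrading N.isSpin) <|
    relBraid_spin M.isGrading M.isSpin N.isSpin (evenProj_spin M.isSpin)

noncomputable instance : BraidedCategory (LSpin k A) where
  braiding M N := braid M N
  braiding_naturality_right X Y Z f := hom_ext <| Mod.hom_ext _ _ <|
    relBraid_nat_right X.isGrading Y.isSpin Z.isSpin f.hom f.comm.symm
  braiding_naturality_left f Z := hom_ext <| Mod.hom_ext _ _ <|
    relBraid_nat_left (isGrading _) (isGrading _) Z.isSpin f.hom (evenProj_nat f.hom).symm
  hexagon_forward X Y Z := hom_ext <| rel_hexagon_forward X.isGrading Y.isSpin Z.isSpin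
  hexagon_reverse X Y Z := hom_ext <|
    rel_hexagon_reverse X.isGrading Y.isGrading (tensor X Y).isGrading Z.isSpin
      (evenProj_relMod k X.isSum Y.isSum)

/-- The twist `t_M ^ (1 + deg M) ∘ θ_M`: it is `t_M ∘ θ_M` on even and `θ_M` on odd direct
summands. -/
noncomputable instance : HasTwist (LSpin k A) where
  twist M := ⟨mkHom ((evenProj M.toMod ≫ M.t + (𝟙 _ - evenProj M.toMod)) ≫ twist M.toMod.X)
    (spinTwist_hom M.isGrading M.isSpin (evenProj_spin M.isSpin)), by
      have h := evenProj_spin M.isSpin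
      have h2 : M.t ≫ (evenProj M.toMod ≫ M.t + (𝟙 _ - evenProj M.toMod)) =
          (evenProj M.toMod ≫ M.t + (𝟙 _ - evenProj M.toMod)) ≫ M.t := by
        rw [Preadditive.comp_add, Preadditive.add_comp, Preadditive.comp_sub,
          Preadditive.sub_comp, ← h, ← Category.assoc, ← h]
        simp
      rw [mkHom_hom, reassoc_of% h2, twist_nat, Category.assoc]⟩

end LSpin

end LSpin

section LocMod
open HasTwist
variable {C : Type u} [Category.{v} C] [MonoidalCategory C] [BraidedCategory C]

/-- The property of being a local module. -/
def localModules (B : C) [MonObj B] : ObjectProperty (Modl B) := fun M => IsLocal M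

/-- The category `C_B^loc` of local modules, a full subcategory of the category of modules. -/
abbrev LocMod (B : C) [MonObj B] := (localModules B).FullSubcategory

variable {B : C} [MonObj B] [ComonObj B] [IsFrobenius B] [IsDeltaSeparable B] [IsCommMonObj B]
  [IsIdempotentComplete C]

instance : (localModules B).IsMonoidal where
  prop_unit := isLocal_regular
  prop_tensor _ _ h₁ h₂ := IsLocal.relMod h₁ h₂

variable [HasTwist C] [IsRibbon C] [Preadditive C] [MonoidalPreadditive C]

lemma sgn_one (M N : Modl B) : sgn M N (𝟙 _) (𝟙 _) = 𝟙 _ := by simp [sgn]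

/-- For local modules the braiding is `π ∘ c ∘ ι`. -/
lemma relBraid_one (M N : Modl B) :
    relBraid M N (𝟙 _) (𝟙 _) = relι M N ≫ (β_ M.X N.X).hom ≫ relπ N M := by
  rw [relBraid, sgn_one, Category.id_comp]

lemma IsLocal.isGrading {M : Modl B} (h : IsLocal M) : IsGrading M (𝟙 _) := by
  have h' : monodromy B M.X ≫ act M = act M := h
  constructor <;> simp [h']

lemma isSpinMap_one [IsSymmetricFrobenius B] (M : Modl B) : IsSpinMap M (𝟙 _) := by
  constructor <;> simp [IsSymmetricFrobenius.nak_eq_id]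

lemma tensSpin_one (M N : Modl B) : 𝟙 _ = tensSpin (𝟙 M.X) (𝟙 N.X) := by simp [tensSpin]

variable [IsSymmetricFrobenius B]

/-- `C_B^loc` is braided by `π ∘ c ∘ ι`. -/
noncomputable instance : BraidedCategory (LocMod B) where
  braiding M N := (localModules B).isoMk
    (relBraidIso (IsLocal.isGrading M.property) (isSpinMap_one N.obj))
  braiding_naturality_right X Y Z f := by
    ext
    exact relBraid_nat_right (IsLocal.isGrading X.property) (isSpinMap_one _) (isSpinMap_one _)
      f.hom (by simp)
  braiding_naturality_left f Z := by
    ext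
    exact relBraid_nat_left (IsLocal.isGrading (ObjectProperty.FullSubcategory.property _))
      (IsLocal.isGrading (ObjectProperty.FullSubcategory.property _)) (isSpinMap_one _) f.hom
      (by simp)
  hexagon_forward X Y Z := ObjectProperty.hom_ext _ <|
    rel_hexagon_forward_of_eq (IsLocal.isGrading X.property) (isSpinMap_one _) (isSpinMap_one _)
      (isSpinMap_one _) (tensSpin_one _ _)
  hexagon_reverse X Y Z := ObjectProperty.hom_ext _ <|
    rel_hexagon_reverse (IsLocal.isGrading X.property) (IsLocal.isGrading Y.property)
      (IsLocal.isGrading (IsLocal.relMod X.property Y.property)) (isSpinMap_one _) (by simp)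

/-- The twist of a local module is the twist of the underlying object. -/
noncomputable instance : HasTwist (LocMod B) where
  twist M := ObjectProperty.homMk <| mkHom (twist M.obj.X) <| by
    have h : monodromy B M.obj.X ≫ act M.obj = act M.obj := M.property
    rw [twist_nat, IsRibbon.twist_tensor, ← nak_eq_twist, IsSymmetricFrobenius.nak_eq_id,
      Category.assoc, h, id_tensorHom]

end LocMod

section SymmPart
open HasTwist
variable (k : Type w) [Field k] [NeZero (2 : k)] {C : Type u} [Category.{v} C]
  [MonoidalCategory C] [BraidedCategory C] [HasTwist C] [IsRibbon C] [Preadditive C] [Linear k C]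
  [IsIdempotentComplete C] (A : C) [MonObj A] [ComonObj A] [IsFrobenius A] [IsCommMonObj A]

/-- The idempotent `(id + θ_A) / 2`. -/
def symmIdem : A ⟶ A := (2 : k)⁻¹ • (𝟙 A + twist A)

lemma twist_symmIdem : twist A ≫ symmIdem k A = symmIdem k A := by
  rw [symmIdem, Linear.comp_smul, Preadditive.comp_add, twist_twist, Category.comp_id, add_comm]

lemma symmIdem_twist : symmIdem k A ≫ twist A = symmIdem k A := by
  rw [symmIdem, Linear.smul_comp, Preadditive.add_comp, twist_twist, Category.id_comp, add_comm]

lemma symmIdem_of_left {A} {Z : C} (f : Z ⟶ A) (h : f ≫ twist A = f) : f ≫ symmIdem k A = f := by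
  have h2 : (2 : k) ≠ 0 := NeZero.ne _
  rw [symmIdem, Linear.comp_smul, Preadditive.comp_add, h, Category.comp_id, ← two_smul k f,
    smul_smul, inv_mul_cancel₀ h2, one_smul]

lemma symmIdem_of_right {A} {Z : C} (f : A ⟶ Z) (h : twist A ≫ f = f) : symmIdem k A ≫ f = f := by
  have h2 : (2 : k) ≠ 0 := NeZero.ne _
  rw [symmIdem, Linear.smul_comp, Preadditive.add_comp, h, Category.id_comp, ← two_smul k f,
    smul_smul, inv_mul_cancel₀ h2, one_smul]

lemma symmIdem_idem : symmIdem k A ≫ symmIdem k A = symmIdem k A :=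
  symmIdem_of_left k _ (symmIdem_twist k A)

lemma exists_symm_split : ∃ (Y : C) (i : Y ⟶ A) (e : A ⟶ Y),
    i ≫ e = 𝟙 Y ∧ e ≫ i = symmIdem k A :=
  IsIdempotentComplete.idempotents_split _ _ (symmIdem_idem k A)

/-- The object `B`, the image of `(id + θ_A) / 2`. -/
noncomputable def symmPart : C := (exists_symm_split k A).choose

/-- The inclusion `B ⟶ A`. -/
noncomputable def symmι : symmPart k A ⟶ A := (exists_symm_split k A).choose_spec.choose

/-- The projection `A ⟶ B`. -/
noncomputable def symmπ : A ⟶ symmPart k A :=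
  (exists_symm_split k A).choose_spec.choose_spec.choose

lemma symmι_π : symmι k A ≫ symmπ k A = 𝟙 _ :=
  (exists_symm_split k A).choose_spec.choose_spec.choose_spec.1

lemma symmπ_ι : symmπ k A ≫ symmι k A = symmIdem k A :=
  (exists_symm_split k A).choose_spec.choose_spec.choose_spec.2

lemma symmι_twist : symmι k A ≫ twist A = symmι k A := by
  rw [← Category.id_comp (symmι k A), ← symmι_π, Category.assoc, Category.assoc,
    reassoc_of% (symmπ_ι k A), symmIdem_twist, ← symmπ_ι, Category.assoc]

lemma twist_symmπ : twist A ≫ symmπ k A = symmπ k A := by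
  rw [← Category.comp_id (symmπ k A), ← symmι_π, reassoc_of% (symmπ_ι k A), ← Category.assoc,
    twist_symmIdem]

lemma symmIdem_π : symmIdem k A ≫ symmπ k A = symmπ k A := symmIdem_of_right k _ (twist_symmπ k A)

lemma ι_mul_idem : (symmι k A ⊗ₘ symmι k A) ≫ μ[A] ≫ symmIdem k A =
    (symmι k A ⊗ₘ symmι k A) ≫ μ[A] := by
  rw [← Category.assoc]
  refine symmIdem_of_left k _ ?_
  rw [Category.assoc, ← twist_mul, tensorHom_comp_tensorHom_assoc, symmι_twist]

lemma comul_twist : Δ[A] ≫ (twist A ⊗ₘ twist A) = twist A ≫ Δ[A] := by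
  rw [← copair_left]
  have h1 : μ[A] ▷ A ≫ (twist A ⊗ₘ twist A) = ((twist A ⊗ₘ twist A) ⊗ₘ twist A) ≫ μ[A] ▷ A := by
    rw [← tensorHom_id, tensorHom_comp_tensorHom, tensorHom_comp_tensorHom, twist_mul]; simp
  have h2 : A ◁ copair A ≫ (twist A ⊗ₘ (twist A ⊗ₘ twist A)) = twist A ▷ _ ≫ A ◁ copair A := by
    rw [← id_tensorHom, tensorHom_comp_tensorHom, copair_twist_twist, ← tensorHom_id,
      tensorHom_comp_tensorHom]; simp
  simp only [Category.assoc]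
  rw [h1, ← associator_inv_naturality_assoc, reassoc_of% h2]
  simp

lemma one_idem : η[A] ≫ symmIdem k A = η[A] := symmIdem_of_left k _ (one_twist A)

lemma idem_counit : symmIdem k A ≫ ε[A] = ε[A] :=
  symmIdem_of_right k _ (by rw [← twist_nat, twist_unit, Category.comp_id])

variable [MonoidalPreadditive C]  [MonoidalLinear k C]

lemma ι_comul_idem : symmι k A ≫ Δ[A] ≫ symmIdem k A ▷ A =
    symmι k A ≫ Δ[A] ≫ A ◁ symmIdem k A := by
  have h : symmι k A ≫ Δ[A] = symmι k A ≫ Δ[A] ≫ (twist A ⊗ₘ twist A) := by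
    rw [comul_twist, reassoc_of% symmι_twist]
  have h2 : symmι k A ≫ Δ[A] ≫ twist A ▷ A = symmι k A ≫ Δ[A] ≫ A ◁ twist A := by
    rw [reassoc_of% h, MonoidalCategory.tensorHom_def', Category.assoc, ← comp_whiskerRight,
      twist_twist]
    simp
  simp only [symmIdem, MonoidalLinear.smul_whiskerRight, MonoidalLinear.whiskerLeft_smul,
    MonoidalPreadditive.add_whiskerRight, MonoidalPreadditive.whiskerLeft_add,
    Linear.comp_smul, Preadditive.comp_add, h2]
  simp

lemma ι_comul_left : symmι k A ≫ Δ[A] ≫ (symmIdem k A ⊗ₘ symmπ k A) =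
    symmι k A ≫ Δ[A] ≫ A ◁ symmπ k A := by
  rw [MonoidalCategory.tensorHom_def, reassoc_of% (ι_comul_idem k A),
    ← MonoidalCategory.whiskerLeft_comp, symmIdem_π]

lemma ι_comul_right : symmι k A ≫ Δ[A] ≫ (symmπ k A ⊗ₘ symmIdem k A) =
    symmι k A ≫ Δ[A] ≫ symmπ k A ▷ A := by
  rw [MonoidalCategory.tensorHom_def', ← reassoc_of% (ι_comul_idem k A),
    ← comp_whiskerRight, symmIdem_π]

/-- The product `π ∘ μ ∘ (ι ⊗ ι)` and the unit `π ∘ η` of `B`. -/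
noncomputable instance : MonObj (symmPart k A) where
  one := η[A] ≫ symmπ k A
  mul := (symmι k A ⊗ₘ symmι k A) ≫ μ[A] ≫ symmπ k A
  one_mul := by
    rw [← tensorHom_id, tensorHom_comp_tensorHom_assoc, Category.assoc, symmπ_ι,
      one_idem, MonoidalCategory.tensorHom_def', Category.id_comp, Category.assoc,
      MonObj.one_mul_assoc, leftUnitor_naturality_assoc, symmι_π, Category.comp_id]
  mul_one := by
    rw [← id_tensorHom, tensorHom_comp_tensorHom_assoc, Category.assoc, symmπ_ι,
      one_idem, MonoidalCategory.tensorHom_def, Category.id_comp, Category.assoc,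
      MonObj.mul_one_assoc, rightUnitor_naturality_assoc, symmι_π, Category.comp_id]
  mul_assoc := by
    rw [← tensorHom_id, ← id_tensorHom, tensorHom_comp_tensorHom_assoc,
      tensorHom_comp_tensorHom_assoc, Category.assoc, Category.assoc, symmπ_ι, ι_mul_idem,
      Category.id_comp, ← Category.comp_id (symmι k A), ← tensorHom_comp_tensorHom_assoc,
      ← tensorHom_comp_tensorHom_assoc, tensorHom_id, id_tensorHom, Category.comp_id,
      MonObj.mul_assoc_assoc, associator_naturality_assoc]

/-- The coproduct `2 (π ⊗ π) ∘ Δ ∘ ι` and the counit `(ε ∘ ι) / 2` of `B`. -/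
noncomputable instance : ComonObj (symmPart k A) where
  counit := (2 : k)⁻¹ • (symmι k A ≫ ε[A])
  comul := (2 : k) • (symmι k A ≫ Δ[A] ≫ (symmπ k A ⊗ₘ symmπ k A))
  counit_comul := by
    have h2 : (2 : k) ≠ 0 := NeZero.ne _
    rw [MonoidalLinear.smul_whiskerRight, Linear.smul_comp, Linear.comp_smul, smul_smul,
      mul_inv_cancel₀ h2, one_smul, ← tensorHom_id, Category.assoc, Category.assoc,
      tensorHom_comp_tensorHom, reassoc_of% (symmπ_ι k A), idem_counit, Category.comp_id,
      MonoidalCategory.tensorHom_def, ComonObj.counit_comul_assoc,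
      ← leftUnitor_inv_naturality, reassoc_of% symmι_π]
  comul_counit := by
    have h2 : (2 : k) ≠ 0 := NeZero.ne _
    rw [MonoidalLinear.whiskerLeft_smul, Linear.smul_comp, Linear.comp_smul, smul_smul,
      mul_inv_cancel₀ h2, one_smul, ← id_tensorHom, Category.assoc, Category.assoc,
      tensorHom_comp_tensorHom, reassoc_of% (symmπ_ι k A), idem_counit, Category.comp_id,
      MonoidalCategory.tensorHom_def', ComonObj.comul_counit_assoc,
      ← rightUnitor_inv_naturality, reassoc_of% symmι_π]
  comul_assoc := by
    have h1 : symmι k A ≫ Δ[A] ≫ (symmπ k A ⊗ₘ (symmIdem k A ≫ Δ[A] ≫ (symmπ k A ⊗ₘ symmπ k A))) =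
        symmι k A ≫ Δ[A] ≫ A ◁ Δ[A] ≫ (symmπ k A ⊗ₘ (symmπ k A ⊗ₘ symmπ k A)) := by
      have := congr($(ι_comul_right k A) ≫ (𝟙 _ ⊗ₘ (Δ[A] ≫ (symmπ k A ⊗ₘ symmπ k A))))
      simp only [Category.assoc, tensorHom_comp_tensorHom, Category.comp_id] at this
      rw [this, ← id_tensorHom, ← tensorHom_id, tensorHom_comp_tensorHom,
        tensorHom_comp_tensorHom]
      simp
    have h2 : symmι k A ≫ Δ[A] ≫ ((symmIdem k A ≫ Δ[A] ≫ (symmπ k A ⊗ₘ symmπ k A)) ⊗ₘ symmπ k A) =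
        symmι k A ≫ Δ[A] ≫ Δ[A] ▷ A ≫ ((symmπ k A ⊗ₘ symmπ k A) ⊗ₘ symmπ k A) := by
      have := congr($(ι_comul_left k A) ≫ ((Δ[A] ≫ (symmπ k A ⊗ₘ symmπ k A)) ⊗ₘ 𝟙 _))
      simp only [Category.assoc, tensorHom_comp_tensorHom, Category.comp_id] at this
      rw [this, ← id_tensorHom, ← tensorHom_id, tensorHom_comp_tensorHom,
        tensorHom_comp_tensorHom]
      simp
    simp only [MonoidalLinear.whiskerLeft_smul, MonoidalLinear.smul_whiskerRight,
      Linear.smul_comp, Linear.comp_smul, Category.assoc]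
    rw [← id_tensorHom, ← tensorHom_id, tensorHom_comp_tensorHom, tensorHom_comp_tensorHom_assoc,
      reassoc_of% (symmπ_ι k A), Category.comp_id, h1, reassoc_of% h2,
      associator_naturality, ComonObj.comul_assoc_assoc]

lemma symm_one : η[symmPart k A] = η[A] ≫ symmπ k A := rfl
lemma symm_mul : μ[symmPart k A] = (symmι k A ⊗ₘ symmι k A) ≫ μ[A] ≫ symmπ k A := rfl
lemma symm_comul : Δ[symmPart k A] =
    (2 : k) • (symmι k A ≫ Δ[A] ≫ (symmπ k A ⊗ₘ symmπ k A)) := rfl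

instance : IsCommMonObj (symmPart k A) where
  mul_comm := by
    rw [symm_mul, ← BraidedCategory.braiding_naturality_assoc, IsCommMonObj.mul_comm_assoc]

instance : IsFrobenius (symmPart k A) where
  frob_left := by
    have h1 : symmι k A ≫ Δ[A] ≫ (symmIdem k A ⊗ₘ symmπ k A) =
        symmι k A ≫ Δ[A] ≫ (𝟙 A ⊗ₘ symmπ k A) := by rw [ι_comul_left, id_tensorHom]
    have h5 : (symmπ k A ⊗ₘ symmπ k A) ≫ symmι k A ▷ _ = (symmIdem k A ⊗ₘ symmπ k A) := by
      rw [← tensorHom_id, tensorHom_comp_tensorHom, symmπ_ι, Category.comp_id]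
    have h2 : (𝟙 (symmPart k A) ⊗ₘ (symmι k A ≫ Δ[A] ≫ (symmπ k A ⊗ₘ symmπ k A))) ≫
        (α_ _ _ _).inv ≫ (((symmι k A ⊗ₘ symmι k A) ≫ μ[A] ≫ symmπ k A) ⊗ₘ 𝟙 (symmPart k A)) =
        (symmι k A ⊗ₘ (symmι k A ≫ Δ[A] ≫ (symmIdem k A ⊗ₘ symmπ k A))) ≫
        (α_ _ _ _).inv ≫ ((μ[A] ≫ symmπ k A) ⊗ₘ 𝟙 (symmPart k A)) := by
      rw [← Category.comp_id (𝟙 (symmPart k A)), ← tensorHom_comp_tensorHom (_ ⊗ₘ _),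
        ← associator_inv_naturality_assoc, tensorHom_comp_tensorHom_assoc]
      simp [h5]
    have h3 : (𝟙 A ⊗ₘ (𝟙 A ⊗ₘ symmπ k A)) ≫ (α_ _ _ _).inv ≫
        ((μ[A] ≫ symmπ k A) ⊗ₘ 𝟙 (symmPart k A)) =
        (α_ _ _ _).inv ≫ μ[A] ▷ A ≫ (symmπ k A ⊗ₘ symmπ k A) := by
      rw [associator_inv_naturality_assoc, tensorHom_comp_tensorHom, ← tensorHom_id,
        tensorHom_comp_tensorHom]
      simp
    have h4 : (symmι k A ⊗ₘ (symmι k A ≫ Δ[A] ≫ (𝟙 A ⊗ₘ symmπ k A))) =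
        (symmι k A ⊗ₘ symmι k A) ≫ A ◁ Δ[A] ≫ (𝟙 A ⊗ₘ (𝟙 A ⊗ₘ symmπ k A)) := by
      rw [← id_tensorHom, tensorHom_comp_tensorHom, tensorHom_comp_tensorHom]
      simp
    rw [symm_comul, symm_mul, MonoidalLinear.whiskerLeft_smul, Linear.smul_comp,
      Linear.comp_smul, ← id_tensorHom, ← tensorHom_id, h2, h1, h4]
    simp only [Category.assoc]
    rw [h3, reassoc_of% (IsFrobenius.frob_left A), reassoc_of% (symmπ_ι k A),
      reassoc_of% ι_mul_idem]
  frob_right := by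
    have h1 : symmι k A ≫ Δ[A] ≫ (symmπ k A ⊗ₘ symmIdem k A) =
        symmι k A ≫ Δ[A] ≫ (symmπ k A ⊗ₘ 𝟙 A) := by rw [ι_comul_right, tensorHom_id]
    have h5 : (symmπ k A ⊗ₘ symmπ k A) ≫ _ ◁ symmι k A = (symmπ k A ⊗ₘ symmIdem k A) := by
      rw [← id_tensorHom, tensorHom_comp_tensorHom, symmπ_ι, Category.comp_id]
    have h2 : ((symmι k A ≫ Δ[A] ≫ (symmπ k A ⊗ₘ symmπ k A)) ⊗ₘ 𝟙 (symmPart k A)) ≫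
        (α_ _ _ _).hom ≫ (𝟙 (symmPart k A) ⊗ₘ ((symmι k A ⊗ₘ symmι k A) ≫ μ[A] ≫ symmπ k A)) =
        ((symmι k A ≫ Δ[A] ≫ (symmπ k A ⊗ₘ symmIdem k A)) ⊗ₘ symmι k A) ≫
        (α_ _ _ _).hom ≫ (𝟙 (symmPart k A) ⊗ₘ (μ[A] ≫ symmπ k A)) := by
      rw [← Category.comp_id (𝟙 (symmPart k A)), ← tensorHom_comp_tensorHom _ (_ ⊗ₘ _),
        ← associator_naturality_assoc, tensorHom_comp_tensorHom_assoc]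
      simp [h5]
    have h3 : ((symmπ k A ⊗ₘ 𝟙 A) ⊗ₘ 𝟙 A) ≫ (α_ _ _ _).hom ≫
        (𝟙 (symmPart k A) ⊗ₘ (μ[A] ≫ symmπ k A)) =
        (α_ _ _ _).hom ≫ A ◁ μ[A] ≫ (symmπ k A ⊗ₘ symmπ k A) := by
      rw [associator_naturality_assoc, tensorHom_comp_tensorHom, ← id_tensorHom,
        tensorHom_comp_tensorHom]
      simp
    have h4 : ((symmι k A ≫ Δ[A] ≫ (symmπ k A ⊗ₘ 𝟙 A)) ⊗ₘ symmι k A) =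
        (symmι k A ⊗ₘ symmι k A) ≫ Δ[A] ▷ A ≫ ((symmπ k A ⊗ₘ 𝟙 A) ⊗ₘ 𝟙 A) := by
      rw [← tensorHom_id, tensorHom_comp_tensorHom, tensorHom_comp_tensorHom]
      simp
    rw [symm_comul, symm_mul, MonoidalLinear.smul_whiskerRight, Linear.smul_comp,
      Linear.comp_smul, ← id_tensorHom, ← tensorHom_id, h2, h1, h4]
    simp only [Category.assoc]
    rw [h3, reassoc_of% (IsFrobenius.frob_right A), reassoc_of% (symmπ_ι k A),
      reassoc_of% ι_mul_idem]

instance : IsSymmetricFrobenius (symmPart k A) where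
  nak_eq_id := by
    rw [nak_eq_twist, ← Category.id_comp (twist _), ← symmι_π, Category.assoc, twist_nat,
      reassoc_of% (symmι_twist k A)]

instance [IsHaploidNonsymmetric k A] [IsDeltaSeparable A] : IsDeltaSeparable (symmPart k A) where
  comul_mul := by
    have h2 : (2 : k) ≠ 0 := NeZero.ne _
    have h0 := comul_nak_mul k A
    rw [nak_eq_twist] at h0
    have h1 : symmι k A ≫ Δ[A] ≫ (symmIdem k A ⊗ₘ symmIdem k A) =
        symmι k A ≫ Δ[A] ≫ symmIdem k A ▷ A := by
      rw [MonoidalCategory.tensorHom_def', ← reassoc_of% (ι_comul_idem k A),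
        ← comp_whiskerRight, symmIdem_idem]
    have h3 : Δ[A] ≫ symmIdem k A ▷ A ≫ μ[A] = (2 : k)⁻¹ • 𝟙 A := by
      rw [symmIdem, MonoidalLinear.smul_whiskerRight, MonoidalPreadditive.add_whiskerRight,
        Linear.smul_comp, Preadditive.add_comp, Linear.comp_smul, Preadditive.comp_add, h0]
      simp [IsDeltaSeparable.comul_mul]
    rw [symm_comul, symm_mul, Linear.smul_comp, Category.assoc, Category.assoc,
      tensorHom_comp_tensorHom_assoc, symmπ_ι, reassoc_of% h1, reassoc_of% h3,
      Linear.smul_comp, Category.id_comp, Linear.comp_smul, smul_smul, mul_inv_cancel₀ h2,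
      one_smul, symmι_π]

end SymmPart

section FreeMod
open HasTwist
variable {C : Type u} [Category.{v} C] [MonoidalCategory C]

/-- The induced module `(A ⊗ x, μ ⊗ id)`. -/
def freeMod (A : C) [MonObj A] (x : C) : Modl A :=
  mkMod (A ⊗ x) ((α_ A A x).inv ≫ μ[A] ▷ x)
    (by
      rw [associator_inv_naturality_left_assoc, ← comp_whiskerRight, MonObj.one_mul]
      simp)
    (by
      have := congr($(MonObj.mul_assoc A) ▷ x)
      simp only [comp_whiskerRight] at this
      rw [associator_inv_naturality_left_assoc, this]
      monoidal)

variable (A : C) [MonObj A]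

/-- The morphism of induced modules `id ⊗ g`. -/
def freeMap {x y : C} (g : x ⟶ y) : freeMod A x ⟶ freeMod A y :=
  mkHom (M := freeMod A x) (N := freeMod A y) (A ◁ g) <| by
    change ((α_ A A x).inv ≫ μ[A] ▷ x) ≫ A ◁ g = A ◁ (A ◁ g) ≫ (α_ A A y).inv ≫ μ[A] ▷ y
    rw [Category.assoc, ← whisker_exchange]
    simp

variable [BraidedCategory C] [HasTwist C] [IsRibbon C] [ComonObj A] [IsFrobenius A]
  [IsCommMonObj A]

lemma isSpinMap_freeMod (x : C) : IsSpinMap (freeMod A x) (nak A ▷ x) where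
  invol := by
    change nak A ▷ x ≫ nak A ▷ x = 𝟙 (A ⊗ x)
    rw [← comp_whiskerRight, nak_nak, id_whiskerRight]
  act_t := by
    have hN : (nak A ⊗ₘ nak A) ≫ μ[A] = μ[A] ≫ nak A := by rw [nak_eq_twist, twist_mul]
    change ((α_ A A x).inv ≫ μ[A] ▷ x) ≫ nak A ▷ x =
      (nak A ⊗ₘ (nak A ▷ x)) ≫ (α_ A A x).inv ≫ μ[A] ▷ x
    rw [Category.assoc, ← comp_whiskerRight, ← hN, ← tensorHom_id (nak A),
      associator_inv_naturality_assoc]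
    simp

end FreeMod

section Fermion
open HasTwist
variable {C : Type u} [Category.{v} C] [MonoidalCategory C] [BraidedCategory C]

lemma monodromy_unit_left (y : C) : monodromy (𝟙_ C) y = 𝟙 _ := by
  simp [monodromy]

lemma monodromy_tensor_left (f x : C) (g : x ⟶ x) (h : monodromy f x = f ◁ g) :
    monodromy (f ⊗ f) x = (f ⊗ f) ◁ (g ≫ g) := by
  have h1 : (β_ f x).hom ≫ g ▷ f ≫ (β_ x f).hom = f ◁ (g ≫ g) := by
    rw [BraidedCategory.braiding_naturality_left, ← Category.assoc]
    change monodromy f x ≫ f ◁ g = _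
    rw [h, MonoidalCategory.whiskerLeft_comp]
  have h2 : (β_ f x).hom ▷ f ≫ (β_ x f).hom ▷ f = (f ◁ g) ▷ f := by
    rw [← comp_whiskerRight, ← h, monodromy]
  rw [monodromy, BraidedCategory.braiding_tensor_left_hom,
    BraidedCategory.braiding_tensor_right_hom]
  simp only [Category.assoc, Iso.hom_inv_id_assoc]
  rw [reassoc_of% h2]
  have h3 := congr((α_ f f x).hom ≫ f ◁ $h1 ≫ (α_ f f x).inv)
  rw [tensor_whiskerLeft, ← h3]
  simp only [MonoidalCategory.whiskerLeft_comp, whisker_assoc, Category.assoc,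
    Iso.inv_hom_id_assoc]

/-- A fermion is an object `f` with `θ_f = -id` and `f ⊗ f ≅ 1`. -/
structure IsFermion [HasTwist C] [Preadditive C] (f : C) : Prop where
  twist_eq : twist f = -𝟙 f
  sq : Nonempty (f ⊗ f ≅ 𝟙_ C)

lemma tensorLeft_isEquivalence {f : C} (e : f ⊗ f ≅ 𝟙_ C) : (tensorLeft f).IsEquivalence :=
  let a : 𝟭 C ≅ tensorLeft f ⋙ tensorLeft f := NatIso.ofComponents
    (fun x => (λ_ x).symm ≪≫ whiskerRightIso e.symm x ≪≫ α_ f f x)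
    (fun {x y} g => by
      have := whisker_exchange e.inv g
      change g ≫ (λ_ y).inv ≫ e.inv ▷ y ≫ (α_ f f y).hom =
        ((λ_ x).inv ≫ e.inv ▷ x ≫ (α_ f f x).hom) ≫ f ◁ (f ◁ g)
      rw [leftUnitor_inv_naturality_assoc, reassoc_of% this]
      simp)
  (CategoryTheory.Equivalence.mk (tensorLeft f) (tensorLeft f) a a.symm).isEquivalence_functor

lemma exists_monodromy_eq {f : C} (e : f ⊗ f ≅ 𝟙_ C) (x : C) :
    ∃ g : x ⟶ x, monodromy f x = f ◁ g ∧ g ≫ g = 𝟙 x := by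
  have := tensorLeft_isEquivalence e
  obtain ⟨g, hg⟩ := (tensorLeft f).map_surjective (X := x) (Y := x) (monodromy f x)
  have hg : f ◁ g = monodromy f x := hg
  refine ⟨g, hg.symm, ?_⟩
  have h1 := monodromy_naturality_left e.hom x
  rw [monodromy_unit_left, monodromy_tensor_left f x g hg.symm, whisker_exchange,
    cancel_epi] at h1
  have h2 := leftUnitor_naturality (g ≫ g)
  rw [← h1] at h2
  exact ((cancel_epi (λ_ x).hom).1 (by simpa using h2)).symm

variable [HasTwist C] [IsRibbon C] {A : C} [MonObj A] [ComonObj A] [IsCommMonObj A] [IsFrobenius A]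
  [Preadditive C] [Limits.HasBinaryBiproducts C] {f : C}

lemma inl_nak (e : A ≅ 𝟙_ C ⊞ f) :
    Limits.biprod.inl ≫ e.inv ≫ nak A = Limits.biprod.inl ≫ e.inv := by
  rw [nak_eq_twist, ← Category.assoc, twist_nat, twist_unit, Category.id_comp]

lemma inr_nak (hf : IsFermion f) (e : A ≅ 𝟙_ C ⊞ f) :
    Limits.biprod.inr ≫ e.inv ≫ nak A = -(Limits.biprod.inr ≫ e.inv) := by
  rw [nak_eq_twist, ← Category.assoc, twist_nat, hf.twist_eq, Preadditive.neg_comp,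
    Category.id_comp]

variable (k : Type w) [Field k]

lemma isHaploidNonsymmetric_of_fermion [NeZero (2 : k)] [Linear k C]
    [MonoidalPreadditive C]
    (hk : Function.Bijective (fun a : k => a • 𝟙 (𝟙_ C)))
    (hf : IsFermion f) (e : A ≅ 𝟙_ C ⊞ f) : IsHaploidNonsymmetric k A := by
  have h2 : (2 : k) ≠ 0 := NeZero.ne _
  have h0 : 𝟙 (𝟙_ C) ≠ 0 := by
    intro h
    have : (0 : k) = 1 := hk.1 (by simp [h])
    exact zero_ne_one this
  have hz {Z : C} (h : Z ⟶ f) (hh : h = -h) : h = 0 := by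
    have : (2 : k) • h = 0 := by
      rw [two_smul]; nth_rw 1 [hh]; simp
    exact (smul_eq_zero.1 this).resolve_left h2
  refine { finrank_eq_one := ?_, nak_ne_id := ?_ }
  · refine finrank_eq_one_iff'.2 ⟨Limits.biprod.inl ≫ e.inv, ?_, fun h => ?_⟩
    · intro h
      apply h0
      have := congr($h ≫ e.hom ≫ Limits.biprod.fst)
      simpa using this
    · obtain ⟨a, ha⟩ := hk.2 (h ≫ e.hom ≫ Limits.biprod.fst)
      have h3 : h ≫ e.hom ≫ Limits.biprod.snd = 0 := by
        apply hz
        have := twist_nat (h ≫ e.hom ≫ Limits.biprod.snd)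
        rw [twist_unit, hf.twist_eq, Category.id_comp, Preadditive.comp_neg,
          Category.comp_id] at this
        exact this.symm
      refine ⟨a, ?_⟩
      rw [← cancel_mono e.hom]
      ext
      · simpa using ha
      · simpa using h3.symm
  · intro h
    have h1 := inr_nak hf e
    rw [h, Category.comp_id] at h1
    have h3 : 𝟙 f = 0 := by
      apply hz
      have := congr($h1 ≫ e.hom ≫ Limits.biprod.snd)
      simpa using this
    obtain ⟨s⟩ := hf.sq
    apply h0
    have : 𝟙 (f ⊗ f) = 0 := by
      rw [← MonoidalCategory.whiskerLeft_id, h3, MonoidalPreadditive.whiskerLeft_zero]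
    rw [← s.inv_hom_id, ← Category.id_comp s.hom, this]
    simp

lemma whiskerRight_ext_biprod [MonoidalPreadditive C] (e : A ≅ 𝟙_ C ⊞ f) {y Z : C}
    {g h : A ⊗ y ⟶ Z}
    (h₁ : (Limits.biprod.inl ≫ e.inv) ▷ y ≫ g = (Limits.biprod.inl ≫ e.inv) ▷ y ≫ h)
    (h₂ : (Limits.biprod.inr ≫ e.inv) ▷ y ≫ g = (Limits.biprod.inr ≫ e.inv) ▷ y ≫ h) :
    g = h := by
  have hA : 𝟙 A = (e.hom ≫ Limits.biprod.fst) ≫ (Limits.biprod.inl ≫ e.inv) +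
      (e.hom ≫ Limits.biprod.snd) ≫ (Limits.biprod.inr ≫ e.inv) := by
    have := congr(e.hom ≫ $(Limits.biprod.total (X := 𝟙_ C) (Y := f)) ≫ e.inv)
    rw [Category.id_comp, e.hom_inv_id] at this
    rw [← this]
    simp only [Preadditive.add_comp, Preadditive.comp_add, Category.assoc]
  rw [← Category.id_comp g, ← Category.id_comp h, ← id_whiskerRight, hA]
  simp only [MonoidalPreadditive.add_whiskerRight, comp_whiskerRight _ (_ ≫ _), Preadditive.add_comp,
    Category.assoc, h₁, h₂]

lemma freeMod_monodromy {y : C} {s : A ⟶ A} (h : monodromy A y = s ▷ y) :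
    monodromy A (A ⊗ y) ≫ (α_ A A y).inv ≫ μ[A] ▷ y =
      s ▷ (A ⊗ y) ≫ (α_ A A y).inv ≫ μ[A] ▷ y := by
  have h1 : monodromy A (A ⊗ y) = (α_ _ _ _).inv ≫ (β_ A A).hom ▷ y ≫
      (α_ _ _ _).hom ≫ A ◁ monodromy A y ≫ (α_ _ _ _).inv ≫ (β_ A A).hom ▷ y ≫
      (α_ _ _ _).hom := by
    simp [monodromy]
  have h2 : (β_ A A).hom ▷ y ≫ (α_ _ _ _).hom ≫ A ◁ (s ▷ y) =
      s ▷ A ▷ y ≫ (β_ A A).hom ▷ y ≫ (α_ _ _ _).hom := by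
    rw [← comp_whiskerRight_assoc (s ▷ A), BraidedCategory.braiding_naturality_left]
    simp
  rw [h1, h]
  simp only [Category.assoc]
  rw [reassoc_of% h2]
  simp [← comp_whiskerRight]

lemma isNakayamaLocal_freeMod_of [MonoidalPreadditive C] (hf : IsFermion f) (e : A ≅ 𝟙_ C ⊞ f)
    {y : C} (h : monodromy f y = 𝟙 _ ∨ monodromy f y = -𝟙 _) :
    IsNakayamaLocal (freeMod A y) := by
  rcases h with h | h
  · left
    have h1 : monodromy A y = 𝟙 A ▷ y := by
      refine whiskerRight_ext_biprod e ?_ ?_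
      · rw [monodromy_naturality_left, monodromy_unit_left]; simp
      · rw [monodromy_naturality_left, h]; simp
    have h2 := freeMod_monodromy h1
    rw [id_whiskerRight, Category.id_comp] at h2
    exact h2
  · right
    have h1 : monodromy A y = nak A ▷ y := by
      refine whiskerRight_ext_biprod e ?_ ?_
      · rw [monodromy_naturality_left, monodromy_unit_left, ← comp_whiskerRight, Category.assoc,
          inl_nak]; simp
      · have h3 : (-(Limits.biprod.inr ≫ e.inv)) ▷ y = -((Limits.biprod.inr ≫ e.inv) ▷ y) :=
          (tensorRight y).map_neg
        rw [monodromy_naturality_left, h, ← comp_whiskerRight, Category.assoc,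
          inr_nak hf, h3]; simp
    exact freeMod_monodromy h1

/-- For `A ≅ 1 ⊕ f` with a fermion `f` every induced module is a direct sum of Nakayama-local
modules. -/
lemma isNakayamaLocalSum_freeMod [NeZero (2 : k)] [Linear k C] [MonoidalPreadditive C]
    [IsIdempotentComplete C] (hf : IsFermion f) (e : A ≅ 𝟙_ C ⊞ f) (x : C) :
    IsNakayamaLocalSum (freeMod A x) := by
  have h2 : (2 : k) ≠ 0 := NeZero.ne _
  obtain ⟨g, hg, hgg⟩ := exists_monodromy_eq hf.sq.some x
  let q : k → (x ⟶ x) := fun s => (2 : k)⁻¹ • (𝟙 x + s • g)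
  have hq (s : k) (hs : s * s = 1) : q s ≫ g = s • q s := by
    have h3 : q s ≫ g = (2 : k)⁻¹ • (g + s • 𝟙 x) := by
      simp only [q, Linear.smul_comp, Preadditive.add_comp, hgg, Category.id_comp]
    rw [h3]
    simp only [q]
    rw [smul_comm s, smul_add s, smul_smul, hs, one_smul, add_comm]
  have hq2 (s r : k) (hs : s * s = 1) : q s ≫ q r = ((2 : k)⁻¹ * (1 + r * s)) • q s := by
    have h3 : q s ≫ q r = (2 : k)⁻¹ • (q s + r • (q s ≫ g)) := by
      simp only [q, Linear.comp_smul, Preadditive.comp_add, Category.comp_id]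
    rw [h3, hq s hs, mul_smul, add_smul, one_smul, mul_smul]
  have hs1 : ∀ b : Bool, ((if b then 1 else -1 : k) * if b then 1 else -1) = 1 := by
    intro b; cases b <;> simp
  have hid (b : Bool) : q (if b then 1 else -1) ≫ q (if b then 1 else -1) =
      q (if b then 1 else -1) := by
    rw [hq2 _ _ (hs1 b), hs1 b, show (1 : k) + 1 = 2 by norm_num, inv_mul_cancel₀ h2, one_smul]
  choose y i p hip hpi using fun b => IsIdempotentComplete.idempotents_split x _ (hid b)
  have hig (b : Bool) : i b ≫ g = (if b then 1 else -1 : k) • i b := by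
    have h3 : i b = i b ≫ q (if b then 1 else -1) := by
      rw [← hpi, reassoc_of% hip]
    rw [h3, Category.assoc, hq _ (hs1 b), Linear.comp_smul]
  have hmono (b : Bool) : monodromy f (y b) = 𝟙 _ ∨ monodromy f (y b) = -𝟙 _ := by
    have h3 : monodromy f (y b) = f ◁ ((if b then 1 else -1 : k) • 𝟙 (y b)) := by
      have h4 : f ◁ i b ≫ monodromy f x ≫ f ◁ p b = monodromy f (y b) := by
        rw [reassoc_of% (monodromy_naturality_right f (i b)), ← MonoidalCategory.whiskerLeft_comp,
          hip]
        simp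
      rw [← h4, hg, ← MonoidalCategory.whiskerLeft_comp, ← MonoidalCategory.whiskerLeft_comp,
        reassoc_of% (hig b), Linear.smul_comp, hip]
    cases b
    · right
      rw [h3]
      have h5 : f ◁ (-𝟙 (y false)) = -(f ◁ 𝟙 (y false)) := (tensorLeft f).map_neg
      simpa using h5
    · left
      rw [h3]
      simp
  refine .of_fintype (J := Bool) (fun b => freeMod A (y b)) (fun b => freeMap A (i b))
    (fun b => freeMap A (p b)) (fun b => isNakayamaLocal_freeMod_of hf e (hmono b)) ?_ ?_ ?_
  · intro b
    refine Mod.hom_ext _ _ ?_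
    change A ◁ i b ≫ A ◁ p b = 𝟙 (A ⊗ y b)
    rw [← MonoidalCategory.whiskerLeft_comp, hip, MonoidalCategory.whiskerLeft_id]
  · intro b c hbc
    refine Mod.hom_ext _ _ ?_
    change A ◁ i b ≫ A ◁ p c = 0
    have h3 : i b ≫ p c = 0 := by
      have h4 : i b ≫ p c = i b ≫ (q (if b then 1 else -1) ≫ q (if c then 1 else -1)) ≫ p c := by
        rw [← hpi, ← hpi]
        simp [reassoc_of% hip, hip]
      rw [h4, hq2 _ _ (hs1 b)]
      cases b <;> cases c <;> simp at hbc ⊢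
    rw [← MonoidalCategory.whiskerLeft_comp, h3, MonoidalPreadditive.whiskerLeft_zero]
  · refine Mod.hom_ext _ _ ?_
    rw [sum_hom, Fintype.sum_bool]
    change A ◁ p true ≫ A ◁ i true + A ◁ p false ≫ A ◁ i false = 𝟙 (A ⊗ x)
    rw [← MonoidalCategory.whiskerLeft_comp, ← MonoidalCategory.whiskerLeft_comp, hpi, hpi,
      ← MonoidalPreadditive.whiskerLeft_add, ← MonoidalCategory.whiskerLeft_id]
    congr 1
    simp only [q]
    rw [← smul_add]
    simp only [if_true, one_smul, neg_smul, Bool.false_eq_true, if_false]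
    rw [add_add_add_comm, add_neg_cancel, add_zero, ← two_smul k, smul_smul, inv_mul_cancel₀ h2,
      one_smul]

end Fermion

section Equivalence
open HasTwist

/-- The induction functor `x ↦ (A ⊗ x, μ ⊗ id, N_A ⊗ id)`, `g ↦ id ⊗ g`, for an algebra all of
whose induced modules are direct sums of Nakayama-local modules. -/
noncomputable def inductionFunctor (k : Type w) {C : Type u} [Category.{v} C] [MonoidalCategory C]
    [BraidedCategory C] [HasTwist C] [IsRibbon C] [Preadditive C] [MonoidalPreadditive C]
    (A : C) [MonObj A] [ComonObj A] [IsFrobenius A] [IsCommMonObj A]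
    (h : ∀ x, IsNakayamaLocalSum (freeMod A x)) : C ⥤ LSpin k A where
  obj x := ⟨freeMod A x, h x, nak A ▷ x, isSpinMap_freeMod A x⟩
  map g := ⟨freeMap A g, (whisker_exchange (nak A) g).symm⟩
  map_id x := LSpin.hom_ext (Mod.hom_ext _ _ (MonoidalCategory.whiskerLeft_id A x))
  map_comp g g' := LSpin.hom_ext (Mod.hom_ext _ _ (MonoidalCategory.whiskerLeft_comp A g g'))

/-- A `k`-linear functor is a ribbon equivalence if it is an equivalence of categories, admits a
braided monoidal structure, and preserves the twist. -/
structure IsRibbonEquivalence (k : Type w) [Field k] {C D : Type*} [Category* C]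
    [Category* D] [Preadditive C] [Preadditive D] [Linear k C] [Linear k D]
    [MonoidalCategory C] [MonoidalCategory D] [BraidedCategory C] [BraidedCategory D]
    [HasTwist C] [HasTwist D] (F : C ⥤ D) : Prop where
  isEquivalence : F.IsEquivalence
  map_add {X Y : C} (f g : X ⟶ Y) : F.map (f + g) = F.map f + F.map g
  map_smul {X Y : C} (a : k) (f : X ⟶ Y) : F.map (a • f) = a • F.map f
  braided : Nonempty F.Braided
  map_twist (X : C) : F.map (twist X) = twist (F.obj X)

/-- A Frobenius algebra is special if `ε ∘ η` and `μ ∘ Δ` are non-zero multiples of the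
identity. -/
structure IsSpecial (k : Type w) [Field k] {C : Type u} [Category.{v} C] [MonoidalCategory C]
    [Preadditive C] [Linear k C] (A : C) [MonObj A] [ComonObj A] : Prop where
  one_counit : ∃ a : k, a ≠ 0 ∧ η[A] ≫ ε[A] = a • 𝟙 (𝟙_ C)
  comul_mul : ∃ b : k, b ≠ 0 ∧ Δ[A] ≫ μ[A] = b • 𝟙 A

end Equivalence

end SpinLine

open SpinLine

/-! Everything is read off from one functor, `fixFunctor`, which sends `(M, ρ, t)` to the image of
`(1 + t)/2`. Let `B` be the symmetric part of `A` and `N` the Nakayama automorphism. Since `A` is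
commutative, `N` is the twist of `A`; hence `N` is the identity on `B`, the semilinear involution
`t` is `B`-linear, and the `t`-invariants form a `B`-module. They are local, because the double
braiding with `A` acts trivially on even summands and through `N` on odd ones, and `B` does not see
`N`. On invariants `t` is the identity, so the powers of `t` in the braiding and the twist of
`L^spin_A` disappear and the plain braiding and twist remain.

The rest depends on one vanishing: for haploid `A` with `N ≠ id` the loop `μ ∘ (N ⊗ id) ∘ Δ ∘ η` is
zero (`copair_nak_mul`). It shows that `t ⊗ id` is zero between the inclusion and the projection of
a relative tensor product (`relι_spin_relπ`), which makes the functor monoidal (`fixMu_Nu`,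
`fixNu_Mu`). It splits the action map from `A ⊗ (invariants of M)` to `M` (`fixSec_extend`), which
gives faithfulness and, with `extend_sec`, fullness. For essential surjectivity a local `B`-module
`L` is induced to `A ⊗_B L`, with `t` descending from `N ⊗ id`. Over `B` this module is local; the
vanishing upgrades locality over `B` to a splitting into an even and an odd part over `A`
(`isGrading_of_loop`). The invariants of the induced module are `L` again (`IsInduced.fixIso`).

The category of local `B`-modules is ribbon because duals of local modules are local
(`IsLocal.dualMod`) and a balanced dual pairing in `C` gives a dual pairing of modules
(`modPairing`). `L^spin_A` inherits this along the braided equivalence `fixFunctor`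
(`IsRibbon.of_braidedEquivalence`), which settles the second claim.

If `A ≅ 1 ⊕ f` with a fermion `f`, then `N` is `1` on the unit summand and `-1` on `f`. So the unit
of `B` is an isomorphism (`isIso_one_symm`), and forgetting the action is a ribbon equivalence from
local `B`-modules to `C`. The invariants of the module induced on `x` are `x`. The induction functor
is therefore quasi-inverse to a ribbon equivalence, hence a ribbon equivalence itself
(`IsRibbonEquivalence.of_comp_iso_id`). -/

namespace SpinLine

/-! ### Transport of the ribbon property along braided equivalences. -/

section Transfer
open HasTwist

section Uniqueness
variable {C : Type*} [Category* C] [MonoidalCategory C] [BraidedCategory C] [HasTwist C]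

/-- The comparison isomorphism of two duals is the mate of the identity of `X`, and mates are
characterised by their effect on coevaluations. -/
lemma coevaluation_rightDualIso {X Y Y' : C} (p : ExactPairing X Y) (p' : ExactPairing X Y') :
    p.coevaluation ≫ X ◁ (rightDualIso p p').hom = p'.coevaluation := by
  let : HasRightDual X := ⟨Y⟩
  have h : (rightDualIso p p').hom = @rightAdjointMate C _ _ X X ⟨Y'⟩ ⟨Y⟩ (𝟙 X) := rfl
  rw [h]
  have := @coevaluation_comp_rightAdjointMate C _ _ X X ⟨Y'⟩ ⟨Y⟩ (𝟙 X)
  simpa using this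

/-- If the twist is natural, its compatibility with one dual of `X` implies that with any other. -/
lemma twist_dual_of_twist_dual (hn : ∀ {X Y : C} (f : X ⟶ Y), f ≫ twist Y = twist X ≫ f)
    {X Y Y' : C} (p : ExactPairing X Y) (p' : ExactPairing X Y')
    (h : p.coevaluation ≫ twist X ▷ Y = p.coevaluation ≫ X ◁ twist Y) :
    p'.coevaluation ≫ twist X ▷ Y' = p'.coevaluation ≫ X ◁ twist Y' := by
  rw [← coevaluation_rightDualIso p p', Category.assoc, Category.assoc, whisker_exchange,
    reassoc_of% h, ← MonoidalCategory.whiskerLeft_comp, ← MonoidalCategory.whiskerLeft_comp, hn]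

end Uniqueness

variable {C D : Type*} [Category* C] [Category* D] [MonoidalCategory C] [MonoidalCategory D]
  [BraidedCategory C] [BraidedCategory D] [HasTwist C] [HasTwist D]

open Functor.OplaxMonoidal (δ)

lemma map_monodromy (F : C ⥤ D) [F.Braided] (X Y : C) :
    F.map (monodromy X Y) = δ F X Y ≫ monodromy (F.obj X) (F.obj Y) ≫ Functor.LaxMonoidal.μ F X Y := by
  have h (X Y : C) : F.map (β_ X Y).hom = δ F X Y ≫ (β_ (F.obj X) (F.obj Y)).hom ≫ Functor.LaxMonoidal.μ F Y X := by
    rw [← Functor.LaxBraided.braided]; simp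
  simp [monodromy, h]

/-- Ribbon categories are transported backwards along braided equivalences that preserve the
twist. -/
lemma IsRibbon.of_braidedEquivalence [IsRibbon D] (F : C ⥤ D) [F.IsEquivalence] [F.Braided]
    (hF : ∀ X, F.map (twist X) = twist (F.obj X)) : IsRibbon C := by
  have hn {X Y : C} (f : X ⟶ Y) : f ≫ twist Y = twist X ≫ f := F.map_injective <| by
    rw [F.map_comp, F.map_comp, hF, hF, twist_nat]
  -- By `twist_dual_of_twist_dual` it suffices to find one dual of each object that is compatible
  -- with the twist; a lift of a dual pairing in `D` is such a dual.
  have hd (X : C) : ∃ (Y : C) (p : ExactPairing X Y),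
      p.coevaluation ≫ twist X ▷ Y = p.coevaluation ≫ X ◁ twist Y := by
    obtain ⟨Z, ⟨q⟩⟩ := IsRibbon.exists_dual (F.obj X)
    let Y := F.objPreimage Z
    -- The dual in `D` is replaced by an object in the image of `F`, so that the pairing lifts along
    -- the fully faithful `F`.
    let q' : ExactPairing (F.obj X) (F.obj Y) := exactPairingCongrRight (F.objObjPreimageIso Z)
    refine ⟨Y, ExactPairing.ofFullyFaithful F X Y, F.map_injective ?_⟩
    have h : F.map (ExactPairing.ofFullyFaithful F X Y).coevaluation =
      Functor.OplaxMonoidal.η F ≫ η_ _ _ ≫ Functor.LaxMonoidal.μ F _ _ := F.map_preimage _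
    rw [F.map_comp, F.map_comp, h, Functor.Monoidal.map_whiskerLeft,
      Functor.Monoidal.map_whiskerRight, hF, hF]
    simp [reassoc_of% (IsRibbon.twist_dual (F.obj X) (F.obj Y))]
  refine ⟨hn, fun X => ?_, fun X Y => F.map_injective ?_, fun X => ?_, fun X Y p => ?_⟩
  · have : IsIso (F.map (twist X)) := by rw [hF]; infer_instance
    exact isIso_of_reflects_iso _ F
  -- Naturality of the twist at the tensorator carries the formula for `F X ⊗ F Y` over to `F (X ⊗
  -- Y)`.
  · have h := twist_nat (Functor.LaxMonoidal.μ F X Y)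
    rw [F.map_comp, hF, Functor.Monoidal.map_tensor, hF, hF, map_monodromy,
      ← cancel_epi (Functor.LaxMonoidal.μ F X Y), h, IsRibbon.twist_tensor]
    simp
  · obtain ⟨Y, p, -⟩ := hd X
    exact ⟨Y, ⟨p⟩⟩
  · obtain ⟨Y', p', h⟩ := hd X
    exact twist_dual_of_twist_dual hn p' p h

lemma IsRibbonEquivalence.isRibbon {k : Type w} [Field k] [Preadditive C] [Preadditive D]
    [Linear k C] [Linear k D] [IsRibbon D] {F : C ⥤ D} (h : IsRibbonEquivalence k F) :
    IsRibbon C :=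
  have := h.isEquivalence
  let := h.braided.some
  .of_braidedEquivalence F h.map_twist

end Transfer

end SpinLine

namespace SpinLine

/-! ### Maps from and to the regular module, and the dual of a module. -/

section DualModule
variable {C : Type u} [Category.{v} C] [MonoidalCategory C] [BraidedCategory C] {A : C} [MonObj A]

lemma eq_of_one_comp {W : Modl A} {f : A ⟶ W.X} (h : μ[A] ≫ f = A ◁ f ≫ act W) :
    f = (ρ_ A).inv ≫ A ◁ (η[A] ≫ f) ≫ act W := by
  rw [MonoidalCategory.whiskerLeft_comp, Category.assoc, ← h, MonObj.mul_one_assoc,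
    Iso.inv_hom_id_assoc]

/-- The regular module is generated by its unit: linearity gives `f a = a · f 1`. -/
lemma regular_hom_ext {W : Modl A} {f g : Mod.regular A ⟶ W} (h : η[A] ≫ f.hom = η[A] ≫ g.hom) :
    f = g := by
  ext
  have hf : f.hom = (ρ_ A).inv ≫ A ◁ (η[A] ≫ f.hom) ≫ act W :=
    eq_of_one_comp (A := A) (f := f.hom) (act_hom f)
  have hg : g.hom = (ρ_ A).inv ≫ A ◁ (η[A] ≫ g.hom) ≫ act W :=
    eq_of_one_comp (A := A) (f := g.hom) (act_hom g)
  rw [h] at hf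
  exact hf.trans hg.symm

/-- The morphism of modules out of the regular module with a given value on the unit. -/
def ofRegular {W : Modl A} (u : 𝟙_ C ⟶ W.X) : Mod.regular A ⟶ W :=
  mkHom (M := Mod.regular A) ((ρ_ A).inv ≫ A ◁ u ≫ act W) <| by
    have h : μ[A] ▷ W.X ≫ act W = (α_ _ _ _).hom ≫ A ◁ act W ≫ act W := mul_act W
    change μ[A] ≫ (ρ_ A).inv ≫ A ◁ u ≫ act W = A ◁ ((ρ_ A).inv ≫ A ◁ u ≫ act W) ≫ act W
    rw [rightUnitor_inv_naturality_assoc, ← whisker_exchange_assoc, h]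
    simp

lemma one_ofRegular {W : Modl A} (u : 𝟙_ C ⟶ W.X) : η[A] ≫ (ofRegular u).hom = u := by
  change η[A] ≫ (ρ_ A).inv ≫ A ◁ u ≫ act W = u
  rw [rightUnitor_inv_naturality_assoc, ← whisker_exchange_assoc, one_act]
  simp [← unitors_inv_equal]

section
variable [ComonObj A] [IsFrobenius A]

/-- The underlying morphism of `toRegular`. -/
def toReg {W : Modl A} (κ : W.X ⟶ 𝟙_ C) : W.X ⟶ A :=
  (λ_ _).inv ≫ copair A ▷ W.X ≫ (α_ _ _ _).hom ≫ A ◁ (act W ≫ κ) ≫ (ρ_ A).hom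

/-- Write the copairing as `Σ eᵢ ⊗ eⁱ`, so that the map is `w ↦ Σ eᵢ κ(eⁱ w)`. Linearity is the
Frobenius identity `Σ eᵢ ⊗ eⁱ a = Σ a eᵢ ⊗ eⁱ`, both sides being `Δ a` (`copair_right`,
`copair_left`). -/
lemma act_toReg {W : Modl A} (κ : W.X ⟶ 𝟙_ C) : act W ≫ toReg κ = A ◁ toReg κ ≫ μ[A] := by
  have e1 : act W ≫ (λ_ W.X).inv ≫ copair A ▷ W.X =
      (λ_ _).inv ≫ copair A ▷ _ ≫ (A ⊗ A) ◁ act W := by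
    rw [← whisker_exchange, leftUnitor_inv_naturality_assoc]
  have e2 : A ◁ A ◁ act W ≫ A ◁ (act W ≫ κ) =
      A ◁ (α_ _ _ _).inv ≫ A ◁ μ[A] ▷ W.X ≫ A ◁ (act W ≫ κ) := by
    simp only [← MonoidalCategory.whiskerLeft_comp]
    rw [← Category.assoc (μ[A] ▷ W.X), mul_act]
    simp
  have l : act W ≫ (λ_ W.X).inv ≫ copair A ▷ W.X ≫ (α_ _ _ _).hom ≫ A ◁ (act W ≫ κ) ≫
      (ρ_ A).hom = Δ[A] ▷ W.X ≫ (α_ _ _ _).hom ≫ A ◁ (act W ≫ κ) ≫ (ρ_ A).hom := by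
    rw [reassoc_of% e1, associator_naturality_right_assoc, reassoc_of% e2, ← copair_right]
    monoidal
  have r : A ◁ ((λ_ W.X).inv ≫ copair A ▷ W.X ≫ (α_ _ _ _).hom ≫ A ◁ (act W ≫ κ) ≫
      (ρ_ A).hom) ≫ μ[A] = Δ[A] ▷ W.X ≫ (α_ _ _ _).hom ≫ A ◁ (act W ≫ κ) ≫ (ρ_ A).hom := by
    have e3 : μ[A] ▷ (A ⊗ W.X) ≫ A ◁ (act W ≫ κ) ≫ (ρ_ A).hom =
        (α_ _ _ _).hom ≫ A ◁ (A ◁ (act W ≫ κ) ≫ (ρ_ A).hom) ≫ μ[A] := by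
      rw [← whisker_exchange_assoc, rightUnitor_naturality]
      monoidal
    have e4 := congr((α_ A A A).inv ▷ W.X ≫ (α_ _ _ _).hom ≫ $e3)
    rw [← copair_left]
    simp only [comp_whiskerRight, Category.assoc, associator_naturality_left_assoc, e3]
    monoidal
  exact l.trans r.symm

/-- The morphism of modules into the regular module determined by a functional. -/
def toRegular {W : Modl A} (κ : W.X ⟶ 𝟙_ C) : W ⟶ Mod.regular A :=
  mkHom (N := Mod.regular A) (toReg κ) (act_toReg κ)

/-- The identity `Σ ε(eᵢ) eⁱ = 1`. Together with `act_toReg` it writes every functional on a module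
as `ε` after a linear map to `A`. -/
lemma toReg_counit {W : Modl A} (κ : W.X ⟶ 𝟙_ C) : toReg κ ≫ ε[A] = κ := by
  have h : copair A ≫ A ◁ ε[A] = η[A] ≫ (ρ_ A).inv := by
    rw [copair, Category.assoc, ComonObj.comul_counit]
  have h2 : copair A ≫ ε[A] ▷ A = η[A] ≫ (λ_ A).inv := by
    rw [copair, Category.assoc, ComonObj.counit_comul]
  change ((λ_ _).inv ≫ copair A ▷ W.X ≫ (α_ _ _ _).hom ≫ A ◁ (act W ≫ κ) ≫ (ρ_ A).hom) ≫ ε[A] = κ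
  have h3 := congr((λ_ _).inv ≫ $h2 ▷ W.X ≫ (α_ _ _ _).hom ≫ 𝟙_ C ◁ (act W ≫ κ) ≫ (λ_ _).hom)
  have h4 : A ◁ (act W ≫ κ) ≫ (ρ_ A).hom ≫ ε[A] =
      ε[A] ▷ _ ≫ 𝟙_ C ◁ (act W ≫ κ) ≫ (λ_ _).hom := by
    rw [← whisker_exchange_assoc, ← rightUnitor_naturality, unitors_equal]
  simp only [Category.assoc, h4]
  simp only [comp_whiskerRight, Category.assoc, associator_naturality_left_assoc] at h3
  rw [h3]
  simp [leftUnitor_whiskerRight, reassoc_of% one_act]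

/-- The functional is `ε` after a linear map to `A`, and the double braiding drops out of the
product of the commutative algebra `A`. Thus functionals do not see the double braiding, even when
`W` is not local; this is what makes duals of local modules local. -/
lemma monodromy_act_functional [IsCommMonObj A] {W : Modl A} (κ : W.X ⟶ 𝟙_ C) :
    monodromy A W.X ≫ act W ≫ κ = act W ≫ κ := by
  have h : act W ≫ κ = A ◁ toReg κ ≫ μ[A] ≫ ε[A] := by
    rw [← reassoc_of% (act_toReg κ), toReg_counit]
  have h2 : monodromy A A ≫ μ[A] = μ[A] := isLocal_regular
  rw [h, ← reassoc_of% (monodromy_naturality_right A (toReg κ)), reassoc_of% h2]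

end

/-- The module `Y ⊗ M` with `A` acting on `M`. -/
def slideMod (Y : C) (M : Modl A) : Modl A :=
  mkMod (Y ⊗ M.X) (slide Y (act M))
    (by
      have h : η[A] ▷ Y ≫ (β_ A Y).hom = (β_ (𝟙_ C) Y).hom ≫ Y ◁ η[A] :=
        BraidedCategory.braiding_naturality_left _ _
      have := congr(Y ◁ $(one_act M))
      rw [MonoidalCategory.whiskerLeft_comp] at this
      simp only [slide, associator_inv_naturality_left_assoc]
      rw [← comp_whiskerRight_assoc, h, comp_whiskerRight_assoc,
        associator_naturality_middle_assoc, this]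
      simp)
    (by
      have h : μ[A] ▷ Y ≫ (β_ A Y).hom = (β_ (A ⊗ A) Y).hom ≫ Y ◁ μ[A] :=
        BraidedCategory.braiding_naturality_left _ _
      have := congr(Y ◁ $(mul_act M))
      simp only [MonoidalCategory.whiskerLeft_comp] at this
      simp only [slide, associator_inv_naturality_left_assoc]
      rw [← comp_whiskerRight_assoc, h, comp_whiskerRight_assoc,
        associator_naturality_middle_assoc, this]
      have e : (β_ A Y).hom ▷ (A ⊗ M.X) ≫ (Y ⊗ A) ◁ act M = (A ⊗ Y) ◁ act M ≫
          (β_ A Y).hom ▷ M.X := (whisker_exchange _ _).symm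
      rw [BraidedCategory.braiding_tensor_left_hom]
      simp only [MonoidalCategory.whiskerLeft_comp, comp_whiskerRight, Category.assoc]
      have e2 : A ◁ Y ◁ act M ≫ (α_ A Y M.X).inv ≫ (β_ A Y).hom ▷ M.X =
        (α_ _ _ _).inv ≫ (β_ A Y).hom ▷ (A ⊗ M.X) ≫ (Y ⊗ A) ◁ act M := by
        rw [e]; simp
      rw [reassoc_of% e2]
      monoidal)

lemma eq_mate {X Y Z : C} [ExactPairing X Y] (f : Z ⟶ Y) :
    f = (ρ_ Z).inv ≫ Z ◁ η_ X Y ≫ (α_ _ _ _).inv ≫ (f ▷ X ≫ ε_ X Y) ▷ Y ≫ (λ_ Y).hom := by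
  have h1 := ExactPairing.coevaluation_evaluation X Y
  have h2 : Z ◁ η_ X Y ≫ (α_ _ _ _).inv ≫ f ▷ X ▷ Y =
      f ▷ 𝟙_ C ≫ Y ◁ η_ X Y ≫ (α_ _ _ _).inv := by
    rw [← associator_inv_naturality_left, whisker_exchange_assoc]
  rw [comp_whiskerRight, Category.assoc, reassoc_of% h2, reassoc_of% h1]
  simp

/-- The evaluation is non-degenerate: by `eq_mate` a map into the dual is recovered from its pairing
with `X`. -/
lemma pairing_ext {X Y Z : C} [ExactPairing X Y] {f g : Z ⟶ Y}
    (h : f ▷ X ≫ ε_ X Y = g ▷ X ≫ ε_ X Y) : f = g := by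
  rw [eq_mate (X := X) f, eq_mate (X := X) g, h]

section
variable (M : Modl A) (Y : C) [ExactPairing M.X Y]

/-- The action of `A` on the dual of the object underlying a module. -/
def dualAct : A ⊗ Y ⟶ Y :=
  (tensorRightHomEquiv (A ⊗ Y) M.X Y (𝟙_ C)) ((α_ _ _ _).hom ≫ slide Y (act M) ≫ ε_ M.X Y) ≫
    (λ_ Y).hom

/-- Pairing with `M` undoes the transposition in the definition of `dualAct`. All properties of the
dual action are derived from this formula. -/
lemma dualAct_evaluation :
    dualAct M Y ▷ M.X ≫ ε_ M.X Y = (α_ _ _ _).hom ≫ slide Y (act M) ≫ ε_ M.X Y := by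
  set g := (α_ A Y M.X).hom ≫ slide Y (act M) ≫ ε_ M.X Y with hg
  have h := (tensorRightHomEquiv (A ⊗ Y) M.X Y (𝟙_ C)).symm_apply_apply g
  set f := (tensorRightHomEquiv (A ⊗ Y) M.X Y (𝟙_ C)) g with hf
  have h1 : dualAct M Y = f ≫ (λ_ Y).hom := rfl
  rw [h1, ← h]
  simp [tensorRightHomEquiv, ← unitors_equal]

variable [IsCommMonObj A] [ComonObj A] [IsFrobenius A] [IsDeltaSeparable A]
  [IsIdempotentComplete C]

/-- The dual module. -/
def dualMod : Modl A :=
  mkMod Y (dualAct M Y)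
    (by
      apply pairing_ext (X := M.X)
      have h : η[A] ▷ (Y ⊗ M.X) ≫ slide Y (act M) = (λ_ _).hom := one_act (slideMod Y M)
      rw [comp_whiskerRight, Category.assoc, dualAct_evaluation,
        associator_naturality_left_assoc, reassoc_of% h]
      simp)
    (by
      apply pairing_ext (X := M.X)
      have h : μ[A] ▷ (Y ⊗ M.X) ≫ slide Y (act M) =
        (α_ _ _ _).hom ≫ A ◁ slide Y (act M) ≫ slide Y (act M) := mul_act (slideMod Y M)
      -- Transposition reverses the order in which two factors act; `act_balanced`, which rests on
      -- commutativity of `A`, restores it.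
      have h' := act_balanced (slideMod Y M)
      change (α_ _ _ _).inv ≫ μ[A] ▷ (Y ⊗ M.X) ≫ slide Y (act M) =
        slide A (slide Y (act M)) ≫ slide Y (act M) at h'
      have h2 : (A ◁ dualAct M Y) ▷ M.X ≫ (α_ A Y M.X).hom ≫ slide Y (act M) =
          (α_ _ _ _).hom ≫ slide (A ⊗ Y) (act M) ≫ dualAct M Y ▷ M.X := by
        rw [associator_naturality_middle_assoc, whiskerRight_slide]
      have h3 : slide (A ⊗ Y) (act M) ≫ (α_ A Y M.X).hom =
        A ◁ (α_ A Y M.X).hom ≫ slide A (slide Y (act M)) := (slide_slide _ _ _).symm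
      rw [comp_whiskerRight, Category.assoc, dualAct_evaluation,
        associator_naturality_left_assoc, comp_whiskerRight, Category.assoc, comp_whiskerRight,
        Category.assoc, dualAct_evaluation, reassoc_of% h2, dualAct_evaluation, reassoc_of% h3,
        ← reassoc_of% h']
      monoidal)

/-- A rearrangement of `dualAct_evaluation`. Balancedness is the condition under which the pairing
in `C` descends to the relative tensor product, as `modPairing` requires. -/
lemma dualMod_balanced : actFst (dualMod M Y) M.X ≫ ε_ M.X Y = actSnd Y M ≫ ε_ M.X Y := by
  have := dualAct_evaluation M Y
  change ((α_ _ _ _).inv ≫ dualAct M Y ▷ M.X) ≫ ε_ M.X Y = slide Y (act M) ≫ ε_ M.X Y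
  rw [Category.assoc, this, Iso.inv_hom_id_assoc]

/-- The functional `ε_ M.X Y` on `Y ⊗ M` does not see the double braiding of `A` with `Y ⊗ M`. That
double braiding is composed of the one with `M`, which is trivial on the action by locality, and of
the two crossings with `Y`. What remains is locality of the dual action, tested against `M`. -/
lemma IsLocal.dualMod {M : Modl A} (hM : IsLocal M) (Y : C)
    [ExactPairing M.X Y] : IsLocal (dualMod M Y) := by
  change monodromy A Y ≫ dualAct M Y = dualAct M Y
  apply pairing_ext (X := M.X)
  have h : monodromy A (Y ⊗ M.X) ≫ slide Y (act M) ≫ ε_ M.X Y = slide Y (act M) ≫ ε_ M.X Y :=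
    monodromy_act_functional (W := slideMod Y M) _
  have h1 : monodromy A (Y ⊗ M.X) = (α_ _ _ _).inv ≫ (β_ A Y).hom ▷ M.X ≫
      (α_ _ _ _).hom ≫ Y ◁ monodromy A M.X ≫ (α_ _ _ _).inv ≫ (β_ Y A).hom ▷ M.X ≫
      (α_ _ _ _).hom := by
    simp [monodromy]
  have h2 : Y ◁ monodromy A M.X ≫ Y ◁ act M = Y ◁ act M := by
    rw [← MonoidalCategory.whiskerLeft_comp, show monodromy A M.X ≫ act M = act M from hM]
  rw [h1] at h
  simp only [slide, Category.assoc, Iso.hom_inv_id_assoc] at h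
  rw [cancel_epi, cancel_epi, cancel_epi] at h
  -- Locality of `M` inserts the double braiding with `M` on the right-hand side as well, so that it
  -- can be cancelled on both sides.
  replace h := h.trans ((reassoc_of% h2) (ε_ M.X Y)).symm
  rw [cancel_epi] at h
  rw [comp_whiskerRight, Category.assoc, dualAct_evaluation]
  simp only [monodromy, slide, comp_whiskerRight, Category.assoc, Iso.hom_inv_id_assoc]
  rw [Iso.inv_comp_eq] at h
  rw [h]

end

end DualModule

end SpinLine

namespace SpinLine

/-! ### Dual pairs of modules with respect to the relative tensor product. -/

section ModulePairing
variable {C : Type u} [Category.{v} C] [MonoidalCategory C] [BraidedCategory C] {A : C} [MonObj A]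
  [ComonObj A] [IsFrobenius A] [IsDeltaSeparable A] [IsCommMonObj A] [IsIdempotentComplete C]

/-- The copairing starts at the tensor unit, so by naturality of the braiding it may be created on
the left of `X` instead of on the right. Its free leg then need not cross `X`, while the acting leg
does, which is `slide`. -/
lemma copair_insert {W : C} (X : C) (a : A ⊗ W ⟶ W) (κ : W ⟶ 𝟙_ C) :
    X ◁ ((λ_ _).inv ≫ copair A ▷ W ≫ (α_ _ _ _).hom ≫ A ◁ (a ≫ κ) ≫ (ρ_ A).hom) ≫
      (β_ A X).inv =
    (λ_ _).inv ≫ copair A ▷ (X ⊗ W) ≫ (α_ _ _ _).hom ≫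
      A ◁ (slide X a ≫ X ◁ κ ≫ (ρ_ X).hom) := by
  have h : copair A ▷ X ≫ (β_ (A ⊗ A) X).hom = (β_ (𝟙_ C) X).hom ≫ X ◁ copair A :=
    BraidedCategory.braiding_naturality_left _ _
  rw [BraidedCategory.braiding_tensor_left_hom, braiding_tensorUnit_left] at h
  have h1 : X ◁ copair A = (ρ_ X).hom ≫ (λ_ X).inv ≫ copair A ▷ X ≫ (α_ _ _ _).hom ≫
      A ◁ (β_ A X).hom ≫ (α_ _ _ _).inv ≫ (β_ A X).hom ▷ A ≫ (α_ _ _ _).hom := by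
    rw [h]; simp
  have h2 := congr(X ◁ (λ_ W).inv ≫ (α_ _ _ _).inv ≫ $h1 ▷ W ≫ (α_ _ _ _).hom ≫
    X ◁ ((α_ _ _ _).hom ≫ A ◁ (a ≫ κ) ≫ (ρ_ A).hom) ≫ (β_ A X).inv)
  have h3 : (β_ A X).hom ▷ (A ⊗ W) ≫ (X ⊗ A) ◁ (a ≫ κ) = (A ⊗ X) ◁ (a ≫ κ) ≫ (β_ A X).hom ▷ 𝟙_ C :=
    (whisker_exchange _ _).symm
  have l : X ◁ ((λ_ W).inv ≫ copair A ▷ W ≫ (α_ _ _ _).hom ≫ A ◁ (a ≫ κ) ≫ (ρ_ A).hom) ≫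
      (β_ A X).inv = X ◁ (λ_ W).inv ≫ (α_ _ _ _).inv ≫ (X ◁ copair A) ▷ W ≫ (α_ _ _ _).hom ≫
    X ◁ ((α_ _ _ _).hom ≫ A ◁ (a ≫ κ) ≫ (ρ_ A).hom) ≫ (β_ A X).inv := by
    simp
  rw [l, h2]
  have r : (β_ A X).hom ▷ A ▷ W ≫ (α_ X A A).hom ▷ W ≫ (α_ _ _ _).hom ≫
      X ◁ ((α_ _ _ _).hom ≫ A ◁ (a ≫ κ) ≫ (ρ_ A).hom) ≫ (β_ A X).inv =
      (α_ _ _ _).hom ≫ (A ⊗ X) ◁ (a ≫ κ) ≫ (ρ_ _).hom := by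
    have : (α_ X A A).hom ▷ W ≫ (α_ _ _ _).hom ≫
      X ◁ ((α_ _ _ _).hom ≫ A ◁ (a ≫ κ) ≫ (ρ_ A).hom) =
      (α_ _ _ _).hom ≫ (X ⊗ A) ◁ (a ≫ κ) ≫ (ρ_ _).hom := by monoidal
    rw [reassoc_of% this, associator_naturality_left_assoc, reassoc_of% h3,
      rightUnitor_naturality_assoc]
    simp
  simp only [comp_whiskerRight, Category.assoc]
  rw [r]
  simp only [slide]
  monoidal

/-- The morphism underlying a morphism out of the regular module. -/
def homFrom {W : Modl A} (f : Mod.regular A ⟶ W) : A ⟶ W.X := f.hom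

/-- The morphism underlying a morphism into the regular module. -/
def homTo {W : Modl A} (f : W ⟶ Mod.regular A) : W.X ⟶ A := f.hom

lemma lamπ_relMap {W : Modl A} (f : Mod.regular A ⟶ W) (M : Modl A) :
    lamπ M ≫ (relMap f (𝟙 M)).hom = homFrom f ▷ M.X ≫ relπ W M := by
  have h := π_relMap f (𝟙 M)
  rw [Mod.id_hom', tensorHom_id] at h
  exact h

lemma rhoπ_relMap {W : Modl A} (f : Mod.regular A ⟶ W) (M : Modl A) :
    rhoπ M ≫ (relMap (𝟙 M) f).hom = M.X ◁ homFrom f ≫ relπ M W := by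
  have h := π_relMap (𝟙 M) f
  rw [Mod.id_hom', id_tensorHom] at h
  exact h

lemma π_relMap_lam {W : Modl A} (f : W ⟶ Mod.regular A) (M : Modl A) :
    relπ W M ≫ (relMap f (𝟙 M)).hom = homTo f ▷ M.X ≫ lamπ M := by
  have h := π_relMap f (𝟙 M)
  rw [Mod.id_hom', tensorHom_id] at h
  exact h

lemma π_relMap_rho {W : Modl A} (f : W ⟶ Mod.regular A) (M : Modl A) :
    relπ M W ≫ (relMap (𝟙 M) f).hom = M.X ◁ homTo f ≫ rhoπ M := by
  have h := π_relMap (𝟙 M) f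
  rw [Mod.id_hom', id_tensorHom] at h
  exact h

variable (M D : Modl A) [ExactPairing M.X D.X]

/-- The evaluation `D ⊗_A M ⟶ A`. -/
noncomputable def evMod : relMod D M ⟶ Mod.regular A := toRegular (relι D M ≫ ε_ M.X D.X)

/-- The coevaluation `A ⟶ M ⊗_A D`. -/
noncomputable def coevMod : Mod.regular A ⟶ relMod M D := ofRegular (η_ M.X D.X ≫ relπ M D)

/-- The map `D ⊗ M ⟶ A` inducing the evaluation. -/
def evReg : D.X ⊗ M.X ⟶ A := (λ_ _).inv ≫ copair A ▷ (D.X ⊗ M.X) ≫ (α_ _ _ _).hom ≫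
    A ◁ (actSnd D.X M ≫ ε_ M.X D.X) ≫ (ρ_ A).hom

lemma one_coevMod : η[A] ≫ homFrom (coevMod M D) = η_ M.X D.X ≫ relπ M D := one_ofRegular _

/-- `copair_insert` pulls the copairing out in front. The zigzag relation of `C` removes the dual
pair, and both legs of the copairing act on `M`; by `Δ`-separability they multiply to the unit. -/
lemma evReg_snake : (λ_ _).inv ≫ η_ M.X D.X ▷ M.X ≫ (α_ _ _ _).hom ≫ M.X ◁ evReg M D ≫ ract M =
    𝟙 M.X := by
  have h := copair_insert M.X (slide D.X (act M)) (ε_ M.X D.X)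
  rw [evReg, ract, actSnd_eq, reassoc_of% h]
  set f : 𝟙_ C ⊗ M.X ⟶ M.X ⊗ (D.X ⊗ M.X) := η_ M.X D.X ▷ M.X ≫ (α_ _ _ _).hom with hf
  have h1 : A ◁ f ≫ slide M.X (slide D.X (act M)) = slide (𝟙_ C) (act M) ≫ f := by
    rw [hf, MonoidalCategory.whiskerLeft_comp, Category.assoc, slide_slide,
      reassoc_of% whiskerRight_slide]
  have h2 : f ≫ M.X ◁ ε_ M.X D.X ≫ (ρ_ M.X).hom = (λ_ M.X).hom := by
    have := ExactPairing.evaluation_coevaluation M.X D.X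
    rw [hf, Category.assoc, reassoc_of% this]
    simp
  have h3 : A ◁ f ≫ slide M.X (slide D.X (act M)) ≫ M.X ◁ ε_ M.X D.X ≫ (ρ_ M.X).hom =
      A ◁ (λ_ M.X).hom ≫ act M := by
    rw [reassoc_of% h1, h2, slide]
    simp [braiding_tensorUnit_right]
  have h4 := congr(A ◁ $h3)
  rw [MonoidalCategory.whiskerLeft_comp] at h4
  -- Associativity merges the actions of the two legs into the action of their product, to which
  -- `copair_mul` applies.
  have h5 := mul_act M
  rw [← Iso.inv_comp_eq] at h5
  rw [← Category.assoc (η_ M.X D.X ▷ M.X), ← hf, leftUnitor_inv_naturality_assoc,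
    whisker_exchange_assoc, associator_naturality_right_assoc, reassoc_of% h4,
    MonoidalCategory.whiskerLeft_comp, Category.assoc, ← h5, ← associator_naturality_right_assoc,
    Iso.hom_inv_id_assoc]
  have h6 : copair A ▷ (𝟙_ C ⊗ M.X) ≫ (A ⊗ A) ◁ (λ_ M.X).hom =
      𝟙_ C ◁ (λ_ M.X).hom ≫ copair A ▷ M.X := (whisker_exchange _ _).symm
  rw [reassoc_of% h6, ← comp_whiskerRight_assoc (copair A), copair_mul, one_act]
  simp

variable {M D}

/-- As the pairing is balanced, `relι` after `relπ` is invisible to it; the evaluation over `A` is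
therefore given on the full tensor product by `evReg`. -/
lemma π_evMod (hb : actFst D M.X ≫ ε_ M.X D.X = actSnd D.X M ≫ ε_ M.X D.X) :
    relπ D M ≫ homTo (evMod M D) = evReg M D := by
  have h := π_relDesc _ hb
  have h1 : A ◁ relπ D M ≫ act (relMod D M) ≫ relι D M ≫ ε_ M.X D.X =
      actSnd D.X M ≫ ε_ M.X D.X := by
    rw [reassoc_of% (whisker_π_act D M), ← hb]
    exact congrArg (fun x => actFst D M.X ≫ x) h
  have h3 := congr(A ◁ $h1)
  rw [MonoidalCategory.whiskerLeft_comp] at h3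
  change relπ D M ≫ (λ_ _).inv ≫ copair A ▷ _ ≫ (α_ _ _ _).hom ≫
    A ◁ (act _ ≫ relι D M ≫ ε_ M.X D.X) ≫ (ρ_ A).hom = _
  rw [leftUnitor_inv_naturality_assoc, whisker_exchange_assoc,
    associator_naturality_right_assoc, reassoc_of% h3, evReg]

/-- Balancedness moves the acting leg of the copairing from `M` to `D`. The pairing and the
coevaluation of `C` then cancel, and the two legs, both acting on `D`, multiply to the unit. -/
lemma evReg_snake' (hb : actFst D M.X ≫ ε_ M.X D.X = actSnd D.X M ≫ ε_ M.X D.X) :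
    (ρ_ D.X).inv ≫ D.X ◁ η_ M.X D.X ≫ (α_ _ _ _).inv ≫ evReg M D ▷ D.X ≫
    act D = 𝟙 D.X := by
  set u := (α_ A D.X M.X).inv ≫ act D ▷ M.X ≫ ε_ M.X D.X with hu
  have hu' : actSnd D.X M ≫ ε_ M.X D.X = u := by rw [← hb, actFst, Category.assoc]
  -- `eq_mate` for the action on `D`: contracting `u` against the coevaluation of `C` returns that
  -- action.
  have h1 : (ρ_ (A ⊗ D.X)).inv ≫ (A ⊗ D.X) ◁ η_ M.X D.X ≫ (α_ _ _ _).inv ≫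
      (α_ _ _ _).hom ▷ D.X ≫ u ▷ D.X ≫ (λ_ D.X).hom = act D := by
    have h3 : (α_ _ _ _).hom ▷ D.X ≫ u ▷ D.X = (act D ▷ M.X ≫ ε_ M.X D.X) ▷ D.X := by
      rw [← comp_whiskerRight, hu, Iso.hom_inv_id_assoc]
    rw [reassoc_of% h3]
    exact (eq_mate (act D)).symm
  have h4 : (ρ_ D.X).inv ≫ D.X ◁ η_ M.X D.X ≫ (α_ _ _ _).inv ≫ evReg M D ▷ D.X =
      (λ_ D.X).inv ≫ copair A ▷ D.X ≫ (α_ _ _ _).hom ≫ A ◁ act D := by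
    rw [← h1, evReg, hu']
    have h5 : (λ_ _).inv ≫ copair A ▷ D.X ≫ (α_ A A D.X).hom ≫ A ◁ (ρ_ (A ⊗ D.X)).inv ≫
        A ◁ (A ⊗ D.X) ◁ η_ M.X D.X = (ρ_ D.X).inv ≫ D.X ◁ η_ M.X D.X ≫ (λ_ _).inv ≫
          copair A ▷ (D.X ⊗ (M.X ⊗ D.X)) ≫ (α_ A A _).hom ≫ A ◁ (α_ _ _ _).inv := by
      rw [leftUnitor_inv_naturality_assoc, whisker_exchange_assoc]
      monoidal
    simp only [MonoidalCategory.whiskerLeft_comp, Category.assoc]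
    rw [reassoc_of% h5]
    monoidal
  have h6 := (Iso.inv_comp_eq _).2 (mul_act D)
  rw [reassoc_of% h4, ← h6, Iso.hom_inv_id_assoc, ← comp_whiskerRight_assoc, copair_mul, one_act,
    Iso.inv_hom_id]

/-- Evaluated on the unit of `A`, the coevaluation over `A` is that of `C` followed by the
projection; the projections pass through associator and evaluation, and `evReg_snake'` remains. -/
lemma modPairing_snake (hb : actFst D M.X ≫ ε_ M.X D.X = actSnd D.X M ≫ ε_ M.X D.X) :
    relRhoInv D ≫ (relMap (𝟙 D) (coevMod M D)).hom ≫
    (relAssocIso D M D).inv.hom ≫ (relMap (evMod M D) (𝟙 D)).hom ≫ (relLam D).hom = 𝟙 D.X := by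
  have h1 : D.X ◁ η[A] ≫ D.X ◁ homFrom (coevMod M D) ≫ relπ D (relMod M D) =
      D.X ◁ η_ M.X D.X ≫ π₃ D M D := by
    rw [← MonoidalCategory.whiskerLeft_comp_assoc, one_coevMod, π₃]
    simp
  have h2 : π₃' D M D ≫ (relMap (evMod M D) (𝟙 D)).hom = evReg M D ▷ D.X ≫ lamπ D := by
    rw [π₃', Category.assoc, π_relMap_lam, ← comp_whiskerRight_assoc, π_evMod hb]
  have h3 : π₃ D M D ≫ (relAssocIso D M D).inv.hom = (α_ _ _ _).inv ≫ π₃' D M D :=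
    π₃_assocInv D M D
  rw [relRhoInv, Category.assoc, Category.assoc, reassoc_of% rhoπ_relMap, reassoc_of% h1,
    reassoc_of% h3, reassoc_of% h2, lamπ_relLam, evReg_snake' hb]

lemma modPairing_snake' (hb : actFst D M.X ≫ ε_ M.X D.X = actSnd D.X M ≫ ε_ M.X D.X) :
    relLamInv M ≫ (relMap (coevMod M D) (𝟙 M)).hom ≫
    (relAssocIso M D M).hom.hom ≫ (relMap (𝟙 M) (evMod M D)).hom ≫ (relRho M).hom = 𝟙 M.X := by
  have h1 : η[A] ▷ M.X ≫ homFrom (coevMod M D) ▷ M.X ≫ relπ (relMod M D) M =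
      η_ M.X D.X ▷ M.X ≫ π₃' M D M := by
    rw [← comp_whiskerRight_assoc, one_coevMod, π₃']
    simp
  have h2 : π₃ M D M ≫ (relMap (𝟙 M) (evMod M D)).hom = M.X ◁ evReg M D ≫ rhoπ M := by
    rw [π₃, Category.assoc, π_relMap_rho, ← MonoidalCategory.whiskerLeft_comp_assoc, π_evMod hb]
  rw [relLamInv, Category.assoc, Category.assoc, reassoc_of% lamπ_relMap, reassoc_of% h1,
    reassoc_of% π₃'_assoc, reassoc_of% h2, rhoπ_relRho, evReg_snake]

/-- Modules whose underlying objects are dual by a balanced pairing are dual modules. -/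
@[reducible]
noncomputable def modPairing (hb : actFst D M.X ≫ ε_ M.X D.X = actSnd D.X M ≫ ε_ M.X D.X) :
    ExactPairing M D where
  evaluation' := evMod M D
  coevaluation' := coevMod M D
  coevaluation_evaluation' := by
    rw [← Iso.inv_comp_eq, ← cancel_mono (λ_ _).hom, Category.assoc, Iso.inv_hom_id]
    simp only [Category.assoc]
    exact Mod.hom_ext _ _ (modPairing_snake hb)
  evaluation_coevaluation' := by
    rw [← Iso.inv_comp_eq, ← cancel_mono (ρ_ _).hom, Category.assoc, Iso.inv_hom_id]
    simp only [Category.assoc]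
    exact Mod.hom_ext _ _ (modPairing_snake' hb)

end ModulePairing

/-! ### Local modules over a symmetric algebra form a ribbon category. -/

section LocRibbon
open HasTwist
variable {C : Type u} [Category.{v} C] [MonoidalCategory C] [BraidedCategory C] [HasTwist C]
  [IsRibbon C] [Preadditive C] [MonoidalPreadditive C] [IsIdempotentComplete C] {A : C} [MonObj A]
  [ComonObj A] [IsFrobenius A] [IsDeltaSeparable A] [IsCommMonObj A]

/-- Maps out of the regular module are compared on the unit. There the coevaluation over `A` is the
one of `C` followed by the projection, and the claim is `IsRibbon.twist_dual` in `C`. -/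
lemma coevMod_twist {M D : Modl A} [ExactPairing M.X D.X] {f : M ⟶ M} {g : D ⟶ D}
    (hf : f.hom = twist M.X) (hg : g.hom = twist D.X) :
    coevMod M D ≫ relMap f (𝟙 D) = coevMod M D ≫ relMap (𝟙 M) g := by
  apply regular_hom_ext
  have h : η_ M.X D.X ≫ relπ M D ≫ (relMap f (𝟙 D)).hom =
      η_ M.X D.X ≫ relπ M D ≫ (relMap (𝟙 M) g).hom := by
    rw [π_relMap, π_relMap, hf, hg, Mod.id_hom', Mod.id_hom', tensorHom_id, id_tensorHom,
      reassoc_of% (IsRibbon.twist_dual M.X D.X)]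
  have h1 := one_coevMod M D
  have e (g : relMod M D ⟶ relMod M D) : η[A] ≫ homFrom (coevMod M D) ≫ g.hom =
      η_ M.X D.X ≫ relπ M D ≫ g.hom := by rw [reassoc_of% h1]
  exact (e _).trans (h.trans (e _).symm)

variable [IsSymmetricFrobenius A]

lemma relBraid_local {M N : Modl A} (hM : IsLocal M) :
    relπ M N ≫ relBraid M N (𝟙 _) (𝟙 _) = (β_ M.X N.X).hom ≫ relπ N M := by
  rw [π_relBraid hM.isGrading (isSpinMap_one N), sbraid, sgn_one, Category.comp_id]

/-- Naturality, invertibility and the tensor formula of the twist are inherited from `C`; duals are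
provided by `dualMod`, and `twist_dual_of_twist_dual` reduces compatibility with arbitrary duals to
these. -/
instance : IsRibbon (LocMod A) := by
  have hn {X Y : LocMod A} (f : X ⟶ Y) : f ≫ twist Y = twist X ≫ f :=
    ObjectProperty.hom_ext _ <| Mod.hom_ext _ _ (twist_nat f.hom.hom)
  have hd (X : LocMod A) : ∃ (Y : LocMod A) (p : ExactPairing X Y),
      p.coevaluation ≫ twist X ▷ Y = p.coevaluation ≫ X ◁ twist Y := by
    obtain ⟨Z, ⟨q⟩⟩ := IsRibbon.exists_dual X.obj.X
    let D : LocMod A := ⟨dualMod X.obj Z, IsLocal.dualMod X.property Z⟩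
    let q' : ExactPairing X.obj.X D.obj.X := q
    have hb := dualMod_balanced X.obj Z
    let p : ExactPairing X.obj D.obj := modPairing hb
    let r : ExactPairing X D :=
      { evaluation' := ObjectProperty.homMk p.evaluation
        coevaluation' := ObjectProperty.homMk p.coevaluation
        coevaluation_evaluation' := ObjectProperty.hom_ext _ p.coevaluation_evaluation'
        evaluation_coevaluation' := ObjectProperty.hom_ext _ p.evaluation_coevaluation' }
    exact ⟨D, r, ObjectProperty.hom_ext _ (coevMod_twist rfl rfl)⟩
  refine ⟨hn, fun X => ?_, fun X Y => ?_, fun X => ?_, fun X Y p => ?_⟩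
  · have h : act X.obj ≫ twist X.obj.X = A ◁ twist X.obj.X ≫ act X.obj := act_hom (twist X).hom
    refine ⟨ObjectProperty.homMk (mkHom (inv (twist X.obj.X)) ?_), ?_, ?_⟩
    · rw [← cancel_mono (twist X.obj.X), Category.assoc, Category.assoc, h,
        ← MonoidalCategory.whiskerLeft_comp_assoc]
      simp
    · exact ObjectProperty.hom_ext _ (Mod.hom_ext _ _ (IsIso.hom_inv_id (twist X.obj.X)))
    · exact ObjectProperty.hom_ext _ (Mod.hom_ext _ _ (IsIso.inv_hom_id (twist X.obj.X)))
  · refine ObjectProperty.hom_ext _ <| Mod.hom_ext _ _ ?_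
    -- Compared after `relπ`, where naturality of the twist reduces the claim to the formula for the
    -- plain tensor product.
    have h : twist (relMod X.obj Y.obj).X = (relMap (twist X).hom (twist Y).hom).hom ≫
        relBraid X.obj Y.obj (𝟙 _) (𝟙 _) ≫ relBraid Y.obj X.obj (𝟙 _) (𝟙 _) := by
      rw [← cancel_epi (relπ X.obj Y.obj), twist_nat, IsRibbon.twist_tensor,
        reassoc_of% π_relMap, reassoc_of% (relBraid_local X.property),
        relBraid_local Y.property, monodromy]
      simp only [Category.assoc]
      rfl
    exact h
  · obtain ⟨Y, p, -⟩ := hd X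
    exact ⟨Y, ⟨p⟩⟩
  · obtain ⟨Y', p', h⟩ := hd X
    exact twist_dual_of_twist_dual hn p' p h

end LocRibbon

end SpinLine

namespace SpinLine

/-! ### The double braiding turns the action of a module into a second, commuting action. -/

section MonodromyAction
variable {C : Type u} [Category.{v} C] [MonoidalCategory C] [BraidedCategory C] {A : C} [MonObj A]

/-- The action of a module preceded by the double braiding. -/
def loopAct (M : Modl A) : A ⊗ M.X ⟶ M.X := monodromy A M.X ≫ act M

lemma monodromy_tensor_right (X Y Z : C) : monodromy X (Y ⊗ Z) =
    (α_ _ _ _).inv ≫ (β_ X Y).hom ▷ Z ≫ (α_ _ _ _).hom ≫ Y ◁ monodromy X Z ≫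
      (α_ _ _ _).inv ≫ (β_ Y X).hom ▷ Z ≫ (α_ _ _ _).hom := by
  simp [monodromy]

/-- Two strands that encircle `Z` together may encircle it one after the other, if they cross in
between: the double braiding is natural with respect to `β_ X Y`, and the loop of `Y` around `Z` is
natural with respect to the crossing with `X`. -/
lemma monodromy_tensor_left_braiding (X Y Z : C) : monodromy (X ⊗ Y) Z ≫ (β_ X Y).hom ▷ Z =
    (α_ _ _ _).hom ≫ X ◁ monodromy Y Z ≫ (α_ _ _ _).inv ≫ (β_ X Y).hom ▷ Z ≫
      (α_ _ _ _).hom ≫ Y ◁ monodromy X Z ≫ (α_ _ _ _).inv := by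
  have l : monodromy (Y ⊗ X) Z = (α_ _ _ _).hom ≫ Y ◁ (β_ X Z).hom ≫ (α_ _ _ _).inv ≫
      monodromy Y Z ▷ X ≫ (α_ _ _ _).hom ≫ Y ◁ (β_ Z X).hom ≫ (α_ _ _ _).inv := by
    simp [monodromy]
  have h : X ◁ monodromy Y Z ≫ (β_ X (Y ⊗ Z)).hom = (β_ X (Y ⊗ Z)).hom ≫ monodromy Y Z ▷ X :=
    BraidedCategory.braiding_naturality_right _ _
  rw [BraidedCategory.braiding_tensor_right_hom] at h
  have h' := congr((α_ X Y Z).hom ≫ $h ≫ (α_ _ _ _).hom ≫ Y ◁ (β_ Z X).hom ≫ (α_ _ _ _).inv)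
  simp only [Category.assoc, Iso.hom_inv_id_assoc, Iso.inv_hom_id_assoc] at h'
  have h3 : monodromy X Z = (β_ X Z).hom ≫ (β_ Z X).hom := rfl
  rw [← monodromy_naturality_left, l, ← h', h3]
  simp

/-- Naturality moves the loop from `M` to `A ⊗ M`, where it consists of a loop around `M` between
two crossings with the other copy of `A`. Commutativity absorbs the second crossing. -/
lemma whiskerLeft_act_monodromy [IsCommMonObj A] (M : Modl A) :
    A ◁ act M ≫ loopAct M =
      (α_ A A M.X).inv ≫ (β_ A A).hom ▷ M.X ≫ (α_ A A M.X).hom ≫ A ◁ loopAct M ≫ act M := by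
  have h1 : (α_ A A M.X).inv ≫ (β_ A A).hom ▷ M.X ≫ (α_ A A M.X).hom ≫ A ◁ act M ≫ act M =
      A ◁ act M ≫ act M := by
    rw [← mul_act, ← comp_whiskerRight_assoc, IsCommMonObj.mul_comm, mul_act,
      Iso.inv_hom_id_assoc]
  rw [loopAct, reassoc_of% (monodromy_naturality_right A (act M)), monodromy_tensor_right]
  simp only [Category.assoc]
  rw [h1, MonoidalCategory.whiskerLeft_comp, Category.assoc]

/-- Its purpose: `evenProj M` is by definition the projector of the pair `act M`, `loopAct M`. The
results on `TwoActions` therefore make it a linear idempotent on every module, before anything is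
known about even or odd summands. -/
lemma twoActions_loop [IsCommMonObj A] (M : Modl A) : TwoActions (act M) (loopAct M) where
  one₁ := one_act M
  mul₁ := mul_act M
  one₂ := by
    rw [loopAct, reassoc_of% (monodromy_naturality_left η[A] M.X), monodromy_unit_left,
      Category.id_comp, one_act]
  mul₂ := by
    -- Commutativity supplies the crossing that `monodromy_tensor_left_braiding` needs to unlink the
    -- two loops.
    have h1 : (β_ A A).hom ▷ M.X ≫ μ[A] ▷ M.X = μ[A] ▷ M.X := by
      rw [← comp_whiskerRight, IsCommMonObj.mul_comm]
    have h2 : A ◁ loopAct M ≫ loopAct M = A ◁ monodromy A M.X ≫ (α_ A A M.X).inv ≫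
        (β_ A A).hom ▷ M.X ≫ (α_ A A M.X).hom ≫ A ◁ monodromy A M.X ≫ A ◁ act M ≫ act M := by
      rw [loopAct, MonoidalCategory.whiskerLeft_comp, Category.assoc]
      have := whiskerLeft_act_monodromy M
      rw [loopAct, MonoidalCategory.whiskerLeft_comp, Category.assoc] at this
      rw [this]
    rw [h2, loopAct, reassoc_of% (monodromy_naturality_left μ[A] M.X), ← h1, Category.assoc,
      reassoc_of% (monodromy_tensor_left_braiding A A M.X), mul_act]
    simp
  comm := whiskerLeft_act_monodromy M

end MonodromyAction

/-! ### Splitting of linear idempotents. -/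

section Splitting
variable {C : Type u} [Category.{v} C] [MonoidalCategory C] {A : C} [MonObj A]
  [IsIdempotentComplete C]

/-- The compressed map `A ◁ i ≫ act M ≫ p` is an action on the image because linearity of `e` lets
the idempotent between two actions be dropped. -/
lemma exists_module_split (M : Modl A) (e : M.X ⟶ M.X) (he : e ≫ e = e)
    (ha : act M ≫ e = A ◁ e ≫ act M) :
    ∃ (N : Modl A) (i : N ⟶ M) (p : M ⟶ N), i ≫ p = 𝟙 N ∧ p.hom ≫ i.hom = e := by
  obtain ⟨Y, i, p, hip, hpi⟩ := IsIdempotentComplete.idempotents_split _ e he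
  have hi : i ≫ e = i := by rw [← hpi, reassoc_of% hip]
  have hp : e ≫ p = p := by rw [← hpi, Category.assoc, hip, Category.comp_id]
  have h1 : (A ◁ i ≫ act M ≫ p) ≫ i = A ◁ i ≫ act M := by
    rw [Category.assoc, Category.assoc, hpi, ha, ← MonoidalCategory.whiskerLeft_comp_assoc, hi]
  have h2 : act M ≫ p = A ◁ p ≫ A ◁ i ≫ act M ≫ p := by
    rw [← MonoidalCategory.whiskerLeft_comp_assoc, hpi, ← reassoc_of% ha, hp]
  let N : Modl A := mkMod Y (A ◁ i ≫ act M ≫ p)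
    (by rw [← whisker_exchange_assoc, reassoc_of% (one_act M), leftUnitor_naturality_assoc, hip,
          Category.comp_id])
    (by rw [← whisker_exchange_assoc, reassoc_of% (mul_act M), ← MonoidalCategory.whiskerLeft_comp_assoc, h1]
        simp)
  exact ⟨N, mkHom (M := N) i h1, mkHom (N := N) p h2, Mod.hom_ext _ _ hip, hpi⟩

end Splitting

/-! ### A criterion for a module to be a sum of an even and an odd module. -/

section GradingOfLoop
open HasTwist
variable {C : Type u} [Category.{v} C] [MonoidalCategory C] [BraidedCategory C]
  [HasTwist C] [IsRibbon C] {A : C} [MonObj A] [ComonObj A] [Preadditive C]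
  [MonoidalPreadditive C]

/-- The images of `e` and `𝟙 - e` are submodules; the fields `even` and `odd` say that they are
local and odd respectively. For haploid non-symmetric `A`, `isGrading_evenProj` is the converse. -/
lemma IsGrading.isNakayamaLocalSum [IsIdempotentComplete C] {M : Modl A} {e : M.X ⟶ M.X}
    (he : IsGrading M e) : IsNakayamaLocalSum M := by
  obtain ⟨N₀, i₀, p₀, h₀, h₀'⟩ := exists_module_split M e he.idem he.act_e
  obtain ⟨N₁, i₁, p₁, h₁, h₁'⟩ := exists_module_split M (𝟙 _ - e) he.o_o he.act_o
  have h₀s := congr(Mod.Hom.hom $h₀)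
  have h₁s := congr(Mod.Hom.hom $h₁)
  rw [Mod.comp_hom', Mod.id_hom'] at h₀s h₁s
  have e₀ : i₀.hom = i₀.hom ≫ e := by rw [← h₀', reassoc_of% h₀s]
  have e₁ : i₁.hom = i₁.hom ≫ (𝟙 _ - e) := by rw [← h₁', reassoc_of% h₁s]
  have f₀ : p₀.hom = e ≫ p₀.hom := by rw [← h₀', Category.assoc, h₀s, Category.comp_id]
  have f₁ : p₁.hom = (𝟙 _ - e) ≫ p₁.hom := by
    rw [← h₁', Category.assoc, h₁s, Category.comp_id]
  have n₀ : IsLocal N₀ := by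
    have h : A ◁ i₀.hom ≫ monodromy A M.X ≫ act M = A ◁ i₀.hom ≫ act M := by
      rw [e₀, MonoidalCategory.whiskerLeft_comp, Category.assoc, Category.assoc, he.even]
    have h2 := congr($h ≫ p₀.hom)
    rw [Category.assoc, Category.assoc, Category.assoc, act_hom,
      ← reassoc_of% (monodromy_naturality_right A p₀.hom),
      ← MonoidalCategory.whiskerLeft_comp_assoc, ← MonoidalCategory.whiskerLeft_comp_assoc, h₀s]
      at h2
    simpa [IsLocal] using h2
  have n₁ : IsOdd N₁ := by
    have h : A ◁ i₁.hom ≫ monodromy A M.X ≫ act M = nak A ▷ _ ≫ A ◁ i₁.hom ≫ act M := by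
      rw [e₁, MonoidalCategory.whiskerLeft_comp, Category.assoc, Category.assoc, he.odd,
        MonoidalCategory.tensorHom_def, Category.assoc, whisker_exchange_assoc]
    have h2 := congr($h ≫ p₁.hom)
    rw [Category.assoc, Category.assoc, Category.assoc, Category.assoc, act_hom,
      ← reassoc_of% (monodromy_naturality_right A p₁.hom),
      ← MonoidalCategory.whiskerLeft_comp_assoc, ← MonoidalCategory.whiskerLeft_comp_assoc, h₁s]
      at h2
    simpa [IsOdd] using h2
  -- `true` indexes the odd summand, `false` the even one.
  refine .of_fintype (J := Bool) (fun b => cond b N₁ N₀)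
    (fun b => match b with | true => i₁ | false => i₀)
    (fun b => match b with | true => p₁ | false => p₀) ?_ ?_ ?_ ?_
  · rintro (_ | _)
    · exact Or.inl n₀
    · exact Or.inr n₁
  · rintro (_ | _)
    · exact h₀
    · exact h₁
  · rintro (_ | _) (_ | _) h
    · exact (h rfl).elim
    · refine Mod.hom_ext _ _ ?_
      change i₀.hom ≫ p₁.hom = 0
      rw [e₀, f₁, Category.assoc, reassoc_of% he.e_o]; simp
    · refine Mod.hom_ext _ _ ?_
      change i₁.hom ≫ p₀.hom = 0
      rw [e₁, f₀, Category.assoc, reassoc_of% he.o_e]; simp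
    · exact (h rfl).elim
  · refine Mod.hom_ext _ _ ?_
    rw [sum_hom, Fintype.sum_bool]
    change p₁.hom ≫ i₁.hom + p₀.hom ≫ i₀.hom = 𝟙 M.X
    rw [h₀', h₁']; simp

variable [IsFrobenius A] [IsDeltaSeparable A] [IsCommMonObj A]

/-- The hypothesis compares the loop action with the action only after symmetrisation under `N`,
that is, on the symmetric part of `A`. It controls the loop action up to its `N`-antisymmetric part,
and the vanishing of the `N`-twisted loop (`comul_nak_mul`) is what forces the complement of
`evenProj M` to be odd. -/
lemma isGrading_of_loop [IsIdempotentComplete C] (k : Type*) [Field k] [Linear k C] [MonoidalLinear k C]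
    [IsHaploidNonsymmetric k A] {M : Modl A}
    (h : loopAct M + nak A ▷ M.X ≫ loopAct M = act M + nak A ▷ M.X ≫ act M) :
    IsGrading M (evenProj M) := by
  have T := twoActions_loop M
  have he : evenProj M = twoActProj (act M) (loopAct M) := rfl
  -- Writing `e` for `evenProj M`: `e` after `act`, and both `act` and `loopAct` after `id ⊗ e`, all
  -- equal `twoActK`. Hence linearity of `e` and the even condition hold without using `h`.
  have hR : act M ≫ evenProj M = A ◁ evenProj M ≫ act M := by
    rw [he, T.act₁_proj, T.whisker_proj_act₁]
  have hK : A ◁ evenProj M ≫ loopAct M = twoActK (act M) (loopAct M) := by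
    rw [loopAct, reassoc_of% (monodromy_naturality_right A (evenProj M)), ← hR, ← Category.assoc,
      ← loopAct, he, T.act₂_proj]
  have hK' : A ◁ evenProj M ≫ act M = twoActK (act M) (loopAct M) := by
    rw [he, T.whisker_proj_act₁]
  have hsub : A ◁ (𝟙 _ - evenProj M) = 𝟙 _ - A ◁ evenProj M :=
    ((tensorLeft A).map_sub).trans (by simp)
  have hz : (Δ[A] ≫ nak A ▷ A ≫ μ[A]) = 0 := comul_nak_mul k A
  -- Write `K` for `twoActK` and `X` for the second summand, in which `N` sits on the first leg of
  -- `Δ`. Substituting `h` for the outer action makes the two loop actions multiply: the term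
  -- without `N` gives `loopAct` by `Δ`-separability and the one with `N` vanishes. So `K + X =
  -- loopAct`.
  have k1 : twoActK (act M) (loopAct M) +
      Δ[A] ▷ M.X ≫ (α_ A A M.X).hom ≫ nak A ▷ _ ≫ A ◁ loopAct M ≫ act M = loopAct M := by
    have e1 : A ◁ loopAct M ≫ act M + nak A ▷ _ ≫ A ◁ loopAct M ≫ act M =
        (α_ A A M.X).inv ≫ μ[A] ▷ M.X ≫ loopAct M +
          nak A ▷ _ ≫ (α_ A A M.X).inv ≫ μ[A] ▷ M.X ≫ loopAct M := by
      have := congr(A ◁ loopAct M ≫ $h)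
      rw [Preadditive.comp_add, Preadditive.comp_add, whisker_exchange_assoc,
        whisker_exchange_assoc] at this
      rw [T.mul₂, Iso.inv_hom_id_assoc]
      exact this.symm
    have e2 := congr(Δ[A] ▷ M.X ≫ (α_ A A M.X).hom ≫ $e1)
    rw [twoActK, ← Preadditive.comp_add, ← Preadditive.comp_add, e2, Preadditive.comp_add,
      Preadditive.comp_add, Iso.hom_inv_id_assoc, ← comp_whiskerRight_assoc,
      IsDeltaSeparable.comul_mul]
    have e3 := congr($hz ▷ M.X ≫ loopAct M)
    simp only [comp_whiskerRight, Category.assoc, MonoidalPreadditive.zero_whiskerRight,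
      Limits.zero_comp] at e3
    simp [e3]
  -- `N` distributes over `Δ`, and `h` rewrites the loop action on the leg that carries `N`. Of the
  -- three resulting terms one vanishes by `comul_nak_mul`, one is `act` preceded by `N`, and one is
  -- `-X`.
  have k2 : nak A ▷ M.X ≫ twoActK (act M) (loopAct M) = nak A ▷ M.X ≫ act M -
      Δ[A] ▷ M.X ≫ (α_ A A M.X).hom ≫ nak A ▷ _ ≫ A ◁ loopAct M ≫ act M := by
    have hn : nak A ≫ Δ[A] = Δ[A] ≫ nak A ▷ A ≫ A ◁ nak A := by
      rw [nak_eq_twist, ← comul_twist, MonoidalCategory.tensorHom_def]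
    have e0 : nak A ▷ M.X ≫ loopAct M = act M + nak A ▷ M.X ≫ act M - loopAct M := by
      rw [← h]; abel
    have e4 : nak A ▷ M.X ≫ twoActK (act M) (loopAct M) = Δ[A] ▷ M.X ≫ (α_ A A M.X).hom ≫
        nak A ▷ _ ≫ A ◁ (nak A ▷ M.X ≫ loopAct M) ≫ act M := by
      rw [twoActK, ← comp_whiskerRight_assoc, hn]; simp
    have hsub' (f g : A ⊗ M.X ⟶ M.X) : A ◁ (f - g) = A ◁ f - A ◁ g := (tensorLeft A).map_sub
    have e3 := congr($hz ▷ M.X ≫ act M)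
    simp only [comp_whiskerRight, Category.assoc, MonoidalPreadditive.zero_whiskerRight,
      Limits.zero_comp, mul_act] at e3
    have e5 : Δ[A] ▷ M.X ≫ (α_ A A M.X).hom ≫ nak A ▷ _ ≫ A ◁ (nak A ▷ M.X ≫ act M) ≫ act M =
        nak A ▷ M.X ≫ act M := by
      have := congr($hn ▷ M.X ≫ μ[A] ▷ M.X ≫ act M)
      simp only [comp_whiskerRight, Category.assoc] at this
      rw [← comp_whiskerRight_assoc Δ[A], IsDeltaSeparable.comul_mul] at this
      rw [id_whiskerRight, Category.id_comp, mul_act] at this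
      exact Eq.trans (by simp) this.symm
    rw [e4, e0, hsub', MonoidalPreadditive.whiskerLeft_add]
    simp only [Preadditive.comp_add, Preadditive.comp_sub, Preadditive.add_comp,
      Preadditive.sub_comp]
    rw [e5]
    have e6 : Δ[A] ▷ M.X ≫ (α_ A A M.X).hom ≫ nak A ▷ _ ≫ A ◁ act M ≫ act M = 0 := by
      rw [← e3]; simp
    rw [e6, zero_add]
  refine ⟨T.proj_proj, hR, hK.trans hK'.symm, ?_⟩
  change A ◁ (𝟙 _ - evenProj M) ≫ loopAct M = _
  rw [MonoidalCategory.tensorHom_def, hsub, Preadditive.sub_comp, hK, Preadditive.comp_sub,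
    Preadditive.sub_comp, Category.assoc, Category.assoc, hK', k2]
  simp only [Category.id_comp, Category.comp_id]
  rw [sub_sub_cancel]
  -- By `k1` and `k2`, `loopAct - K` and the `N`-twist of `act - K` are both `X`, which is the odd
  -- condition.
  exact sub_eq_iff_eq_add'.2 k1.symm

end GradingOfLoop

end SpinLine

namespace SpinLine

/-! ### Restriction along algebra morphisms and retracts of local modules. -/

section Restriction
variable {C : Type u} [Category.{v} C] [MonoidalCategory C] {A B : C} [MonObj A] [MonObj B]

/-- Restriction of modules along a morphism of algebras. -/
def resMod (j : B ⟶ A) [IsMonHom j] (M : Modl A) : Modl B :=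
  mkMod M.X (j ▷ M.X ≫ act M)
    (by rw [← comp_whiskerRight_assoc, IsMonHom.one_hom, one_act])
    (by
      have h1 : j ▷ (A ⊗ M.X) ≫ (α_ _ _ _).inv ≫ μ[A] ▷ M.X ≫ act M =
          j ▷ (A ⊗ M.X) ≫ A ◁ act M ≫ act M := by rw [mul_act, Iso.inv_hom_id_assoc]
      rw [← comp_whiskerRight_assoc, IsMonHom.mul_hom, MonoidalCategory.whiskerLeft_comp,
        Category.assoc, whisker_exchange_assoc, ← h1, MonoidalCategory.tensorHom_def']
      simp)

lemma IsLocal.of_retract [BraidedCategory C] {M N : Modl A} (hM : IsLocal M) (i : N ⟶ M)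
    (p : M ⟶ N) (h : i ≫ p = 𝟙 N) : IsLocal N := by
  have hs := congr(Mod.Hom.hom $h)
  rw [Mod.comp_hom', Mod.id_hom'] at hs
  have hM' : monodromy A M.X ≫ act M = act M := hM
  have h2 := congr(A ◁ i.hom ≫ $hM' ≫ p.hom)
  rw [Category.assoc, act_hom, ← reassoc_of% (monodromy_naturality_right A p.hom),
      ← MonoidalCategory.whiskerLeft_comp_assoc, ← MonoidalCategory.whiskerLeft_comp_assoc, hs] at h2
  simpa [IsLocal] using h2

variable [ComonObj A]

/-- The Frobenius identity `Σ eᵢ ⊗ eⁱ a = Δ a` for the copairing `Σ eᵢ ⊗ eⁱ`. -/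
lemma act_sec [IsFrobenius A] (M : Modl A) :
    act M ≫ TwoActions.sec (act M) = Δ[A] ▷ M.X ≫ (α_ _ _ _).hom ≫ A ◁ act M := by
  have h1 := mul_act M
  rw [TwoActions.sec, leftUnitor_inv_naturality_assoc, whisker_exchange_assoc,
    associator_naturality_right_assoc, ← MonoidalCategory.whiskerLeft_comp, ← Iso.inv_comp_eq] at *
  rw [← h1, ← copair_right]
  simp

end Restriction

/-! ### The symmetric part as a subalgebra, and its copairing. -/

section SymmetricPart
open HasTwist
variable (k : Type w) [Field k] [NeZero (2 : k)] {C : Type u} [Category.{v} C]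
  [MonoidalCategory C] [BraidedCategory C] [HasTwist C] [IsRibbon C] [Preadditive C] [Linear k C]
  [IsIdempotentComplete C] [MonoidalPreadditive C] [MonoidalLinear k C]
  (A : C) [MonObj A] [ComonObj A] [IsFrobenius A] [IsCommMonObj A]

/-- The twist fixes the unit and is multiplicative, so its invariants contain the unit and are
closed under products; projecting to them changes nothing. -/
instance : IsMonHom (symmι k A) where
  one_hom := by rw [symm_one, Category.assoc, symmπ_ι, one_idem]
  mul_hom := by rw [symm_mul, Category.assoc, Category.assoc, symmπ_ι, ι_mul_idem]

lemma symmι_nak : symmι k A ≫ nak A = symmι k A := by rw [nak_eq_twist, symmι_twist]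

lemma two_smul_inv_two {X Y : C} (f : X ⟶ Y) : (2 : k) • (2 : k)⁻¹ • f = f := by
  rw [smul_smul, mul_inv_cancel₀ (NeZero.ne _), one_smul]

lemma inv_two_smul_add {X Y : C} (f : X ⟶ Y) : (2 : k)⁻¹ • (f + f) = f := by
  rw [← two_smul k f, smul_smul, inv_mul_cancel₀ (NeZero.ne _), one_smul]

/-- The copairing of the symmetric part, viewed in `A`. -/
lemma copair_symm : copair (symmPart k A) ≫ (symmι k A ⊗ₘ symmι k A) =
    copair A + copair A ≫ nak A ▷ A := by
  have h : copair (symmPart k A) =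
      (2 : k) • (copair A ≫ (symmπ k A ⊗ₘ symmπ k A)) := by
    rw [copair, symm_one, symm_comul, Linear.comp_smul, Category.assoc, reassoc_of% (symmπ_ι k A),
      reassoc_of% (one_idem k A), copair, Category.assoc]
  have h1 : copair A ≫ A ◁ symmIdem k A = copair A ≫ symmIdem k A ▷ A := by
    simp only [symmIdem, MonoidalLinear.smul_whiskerRight, MonoidalLinear.whiskerLeft_smul,
      MonoidalPreadditive.add_whiskerRight, MonoidalPreadditive.whiskerLeft_add,
      Linear.comp_smul, Preadditive.comp_add, copair_twist]
    simp
  -- The idempotents on the two legs can be moved to the same leg, where they merge into one. The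
  -- factor `2` of the coproduct cancels its `1/2`, leaving `1 + N` on one leg.
  rw [h, Linear.smul_comp, Category.assoc, tensorHom_comp_tensorHom, symmπ_ι,
    MonoidalCategory.tensorHom_def', reassoc_of% h1, ← comp_whiskerRight, symmIdem_idem, symmIdem,
    MonoidalLinear.smul_whiskerRight, Linear.comp_smul, two_smul_inv_two,
    MonoidalPreadditive.add_whiskerRight, Preadditive.comp_add, nak_eq_twist]
  simp

end SymmetricPart

/-! ### The functor of `t`-invariants. -/

section Fixed
open HasTwist
variable {k : Type w} [Field k] [NeZero (2 : k)] {C : Type u} [Category.{v} C]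
  [MonoidalCategory C] [BraidedCategory C] [HasTwist C] [IsRibbon C] [Preadditive C] [Linear k C]
  [IsIdempotentComplete C] [MonoidalPreadditive C] [MonoidalLinear k C]
  {A : C} [MonObj A] [ComonObj A] [IsFrobenius A] [IsCommMonObj A]

/-- `t` is semilinear with respect to `N`, which is the identity on the symmetric part; so `t` is
linear over the symmetric part. -/
lemma IsSpinMap.symm_act {M : Modl A} {t : M.X ⟶ M.X} (ht : IsSpinMap M t) :
    symmι k A ▷ M.X ≫ act M ≫ t = symmPart k A ◁ t ≫ symmι k A ▷ M.X ≫ act M := by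
  rw [ht.act_t, MonoidalCategory.tensorHom_def, Category.assoc, ← comp_whiskerRight_assoc,
    symmι_nak, whisker_exchange_assoc]

/-- `(1 + t)/2` is idempotent because `t` is an involution, and linear over the symmetric part by
`IsSpinMap.symm_act`, so it splits among modules. The last two clauses are linearity of the
inclusion and the projection. -/
lemma exists_fixed_split (M : LSpin k A) : ∃ (N : Modl (symmPart k A))
    (i : N.X ⟶ M.toMod.X) (p : M.toMod.X ⟶ N.X), i ≫ p = 𝟙 N.X ∧
      p ≫ i = (2 : k)⁻¹ • (𝟙 _ + M.t) ∧
      act N ≫ i = _ ◁ i ≫ symmι k A ▷ _ ≫ act M.toMod ∧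
      symmι k A ▷ _ ≫ act M.toMod ≫ p = _ ◁ p ≫ act N := by
  let R := resMod (symmι k A) M.toMod
  let e : M.toMod.X ⟶ M.toMod.X := (2 : k)⁻¹ • (𝟙 _ + M.t)
  have ht : M.t ≫ e = e := by
    simp only [e, Linear.comp_smul, Preadditive.comp_add, M.isSpin.invol, Category.comp_id]
    rw [add_comm]
  have he : e ≫ e = e := by
    have : e ≫ e = (2 : k)⁻¹ • (e + M.t ≫ e) := by
      nth_rw 1 [show e = (2 : k)⁻¹ • (𝟙 _ + M.t) from rfl]
      rw [Linear.smul_comp, Preadditive.add_comp, Category.id_comp]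
    rw [this, ht, inv_two_smul_add]
  have ha : (symmι k A ▷ M.toMod.X ≫ act M.toMod) ≫ e =
      symmPart k A ◁ e ≫ symmι k A ▷ M.toMod.X ≫ act M.toMod := by
    simp only [e, MonoidalLinear.whiskerLeft_smul, MonoidalPreadditive.whiskerLeft_add,
      Linear.comp_smul, Linear.smul_comp, Preadditive.comp_add, Preadditive.add_comp]
    have h := M.isSpin.symm_act (k := k)
    rw [← Category.assoc] at h
    rw [h]
    simp
  obtain ⟨N, i, p, h₁, h₂⟩ := exists_module_split R e he ha
  refine ⟨N, i.hom, p.hom, ?_, h₂, act_hom i, ?_⟩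
  · have := congr(Mod.Hom.hom $h₁)
    rwa [Mod.comp_hom', Mod.id_hom'] at this
  · exact (Category.assoc _ _ _).symm.trans (act_hom p)

/-- The module of `t`-invariants of `M` over the symmetric part of `A`. -/
noncomputable def fixMod (M : LSpin k A) : Modl (symmPart k A) := (exists_fixed_split M).choose

/-- The inclusion of the `t`-invariants. -/
noncomputable def fixι (M : LSpin k A) : (fixMod M).X ⟶ M.toMod.X :=
  (exists_fixed_split M).choose_spec.choose

/-- The projection to the `t`-invariants. -/
noncomputable def fixπ (M : LSpin k A) : M.toMod.X ⟶ (fixMod M).X :=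
  (exists_fixed_split M).choose_spec.choose_spec.choose

variable (M N : LSpin k A)

@[simp]
lemma fixι_π : fixι M ≫ fixπ M = 𝟙 _ :=
  (exists_fixed_split M).choose_spec.choose_spec.choose_spec.1

@[simp]
lemma fixι_π_assoc {Z : C} (h : (fixMod M).X ⟶ Z) : fixι M ≫ fixπ M ≫ h = h := by
  rw [← Category.assoc, fixι_π, Category.id_comp]

lemma fixπ_ι : fixπ M ≫ fixι M = (2 : k)⁻¹ • (𝟙 _ + M.t) :=
  (exists_fixed_split M).choose_spec.choose_spec.choose_spec.2.1

lemma act_fixι : act (fixMod M) ≫ fixι M = _ ◁ fixι M ≫ symmι k A ▷ _ ≫ act M.toMod :=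
  (exists_fixed_split M).choose_spec.choose_spec.choose_spec.2.2.1

lemma act_fixπ : symmι k A ▷ _ ≫ act M.toMod ≫ fixπ M = _ ◁ fixπ M ≫ act (fixMod M) :=
  (exists_fixed_split M).choose_spec.choose_spec.choose_spec.2.2.2

instance : IsSplitMono (fixι M) := ⟨⟨⟨fixπ M, fixι_π M⟩⟩⟩

lemma fixι_t : fixι M ≫ M.t = fixι M := by
  have h : (2 : k)⁻¹ • ((𝟙 _ + M.t) ≫ M.t) = (2 : k)⁻¹ • (𝟙 _ + M.t) := by
    rw [Preadditive.add_comp, M.isSpin.invol, Category.id_comp, add_comm]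
  have h2 : fixι M = fixι M ≫ ((2 : k)⁻¹ • (𝟙 _ + M.t)) := by rw [← fixπ_ι, fixι_π_assoc]
  rw [h2, Category.assoc, Linear.smul_comp, h]

lemma t_fixπ : M.t ≫ fixπ M = fixπ M := by
  rw [← cancel_mono (fixι M), Category.assoc, fixπ_ι, Linear.comp_smul, Preadditive.comp_add,
    M.isSpin.invol, Category.comp_id, add_comm]

lemma fix_of_invariant {M : LSpin k A} {X : C} (f : X ⟶ M.toMod.X) (h : f ≫ M.t = f) :
    f ≫ fixπ M ≫ fixι M = f := by
  rw [fixπ_ι, Linear.comp_smul, Preadditive.comp_add, h, Category.comp_id, inv_two_smul_add]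

/-- The induced morphism between the `t`-invariants. -/
noncomputable def fixMap {M N : LSpin k A} (f : M ⟶ N) : fixMod M ⟶ fixMod N :=
  mkHom (fixι M ≫ f.hom.hom ≫ fixπ N) <| by
    rw [reassoc_of% act_fixι, reassoc_of% (act_hom f.hom), MonoidalCategory.whiskerLeft_comp_assoc,
      MonoidalCategory.whiskerLeft_comp_assoc, ← act_fixπ, ← whisker_exchange_assoc]

lemma fixMap_ι {M N : LSpin k A} (f : M ⟶ N) :
    (fixMap f).hom ≫ fixι N = fixι M ≫ f.hom.hom := by
  change (fixι M ≫ f.hom.hom ≫ fixπ N) ≫ fixι N = _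
  have h : (fixι M ≫ f.hom.hom) ≫ N.t = fixι M ≫ f.hom.hom := by
    rw [Category.assoc, ← f.comm, reassoc_of% fixι_t]
  rw [Category.assoc, Category.assoc]
  simpa using fix_of_invariant _ h

lemma fix_hom_ext {M : LSpin k A} {W : Modl (symmPart k A)} {f g : W ⟶ fixMod M}
    (h : f.hom ≫ fixι M = g.hom ≫ fixι M) : f = g :=
  Mod.hom_ext _ _ ((cancel_mono (fixι M)).1 h)

variable [IsDeltaSeparable A] [IsHaploidNonsymmetric k A]

/-- On the even part the double braiding drops out; on the odd part it becomes `N`, which is the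
identity on the symmetric part. -/
lemma symm_loop {M : Modl A} {e : M.X ⟶ M.X} (he : IsGrading M e) :
    symmι k A ▷ M.X ≫ monodromy A M.X ≫ act M = symmι k A ▷ M.X ≫ act M := by
  refine add_ext (a := symmPart k A ◁ e) (b := symmPart k A ◁ (𝟙 _ - e))
    (by rw [← MonoidalPreadditive.whiskerLeft_add]; simp) ?_ ?_
  · rw [whisker_exchange_assoc, whisker_exchange_assoc, he.even]
  · rw [whisker_exchange_assoc, whisker_exchange_assoc, he.odd, MonoidalCategory.tensorHom_def,
      Category.assoc, ← comp_whiskerRight_assoc, symmι_nak]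

lemma isLocal_fixMod : IsLocal (fixMod M) := by
  rw [IsLocal, ← cancel_mono (fixι M), Category.assoc, act_fixι,
    ← reassoc_of% (monodromy_naturality_right (symmPart k A) (fixι M)),
    ← reassoc_of% (monodromy_naturality_left (symmι k A)), symm_loop M.isGrading]

/-- The functor of `t`-invariants. -/
noncomputable def fixFunctor (k : Type w) [Field k] [NeZero (2 : k)] {C : Type u} [Category.{v} C]
    [MonoidalCategory C] [BraidedCategory C] [HasTwist C] [IsRibbon C] [Preadditive C] [Linear k C]
    [IsIdempotentComplete C] [MonoidalPreadditive C] [MonoidalLinear k C]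
    (A : C) [MonObj A] [ComonObj A] [IsFrobenius A] [IsCommMonObj A]
    [IsDeltaSeparable A] [IsHaploidNonsymmetric k A] : LSpin k A ⥤ LocMod (symmPart k A) where
  obj M := ⟨fixMod M, isLocal_fixMod M⟩
  map f := ObjectProperty.homMk (fixMap f)
  map_id M := ObjectProperty.hom_ext _ <| fix_hom_ext <| by
    change (fixMap (𝟙 M)).hom ≫ fixι M = 𝟙 _ ≫ fixι M
    rw [fixMap_ι, LSpin.id_hom, Mod.id_hom']
    simp
  map_comp {M N P} f g := ObjectProperty.hom_ext _ <| fix_hom_ext <| by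
    change (fixMap (f ≫ g)).hom ≫ fixι P = ((fixMap f).hom ≫ (fixMap g).hom) ≫ fixι P
    rw [fixMap_ι, LSpin.comp_hom, Mod.comp_hom', Category.assoc, fixMap_ι, ← Category.assoc,
      ← Category.assoc, fixMap_ι]

end Fixed

end SpinLine

namespace SpinLine

/-! ### Behaviour of the projector of two actions under semilinear maps. -/

section TwoActionMaps
variable {C : Type u} [Category.{v} C] [MonoidalCategory C] {A B : C} [MonObj A] [ComonObj A]
  [MonObj B] [ComonObj B] {V W : C}

/-- The endomorphism of `W` that inserts `q` and lets its legs act by `a₁` and `a₂`. -/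
def insertAct (q : 𝟙_ C ⟶ A ⊗ A) (a₁ a₂ : A ⊗ W ⟶ W) : W ⟶ W :=
  (λ_ W).inv ≫ q ▷ W ≫ (α_ A A W).hom ≫ A ◁ a₂ ≫ a₁

/-- Moving `s` through the projector passes the second action freely, and leaves an `n` on the first
leg of the copairing when it passes the first action. -/
lemma twoActProj_semilinear {a₁ a₂ : A ⊗ W ⟶ W} {n : A ⟶ A} {s : W ⟶ W}
    (h₁ : a₁ ≫ s = n ▷ W ≫ A ◁ s ≫ a₁) (h₂ : a₂ ≫ s = A ◁ s ≫ a₂) :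
    twoActProj a₁ a₂ ≫ s = s ≫ insertAct (copair A ≫ n ▷ A) a₁ a₂ := by
  have e : A ◁ a₂ ≫ n ▷ W ≫ A ◁ s ≫ a₁ = n ▷ _ ≫ A ◁ A ◁ s ≫ A ◁ a₂ ≫ a₁ := by
    rw [whisker_exchange_assoc, ← MonoidalCategory.whiskerLeft_comp_assoc, h₂,
      MonoidalCategory.whiskerLeft_comp_assoc]
  rw [insertAct, leftUnitor_inv_naturality_assoc, whisker_exchange_assoc,
    associator_naturality_right_assoc]
  simp only [twoActProj, Category.assoc, h₁, e]
  simp only [whisker_exchange_assoc, associator_naturality_right_assoc, comp_whiskerRight,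
    Category.assoc, associator_naturality_left_assoc]

/-- Moving `f` through both actions leaves a `j` on each leg, so the copairing of `B` is replaced by
its image in `A ⊗ A`. -/
lemma twoActProj_map {b₁ b₂ : B ⊗ V ⟶ V} {a₁ a₂ : A ⊗ W ⟶ W} {j : B ⟶ A} {f : V ⟶ W}
    (h₁ : b₁ ≫ f = (j ⊗ₘ f) ≫ a₁) (h₂ : b₂ ≫ f = (j ⊗ₘ f) ≫ a₂) :
    twoActProj b₁ b₂ ≫ f = f ≫ insertAct (copair B ≫ (j ⊗ₘ j)) a₁ a₂ := by
  have e : B ◁ b₂ ≫ (j ⊗ₘ f) = (j ⊗ₘ (j ⊗ₘ f)) ≫ A ◁ a₂ := by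
    rw [← id_tensorHom, tensorHom_comp_tensorHom, ← id_tensorHom, tensorHom_comp_tensorHom, h₂]
    simp
  have e2 : copair B ▷ V ≫ ((j ⊗ₘ j) ⊗ₘ f) = 𝟙_ C ◁ f ≫ (copair B ≫ (j ⊗ₘ j)) ▷ W := by
    rw [whisker_exchange, comp_whiskerRight, Category.assoc, MonoidalCategory.tensorHom_def]
  rw [insertAct, leftUnitor_inv_naturality_assoc, ← reassoc_of% e2]
  simp only [twoActProj, Category.assoc, h₁, reassoc_of% e]
  rw [associator_naturality_assoc]

lemma insertAct_add [Preadditive C] [MonoidalPreadditive C] (q q' : 𝟙_ C ⟶ A ⊗ A)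
    (a₁ a₂ : A ⊗ W ⟶ W) : insertAct (q + q') a₁ a₂ = insertAct q a₁ a₂ + insertAct q' a₁ a₂ := by
  simp [insertAct]

end TwoActionMaps

/-! ### The involution on one factor of a relative tensor product. -/

section SpinRelative
open HasTwist
variable {C : Type u} [Category.{v} C]
  [MonoidalCategory C] [BraidedCategory C] [HasTwist C] [IsRibbon C]
  {A : C} [MonObj A] [ComonObj A] [IsFrobenius A] [IsCommMonObj A] [IsDeltaSeparable A]

/-- `t` on the first factor is semilinear for the action there and commutes with the action on the
second factor, which only crosses `M` by a braiding. -/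
lemma relProj_spin {M N : Modl A} {t : M.X ⟶ M.X} (ht : IsSpinMap M t) :
    relProj M N ≫ t ▷ N.X =
      t ▷ N.X ≫ insertAct (copair A ≫ nak A ▷ A) (actFst M N.X) (actSnd M.X N) :=
  twoActProj_semilinear (actFst_left _ _ _ _ ht.act_t) (by rw [actSnd_eq, whiskerRight_slide])

variable [IsIdempotentComplete C] [Preadditive C] [MonoidalPreadditive C]

/-- Moving `t` out puts `N` on one leg of the copairing. After `relπ` both legs may act on the
second factor, where they multiply to the `N`-twisted loop of `copair_nak_mul`, which is zero. -/
lemma relι_spin_relπ (k : Type*) [Field k] [Linear k C] [MonoidalLinear k C]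
    [IsHaploidNonsymmetric k A] {M N : Modl A} {t : M.X ⟶ M.X} (ht : IsSpinMap M t) :
    relι M N ≫ t ▷ N.X ≫ relπ M N = 0 := by
  rw [← cancel_epi (relπ M N), reassoc_of% relπ_ι, reassoc_of% (relProj_spin ht), insertAct]
  have h := (twoActions M N).mul₂
  rw [← Iso.inv_comp_eq] at h
  have h2 := congr($(copair_nak_mul k A) ▷ (M.X ⊗ N.X) ≫ actSnd M.X N ≫ relπ M N)
  simp only [comp_whiskerRight, Category.assoc, MonoidalPreadditive.zero_whiskerRight,
      Limits.zero_comp] at h2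
  simp only [Category.assoc]
  rw [actFst_π, ← reassoc_of% h, Iso.hom_inv_id_assoc, comp_whiskerRight_assoc, h2]
  simp

end SpinRelative

/-! ### Projection and inclusion of the tensor product in `L^spin_A`. -/

section LSpinTensor
open HasTwist
variable {k : Type w} {C : Type u} [Category.{v} C]
  [MonoidalCategory C] [BraidedCategory C] [HasTwist C] [IsRibbon C] [Preadditive C]
  [MonoidalPreadditive C] [IsIdempotentComplete C]
  {A : C} [MonObj A] [ComonObj A] [IsFrobenius A] [IsCommMonObj A] [IsDeltaSeparable A]

namespace LSpin

variable (M N : LSpin k A)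

/-- The projection `M ⊗ N ⟶ M ⊗_A N`. -/
noncomputable def proj : M.toMod.X ⊗ N.toMod.X ⟶ (M.tensor N).toMod.X := relπ M.toMod N.toMod

/-- The inclusion `M ⊗_A N ⟶ M ⊗ N`. -/
noncomputable def incl : (M.tensor N).toMod.X ⟶ M.toMod.X ⊗ N.toMod.X := relι M.toMod N.toMod

lemma incl_proj : M.incl N ≫ M.proj N = 𝟙 _ := relι_π _ _

lemma proj_incl : M.proj N ≫ M.incl N = relProj M.toMod N.toMod := relπ_ι _ _

lemma actFst_proj : actFst M.toMod N.toMod.X ≫ M.proj N = A ◁ M.proj N ≫ act (M.tensor N).toMod :=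
  (whisker_π_act _ _).symm

lemma actSnd_proj : actSnd M.toMod.X N.toMod ≫ M.proj N = A ◁ M.proj N ≫ act (M.tensor N).toMod :=
  (actFst_π _ _).symm.trans (actFst_proj M N)

lemma proj_t : M.proj N ≫ (M.tensor N).t = (M.t ⊗ₘ N.t) ≫ M.proj N :=
  π_tensSpin M.isSpin N.isSpin

lemma incl_t_proj [Field k] [Linear k C] [MonoidalLinear k C] [IsHaploidNonsymmetric k A] :
    M.incl N ≫ M.t ▷ N.toMod.X ≫ M.proj N = 0 :=
  relι_spin_relπ k M.isSpin

end LSpin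

end LSpinTensor

/-! ### The tensorator of the functor of invariants. -/

section FixTensor
open HasTwist
variable {k : Type w} [Field k] [NeZero (2 : k)] {C : Type u} [Category.{v} C]
  [MonoidalCategory C] [BraidedCategory C] [HasTwist C] [IsRibbon C] [Preadditive C] [Linear k C]
  [IsIdempotentComplete C] [MonoidalPreadditive C] [MonoidalLinear k C]
  {A : C} [MonObj A] [ComonObj A] [IsFrobenius A] [IsCommMonObj A]

lemma act_fixι' (M : LSpin k A) :
    act (fixMod M) ≫ fixι M = (symmι k A ⊗ₘ fixι M) ≫ act M.toMod := by
  rw [act_fixι, MonoidalCategory.tensorHom_def', Category.assoc]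

lemma actFst_fix (M : LSpin k A) {Y Y' : C} (f : Y ⟶ Y') :
    actFst (fixMod M) Y ≫ (fixι M ⊗ₘ f) =
      (symmι k A ⊗ₘ (fixι M ⊗ₘ f)) ≫ actFst M.toMod Y' := by
  rw [actFst, actFst, Category.assoc, ← tensorHom_id, tensorHom_comp_tensorHom, act_fixι',
    associator_inv_naturality_assoc, ← tensorHom_id, tensorHom_comp_tensorHom]
  simp

lemma actSnd_fix (N : LSpin k A) {X X' : C} (f : X ⟶ X') :
    actSnd X (fixMod N) ≫ (f ⊗ₘ fixι N) =
      (symmι k A ⊗ₘ (f ⊗ₘ fixι N)) ≫ actSnd X' N.toMod := by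
  have h : (β_ (symmPart k A) X).hom ▷ (fixMod N).X ≫ ((f ⊗ₘ symmι k A) ⊗ₘ fixι N) =
      ((symmι k A ⊗ₘ f) ⊗ₘ fixι N) ≫ (β_ A X').hom ▷ N.toMod.X := by
    rw [← tensorHom_id, ← tensorHom_id, tensorHom_comp_tensorHom, tensorHom_comp_tensorHom,
      BraidedCategory.braiding_naturality]
    simp
  simp only [actSnd, Category.assoc]
  rw [← id_tensorHom, tensorHom_comp_tensorHom, act_fixι', associator_inv_naturality_assoc,
    ← reassoc_of% h, associator_naturality_assoc, ← id_tensorHom, tensorHom_comp_tensorHom]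
  simp

variable [IsDeltaSeparable A] (M N : LSpin k A)

/-- By `copair_symm` the copairing of the symmetric part becomes that of `A` plus its `N`-twist. The
first summand gives the projector over `A`, and by `relProj_spin` the second gives its conjugate by
`t ⊗ id`. -/
lemma relProj_fix : relProj (fixMod M) (fixMod N) ≫ (fixι M ⊗ₘ fixι N) =
    (fixι M ⊗ₘ fixι N) ≫ (relProj M.toMod N.toMod +
      M.t ▷ _ ≫ relProj M.toMod N.toMod ≫ M.t ▷ _) := by
  have h : M.t ▷ N.toMod.X ≫ relProj M.toMod N.toMod ≫ M.t ▷ N.toMod.X =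
      insertAct (copair A ≫ nak A ▷ A) (actFst M.toMod N.toMod.X) (actSnd M.toMod.X N.toMod) := by
    rw [relProj_spin M.isSpin, ← comp_whiskerRight_assoc, M.isSpin.invol]
    simp
  rw [h, relProj, twoActProj_map (actFst_fix M (fixι N)) (actSnd_fix N (fixι M)), copair_symm,
    insertAct_add]
  rfl

/-- Between invariants `t` disappears, so the two summands of `relProj_fix` coincide. This is the
origin of the factor `2` in `fixNu`. -/
lemma relProj_fixMod : relProj (fixMod M) (fixMod N) =
    (2 : k) • ((fixι M ⊗ₘ fixι N) ≫ relProj M.toMod N.toMod ≫ (fixπ M ⊗ₘ fixπ N)) := by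
  have h1 : (fixι M ⊗ₘ fixι N) ≫ M.t ▷ N.toMod.X = fixι M ⊗ₘ fixι N := by
    rw [← tensorHom_id, tensorHom_comp_tensorHom, fixι_t, Category.comp_id]
  have h2 : M.t ▷ N.toMod.X ≫ (fixπ M ⊗ₘ fixπ N) = fixπ M ⊗ₘ fixπ N := by
    rw [← tensorHom_id, tensorHom_comp_tensorHom, t_fixπ, Category.id_comp]
  have h := congr($(relProj_fix M N) ≫ (fixπ M ⊗ₘ fixπ N))
  rw [Category.assoc, tensorHom_comp_tensorHom, fixι_π, fixι_π, id_tensorHom_id,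
    Category.comp_id, Preadditive.comp_add, reassoc_of% h1, Preadditive.add_comp, Category.assoc,
    Category.assoc, Category.assoc, h2, ← two_smul k] at h
  exact h

lemma fix_balanced : actFst (fixMod M) (fixMod N).X ≫ (fixι M ⊗ₘ fixι N) ≫ M.proj N =
    actSnd (fixMod M).X (fixMod N) ≫ (fixι M ⊗ₘ fixι N) ≫ M.proj N := by
  rw [reassoc_of% (actFst_fix M (fixι N)), reassoc_of% (actSnd_fix N (fixι M)), M.actFst_proj,
    M.actSnd_proj]

lemma fix_proj_t : ((fixι M ⊗ₘ fixι N) ≫ M.proj N) ≫ (M.tensor N).t =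
    (fixι M ⊗ₘ fixι N) ≫ M.proj N := by
  rw [Category.assoc, M.proj_t, tensorHom_comp_tensorHom_assoc, fixι_t, fixι_t]

variable [IsHaploidNonsymmetric k A]

/-- The morphism underlying the tensorator of the functor of `t`-invariants. -/
noncomputable def fixMu : (relMod (fixMod M) (fixMod N)).X ⟶ (fixMod (M.tensor N)).X :=
  relDesc (((fixι M ⊗ₘ fixι N) ≫ M.proj N) ≫ fixπ (M.tensor N))

lemma π_fixMu : relπ _ _ ≫ fixMu M N =
    ((fixι M ⊗ₘ fixι N) ≫ M.proj N) ≫ fixπ (M.tensor N) :=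
  π_relDesc _ (by
    have := congr($(fix_balanced M N) ≫ fixπ (M.tensor N))
    simpa only [Category.assoc] using this)

lemma π_fixMu_ι : relπ _ _ ≫ fixMu M N ≫ fixι (M.tensor N) =
    (fixι M ⊗ₘ fixι N) ≫ M.proj N := by
  have h := fix_of_invariant _ (fix_proj_t M N)
  rw [Category.assoc] at h
  rw [reassoc_of% π_fixMu, h]

lemma fixMu_hom : act (relMod (fixMod M) (fixMod N)) ≫ fixMu M N =
    _ ◁ fixMu M N ≫ act (fixMod (M.tensor N)) :=
  relMod_hom_intertwine _ <| by
    rw [← cancel_mono (fixι (M.tensor N))]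
    simp only [Category.assoc, act_fixι', π_fixMu_ι]
    have h2 : _ ◁ (relπ (fixMod M) (fixMod N) ≫ fixMu M N) ≫
        (symmι k A ⊗ₘ fixι (M.tensor N)) = (symmι k A ⊗ₘ (fixι M ⊗ₘ fixι N)) ≫
          A ◁ M.proj N := by
      rw [← id_tensorHom, ← id_tensorHom, tensorHom_comp_tensorHom, tensorHom_comp_tensorHom,
        Category.assoc, π_fixMu_ι, Category.id_comp, Category.comp_id]
    rw [reassoc_of% h2, reassoc_of% (actFst_fix M (fixι N)), M.actFst_proj]

/-- The inverse of the tensorator. -/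
noncomputable def fixNu : (fixMod (M.tensor N)).X ⟶ (relMod (fixMod M) (fixMod N)).X :=
  (2 : k) • (fixι (M.tensor N) ≫ M.incl N ≫ (fixπ M ⊗ₘ fixπ N) ≫ relπ _ _)

/-- Composed with `relπ`, this is `relProj_fixMod`: twice the compressed projector over `A` is the
projector over the symmetric part. -/
lemma fixMu_Nu : fixMu M N ≫ fixNu M N = 𝟙 _ := by
  rw [← cancel_epi (relπ _ _), fixNu, Linear.comp_smul, Linear.comp_smul]
  have h := congr($(π_fixMu_ι M N) ≫ M.incl N ≫ (fixπ M ⊗ₘ fixπ N) ≫ relπ _ _)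
  simp only [Category.assoc] at h
  rw [h, reassoc_of% (M.proj_incl N)]
  have h2 := congr($(relProj_fixMod M N) ≫ relπ _ _)
  rw [Linear.smul_comp, Category.assoc, Category.assoc] at h2
  rw [← h2, ← relπ_ι, Category.assoc, relι_π]

/-- Between `incl` and `proj` the product of the averages of the two involutions is a quarter of `1
+ t ⊗ t' + t ⊗ 1 + 1 ⊗ t'`. The mixed terms vanish by `relι_spin_relπ`; the others give half of the
average on the tensor product, and that average is the identity on invariants. -/
lemma fixNu_Mu : fixNu M N ≫ fixMu M N = 𝟙 _ := by
  rw [← cancel_mono (fixι (M.tensor N)), fixNu, Linear.smul_comp, Linear.smul_comp]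
  simp only [Category.assoc, π_fixMu_ι, tensorHom_comp_tensorHom_assoc, fixπ_ι]
  -- The mixed term `1 ⊗ t'` is written as `t ⊗ 1` followed by `t ⊗ t'`, so that a single vanishing
  -- disposes of both mixed terms.
  have e : ((2 : k)⁻¹ • (𝟙 _ + M.t)) ⊗ₘ ((2 : k)⁻¹ • (𝟙 _ + N.t)) = (2 : k)⁻¹ • (2 : k)⁻¹ •
      (𝟙 _ + (M.t ⊗ₘ N.t) + (M.t ▷ N.toMod.X + M.t ▷ N.toMod.X ≫ (M.t ⊗ₘ N.t))) := by
    have e1 : M.t ▷ N.toMod.X ≫ (M.t ⊗ₘ N.t) = M.toMod.X ◁ N.t := by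
      rw [← tensorHom_id, tensorHom_comp_tensorHom, M.isSpin.invol]; simp
    rw [e1, MonoidalCategory.tensorHom_def]
    simp only [MonoidalLinear.smul_whiskerRight, MonoidalLinear.whiskerLeft_smul,
      MonoidalPreadditive.add_whiskerRight, MonoidalPreadditive.whiskerLeft_add,
      Linear.comp_smul, Linear.smul_comp, Preadditive.comp_add, Preadditive.add_comp,
      MonoidalCategory.tensorHom_def]
    simp
    abel
  have z := M.incl_t_proj N
  have hT : M.incl N ≫ (M.t ⊗ₘ N.t) ≫ M.proj N = (M.tensor N).t := by
    rw [← M.proj_t, reassoc_of% (M.incl_proj N)]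
  have hz : M.incl N ≫ M.t ▷ N.toMod.X ≫ (M.t ⊗ₘ N.t) ≫ M.proj N = 0 := by
    rw [← M.proj_t, reassoc_of% z]; simp
  rw [e]
  simp only [Linear.comp_smul, Linear.smul_comp, Preadditive.comp_add, Preadditive.add_comp,
    Category.assoc, z, hz, hT, Category.id_comp, M.incl_proj, fixι_t, Category.comp_id, add_zero]
  rw [two_smul_inv_two, inv_two_smul_add]

/-- The tensorator of the functor of `t`-invariants. -/
noncomputable def fixMuIso : relMod (fixMod M) (fixMod N) ≅ fixMod (M.tensor N) where
  hom := mkHom (fixMu M N) (fixMu_hom M N)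
  inv := mkHom (fixNu M N) (by
    have : IsIso (fixMu M N) := ⟨_, fixMu_Nu M N, fixNu_Mu M N⟩
    rw [← cancel_mono (fixMu M N), Category.assoc, Category.assoc, fixMu_hom,
      ← MonoidalCategory.whiskerLeft_comp_assoc, fixNu_Mu]
    simp)
  hom_inv_id := by ext; exact fixMu_Nu M N
  inv_hom_id := by ext; exact fixNu_Mu M N

end FixTensor

end SpinLine

namespace SpinLine

/-! ### The functor of invariants is braided monoidal and preserves twists. -/

section FixMonoidal
open HasTwist
variable {k : Type w} [Field k] [NeZero (2 : k)] {C : Type u} [Category.{v} C]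
  [MonoidalCategory C] [BraidedCategory C] [HasTwist C] [IsRibbon C] [Preadditive C] [Linear k C]
  [IsIdempotentComplete C] [MonoidalPreadditive C] [MonoidalLinear k C]
  {A : C} [MonObj A] [ComonObj A] [IsFrobenius A] [IsCommMonObj A] [IsDeltaSeparable A]

variable (k A) in
/-- The inclusion of the invariants of the Nakayama automorphism into `A`. -/
noncomputable def unitFixι : (fixMod (LSpin.unit k A)).X ⟶ A := fixι (LSpin.unit k A)

variable (k A) in
/-- The projection of `A` to the invariants of the Nakayama automorphism. -/
noncomputable def unitFixπ : A ⟶ (fixMod (LSpin.unit k A)).X := fixπ (LSpin.unit k A)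

lemma unitFixι_π : unitFixι k A ≫ unitFixπ k A = 𝟙 _ := fixι_π _

instance : IsSplitMono (unitFixι k A) := ⟨⟨⟨unitFixπ k A, unitFixι_π⟩⟩⟩

/-- Since `N` is the twist of `A`, the symmetric part and the invariants of the tensor unit split
the same idempotent; this is why `unitFix` is invertible. -/
lemma unitFixπ_ι : unitFixπ k A ≫ unitFixι k A = symmIdem k A := by
  rw [symmIdem, ← nak_eq_twist]
  exact fixπ_ι (LSpin.unit k A)

lemma unitFixι_twist : unitFixι k A ≫ twist A = unitFixι k A := by
  rw [← nak_eq_twist]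
  exact fixι_t (LSpin.unit k A)

lemma act_unitFix : act (fixMod (LSpin.unit k A)) ≫ unitFixι k A =
    (symmι k A ⊗ₘ unitFixι k A) ≫ μ[A] := act_fixι' (LSpin.unit k A)

variable (k A) in
/-- The unit isomorphism of the functor of `t`-invariants. -/
noncomputable def unitFix : symmPart k A ⟶ (fixMod (LSpin.unit k A)).X :=
  symmι k A ≫ unitFixπ k A

lemma unitFix_ι : unitFix k A ≫ unitFixι k A = symmι k A := by
  rw [unitFix, Category.assoc, unitFixπ_ι, symmIdem_of_left _ _ (symmι_twist k A)]

lemma unitFix_symmπ : unitFix k A ≫ unitFixι k A ≫ symmπ k A = 𝟙 _ := by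
  rw [reassoc_of% unitFix_ι, symmι_π]

lemma symmπ_unitFix : (unitFixι k A ≫ symmπ k A) ≫ unitFix k A = 𝟙 _ := by
  rw [← cancel_mono (unitFixι k A), Category.assoc, unitFix_ι, Category.assoc, symmπ_ι,
    symmIdem_of_left _ _ unitFixι_twist, Category.id_comp]

lemma unitFix_hom : μ[symmPart k A] ≫ unitFix k A =
    _ ◁ unitFix k A ≫ act (fixMod (LSpin.unit k A)) := by
  rw [← cancel_mono (unitFixι k A), Category.assoc, unitFix_ι, Category.assoc, act_unitFix,
    ← id_tensorHom, tensorHom_comp_tensorHom_assoc, unitFix_ι, symm_mul]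
  simp only [Category.assoc, Category.id_comp]
  rw [symmπ_ι, ι_mul_idem]

variable (k A) in
/-- The unit isomorphism of the functor of `t`-invariants. -/
noncomputable def unitFixIso : Mod.regular (symmPart k A) ≅ fixMod (LSpin.unit k A) where
  hom := mkHom (M := Mod.regular (symmPart k A)) (unitFix k A) unitFix_hom
  inv := mkHom (N := Mod.regular (symmPart k A)) (unitFixι k A ≫ symmπ k A) (by
    have : IsIso (unitFix k A) := ⟨_, unitFix_symmπ, symmπ_unitFix⟩
    have h := symmπ_unitFix (k := k) (A := A)
    rw [Category.assoc] at h
    change act (fixMod (LSpin.unit k A)) ≫ (unitFixι k A ≫ symmπ k A) =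
      symmPart k A ◁ (unitFixι k A ≫ symmπ k A) ≫ μ[symmPart k A]
    rw [← cancel_mono (unitFix k A), Category.assoc, Category.assoc, Category.assoc, unitFix_hom,
      ← MonoidalCategory.whiskerLeft_comp_assoc, symmπ_unitFix, h]
    simp)
  hom_inv_id := by ext; exact unitFix_symmπ
  inv_hom_id := by ext; exact symmπ_unitFix

namespace LSpin

/-- The associator. -/
noncomputable def assoc (M N P : LSpin k A) : (M.tensor N).tensor P ⟶ M.tensor (N.tensor P) :=
  (α_ M N P).hom

/-- The left unitor. -/
noncomputable def lam (M : LSpin k A) : (unit k A).tensor M ⟶ M := (λ_ M).hom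

/-- The right unitor. -/
noncomputable def rho (M : LSpin k A) : M.tensor (unit k A) ⟶ M := (ρ_ M).hom

lemma proj_assoc (M N P : LSpin k A) :
    M.proj N ▷ P.toMod.X ≫ (M.tensor N).proj P ≫ (assoc M N P).hom.hom =
      (α_ _ _ _).hom ≫ M.toMod.X ◁ N.proj P ≫ M.proj (N.tensor P) :=
  (Category.assoc _ _ _).symm.trans (π₃'_assoc M.toMod N.toMod P.toMod)

lemma proj_tensorMap {M N M' N' : LSpin k A} (f : M ⟶ M') (g : N ⟶ N') :
    M.proj N ≫ (tensorMap f g).hom.hom = (f.hom.hom ⊗ₘ g.hom.hom) ≫ M'.proj N' :=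
  π_relMap f.hom g.hom

end LSpin

variable [IsHaploidNonsymmetric k A]

/-- As for the coherence laws below, both sides are compared after the projection `relπ` and before
the inclusion `fixι`. There `π_fixMu_ι` replaces the tensorator by the projection over `A`, and the
claim becomes the corresponding property in `L^spin_A`. -/
lemma fixMu_natural {M N M' N' : LSpin k A} (f : M ⟶ M') (g : N ⟶ N') :
    relMap (fixMap f) (fixMap g) ≫ (fixMuIso M' N').hom =
      (fixMuIso M N).hom ≫ fixMap (LSpin.tensorMap f g) := by
  refine rel_hom_ext ?_
  rw [← cancel_mono (fixι _)]
  change (relπ _ _ ≫ (relMap _ _).hom ≫ fixMu M' N') ≫ fixι _ =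
    (relπ _ _ ≫ fixMu M N ≫ (fixMap _).hom) ≫ fixι _
  simp only [Category.assoc]
  rw [reassoc_of% (π_relMap (fixMap f) (fixMap g)), π_fixMu_ι, fixMap_ι, reassoc_of% (π_fixMu_ι M N),
    LSpin.proj_tensorMap, tensorHom_comp_tensorHom_assoc, tensorHom_comp_tensorHom_assoc,
    fixMap_ι, fixMap_ι]

lemma fixMu_assoc (M N P : LSpin k A) :
    relMap (fixMuIso M N).hom (𝟙 (fixMod P)) ≫ (fixMuIso (M.tensor N) P).hom ≫
      fixMap (LSpin.assoc M N P) =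
    (relAssocIso (fixMod M) (fixMod N) (fixMod P)).hom ≫
      relMap (𝟙 (fixMod M)) (fixMuIso N P).hom ≫ (fixMuIso M (N.tensor P)).hom := by
  refine rel_hom_ext₃ ?_
  rw [← cancel_mono (fixι _)]
  change (π₃' _ _ _ ≫ (relMap _ _).hom ≫ fixMu (M.tensor N) P ≫ (fixMap _).hom) ≫ fixι _ =
    (π₃' _ _ _ ≫ (relAssocIso _ _ _).hom.hom ≫ (relMap _ _).hom ≫ fixMu M (N.tensor P)) ≫ fixι _
  simp only [Category.assoc]
  rw [reassoc_of% π₃'_assoc, π₃', π₃, Category.assoc, Category.assoc, reassoc_of% π_relMap,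
    reassoc_of% π_relMap, fixMap_ι, reassoc_of% (π_fixMu_ι (M.tensor N) P), π_fixMu_ι]
  have h1 : relπ (fixMod M) (fixMod N) ▷ (fixMod P).X ≫
      ((fixMuIso M N).hom.hom ⊗ₘ (𝟙 (fixMod P) : fixMod P ⟶ fixMod P).hom) ≫
        (fixι (M.tensor N) ⊗ₘ fixι P) =
      ((fixι M ⊗ₘ fixι N) ⊗ₘ fixι P) ≫ M.proj N ▷ P.toMod.X := by
    rw [Mod.id_hom', ← tensorHom_id, tensorHom_comp_tensorHom, tensorHom_comp_tensorHom]
    change (relπ _ _ ≫ fixMu M N ≫ _) ⊗ₘ _ = _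
    rw [π_fixMu_ι, ← tensorHom_id, tensorHom_comp_tensorHom]
    simp
  have h2 : (fixMod M).X ◁ relπ (fixMod N) (fixMod P) ≫
      ((𝟙 (fixMod M) : fixMod M ⟶ fixMod M).hom ⊗ₘ (fixMuIso N P).hom.hom) ≫
        (fixι M ⊗ₘ fixι (N.tensor P)) =
      (fixι M ⊗ₘ (fixι N ⊗ₘ fixι P)) ≫ M.toMod.X ◁ N.proj P := by
    rw [Mod.id_hom', ← id_tensorHom, tensorHom_comp_tensorHom, tensorHom_comp_tensorHom]
    change _ ⊗ₘ (relπ _ _ ≫ fixMu N P ≫ _) = _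
    rw [π_fixMu_ι, ← id_tensorHom, tensorHom_comp_tensorHom]
    simp
  rw [reassoc_of% h1, reassoc_of% h2, LSpin.proj_assoc, associator_naturality_assoc]

lemma fix_left_unit (M : LSpin k A) : relLam (fixMod M) =
    relMap (unitFixIso k A).hom (𝟙 (fixMod M)) ≫ (fixMuIso (LSpin.unit k A) M).hom ≫
      fixMap (LSpin.lam M) := by
  refine rel_hom_ext ?_
  rw [← cancel_mono (fixι _)]
  have h : (LSpin.unit k A).proj M ≫ (LSpin.lam M).hom.hom = act M.toMod := π_relLam M.toMod
  have h1 : relπ (fixMod (LSpin.unit k A)) (fixMod M) ≫ fixMu (LSpin.unit k A) M ≫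
      (fixMap (LSpin.lam M)).hom ≫ fixι M = (unitFixι k A ⊗ₘ fixι M) ≫ act M.toMod := by
    rw [fixMap_ι, reassoc_of% (π_fixMu_ι (LSpin.unit k A) M)]
    exact congrArg (fun x => (fixι (LSpin.unit k A) ⊗ₘ fixι M) ≫ x) h
  have h2 : homFrom (unitFixIso k A).hom = unitFix k A := rfl
  change (lamπ (fixMod M) ≫ (relLam (fixMod M)).hom) ≫ fixι M =
    (lamπ (fixMod M) ≫ (relMap _ _).hom ≫ fixMu _ _ ≫ (fixMap _).hom) ≫ fixι M
  rw [lamπ_relLam, act_fixι', Category.assoc, Category.assoc, Category.assoc,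
    reassoc_of% (lamπ_relMap (unitFixIso k A).hom (fixMod M)), h1, h2, ← tensorHom_id,
    tensorHom_comp_tensorHom_assoc, unitFix_ι, Category.id_comp]

lemma fix_right_unit (M : LSpin k A) : relRho (fixMod M) =
    relMap (𝟙 (fixMod M)) (unitFixIso k A).hom ≫ (fixMuIso M (LSpin.unit k A)).hom ≫
      fixMap (LSpin.rho M) := by
  refine rel_hom_ext ?_
  rw [← cancel_mono (fixι _)]
  have h : M.proj (LSpin.unit k A) ≫ (LSpin.rho M).hom.hom = ract M.toMod := π_relRho M.toMod
  have h1 : relπ (fixMod M) (fixMod (LSpin.unit k A)) ≫ fixMu M (LSpin.unit k A) ≫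
      (fixMap (LSpin.rho M)).hom ≫ fixι M = (fixι M ⊗ₘ unitFixι k A) ≫ ract M.toMod := by
    rw [fixMap_ι, reassoc_of% (π_fixMu_ι M (LSpin.unit k A))]
    exact congrArg (fun x => (fixι M ⊗ₘ fixι (LSpin.unit k A)) ≫ x) h
  have h2 : homFrom (unitFixIso k A).hom = unitFix k A := rfl
  have h3 : ract (fixMod M) ≫ fixι M = (fixι M ⊗ₘ symmι k A) ≫ ract M.toMod := by
    rw [ract, ract, Category.assoc, act_fixι', BraidedCategory.braiding_inv_naturality_assoc]
  change (rhoπ (fixMod M) ≫ (relRho (fixMod M)).hom) ≫ fixι M =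
    (rhoπ (fixMod M) ≫ (relMap _ _).hom ≫ fixMu _ _ ≫ (fixMap _).hom) ≫ fixι M
  rw [rhoπ_relRho, h3, Category.assoc, Category.assoc, Category.assoc,
    reassoc_of% (rhoπ_relMap (unitFixIso k A).hom (fixMod M)), h1, h2, ← id_tensorHom,
    tensorHom_comp_tensorHom_assoc, unitFix_ι, Category.id_comp]

/-- The sign map applies `t` to the factor `N` when `M` is odd. On invariants of `N` this is the
identity, so only the plain braiding is left. -/
lemma fixMu_braid (M N : LSpin k A) :
    (fixMuIso M N).hom ≫ fixMap (LSpin.braid M N).hom =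
      (relBraidIso (IsLocal.isGrading (isLocal_fixMod M)) (isSpinMap_one (fixMod N))).hom ≫
        (fixMuIso N M).hom := by
  refine rel_hom_ext ?_
  rw [← cancel_mono (fixι _)]
  have h : M.proj N ≫ (LSpin.braid M N).hom.hom.hom =
      sbraid M.toMod N.toMod (evenProj M.toMod) N.t ≫ N.proj M :=
    π_relBraid M.isGrading N.isSpin
  have h1 := π_relBraid (IsLocal.isGrading (isLocal_fixMod M)) (isSpinMap_one (fixMod N))
  change (relπ _ _ ≫ fixMu M N ≫ (fixMap _).hom) ≫ fixι (N.tensor M) =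
    (relπ _ _ ≫ relBraid _ _ _ _ ≫ fixMu N M) ≫ fixι (N.tensor M)
  simp only [Category.assoc]
  rw [reassoc_of% h1, fixMap_ι, reassoc_of% (π_fixMu_ι M N), h, π_fixMu_ι, sbraid, sbraid, sgn_one]
  have h2 : (fixι N ⊗ₘ fixι M) ≫ sgn M.toMod N.toMod (evenProj M.toMod) N.t =
      fixι N ⊗ₘ fixι M := by
    have h3 : (fixι N ⊗ₘ fixι M) ≫ N.t ▷ M.toMod.X = fixι N ⊗ₘ fixι M := by
      rw [← tensorHom_id, tensorHom_comp_tensorHom, fixι_t, Category.comp_id]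
    rw [sgn, Preadditive.comp_add, reassoc_of% h3, ← Preadditive.comp_add,
      ← MonoidalPreadditive.whiskerLeft_add]
    simp
  simp only [Category.assoc, Category.comp_id, BraidedCategory.braiding_naturality_assoc]
  rw [reassoc_of% h2]

/-- On invariants `t` is the identity, so its powers in the twist of `L^spin_A` drop out on even and
odd summands alike. -/
lemma fix_twist (M : LSpin k A) : fixMap (twist M) =
    (twist (C := LocMod (symmPart k A)) ⟨fixMod M, isLocal_fixMod M⟩).hom := by
  refine fix_hom_ext ?_
  rw [fixMap_ι]
  change fixι M ≫ (evenProj M.toMod ≫ M.t + (𝟙 _ - evenProj M.toMod)) ≫ twist M.toMod.X =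
    twist (fixMod M).X ≫ fixι M
  have h : fixι M ≫ (evenProj M.toMod ≫ M.t + (𝟙 _ - evenProj M.toMod)) = fixι M := by
    rw [evenProj_spin M.isSpin, Preadditive.comp_add, reassoc_of% (fixι_t M), ← Preadditive.comp_add]
    simp
  rw [reassoc_of% h, twist_nat]

/-- The monoidal structure on the functor of `t`-invariants. -/
noncomputable def fixCore (k : Type w) [Field k] [NeZero (2 : k)] {C : Type u} [Category.{v} C]
    [MonoidalCategory C] [BraidedCategory C] [HasTwist C] [IsRibbon C] [Preadditive C] [Linear k C]
    [IsIdempotentComplete C] [MonoidalPreadditive C] [MonoidalLinear k C]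
    (A : C) [MonObj A] [ComonObj A] [IsFrobenius A] [IsCommMonObj A]
    [IsDeltaSeparable A] [IsHaploidNonsymmetric k A] : (fixFunctor k A).CoreMonoidal where
  εIso := (localModules (symmPart k A)).isoMk (unitFixIso k A)
  μIso M N := (localModules (symmPart k A)).isoMk (fixMuIso M N)
  μIso_hom_natural_left f X := ObjectProperty.hom_ext _ <| by
    have h := fixMu_natural f (𝟙 X)
    rw [show fixMap (𝟙 X) = 𝟙 (fixMod X) from
      congrArg (·.hom) ((fixFunctor k A).map_id X)] at h
    exact h
  μIso_hom_natural_right X f := ObjectProperty.hom_ext _ <| by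
    have h := fixMu_natural (𝟙 X) f
    rw [show fixMap (𝟙 X) = 𝟙 (fixMod X) from
      congrArg (·.hom) ((fixFunctor k A).map_id X)] at h
    exact h
  associativity M N P := ObjectProperty.hom_ext _ (fixMu_assoc M N P)
  left_unitality M := ObjectProperty.hom_ext _ (fix_left_unit M)
  right_unitality M := ObjectProperty.hom_ext _ (fix_right_unit M)

lemma fixFunctor_braided : Nonempty (fixFunctor k A).Braided := by
  let _ := (fixCore k A).toMonoidal
  exact ⟨{ braided := fun M N => ObjectProperty.hom_ext _ (fixMu_braid M N) }⟩

end FixMonoidal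

end SpinLine

namespace SpinLine

/-! ### Extension of morphisms to induced modules. -/

section Extend
variable {C : Type u} [Category.{v} C] [MonoidalCategory C] {A : C} [MonObj A]

/-- The morphism `A ⊗ X ⟶ M` of modules induced by `X ⟶ M`. -/
def extend {M : Modl A} {X : C} (f : X ⟶ M.X) : A ⊗ X ⟶ M.X := A ◁ f ≫ act M

lemma mul_extend {M : Modl A} {X : C} (f : X ⟶ M.X) :
    (α_ A A X).inv ≫ μ[A] ▷ X ≫ extend f = A ◁ extend f ≫ act M := by
  rw [extend, ← whisker_exchange_assoc, mul_act]
  simp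

lemma one_extend {M : Modl A} {X : C} (f : X ⟶ M.X) :
    (λ_ X).inv ≫ η[A] ▷ X ≫ extend f = f := by
  rw [extend, ← whisker_exchange_assoc, one_act]
  simp

end Extend

/-! ### The functor of invariants is full and faithful. -/

section FixFull
open HasTwist
variable {k : Type w} [Field k] [NeZero (2 : k)] {C : Type u} [Category.{v} C]
  [MonoidalCategory C] [BraidedCategory C] [HasTwist C] [IsRibbon C] [Preadditive C] [Linear k C]
  [IsIdempotentComplete C] [MonoidalPreadditive C] [MonoidalLinear k C]
  {A : C} [MonObj A] [ComonObj A] [IsFrobenius A] [IsCommMonObj A] [IsDeltaSeparable A]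

/-- Semilinearity `t(a · m) = N(a) · t(m)`, applied to elements with `t(m) = m`. -/
lemma nak_extend {M : Modl A} {X : C} {t : M.X ⟶ M.X} (ht : IsSpinMap M t) (f : X ⟶ M.X)
    (hf : f ≫ t = f) : nak A ▷ X ≫ extend f = extend f ≫ t := by
  rw [extend, Category.assoc, ht.act_t, MonoidalCategory.tensorHom_def',
    Category.assoc, ← MonoidalCategory.whiskerLeft_comp_assoc, hf, whisker_exchange_assoc]

variable (M : LSpin k A)

/-- A section of the morphism `A ⊗ X ⟶ M`, for `X` the `t`-invariants of `M`. -/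
noncomputable def fixSec : M.toMod.X ⟶ A ⊗ (fixMod M).X :=
  (2 : k) • (TwoActions.sec (act M.toMod) ≫ A ◁ fixπ M)

variable [IsHaploidNonsymmetric k A]

/-- The factor `2` turns the average over `t` into `1 + t`. The term with `1` is the identity by
`Δ`-separability; in the term with `t`, semilinearity moves `N` onto the copairing and
`copair_nak_mul` makes it zero. So `M` is generated over `A` by its invariants. -/
lemma fixSec_extend : fixSec M ≫ extend (fixι M) = 𝟙 _ := by
  have h1 : TwoActions.sec (act M.toMod) ≫ act M.toMod = 𝟙 _ := by
    rw [TwoActions.sec]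
    simp only [Category.assoc]
    rw [← mul_act, ← comp_whiskerRight_assoc, copair_mul, one_act]
    simp
  have h2 : TwoActions.sec (act M.toMod) ≫ A ◁ M.t ≫ act M.toMod = 0 := by
    have h3 : A ◁ M.t ≫ act M.toMod = nak A ▷ _ ≫ act M.toMod ≫ M.t := by
      rw [M.isSpin.act_t, MonoidalCategory.tensorHom_def, Category.assoc,
        ← comp_whiskerRight_assoc, nak_nak]
      simp
    have h4 := congr($(copair_nak_mul k A) ▷ M.toMod.X ≫ act M.toMod ≫ M.t)
    simp only [comp_whiskerRight, Category.assoc, MonoidalPreadditive.zero_whiskerRight,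
      Limits.zero_comp] at h4
    rw [reassoc_of% (mul_act M.toMod), associator_naturality_left_assoc] at h4
    rw [h3, TwoActions.sec]
    simp only [Category.assoc]
    rw [whisker_exchange_assoc, h4]
    simp
  rw [fixSec, extend, Linear.smul_comp, Category.assoc, ← MonoidalCategory.whiskerLeft_comp_assoc,
    fixπ_ι, MonoidalLinear.whiskerLeft_smul, MonoidalPreadditive.whiskerLeft_add, Linear.smul_comp,
    Linear.comp_smul, two_smul_inv_two, Preadditive.add_comp, Preadditive.comp_add, h2,
    MonoidalCategory.whiskerLeft_id, Category.id_comp, h1, add_zero]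

instance : IsSplitEpi (extend (fixι M)) := ⟨⟨⟨fixSec M, fixSec_extend M⟩⟩⟩

/-- The `t`-invariant part of `a · m` for invariant `m` only depends on the invariant part of
`a`. -/
lemma extend_fixπ : extend (fixι M) ≫ fixπ M = symmπ k A ▷ _ ≫ act (fixMod M) := by
  -- By `nak_extend`, averaging a product `a · m` with invariant `m` over `t` amounts to averaging
  -- `a` over `N`.
  have h : symmIdem k A ▷ _ ≫ extend (fixι M) = extend (fixι M) ≫ fixπ M ≫ fixι M := by
    rw [fixπ_ι, symmIdem, ← nak_eq_twist, MonoidalLinear.smul_whiskerRight,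
      MonoidalPreadditive.add_whiskerRight, Linear.smul_comp, Preadditive.add_comp,
      nak_extend M.isSpin _ (fixι_t M), Linear.comp_smul, Preadditive.comp_add]
    simp
  rw [← cancel_mono (fixι M), Category.assoc, ← h, Category.assoc, act_fixι,
    ← whisker_exchange_assoc, ← comp_whiskerRight_assoc, symmπ_ι, extend, whisker_exchange_assoc]

/-- Since `fixSec` is only one choice of section, this says that the morphism built from it does not
depend on the choice: extending `h` respects the relations among the generators of `M`. By linearity
of `TwoActions.sec` and `extend_fixπ` the left side is the extension of `h` preceded by `2 μ ∘ (id ⊗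
(1 + θ)/2) ∘ Δ`, which is the identity. -/
lemma extend_sec (N : LSpin k A) (h : fixMod M ⟶ fixMod N) :
    extend (fixι M) ≫ fixSec M ≫ extend (h.hom ≫ fixι N) = extend (h.hom ≫ fixι N) := by
  have e1 : extend (fixι M) ≫ TwoActions.sec (act M.toMod) =
      Δ[A] ▷ _ ≫ (α_ _ _ _).hom ≫ A ◁ extend (fixι M) := by
    rw [extend, Category.assoc, act_sec, whisker_exchange_assoc,
      associator_naturality_right_assoc, ← MonoidalCategory.whiskerLeft_comp]
  have e2 : extend (fixι M) ≫ fixπ M ≫ h.hom ≫ fixι N =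
      symmIdem k A ▷ _ ≫ extend (h.hom ≫ fixι N) := by
    rw [reassoc_of% (extend_fixπ M), ← symmπ_ι, comp_whiskerRight, Category.assoc,
      reassoc_of% (act_hom h), act_fixι, extend, ← MonoidalCategory.whiskerLeft_comp_assoc,
      whisker_exchange_assoc]
  have e2' : A ◁ extend (fixι M) ≫ A ◁ fixπ M ≫ extend (h.hom ≫ fixι N) =
      A ◁ symmIdem k A ▷ _ ≫ A ◁ extend (h.hom ≫ fixι N) ≫ act N.toMod := by
    calc _ = A ◁ (extend (fixι M) ≫ fixπ M ≫ h.hom ≫ fixι N) ≫ act N.toMod := by simp [extend]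
      _ = _ := by rw [e2, MonoidalCategory.whiskerLeft_comp_assoc]
  have e3 : Δ[A] ≫ A ◁ symmIdem k A ≫ μ[A] = (2 : k)⁻¹ • 𝟙 A := by
    -- The vanishing is known with `θ` on the first leg; precomposing with `θ` moves it to the
    -- second, because `θ` is comultiplicative and an involution.
    have h0 : Δ[A] ≫ A ◁ twist A ≫ μ[A] = 0 := by
      have h1 : twist A ≫ Δ[A] ≫ twist A ▷ A ≫ μ[A] = Δ[A] ≫ A ◁ twist A ≫ μ[A] := by
        rw [← reassoc_of% (comul_twist A), MonoidalCategory.tensorHom_def', Category.assoc,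
          ← comp_whiskerRight_assoc, twist_twist]
        simp
      rw [← h1, ← nak_eq_twist, comul_nak_mul k A, Limits.comp_zero]
    rw [symmIdem, MonoidalLinear.whiskerLeft_smul, MonoidalPreadditive.whiskerLeft_add,
      Linear.smul_comp, Preadditive.add_comp, Linear.comp_smul, Preadditive.comp_add, h0]
    simp [IsDeltaSeparable.comul_mul]
  have e4 := congr($e3 ▷ _ ≫ extend (h.hom ≫ fixι N))
  have e5 := mul_extend (h.hom ≫ fixι N)
  rw [Iso.inv_comp_eq] at e5
  simp only [comp_whiskerRight, Category.assoc] at e4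
  rw [e5] at e4
  rw [fixSec, Linear.smul_comp, Linear.comp_smul, Category.assoc, reassoc_of% e1, e2',
    ← associator_naturality_middle_assoc, e4, MonoidalLinear.smul_whiskerRight, Linear.smul_comp,
    two_smul_inv_two]
  simp

/-- A linear map is determined on the invariants, since they generate: `extend (fixι M)` is a split
epimorphism. -/
instance : (fixFunctor k A).Faithful where
  map_injective {M N} f g hfg := by
    have h1 : fixMap f = fixMap g := congrArg (·.hom) hfg
    have h2 : fixι M ≫ f.hom.hom = fixι M ≫ g.hom.hom := by rw [← fixMap_ι, ← fixMap_ι, h1]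
    refine LSpin.hom_ext (Mod.hom_ext _ _ ?_)
    rw [← cancel_epi (extend (fixι M)), extend, Category.assoc, Category.assoc, act_hom, act_hom,
      ← MonoidalCategory.whiskerLeft_comp_assoc, ← MonoidalCategory.whiskerLeft_comp_assoc, h2]

instance : (fixFunctor k A).Full where
  map_surjective {M N} h' := by
    let h : fixMod M ⟶ fixMod N := h'.hom
    -- The extension of `h` to `A ⊗ (invariants)`, descended to `M` along the section. Linearity and
    -- compatibility with `t` are tested after the epimorphism `extend (fixι M)`, where `hf` makes
    -- them properties of the extension.
    let f : M.toMod.X ⟶ N.toMod.X := fixSec M ≫ extend (h.hom ≫ fixι N)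
    have hf : extend (fixι M) ≫ f = extend (h.hom ≫ fixι N) := extend_sec M N h
    have hlin : act M.toMod ≫ f = A ◁ f ≫ act N.toMod := by
      rw [← cancel_epi (A ◁ extend (fixι M)), ← reassoc_of% (mul_extend (fixι M)), hf, mul_extend,
        ← MonoidalCategory.whiskerLeft_comp_assoc, hf]
    have ht : M.t ≫ f = f ≫ N.t := by
      rw [← cancel_epi (extend (fixι M)), ← Category.assoc, ← nak_extend M.isSpin _ (fixι_t M),
        Category.assoc, hf, nak_extend N.isSpin _ (by rw [Category.assoc, fixι_t]),
        reassoc_of% hf]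
    have hι : fixι M ≫ f = h.hom ≫ fixι N := by
      have := congr((λ_ _).inv ≫ η[A] ▷ _ ≫ $hf)
      rwa [one_extend, reassoc_of% (one_extend (fixι M))] at this
    refine ⟨⟨mkHom f hlin, ht⟩, ObjectProperty.hom_ext _ (fix_hom_ext ?_)⟩
    exact (fixMap_ι _).trans hι

end FixFull

end SpinLine

namespace SpinLine

/-! ### Induction of modules along a morphism of commutative algebras. -/

section Induction
variable {C : Type u} [Category.{v} C] [MonoidalCategory C] {A B : C} [MonObj A] [MonObj B]

lemma whiskerLeft_one_mul (Y : C) : A ◁ ((λ_ Y).inv ≫ η[A] ▷ Y) ≫ (α_ A A Y).inv ≫ μ[A] ▷ Y =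
    𝟙 (A ⊗ Y) := by
  rw [MonoidalCategory.whiskerLeft_comp, Category.assoc, associator_inv_naturality_middle_assoc,
    ← comp_whiskerRight, MonObj.mul_one]
  monoidal

/-- The action of `B` on `A ⊗ Y` through `j : B ⟶ A`. -/
def indFst (j : B ⟶ A) (Y : C) : B ⊗ (A ⊗ Y) ⟶ A ⊗ Y :=
  j ▷ (A ⊗ Y) ≫ (α_ _ _ _).inv ≫ μ[A] ▷ Y

lemma actFst_res (j : B ⟶ A) [IsMonHom j] (Y : C) :
    actFst (resMod j (Mod.regular A)) Y = indFst j Y := by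
  change (α_ _ _ _).inv ≫ (j ▷ A ≫ μ[A]) ▷ Y = _
  simp [indFst]

variable [ComonObj B]

/-- The morphism `N ⟶ A ⊗ N` that inserts the copairing of `B`, with one leg mapped to `A` and the
other one acting on `N`. -/
def indIncl (j : B ⟶ A) (N : Modl B) : N.X ⟶ A ⊗ N.X :=
  TwoActions.sec (act N) ≫ j ▷ N.X

variable [BraidedCategory C] [IsCommMonObj A]

/-- The projector with image `A ⊗_B N` is `a ⊗ n ↦ Σ a j(eᵢ) ⊗ eⁱ n`: commutativity of `A` lets the
first leg multiply from the right, and the copairing slides past `A`. In this form it is visibly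
linear over `A`. -/
lemma twoActProj_ind (j : B ⟶ A) (N : Modl B) :
    twoActProj (indFst j N.X) (slide A (act N)) = extend (M := freeMod A N.X) (indIncl j N) := by
  have e1 : indFst j N.X = (α_ _ _ _).inv ≫ (β_ B A).hom ▷ N.X ≫ (α_ _ _ _).hom ≫
      A ◁ j ▷ N.X ≫ (α_ _ _ _).inv ≫ μ[A] ▷ N.X := by
    have h : (β_ B A).hom ≫ A ◁ j ≫ μ[A] = j ▷ A ≫ μ[A] := by
      rw [← BraidedCategory.braiding_naturality_left_assoc, IsCommMonObj.mul_comm]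
    have h2 := congr((α_ _ _ _).inv ≫ $h ▷ N.X)
    simp only [comp_whiskerRight, Category.assoc] at h2
    rw [indFst, associator_inv_naturality_left_assoc, ← h2]
    simp
  -- Naturality of the braiding: the copairing is created to the right of `A` instead of to the
  -- left.
  have e2 : copair B ▷ A ≫ (β_ (B ⊗ B) A).hom = (λ_ A).hom ≫ (ρ_ A).inv ≫ A ◁ copair B := by
    rw [BraidedCategory.braiding_naturality_left, braiding_tensorUnit_left, Category.assoc]
  rw [BraidedCategory.braiding_tensor_left_hom] at e2
  have e3 := congr((λ_ (A ⊗ N.X)).inv ≫ (α_ _ _ _).inv ≫ $e2 ▷ N.X ≫ (α_ _ _ _).hom ≫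
    A ◁ ((α_ _ _ _).hom ≫ B ◁ act N ≫ j ▷ N.X) ≫ (α_ _ _ _).inv ≫ μ[A] ▷ N.X)
  change _ = A ◁ indIncl j N ≫ (α_ _ _ _).inv ≫ μ[A] ▷ N.X
  rw [indIncl, TwoActions.sec]
  refine Eq.trans ?_ (e3.trans ?_)
  · rw [twoActProj, e1, slide]
    simp only [comp_whiskerRight, Category.assoc, MonoidalCategory.whiskerLeft_comp]
    have e4 : B ◁ A ◁ act N ≫ (α_ _ _ _).inv ≫ (β_ B A).hom ▷ N.X ≫ (α_ _ _ _).hom =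
        (α_ _ _ _).inv ≫ (β_ B A).hom ▷ (B ⊗ N.X) ≫ (α_ _ _ _).hom ≫ A ◁ B ◁ act N := by
      rw [associator_inv_naturality_right_assoc, whisker_exchange_assoc,
        associator_naturality_right]
    rw [reassoc_of% e4]
    monoidal
  · simp only [comp_whiskerRight, Category.assoc, MonoidalCategory.whiskerLeft_comp]
    monoidal

variable [IsFrobenius B] [IsCommMonObj B] [IsDeltaSeparable B] (j : B ⟶ A) [IsMonHom j]
  (N : Modl B)

lemma twoActions_ind : TwoActions (indFst j N.X) (slide A (act N)) := by
  rw [← actFst_res]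
  exact twoActions (resMod j (Mod.regular A)) N

lemma relProj_ind : relProj (resMod j (Mod.regular A)) N =
    extend (M := freeMod A N.X) (indIncl j N) := by
  rw [relProj, actFst_res, ← twoActProj_ind]
  rfl

/-- The double braiding of `A` with itself drops out of the commutative product, and this pulls back
along `j`. -/
lemma isLocal_resMod_regular : IsLocal (resMod j (Mod.regular A)) := by
  change monodromy B A ≫ j ▷ A ≫ μ[A] = j ▷ A ≫ μ[A]
  have h : monodromy A A ≫ μ[A] = μ[A] := isLocal_regular
  rw [← reassoc_of% (monodromy_naturality_left j A), h]

/-- The properties of the splitting of the idempotent with image `A ⊗_B N`. -/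
structure IsInduced (M : Modl A) (i : M.X ⟶ A ⊗ N.X) (p : A ⊗ N.X ⟶ M.X) : Prop where
  incl_proj : i ≫ p = 𝟙 _
  proj_incl : p ≫ i = extend (M := freeMod A N.X) (indIncl j N)
  act_incl : act M ≫ i = A ◁ i ≫ (α_ _ _ _).inv ≫ μ[A] ▷ N.X
  act_proj : ((α_ _ _ _).inv ≫ μ[A] ▷ N.X) ≫ p = A ◁ p ≫ act M

/-- The projector is `A`-linear by `twoActProj_ind`, so it is split among `A`-modules; this gives `A
⊗_B N` an action of `A` and not only of `B`. -/
lemma exists_isInduced [IsIdempotentComplete C] : ∃ M i p, IsInduced j N M i p := by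
  obtain ⟨M, i, p, hip, hpi⟩ := exists_module_split (freeMod A N.X)
    (extend (M := freeMod A N.X) (indIncl j N)) (by
      rw [← twoActProj_ind]
      exact (twoActions_ind j N).proj_proj) (by
      have h := mul_extend (M := freeMod A N.X) (indIncl j N)
      rw [← Category.assoc] at h
      exact h)
  have h := congr(Mod.Hom.hom $hip)
  rw [Mod.comp_hom', Mod.id_hom'] at h
  exact ⟨M, i.hom, p.hom, h, hpi, act_hom i, act_hom p⟩

namespace IsInduced

variable {j N} {M : Modl A} {i : M.X ⟶ A ⊗ N.X} {p : A ⊗ N.X ⟶ M.X}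

lemma balanced (h : IsInduced j N M i p) : indFst j N.X ≫ p = slide A (act N) ≫ p := by
  have T := twoActions_ind j N
  have hp : p = twoActProj (indFst j N.X) (slide A (act N)) ≫ p := by
    rw [twoActProj_ind, ← h.proj_incl, Category.assoc, h.incl_proj, Category.comp_id]
  rw [hp, ← Category.assoc, ← Category.assoc, T.act₁_proj, T.act₂_proj]

/-- Over `B` the induced module and the relative tensor product of `A` with `N` split the same
projector. Both tensor factors are local over `B`, and locality passes to tensor products and
retracts. -/
lemma isLocal_resMod [IsIdempotentComplete C] (h : IsInduced j N M i p) (hN : IsLocal N) :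
    IsLocal (resMod j M) := by
  let R := resMod j (Mod.regular A)
  let πR : A ⊗ N.X ⟶ (relMod R N).X := relπ R N
  let ιR : (relMod R N).X ⟶ A ⊗ N.X := relι R N
  have hπι : πR ≫ ιR = extend (M := freeMod A N.X) (indIncl j N) :=
    (relπ_ι R N).trans (relProj_ind j N)
  have hact : B ◁ πR ≫ act (relMod R N) = indFst j N.X ≫ πR := by
    rw [← actFst_res]
    exact whisker_π_act R N
  have hpp : (p ≫ i) ≫ p = p := by rw [Category.assoc, h.incl_proj, Category.comp_id]
  have h1 : (j ▷ M.X ≫ act M) ≫ i ≫ πR = B ◁ (i ≫ πR) ≫ act (relMod R N) := by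
    rw [MonoidalCategory.whiskerLeft_comp, Category.assoc, Category.assoc, hact,
      reassoc_of% h.act_incl, indFst, ← whisker_exchange_assoc]
    simp only [Category.assoc]
  have h2 : act (relMod R N) ≫ ιR ≫ p = B ◁ (ιR ≫ p) ≫ j ▷ M.X ≫ act M := by
    refine relMod_hom_intertwine (M := R) (N := N) (Z := resMod j M) (ιR ≫ p) ?_
    have h3 : πR ≫ ιR ≫ p = p := by
      rw [reassoc_of% hπι, ← h.proj_incl, hpp]
    have h4 : indFst j N.X ≫ πR ≫ ιR ≫ p = B ◁ (πR ≫ ιR ≫ p) ≫ j ▷ M.X ≫ act M := by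
      have h5 := h.act_proj
      rw [Category.assoc] at h5
      rw [h3, whisker_exchange_assoc, ← h5, indFst]
      simp only [Category.assoc]
    exact (congrArg (fun x : B ⊗ (A ⊗ N.X) ⟶ A ⊗ N.X => x ≫ πR ≫ ιR ≫ p)
      (actFst_res j N.X)).trans h4
  refine (IsLocal.relMod (isLocal_resMod_regular j) hN).of_retract
    (mkHom (M := resMod j M) (i ≫ πR) h1) (mkHom (N := resMod j M) (ιR ≫ p) h2) ?_
  refine Mod.hom_ext _ _ ?_
  change (i ≫ πR) ≫ ιR ≫ p = 𝟙 M.X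
  rw [Category.assoc, reassoc_of% hπι, ← h.proj_incl, Category.assoc,
    reassoc_of% h.incl_proj, h.incl_proj]

/-- The canonical morphism `N ⟶ A ⊗_B N` is `B`-linear. -/
lemma act_unit (h : IsInduced j N M i p) :
    act N ≫ (λ_ N.X).inv ≫ η[A] ▷ N.X ≫ p = j ▷ N.X ≫ p := by
  have h1 := congr(B ◁ ((λ_ N.X).inv ≫ η[A] ▷ N.X) ≫ $h.balanced)
  have h2 : B ◁ ((λ_ N.X).inv ≫ η[A] ▷ N.X) ≫ slide A (act N) =
      act N ≫ (λ_ N.X).inv ≫ η[A] ▷ N.X := by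
    have h4 : B ◁ (λ_ N.X).inv ≫ slide (𝟙_ C) (act N) = act N ≫ (λ_ N.X).inv := by
      simp [slide, braiding_tensorUnit_right]
    rw [MonoidalCategory.whiskerLeft_comp, Category.assoc, whiskerRight_slide, reassoc_of% h4]
  have h3 : B ◁ ((λ_ N.X).inv ≫ η[A] ▷ N.X) ≫ indFst j N.X = j ▷ N.X := by
    rw [indFst, whisker_exchange_assoc, whiskerLeft_one_mul, Category.comp_id]
  rw [reassoc_of% h2, reassoc_of% h3] at h1
  simpa using h1.symm

lemma extend_unit (h : IsInduced j N M i p) :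
    extend ((λ_ N.X).inv ≫ η[A] ▷ N.X ≫ p) = p := by
  rw [← Category.assoc, extend, MonoidalCategory.whiskerLeft_comp, Category.assoc, ← h.act_proj,
    Category.assoc, reassoc_of% whiskerLeft_one_mul]

end IsInduced

end Induction

end SpinLine

namespace SpinLine

/-! ### Essential surjectivity of the functor of invariants, and the resulting ribbon equivalence.
-/

section EssSurj
open HasTwist
variable {k : Type w} [Field k] [NeZero (2 : k)] {C : Type u} [Category.{v} C]
  [MonoidalCategory C] [BraidedCategory C] [HasTwist C] [IsRibbon C] [Preadditive C] [Linear k C]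
  [IsIdempotentComplete C] [MonoidalPreadditive C] [MonoidalLinear k C]
  {A : C} [MonObj A] [ComonObj A] [IsFrobenius A] [IsCommMonObj A] [IsDeltaSeparable A]
  [IsHaploidNonsymmetric k A]

/-- An isomorphism of modules from an intertwiner that is an isomorphism. -/
def modIso {D : Type*} [Category* D] [MonoidalCategory D] {B : D} [MonObj B] {M N : Modl B}
    (f : M ⟶ N) (g : N.X ⟶ M.X) (h₁ : f.hom ≫ g = 𝟙 _) (h₂ : g ≫ f.hom = 𝟙 _) : M ≅ N where
  hom := f
  inv := mkHom g <| by
    have : IsIso f.hom := ⟨g, h₁, h₂⟩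
    rw [← cancel_mono f.hom, Category.assoc, Category.assoc, act_hom,
      ← MonoidalCategory.whiskerLeft_comp_assoc, h₂]
    simp
  hom_inv_id := Mod.hom_ext _ _ h₁
  inv_hom_id := Mod.hom_ext _ _ h₂

variable (k) in
-- Locality over the symmetric part, pulled back along the projection of `A` and doubled, says that
-- the action and the loop action agree after precomposition with `1 + N`. This is the hypothesis of
-- `isGrading_of_loop`.
lemma isNakayamaLocalSum_of_symm {M : Modl A} (h : IsLocal (resMod (symmι k A) M)) :
    IsNakayamaLocalSum M := by
  have h' : monodromy (symmPart k A) M.X ≫ symmι k A ▷ M.X ≫ act M = symmι k A ▷ M.X ≫ act M := h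
  rw [← reassoc_of% (monodromy_naturality_left (symmι k A))] at h'
  have h1 := congr((2 : k) • (symmπ k A ▷ M.X ≫ $h'))
  rw [← comp_whiskerRight_assoc, ← comp_whiskerRight_assoc, symmπ_ι, symmIdem, ← nak_eq_twist,
    MonoidalLinear.smul_whiskerRight, Linear.smul_comp, Linear.smul_comp, two_smul_inv_two,
    two_smul_inv_two] at h1
  refine (isGrading_of_loop k (M := M) ?_).isNakayamaLocalSum
  simpa [loopAct] using h1

section
variable {N : Modl (symmPart k A)} {M : Modl A} {i : M.X ⟶ A ⊗ N.X} {p : A ⊗ N.X ⟶ M.X}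

/-- `N ⊗ id` commutes with the projector `p ≫ i`, because the first leg inserted by `indIncl` lies
in the symmetric part, where `N` is the identity. Hence `N ⊗ id` descends to the induced module. -/
lemma IsInduced.proj_nak (h : IsInduced (symmι k A) N M i p) :
    p ≫ i ≫ nak A ▷ N.X ≫ p = nak A ▷ N.X ≫ p := by
  have h1 : indIncl (symmι k A) N ≫ nak A ▷ N.X = indIncl (symmι k A) N := by
    rw [indIncl, Category.assoc, ← comp_whiskerRight, symmι_nak]
  have h2 : nak A ▷ N.X ≫ p ≫ i = (p ≫ i) ≫ nak A ▷ N.X := by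
    rw [h.proj_incl]
    exact nak_extend (M := freeMod A N.X) (isSpinMap_freeMod A N.X) (indIncl (symmι k A) N) h1
  have h3 := congr($h2 ≫ p)
  simp only [Category.assoc] at h3
  rw [← h3, h.incl_proj, Category.comp_id]

lemma IsInduced.isSpinMap (h : IsInduced (symmι k A) N M i p) :
    IsSpinMap M (i ≫ nak A ▷ N.X ≫ p) where
  invol := by
    simp only [Category.assoc]
    rw [h.proj_nak, ← comp_whiskerRight_assoc, nak_nak, id_whiskerRight, Category.id_comp,
      h.incl_proj]
  act_t := by
    have h1 := (isSpinMap_freeMod A N.X).act_t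
    change ((α_ A A N.X).inv ≫ μ[A] ▷ N.X) ≫ nak A ▷ N.X =
      (nak A ⊗ₘ (nak A ▷ N.X)) ≫ (α_ A A N.X).inv ≫ μ[A] ▷ N.X at h1
    have h2 := congr(A ◁ i ≫ $h1 ≫ p)
    have h3 := h.act_proj
    simp only [Category.assoc] at h2 h3
    rw [reassoc_of% h.act_incl, h2, h3, MonoidalCategory.tensorHom_def,
      MonoidalCategory.tensorHom_def, Category.assoc, whisker_exchange_assoc]
    simp

/-- The object of `L^spin_A` induced from a local module over the symmetric part of `A`. -/
noncomputable def IsInduced.toSpin (h : IsInduced (symmι k A) N M i p) (hN : IsLocal N) : LSpin k A where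
  toMod := M
  isSum := isNakayamaLocalSum_of_symm k (h.isLocal_resMod hN)
  t := i ≫ nak A ▷ N.X ≫ p
  isSpin := h.isSpinMap

/-- The canonical isomorphism between a local module `N` and the invariants of the induced one. -/
noncomputable def IsInduced.fixIso (h : IsInduced (symmι k A) N M i p) (hN : IsLocal N) :
    N ≅ fixMod (h.toSpin hN) := by
  let L := h.toSpin hN
  let prj : M.X ⟶ (fixMod L).X := fixπ L
  let inc : (fixMod L).X ⟶ M.X := fixι L
  -- `u` is `n ↦ 1 ⊗ n`, while `v` projects the factor `A` to the symmetric part and lets it act on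
  -- `N`. They compose to the identity of `N` one way, and the other way to the idempotent that cuts
  -- out the invariants.
  let u : N.X ⟶ M.X := (λ_ N.X).inv ≫ η[A] ▷ N.X ≫ p
  let v : M.X ⟶ N.X := i ≫ symmπ k A ▷ N.X ≫ act N
  have hιπ : inc ≫ prj = 𝟙 _ := fixι_π L
  have hπι : prj ≫ inc = (2 : k)⁻¹ • (𝟙 _ + i ≫ nak A ▷ N.X ≫ p) := fixπ_ι L
  have hu : u ≫ i ≫ nak A ▷ N.X ≫ p = u := by
    simp only [u, Category.assoc]
    rw [h.proj_nak, ← comp_whiskerRight_assoc, nak_eq_twist, one_twist]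
  have huπ : u ≫ prj ≫ inc = u := fix_of_invariant (M := L) u hu
  have hau : act N ≫ u = symmPart k A ◁ u ≫ symmι k A ▷ M.X ≫ act M := by
    have h1 := h.extend_unit
    rw [extend] at h1
    rw [whisker_exchange_assoc, h.act_unit, h1]
  have huv : u ≫ v = 𝟙 _ := by
    have h1 := one_extend (M := freeMod A N.X) (indIncl (symmι k A) N)
    have h2 : (λ_ N.X).inv ≫ η[A] ▷ N.X ≫ p ≫ i = indIncl (symmι k A) N := by
      rw [h.proj_incl]
      exact h1
    simp only [u, v, Category.assoc]
    rw [reassoc_of% h2, indIncl, Category.assoc, ← comp_whiskerRight_assoc, symmι_π,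
      TwoActions.sec]
    simp only [Category.assoc, id_whiskerRight, Category.id_comp]
    rw [← mul_act, ← comp_whiskerRight_assoc, copair_mul, one_act]
    simp
  -- Inside `A ⊗_B N` the element of the symmetric part may act on `N` or multiply into `A`; so `v ≫
  -- u` is `(1 + N)/2` on the factor `A`, which is the average over `t`.
  have hvu : v ≫ u = prj ≫ inc := by
    have h1 : v ≫ u = i ≫ symmIdem k A ▷ N.X ≫ p := by
      simp only [v, Category.assoc]
      rw [h.act_unit, ← comp_whiskerRight_assoc, symmπ_ι]
    rw [h1, hπι, symmIdem, ← nak_eq_twist, MonoidalLinear.smul_whiskerRight,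
      MonoidalPreadditive.add_whiskerRight, Linear.smul_comp, Linear.comp_smul,
      Preadditive.add_comp, Preadditive.comp_add, id_whiskerRight, Category.id_comp, h.incl_proj]
  refine modIso (mkHom (u ≫ prj) ?_) (inc ≫ v) ?_ ?_
  · have h1 : symmι k A ▷ M.X ≫ act M ≫ prj = symmPart k A ◁ prj ≫ act (fixMod L) := act_fixπ L
    rw [reassoc_of% hau]
    refine (congrArg (fun x => symmPart k A ◁ u ≫ x) h1).trans ?_
    exact (MonoidalCategory.whiskerLeft_comp_assoc _ _ _ _).symm
  · change (u ≫ prj) ≫ inc ≫ v = 𝟙 _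
    rw [Category.assoc, reassoc_of% huπ, huv]
  · change (inc ≫ v) ≫ u ≫ prj = 𝟙 _
    rw [Category.assoc, reassoc_of% hvu, reassoc_of% hιπ, hιπ]

end

instance : (fixFunctor k A).EssSurj where
  mem_essImage N := by
    obtain ⟨M, i, p, h⟩ := exists_isInduced (symmι k A) N.obj
    exact ⟨h.toSpin N.property, ⟨(localModules _).isoMk (h.fixIso N.property).symm⟩⟩

variable (k A) in
lemma fixFunctor_isRibbonEquivalence : IsRibbonEquivalence k (fixFunctor k A) where
  isEquivalence := {}
  map_add {M N} f g := ObjectProperty.hom_ext _ <| fix_hom_ext <| by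
    change (fixMap (f + g)).hom ≫ fixι N = ((fixMap f).hom + (fixMap g).hom) ≫ fixι N
    rw [Preadditive.add_comp, fixMap_ι, fixMap_ι, fixMap_ι]
    exact Preadditive.comp_add _ _ _ _ _ _
  map_smul {M N} a f := ObjectProperty.hom_ext _ <| fix_hom_ext <| by
    change (fixMap (a • f)).hom ≫ fixι N = (a • (fixMap f).hom) ≫ fixι N
    rw [Linear.smul_comp, fixMap_ι, fixMap_ι]
    exact Linear.comp_smul _ _ _ _ _ _
  braided := fixFunctor_braided
  map_twist M := ObjectProperty.hom_ext _ (fix_twist M)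

/-- Transported back along `fixFunctor` from local modules over the symmetric part; no duals are
constructed in `L^spin_A` by hand. -/
instance : IsRibbon (LSpin k A) := (fixFunctor_isRibbonEquivalence k A).isRibbon

end EssSurj

end SpinLine

namespace SpinLine

/-! ### Composites and quasi-inverses of ribbon equivalences. -/

section Abstract
open Functor HasTwist

/-- With the monoidal structure obtained from the adjunction the counit is a monoidal isomorphism,
so the inverse followed by the functor is braided, being isomorphic to the identity. The functor is
braided and faithful, and can be cancelled. -/
lemma inverse_braided {C D : Type*} [Category* C] [Category* D]
    [MonoidalCategory C] [MonoidalCategory D] [BraidedCategory C] [BraidedCategory D]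
    (e : C ≌ D) [e.functor.Braided] : Nonempty e.inverse.Braided := by
  have hm : letI := e.toAdjunction.rightAdjointLaxMonoidal; e.toAdjunction.IsMonoidal :=
    inferInstance
  let m : e.inverse.Monoidal := e.inverseMonoidal
  have hm' : e.IsMonoidal := hm
  have : NatTrans.IsMonoidal e.counitIso.hom :=
    inferInstanceAs (NatTrans.IsMonoidal e.toAdjunction.counit)
  have : NatTrans.IsMonoidal e.counitIso.symm.hom :=
    inferInstanceAs (NatTrans.IsMonoidal e.counitIso.inv)
  let b : (e.inverse ⋙ e.functor).LaxBraided := .ofNatIso e.counitIso.symm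
  refine ⟨{ m with braided := fun X Y => e.functor.map_injective ?_ }⟩
  have h := b.braided X Y
  have h1 (X Y : D) : LaxMonoidal.μ (e.inverse ⋙ e.functor) X Y =
    LaxMonoidal.μ e.functor _ _ ≫ e.functor.map (LaxMonoidal.μ e.inverse X Y) := rfl
  change LaxMonoidal.μ (e.inverse ⋙ e.functor) X Y ≫ _ =
    _ ≫ LaxMonoidal.μ (e.inverse ⋙ e.functor) Y X at h
  rw [h1, h1] at h
  rw [← cancel_epi (LaxMonoidal.μ e.functor _ _)]
  simpa using h

variable {k : Type w} [Field k] {C D E : Type*} [Category* C] [Category* D] [Category* E]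
  [Preadditive C] [Preadditive D] [Preadditive E] [Linear k C] [Linear k D] [Linear k E]
  [MonoidalCategory C] [MonoidalCategory D] [MonoidalCategory E]
  [BraidedCategory C] [BraidedCategory D] [BraidedCategory E] [HasTwist C] [HasTwist D] [HasTwist E]

lemma IsRibbonEquivalence.comp {F : C ⥤ D} {G : D ⥤ E} (hF : IsRibbonEquivalence k F)
    (hG : IsRibbonEquivalence k G) : IsRibbonEquivalence k (F ⋙ G) where
  isEquivalence :=
    have := hF.isEquivalence
    have := hG.isEquivalence
    inferInstance
  map_add f g := by simp [hF.map_add, hG.map_add]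
  map_smul a f := by simp [hF.map_smul, hG.map_smul]
  braided :=
    let := hF.braided.some
    let := hG.braided.some
    ⟨inferInstance⟩
  map_twist X := by simp [hF.map_twist, hG.map_twist]

/-- A quasi-inverse of a ribbon equivalence is a ribbon equivalence. -/
lemma IsRibbonEquivalence.of_comp_iso_id [IsRibbon C] {F : D ⥤ C} (hF : IsRibbonEquivalence k F)
    {U : C ⥤ D} (i : U ⋙ F ≅ 𝟭 C) : IsRibbonEquivalence k U := by
  have := hF.isEquivalence
  -- Up to the isomorphism `i` the composite `U ⋙ F` is the identity, and `F` is faithful;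
  -- identities for `U` are checked after applying `F`.
  have hm {X Y : C} (f : X ⟶ Y) : F.map (U.map f) = i.hom.app X ≫ f ≫ i.inv.app Y := by
    have := i.hom.naturality f
    rw [← Category.assoc, ← CategoryTheory.Iso.app_inv, Iso.eq_comp_inv]
    exact this
  have j : F.inv ≅ U := (isoWhiskerRight i F.inv).symm ≪≫ associator _ _ _ ≪≫
    isoWhiskerLeft U F.asEquivalence.unitIso.symm
  refine ⟨isEquivalence_of_iso j, fun f g => F.map_injective ?_, fun a f => F.map_injective ?_, ?_,
    fun X => F.map_injective ?_⟩
  · rw [hF.map_add, hm, hm, hm, Preadditive.add_comp, Preadditive.comp_add]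
  · rw [hF.map_smul, hm, hm, Linear.smul_comp, Linear.comp_smul]
  -- The braided structure of the inverse of `F` is transported to `U` along `j`.
  · let : F.asEquivalence.functor.Braided := hF.braided.some
    let : F.asEquivalence.inverse.Braided :=
      (inverse_braided F.asEquivalence).some
    let j' : F.asEquivalence.inverse ≅ U := j
    let m : U.Monoidal := Monoidal.transport j'
    have := Monoidal.natTransIsMonoidal_of_transport j'
    let b : U.LaxBraided := .ofNatIso j'
    exact ⟨{ m with braided := b.braided }⟩
  · rw [hm, hF.map_twist]
    -- Conjugation by `i` preserves the twist because the twist of `C` is natural.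
    have := twist_nat (i.inv.app X)
    change _ ≫ twist ((U ⋙ F).obj X) = twist X ≫ _ at this
    rw [← this]
    exact i.hom_inv_id_app_assoc X _

end Abstract

/-! ### Local modules over an algebra whose unit is an isomorphism. -/

section ForgetLocal
open HasTwist
variable {C : Type u} [Category.{v} C] [MonoidalCategory C] [BraidedCategory C] [HasTwist C]
  [IsRibbon C] [IsIdempotentComplete C] [Preadditive C] [MonoidalPreadditive C]
  {B : C} [MonObj B] [ComonObj B] [IsFrobenius B] [IsDeltaSeparable B] [IsCommMonObj B]
  [IsSymmetricFrobenius B]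

variable (B) in
/-- The functor that forgets the action. -/
def forgetLoc : LocMod B ⥤ C where
  obj M := M.obj.X
  map f := f.hom.hom
  map_id M := rfl
  map_comp f g := rfl

variable [IsIso η[B]]

/-- The action is determined by its restriction along the invertible unit, where linearity is
automatic. -/
lemma hom_linear {M N : Modl B} (f : M.X ⟶ N.X) : act M ≫ f = B ◁ f ≫ act N := by
  rw [← cancel_epi (η[B] ▷ M.X), reassoc_of% (one_act M), ← whisker_exchange_assoc, one_act]
  simp

/-- The action of an algebra isomorphic to the unit on an object. -/
noncomputable def unitMod (x : C) : Modl B :=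
  mkMod x (inv η[B] ▷ x ≫ (λ_ x).hom)
    (by rw [← comp_whiskerRight_assoc]; simp)
    (by
      have h : inv η[B] ▷ B ≫ (λ_ B).hom = μ[B] := by
        rw [← cancel_epi (η[B] ▷ B), ← comp_whiskerRight_assoc]
        simp
      rw [← h, whisker_exchange_assoc, leftUnitor_naturality]
      simp)

lemma isLocal_unitMod (x : C) : IsLocal (unitMod x : Modl B) := by
  change monodromy B x ≫ inv η[B] ▷ x ≫ (λ_ x).hom = inv η[B] ▷ x ≫ (λ_ x).hom
  rw [← reassoc_of% (monodromy_naturality_left (inv η[B]) x), monodromy_unit_left,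
    Category.id_comp]

/-- The two actions on `M ⊗ N` agree on the unit, hence everywhere. The identity is therefore
balanced, and the projector is absorbed by balanced maps. -/
lemma relProj_of_isIso (M N : Modl B) : relProj M N = 𝟙 _ := by
  have h : actFst M N.X = actSnd M.X N := by
    rw [← cancel_epi (η[B] ▷ (M.X ⊗ N.X)), (twoActions M N).one₁, (twoActions M N).one₂]
  simpa using relProj_comp (M := M) (N := N) (𝟙 _) (by rw [h])

/-- For an algebra isomorphic to the unit, the relative tensor product is the tensor product. -/
noncomputable def relπIso (M N : Modl B) : M.X ⊗ N.X ≅ (relMod M N).X where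
  hom := relπ M N
  inv := relι M N
  hom_inv_id := by rw [relπ_ι, relProj_of_isIso]
  inv_hom_id := relι_π M N

variable (B) in
/-- The monoidal structure of the forgetful functor. -/
noncomputable def forgetLocCore : (forgetLoc B).CoreMonoidal where
  εIso := show 𝟙_ C ≅ B from asIso η[B]
  μIso M N := relπIso M.obj N.obj
  μIso_hom_natural_left f X := by
    have := π_relMap f.hom (𝟙 X.obj)
    rw [Mod.id_hom', tensorHom_id] at this
    exact this.symm
  μIso_hom_natural_right X f := by
    have := π_relMap (𝟙 X.obj) f.hom
    rw [Mod.id_hom', id_tensorHom] at this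
    exact this.symm
  associativity M N P :=
    (Category.assoc _ _ _).symm.trans (π₃'_assoc M.obj N.obj P.obj)
  left_unitality M := by
    have h : relπ (Mod.regular B) M.obj ≫ (relLam M.obj).hom = act M.obj := π_relLam M.obj
    have h2 := one_act M.obj
    rw [← h] at h2
    exact h2.symm
  right_unitality M := by
    have h : relπ M.obj (Mod.regular B) ≫ (relRho M.obj).hom = ract M.obj := π_relRho M.obj
    have h2 : M.obj.X ◁ η[B] ≫ ract M.obj = (ρ_ M.obj.X).hom := by
      rw [ract, BraidedCategory.braiding_inv_naturality_right_assoc, one_act]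
      simp
    rw [← h] at h2
    exact h2.symm

/-- All morphisms are linear by `hom_linear`, and every object carries the action of `unitMod`. The
sign map for the trivial grading is the identity, so the braiding on relative tensor products is the
one of `C`. -/
lemma forgetLoc_isRibbonEquivalence (k : Type w) [Field k] [Linear k C] [MonoidalLinear k C] :
    IsRibbonEquivalence k (forgetLoc B) where
  isEquivalence :=
    { faithful := ⟨fun h => ObjectProperty.hom_ext _ (Mod.hom_ext _ _ h)⟩
      full := ⟨fun f => ⟨ObjectProperty.homMk (mkHom f (hom_linear f)), rfl⟩⟩
      essSurj := ⟨fun x => ⟨⟨unitMod x, isLocal_unitMod x⟩, ⟨Iso.refl x⟩⟩⟩ }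
  map_add f g := rfl
  map_smul a f := rfl
  braided := by
    let _ := (forgetLocCore B).toMonoidal
    refine ⟨{ braided := fun M N => ?_ }⟩
    have h := π_relBraid (IsLocal.isGrading M.property) (isSpinMap_one N.obj)
    rw [sbraid, sgn_one, Category.comp_id] at h
    exact h
  map_twist X := rfl

end ForgetLocal

end SpinLine

namespace SpinLine

/-! ### Algebras `1 ⊕ f` with a fermion `f`. -/

section FermionEquivalence
open HasTwist
variable {k : Type w} [Field k] [NeZero (2 : k)] {C : Type u} [Category.{v} C]
  [Preadditive C] [Linear k C] [Limits.HasBinaryBiproducts C] [IsIdempotentComplete C]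
  [MonoidalCategory C] [MonoidalPreadditive C] [MonoidalLinear k C] [BraidedCategory C]
  [HasTwist C] [IsRibbon C] {A f : C} [MonObj A] [ComonObj A] [IsFrobenius A] [IsCommMonObj A]

/-- The twist is `1` on the unit summand and `-1` on the fermion, so its average is the projection
to the unit summand. -/
lemma symmIdem_of_fermion (hf : IsFermion f) (e : A ≅ 𝟙_ C ⊞ f) :
    symmIdem k A = (e.hom ≫ Limits.biprod.fst) ≫ Limits.biprod.inl ≫ e.inv := by
  rw [← cancel_epi e.inv, symmIdem, ← nak_eq_twist]
  ext1
  · rw [Linear.comp_smul, Linear.comp_smul, Preadditive.comp_add, Preadditive.comp_add, inl_nak,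
      Category.comp_id, inv_two_smul_add]
    simp
  · rw [Linear.comp_smul, Linear.comp_smul, Preadditive.comp_add, Preadditive.comp_add,
      inr_nak hf, Category.comp_id, add_neg_cancel]
    simp

/-- The symmetric part is isomorphic to the tensor unit through `s` and `r`, as both split the same
idempotent. The unit morphism need not be `s`, but it is a multiple of `s`, and the scalar is
non-zero. -/
lemma isIso_one_symm (hk : Function.Bijective (fun a : k => a • 𝟙 (𝟙_ C))) (hf : IsFermion f)
    (e : A ≅ 𝟙_ C ⊞ f) : IsIso η[symmPart k A] := by
  let s : 𝟙_ C ⟶ symmPart k A := (Limits.biprod.inl ≫ e.inv) ≫ symmπ k A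
  let r : symmPart k A ⟶ 𝟙_ C := symmι k A ≫ e.hom ≫ Limits.biprod.fst
  have hs := symmIdem_of_fermion (k := k) hf e
  have hsr : s ≫ r = 𝟙 _ := by
    simp only [s, r, Category.assoc]
    rw [reassoc_of% (symmπ_ι k A), hs]
    simp
  have hrs : r ≫ s = 𝟙 _ := by
    have h : r ≫ s = symmι k A ≫ symmIdem k A ≫ symmπ k A := by
      rw [hs]
      simp only [r, s, Category.assoc]
    rw [h, symmIdem_π, symmι_π]
  -- The hypothesis that the endomorphisms of the tensor unit are scalars provides `a`.
  obtain ⟨a, ha⟩ := hk.2 (η[symmPart k A] ≫ r)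
  have ha : a • 𝟙 (𝟙_ C) = η[symmPart k A] ≫ r := ha
  have h1 : η[symmPart k A] = a • s := by
    rw [← Category.comp_id η[symmPart k A], ← hrs, ← reassoc_of% ha]
    simp
  -- If the unit morphism were zero the symmetric part would be zero, and with it the tensor unit,
  -- against injectivity of `a ↦ a • 𝟙`.
  have h0 : a ≠ 0 := by
    rintro rfl
    rw [zero_smul] at h1
    have h2 := MonObj.one_mul (symmPart k A)
    rw [h1, MonoidalPreadditive.zero_whiskerRight, Limits.zero_comp] at h2
    have h3 : 𝟙 (symmPart k A) = 0 := by
      rw [← (λ_ (symmPart k A)).inv_hom_id, ← h2, Limits.comp_zero]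
    have h4 : 𝟙 (𝟙_ C) = 0 := by
      rw [← hsr, ← Category.id_comp r, h3]
      simp
    exact zero_ne_one (hk.1 (a₁ := 0) (a₂ := 1) (by simp [h4]))
  refine ⟨a⁻¹ • r, ?_, ?_⟩
  · rw [h1, Linear.smul_comp, Linear.comp_smul, smul_smul, mul_inv_cancel₀ h0, one_smul, hsr]
  · rw [h1, Linear.smul_comp, Linear.comp_smul, smul_smul, inv_mul_cancel₀ h0, one_smul, hrs]

variable [IsDeltaSeparable A] [IsHaploidNonsymmetric k A]

/-- The invariants of the induced module on `x` are isomorphic to `x`. -/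
noncomputable def inductionFixIso (hf : IsFermion f) (e : A ≅ 𝟙_ C ⊞ f) :
    inductionFunctor k A (fun x => isNakayamaLocalSum_freeMod k hf e x) ⋙ fixFunctor k A ⋙
      forgetLoc (symmPart k A) ≅ 𝟭 C := by
  let U := inductionFunctor k A (fun x => isNakayamaLocalSum_freeMod k hf e x)
  let inc (x : C) : (fixMod (U.obj x)).X ⟶ A ⊗ x := fixι (U.obj x)
  let prj (x : C) : A ⊗ x ⟶ (fixMod (U.obj x)).X := fixπ (U.obj x)
  let s : 𝟙_ C ⟶ A := Limits.biprod.inl ≫ e.inv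
  let r : A ⟶ 𝟙_ C := e.hom ≫ Limits.biprod.fst
  have hs : symmIdem k A = r ≫ s := symmIdem_of_fermion (k := k) hf e
  have hip (x : C) : inc x ≫ prj x = 𝟙 _ := fixι_π (U.obj x)
  -- The involution of the induced module is `N ⊗ id`, so its invariants are cut out by `(1 + N)/2`
  -- on the factor `A`. By `hs` this factors through `1 ⊗ x`.
  have hpi (x : C) : prj x ≫ inc x = symmIdem k A ▷ x := by
    have h : prj x ≫ inc x = (2 : k)⁻¹ • (𝟙 _ + nak A ▷ x) := fixπ_ι (U.obj x)
    rw [h, symmIdem, ← nak_eq_twist, MonoidalLinear.smul_whiskerRight,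
      MonoidalPreadditive.add_whiskerRight, id_whiskerRight]
  have hnat {x y : C} (g : x ⟶ y) : (fixMap (U.map g)).hom ≫ inc y = inc x ≫ A ◁ g :=
    fixMap_ι (U.map g)
  refine NatIso.ofComponents (fun x =>
    { hom := inc x ≫ r ▷ x ≫ (λ_ x).hom
      inv := (λ_ x).inv ≫ s ▷ x ≫ prj x
      hom_inv_id := ?_
      inv_hom_id := ?_ }) ?_
  · have h : (inc x ≫ r ▷ x ≫ (λ_ x).hom) ≫ (λ_ x).inv ≫ s ▷ x ≫ prj x = 𝟙 _ := by
      simp only [Category.assoc, Iso.hom_inv_id_assoc]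
      rw [← comp_whiskerRight_assoc, ← hs, ← hpi, Category.assoc, hip, Category.comp_id, hip]
    exact h
  · change ((λ_ x).inv ≫ s ▷ x ≫ prj x) ≫ inc x ≫ r ▷ x ≫ (λ_ x).hom = 𝟙 x
    simp only [Category.assoc]
    rw [reassoc_of% (hpi x), hs, ← comp_whiskerRight_assoc, ← comp_whiskerRight_assoc,
      show (s ≫ r ≫ s) ≫ r = 𝟙 _ by simp [r, s]]
    simp
  · intro x y g
    change (fixMap (U.map g)).hom ≫ inc y ≫ r ▷ y ≫ (λ_ y).hom =
      (inc x ≫ r ▷ x ≫ (λ_ x).hom) ≫ g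
    rw [reassoc_of% (hnat g), whisker_exchange_assoc, leftUnitor_naturality]
    simp only [Category.assoc]

/-- Taking invariants and forgetting the action are ribbon equivalences, and by `inductionFixIso`
induction followed by both is isomorphic to the identity. -/
lemma inductionFunctor_isRibbonEquivalence
    (hk : Function.Bijective (fun a : k => a • 𝟙 (𝟙_ C))) (hf : IsFermion f)
    (e : A ≅ 𝟙_ C ⊞ f) : IsRibbonEquivalence k
      (inductionFunctor k A (fun x => isNakayamaLocalSum_freeMod k hf e x)) :=
  have := isIso_one_symm hk hf e
  .of_comp_iso_id ((fixFunctor_isRibbonEquivalence k A).comp (forgetLoc_isRibbonEquivalence k))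
    (inductionFixIso hf e)

end FermionEquivalence

end SpinLine

/-- Let `C` be a `k`-linear additive idempotent-complete ribbon category with `End(1) = k`, where
`k` is a field of characteristic different from two.

* If `A` is a commutative `Δ`-separable Frobenius algebra with `A ≅ 1 ⊕ f` for a fermion `f`, then
  the induction functor `x ↦ (A ⊗ x, μ ⊗ id, N_A ⊗ id)` is a ribbon equivalence `C ≃ L^spin_A`.
* If `A` is a haploid commutative `Δ`-separable special Frobenius algebra with `N_A ≠ id` and `B` is
  its symmetric part, then there is a ribbon equivalence `L^spin_A ≃ C_B^loc`. -/
theorem mainTheorem6 {k : Type w} [Field k] [NeZero (2 : k)]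
    {C : Type u} [Category.{v} C] [Preadditive C] [Linear k C]
    [Limits.HasZeroObject C] [Limits.HasBinaryBiproducts C] [IsIdempotentComplete C]
    [MonoidalCategory C] [MonoidalPreadditive C] [MonoidalLinear k C]
    [BraidedCategory C] [HasTwist C] [IsRibbon C]
    (hk : Function.Bijective (fun a : k => a • 𝟙 (𝟙_ C))) :
    (∀ (A f : C) [MonObj A] [ComonObj A] [IsFrobenius A] [IsDeltaSeparable A] [IsCommMonObj A]
        (hf : IsFermion f) (e : A ≅ 𝟙_ C ⊞ f),
      haveI : IsHaploidNonsymmetric k A := isHaploidNonsymmetric_of_fermion k hk hf e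
      IsRibbon (LSpin k A) ∧
        IsRibbonEquivalence k
          (inductionFunctor k A (fun x => isNakayamaLocalSum_freeMod k hf e x))) ∧
    (∀ (A : C) [MonObj A] [ComonObj A] [IsFrobenius A] [IsDeltaSeparable A] [IsCommMonObj A]
        [IsHaploidNonsymmetric k A], IsSpecial k A →
      IsRibbon (LSpin k A) ∧ IsRibbon (LocMod (symmPart k A)) ∧
        ∃ F : LSpin k A ⥤ LocMod (symmPart k A), IsRibbonEquivalence k F) := by
  refine ⟨fun A f _ _ _ _ _ hf e => ?_, fun A _ _ _ _ _ _ _ => ?_⟩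
  · have : IsHaploidNonsymmetric k A := isHaploidNonsymmetric_of_fermion k hk hf e
    exact ⟨inferInstance, inductionFunctor_isRibbonEquivalence hk hf e⟩
  · exact ⟨inferInstance, inferInstance, fixFunctor k A, fixFunctor_isRibbonEquivalence k A⟩
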